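/- Let $J\subset\mathbb C$ be an oriented simple, compact, piecewise smooth curve, open or closed (finitely many $C^\infty$ regular pieces; corners allowed, cusps excluded). Let $\partial J$ be its set of end points (empty if $J$ is closed) and $\overset{\circ}{J}=J\setminus\partial J$. Let $f_1,\dots,f_N,e_1,\dots,e_N$ be complex functions on $J$, smooth along each smooth piece of $J$ up to its ends, with $\sum_{a=1}^N f_a(\lambda)e_a(\lambda)=0$ for all $\lambda\in J$. Put $\boldsymbol E_L=(f_1,\dots,f_N)^{T}$, $\boldsymbol E_R=(e_1,\dots,e_N)^{T}$, $(x,y)=\sum_a x_ay_a$, and let $\boldsymbol e_n$ be the $n$-th vector of the standard basis. Let $\gamma_a\in\mathbb C$, $c_a\in\mathbb R\setminus\{0\}$ and $v_a\in\{1,\dots,N\}$ for $a=1,\dots,N$, and assume $\lambda-\mu+ic_a\neq0$ for all $\lambda,\mu\in J$ and all $a$. Set $$\widetilde V(\lambda,\mu)=\frac{\sum_{a=1}^N f_a(\lambda)e_a(\mu)}{\lambda-\mu},\qquad V(\lambda,\mu)=\widetilde V(\lambda,\mu)-\sum_{a=1}^N\gamma_a\frac{f_a(\lambda)e_{v_a}(\mu)}{\lambda-\mu+ic_a},$$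 where $\widetilde V(\lambda,\lambda)=\sum_a f_a'(\lambda)e_a(\lambda)$ is the limiting value (derivative along $J$). For a kernel $K$ on $J$ let $$\det[I+K]=\sum_{k\ge0}\frac1{k!}\int_{J^k}\det\big[K(\lambda_i,\lambda_j)\big]_{i,j=1}^k\,d\lambda_1\cdots d\lambda_k$$ be its Fredholm determinant. Assume $\det[I+\widetilde V]\neq0$. Then the following hold. 1. There is an $N\times N$ matrix function $\chi$, unique on $\mathbb C\setminus J$, such that: $\chi$ is holomorphic on $\mathbb C\setminus J$ and has continuous boundary values $\chi_+$ (from the left) and $\chi_-$ (from the right) on $\overset{\circ}{J}$ (so in particular it is bounded near each point of $\overset{\circ}{J}$); $\chi(z)=O(\ln|z-a|)$ entrywise as $z\to a$ for $a\in\partial J$; $\chi(z)=I_N+O(z^{-1})$ as $z\to\infty$; and $\chi_-=\chi_+\,\big(I_N+2i\pi\,\boldsymbol E_R\boldsymbol E_L^{T}\big)$ on $\overset{\circ}{J}$. 2. There is a unique continuous $\boldsymbol F_L:J\to\mathbb C^N$ with $\boldsymbol F_L(\lambda)+\int_J\widetilde V(\lambda,\mu)\boldsymbol F_L(\mu)\,d\mu=\boldsymbol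 E_L(\lambda)$ for all $\lambda\in J$. 3. With these $\chi$ and $\boldsymbol F_L$ and $$W(\lambda,\mu)=-\sum_{n=1}^N\gamma_n\frac{\big(\boldsymbol F_L(\lambda),\chi(\mu-ic_n)\boldsymbol e_n\big)\,\big(\boldsymbol e_{v_n},\boldsymbol E_R(\mu)\big)}{\lambda-\mu+ic_n},$$ the Fredholm series of $\widetilde V$, $V$ and $W$ converge absolutely, and $$\det[I+V]=\det[I+\widetilde V]\cdot\det[I+W].$$ -/

import Mathlib

open Set Filter Topology
open scoped ContDiff

/-- An oriented simple curve in the plane, open (an arc) or closed, made of `pieces` smooth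
regular pieces, the `i`-th of which is parametrised by `[i, i + 1]`. Consecutive pieces may meet at
a corner of any nonzero angle, but not in a cusp. -/
structure PiecewiseSmoothCurve where
  /-- the number of smooth pieces -/
  pieces : ℕ
  pieces_pos : 0 < pieces
  /-- the parametrisation, only its values on `[0, pieces]` matter -/
  toFun : ℝ → ℂ
  smooth : ∀ i < pieces, ContDiffOn ℝ ∞ toFun (Icc (i : ℝ) (i + 1))
  regular : ∀ i < pieces, ∀ t ∈ Icc (i : ℝ) (i + 1),
    derivWithin toFun (Icc (i : ℝ) (i + 1)) t ≠ 0
  simple : ∀ s ∈ Icc (0 : ℝ) pieces, ∀ t ∈ Icc (0 : ℝ) pieces, s < t → toFun s = toFun t →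
    s = 0 ∧ t = pieces
  no_cusp : ∀ i : ℕ, i + 1 < pieces →
    ¬ SameRay ℝ (derivWithin toFun (Icc (i : ℝ) (i + 1)) (i + 1))
        (-(derivWithin toFun (Icc ((i : ℝ) + 1) (i + 2)) (i + 1)))
  no_cusp_closed : toFun 0 = toFun pieces →
    ¬ SameRay ℝ (derivWithin toFun (Icc ((pieces : ℝ) - 1) pieces) pieces)
        (-(derivWithin toFun (Icc 0 1) 0))

namespace PiecewiseSmoothCurve

/-- The set of points of the curve. -/
def carrier (J : PiecewiseSmoothCurve) : Set ℂ := J.toFun '' Icc (0 : ℝ) J.pieces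

/-- The end points of the curve: none if the curve is closed. -/
def boundary (J : PiecewiseSmoothCurve) : Set ℂ :=
  {z | J.toFun 0 ≠ J.toFun J.pieces ∧ (z = J.toFun 0 ∨ z = J.toFun J.pieces)}

/-- The curve without its end points. -/
def interior (J : PiecewiseSmoothCurve) : Set ℂ := J.carrier \ J.boundary

/-- A function on the curve is smooth if it is smooth along every smooth piece
(up to the ends of the piece). -/
def IsSmooth (J : PiecewiseSmoothCurve) (h : ℂ → ℂ) : Prop :=
  ∀ i < J.pieces, ContDiffOn ℝ ∞ (fun t => h (J.toFun t)) (Icc (i : ℝ) (i + 1))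

/-- The contour integral `∫_J h(μ) dμ`. -/
noncomputable def contourIntegral (J : PiecewiseSmoothCurve) (h : ℂ → ℂ) : ℂ :=
  ∫ t in Icc (0 : ℝ) J.pieces, h (J.toFun t) * deriv J.toFun t

/-- The integrand `det [K(λ_i, λ_j)] dλ_1 ⋯ dλ_k` of the `k`-th term of the Fredholm series, in the
parameters of the points `λ_i`. -/
noncomputable def fredholmIntegrand (J : PiecewiseSmoothCurve) (K : ℂ → ℂ → ℂ) (k : ℕ)
    (t : Fin k → ℝ) : ℂ :=
  (Matrix.of fun i j => K (J.toFun (t i)) (J.toFun (t j))).det * ∏ i, deriv J.toFun (t i)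

/-- The `k`-th term `(1 / k!) ∫_{J^k} det [K(λ_i, λ_j)] dλ_1 ⋯ dλ_k` of the Fredholm series. -/
noncomputable def fredholmTerm (J : PiecewiseSmoothCurve) (K : ℂ → ℂ → ℂ) (k : ℕ) : ℂ :=
  ((k.factorial : ℂ))⁻¹ *
    ∫ t in Set.univ.pi fun _ : Fin k => Icc (0 : ℝ) J.pieces, J.fredholmIntegrand K k t

/-- All the integrals in the Fredholm series converge absolutely, and so does the series. -/
def FredholmConverges (J : PiecewiseSmoothCurve) (K : ℂ → ℂ → ℂ) : Prop :=
  (∀ k : ℕ, MeasureTheory.IntegrableOn (J.fredholmIntegrand K k)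
    (Set.univ.pi fun _ : Fin k => Icc (0 : ℝ) J.pieces)) ∧
  Summable (J.fredholmTerm K)

/-- The Fredholm determinant `det [I + K]` of the integral operator
`φ ↦ φ + ∫_J K(·, μ) φ(μ) dμ` on `L²(J)`. -/
noncomputable def fredholmDet (J : PiecewiseSmoothCurve) (K : ℂ → ℂ → ℂ) : ℂ :=
  ∑' k, J.fredholmTerm K k

/-- The filter of the points that approach `J.toFun t` non-tangentially from the left (`σ = 1`) or
from the right (`σ = -1`), inside the cone of aperture prescribed by `δ`. -/
noncomputable def sideCone (J : PiecewiseSmoothCurve) (σ : ℝ) (t δ : ℝ) : Filter ℂ :=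
  𝓝 (J.toFun t) ⊓
    𝓟 {z | δ * ‖z - J.toFun t‖ < σ * ((z - J.toFun t) / deriv J.toFun t).im}

/-- `B` gives the continuous boundary values of `χ` on the curve without its end points,
from the left (`σ = 1`) or from the right (`σ = -1`). The tangent exists off the points where two
pieces meet, and there `B` is the non-tangential limit of `χ`; `B` is continuous at all points. -/
def IsBoundaryValue (J : PiecewiseSmoothCurve) {N : ℕ} (σ : ℝ)
    (χ B : ℂ → Matrix (Fin N) (Fin N) ℂ) : Prop :=
  ContinuousOn B J.interior ∧
  ∀ i < J.pieces, ∀ t ∈ Ioo (i : ℝ) (i + 1), ∀ δ > 0,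
    Tendsto χ (J.sideCone σ t δ) (𝓝 (B (J.toFun t)))

/-- The kernel `(∑ f_a(λ) e_a(μ)) / (λ - μ)`. On the diagonal it takes its limiting value
`∑ f_a'(λ) e_a(λ)`, where `'` is the derivative `dλ` along the curve. -/
noncomputable def integrableKernel (J : PiecewiseSmoothCurve) {N : ℕ} (f e : Fin N → ℂ → ℂ)
    (z w : ℂ) : ℂ :=
  if z = w then ∑ a, derivWithin (f a) J.carrier z * e a z
  else (∑ a, f a z * e a w) / (z - w)

/-- The kernel with shifts `V = Ṽ - ∑ γ_a f_a(λ) e_{v_a}(μ) / (λ - μ + i c_a)`. -/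
noncomputable def shiftKernel (J : PiecewiseSmoothCurve) {N : ℕ} (f e : Fin N → ℂ → ℂ)
    (γ : Fin N → ℂ) (c : Fin N → ℝ) (v : Fin N → Fin N) (z w : ℂ) : ℂ :=
  J.integrableKernel f e z w - ∑ a, γ a * (f a z * e (v a) w / (z - w + Complex.I * c a))

/-- The jump matrix `I_N + 2 π i E_R E_Lᵀ`, with `E_L = (f_1, …, f_N)ᵀ`, `E_R = (e_1, …, e_N)ᵀ`. -/
noncomputable def jumpMatrix {N : ℕ} (f e : Fin N → ℂ → ℂ) (z : ℂ) :
    Matrix (Fin N) (Fin N) ℂ :=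
  1 + (2 * Real.pi * Complex.I) • Matrix.vecMulVec (fun a => e a z) (fun a => f a z)

/-- `χ` solves the Riemann-Hilbert problem of the kernel `(∑ f_a(λ) e_a(μ)) / (λ - μ)`.
The values of `χ` on the curve are irrelevant. The field `bounded` belongs to having continuous
boundary values: it says that `χ` does not blow up in a tangential approach or at a corner. -/
structure IsRHPSolution (J : PiecewiseSmoothCurve) {N : ℕ} (f e : Fin N → ℂ → ℂ)
    (χ : ℂ → Matrix (Fin N) (Fin N) ℂ) : Prop where
  holomorphic : ∀ i j, DifferentiableOn ℂ (fun z => χ z i j) J.carrierᶜ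
  bounded : ∀ s ∈ J.interior, ∀ i j, ∃ M : ℝ, ∀ᶠ z in 𝓝[J.carrierᶜ] s, ‖χ z i j‖ ≤ M
  jump : ∃ χp χm : ℂ → Matrix (Fin N) (Fin N) ℂ,
    J.IsBoundaryValue 1 χ χp ∧ J.IsBoundaryValue (-1) χ χm ∧
    ∀ s ∈ J.interior, χm s = χp s * jumpMatrix f e s
  endpoints : ∀ a ∈ J.boundary, ∀ i j,
    (fun z => χ z i j) =O[𝓝[J.carrierᶜ] a] (fun z => Real.log ‖z - a‖)
  infinity : ∀ i j,
    (fun z => χ z i j - (1 : Matrix (Fin N) (Fin N) ℂ) i j) =O[Bornology.cobounded ℂ]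
      (fun z => z⁻¹)

/-- `F` is a continuous solution on the curve of the integral equation
`F(λ) + ∫_J Ṽ(λ, μ) F(μ) dμ = E_L(λ)`. -/
structure IsLeftSolution (J : PiecewiseSmoothCurve) {N : ℕ} (f e : Fin N → ℂ → ℂ)
    (F : Fin N → ℂ → ℂ) : Prop where
  continuousOn : ∀ a, ContinuousOn (F a) J.carrier
  equation : ∀ a, ∀ z ∈ J.carrier,
    F a z + J.contourIntegral (fun w => J.integrableKernel f e z w * F a w) = f a z

/-- The kernel
`W(λ, μ) = - ∑ γ_n (F_L(λ), χ(μ - i c_n) e_n) (e_{v_n}, E_R(μ)) / (λ - μ + i c_n)`,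
where `e_n` is the `n`-th vector of the standard basis. -/
noncomputable def factorKernel {N : ℕ} (e : Fin N → ℂ → ℂ) (γ : Fin N → ℂ) (c : Fin N → ℝ)
    (v : Fin N → Fin N) (χ : ℂ → Matrix (Fin N) (Fin N) ℂ) (F : Fin N → ℂ → ℂ) (z w : ℂ) : ℂ :=
  -∑ n, γ n *
    (((fun a => F a z) ⬝ᵥ (Matrix.mulVec (χ (w - Complex.I * c n)) (Pi.single n 1))) *
      ((Pi.single (v n) 1) ⬝ᵥ (fun a => e a w)) / (z - w + Complex.I * c n))

end PiecewiseSmoothCurve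

/-!
The factorization is multiplicativity of the Fredholm determinant, applied to a kernel `W` that is
computed explicitly by means of a Riemann–Hilbert problem.

*Fredholm theory.* Write `V = Ṽ + U`, where `U` collects the terms with shifts. If a bounded kernel
`W` satisfies `W + ṼW = U`, then `I + V = (I + Ṽ)(I + W)` and `det [I + V] = det [I + Ṽ] det [I + W]`
(`Fredholm.fdet_add_eq_mul`). Multiplicativity is derived from the Fredholm series itself: the minors
of the series satisfy Fredholm's identities (`Fredholm.minor_add_integral`), hence the logarithmic
derivatives in `ε` of `det [I + Ṽ + εU]` and `det [I + εW]` agree. Hadamard's inequality gives the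
convergence, and the same identities solve `(I + Ṽ)F = b` when `det [I + Ṽ] ≠ 0`
(`Fredholm.exists_solution`).

*The Riemann–Hilbert problem.* Let `F_R` solve the transposed equation with right-hand side `E_R`. Then
`χ(z) = I - ∫ F_R(μ) E_Lᵀ(μ) / (μ - z) dμ` is a solution (`isRHPSolution_rhpMatrix`): the jump is the
Sokhotski–Plemelj relation (`LocalArc.bval_sub_bval`) together with `χ_± E_R = F_R`, which is the
integral equation. The boundary behaviour of Cauchy integrals is studied on a local arc
(`LocalArc`), a piece of the curve that is a Lipschitz graph in a suitable direction `d`; at a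
corner such a direction exists because there are no cusps. A point near the arc is written as
`Γ(τ) + i y d`, and the Cauchy integral is split into a constant density, for which it is a
difference of logarithms, and a density that vanishes at `Γ(τ)`, for which it is continuous up to the
curve (`LocalArc.tendsto_regInt`). This works at corners as well as at smooth points. The densities
are only known to be Hölder continuous of order `1 / 2`, which is what the integral operator with
kernel `Ṽ` provides (`exists_holder_transform`).

*Uniqueness.* With `F_L` in place of `F_R`, the same construction gives a matrix
`M(z) = I + ∫ E_R(μ) F_Lᵀ(μ) / (μ - z) dμ` with the inverse jump. For any solution `χ` the product `χM`
has no jump. Cauchy's formula on a rectangle crossed by the curve shows that it extends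
holomorphically across the curve (`exists_extension_interior`), the end points are removable because
of the logarithmic growth, and Liouville's theorem gives `χM = I` (`IsRHPSolution.mul_rhpInverse`).
So `χ` is unique and `M = χ⁻¹`.

*The kernel `W`.* A partial fraction expansion in the equation for `F_L` shows that `I + Ṽ` maps
`F_L(·) / (· - w)` to `Mᵀ(w) E_L(·) / (· - w)` for `w` off the curve, hence
`(F_L(·), χ(w) e_n) / (· - w)` to `f_n(·) / (· - w)`. For `w = μ - i c_n` these are the building blocks of
`W` and `U` (`factorKernel_add_contourIntegral`).
-/

/-! ### Hadamard's bound for determinants -/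

open scoped ComplexOrder in
/-- Hadamard's inequality, from the inequality of arithmetic and geometric means for the eigenvalues
of `Aᴴ * A`. -/
theorem norm_det_le_of_norm_entries_le {k : ℕ} (A : Matrix (Fin k) (Fin k) ℂ) {M : ℝ}
    (hA : ∀ i j, ‖A i j‖ ≤ M) : ‖A.det‖ ≤ (Real.sqrt k * M) ^ k := by
  rcases Nat.eq_zero_or_pos k with rfl | hk
  · simp
  have hM : 0 ≤ M := (norm_nonneg _).trans (hA ⟨0, hk⟩ ⟨0, hk⟩)
  have hP := Matrix.posSemidef_conjTranspose_mul_self A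
  have hdet : ‖A.det‖ ^ 2 = ∏ i, hP.1.eigenvalues i := by
    have h1 := hP.1.det_eq_prod_eigenvalues
    rw [Matrix.det_mul, Matrix.det_conjTranspose] at h1
    have h2 : (((‖A.det‖ ^ 2 : ℝ)) : ℂ) = ((∏ i, hP.1.eigenvalues i : ℝ) : ℂ) := by
      push_cast
      rw [← Complex.conj_mul']
      exact h1
    exact_mod_cast h2
  have htr : ∑ i, hP.1.eigenvalues i ≤ k * (k * M ^ 2) := by
    have h1 := hP.1.trace_eq_sum_eigenvalues
    have h2 : (Matrix.trace (A.conjTranspose * A)) = ((∑ i, ∑ j, ‖A j i‖ ^ 2 : ℝ) : ℂ) := by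
      push_cast
      simp only [Matrix.trace, Matrix.diag, Matrix.mul_apply, Matrix.conjTranspose_apply]
      refine Finset.sum_congr rfl fun i _ => Finset.sum_congr rfl fun j _ => ?_
      rw [← Complex.conj_mul']
      rfl
    rw [h2] at h1
    have h3 : (∑ i, ∑ j, ‖A j i‖ ^ 2 : ℝ) = ∑ i, hP.1.eigenvalues i := by
      apply Complex.ofReal_injective
      rw [h1]
      push_cast
      rfl
    rw [← h3]
    calc (∑ i, ∑ j, ‖A j i‖ ^ 2 : ℝ) ≤ ∑ _i : Fin k, ∑ _j : Fin k, M ^ 2 := by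
          gcongr; exact hA _ _
      _ = k * (k * M ^ 2) := by simp
  have hk' : (0 : ℝ) < k := by exact_mod_cast hk
  have amgm : ∏ i, hP.1.eigenvalues i ≤ (k * M ^ 2) ^ k := by
    have h := Real.geom_mean_le_arith_mean_weighted Finset.univ (fun _ : Fin k => (k : ℝ)⁻¹)
      hP.1.eigenvalues (fun _ _ => by positivity) (by simp [hk'.ne'])
      (fun i _ => hP.eigenvalues_nonneg i)
    rw [← Finset.mul_sum] at h
    have h' : (k : ℝ)⁻¹ * ∑ i, hP.1.eigenvalues i ≤ k * M ^ 2 := by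
      rw [inv_mul_le_iff₀ hk']; exact htr
    have h0 := pow_le_pow_left₀ (Finset.prod_nonneg fun i _ =>
      Real.rpow_nonneg (hP.eigenvalues_nonneg i) _) (h.trans h') k
    rw [← Finset.prod_pow] at h0
    refine le_of_eq_of_le (Finset.prod_congr rfl fun i _ => ?_) h0
    rw [Real.rpow_inv_natCast_pow (hP.eigenvalues_nonneg i) hk.ne']
  have h4 : ‖A.det‖ ^ 2 ≤ ((Real.sqrt k * M) ^ k) ^ 2 := by
    rw [hdet, ← pow_mul, mul_comm k 2, pow_mul, mul_pow, Real.sq_sqrt hk'.le]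
    exact amgm
  exact le_of_sq_le_sq h4 (by positivity)

/-- The majorant `C ^ k * k ^ (k / 2) / k!` of the Fredholm series. -/
noncomputable def hadamardBound (C : ℝ) (k : ℕ) : ℝ :=
  (k.factorial : ℝ)⁻¹ * (Real.sqrt k * C) ^ k

theorem hadamardBound_nonneg {C : ℝ} (hC : 0 ≤ C) (k : ℕ) : 0 ≤ hadamardBound C k := by
  unfold hadamardBound; positivity

theorem summable_hadamardBound {C : ℝ} (hC : 0 ≤ C) : Summable (hadamardBound C) := by
  -- `k ^ k ≤ e ^ k * k!`, so the majorant is at most `(√e C) ^ k / √(k!)`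
  set B : ℝ := Real.sqrt (Real.exp 1) * C + 1 with hB
  have hBpos : 0 < B := by positivity
  have hsum : Summable fun k : ℕ => B ^ k / Real.sqrt (k.factorial) := by
    refine summable_of_ratio_test_tendsto_lt_one (l := 0) one_pos
      (Eventually.of_forall fun k => by positivity) ?_
    have h1 : ∀ k : ℕ, ‖B ^ (k + 1) / Real.sqrt ((k + 1).factorial)‖ /
        ‖B ^ k / Real.sqrt (k.factorial)‖ = B / Real.sqrt ((k + 1 : ℕ) : ℝ) := by
      intro k
      rw [Real.norm_of_nonneg (by positivity), Real.norm_of_nonneg (by positivity),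
        Nat.factorial_succ, Nat.cast_mul, Real.sqrt_mul (by positivity)]
      field_simp
      ring
    simp_rw [h1]
    refine Tendsto.div_atTop tendsto_const_nhds ?_
    exact Real.tendsto_sqrt_atTop.comp
      ((tendsto_natCast_atTop_atTop (R := ℝ)).comp (tendsto_add_atTop_nat 1))
  refine Summable.of_nonneg_of_le (hadamardBound_nonneg hC) (fun k => ?_) hsum
  unfold hadamardBound
  have hk : (0 : ℝ) < k.factorial := by positivity
  have h1 : (k : ℝ) ^ k ≤ Real.exp 1 ^ k * k.factorial := by
    have := Real.pow_div_factorial_le_exp (k : ℝ) (by positivity) k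
    rw [div_le_iff₀ hk] at this
    rwa [← Real.exp_nat_mul, mul_one]
  have h2 : Real.sqrt k ^ k ≤ Real.sqrt (Real.exp 1) ^ k * Real.sqrt k.factorial := by
    refine le_of_sq_le_sq ?_ (by positivity)
    rw [mul_pow, ← pow_mul, ← pow_mul, mul_comm k 2, pow_mul, pow_mul, Real.sq_sqrt (by positivity),
      Real.sq_sqrt (by positivity), Real.sq_sqrt hk.le]
    exact h1
  rw [mul_pow, inv_mul_le_iff₀ hk]
  have h3 : (k.factorial : ℝ) * (B ^ k / Real.sqrt k.factorial) = B ^ k * Real.sqrt k.factorial := by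
    have : (k.factorial : ℝ) = Real.sqrt k.factorial * Real.sqrt k.factorial :=
      (Real.mul_self_sqrt hk.le).symm
    field_simp
    rw [Real.sq_sqrt hk.le]
  rw [h3]
  calc Real.sqrt k ^ k * C ^ k ≤ Real.sqrt (Real.exp 1) ^ k * Real.sqrt k.factorial * C ^ k := by
        gcongr
    _ = (Real.sqrt (Real.exp 1) * C) ^ k * Real.sqrt k.factorial := by rw [mul_pow]; ring
    _ ≤ B ^ k * Real.sqrt k.factorial := by
        gcongr
        rw [hB]; linarith

/-- A shift of the index in the numerator costs at most a factor that the constant absorbs. -/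
theorem inv_factorial_mul_le_hadamardBound {C : ℝ} (hC : 0 ≤ C) (k : ℕ) :
    (k.factorial : ℝ)⁻¹ * (Real.sqrt (k + 1 : ℕ) * C) ^ (k + 1) ≤ hadamardBound (2 * C) (k + 1) := by
  unfold hadamardBound
  have h : ((k + 1 : ℕ) : ℝ) ≤ 2 ^ (k + 1) := by exact_mod_cast (Nat.lt_two_pow_self).le
  rw [Nat.factorial_succ, Nat.cast_mul, mul_inv, mul_left_comm _ 2 C, mul_pow 2]
  have hk : (0 : ℝ) < ((k + 1 : ℕ) : ℝ) := by positivity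
  calc (k.factorial : ℝ)⁻¹ * (Real.sqrt (k + 1 : ℕ) * C) ^ (k + 1)
      = ((k + 1 : ℕ) : ℝ)⁻¹ * (k.factorial : ℝ)⁻¹ * (((k + 1 : ℕ) : ℝ) *
          (Real.sqrt (k + 1 : ℕ) * C) ^ (k + 1)) := by field_simp
    _ ≤ _ := by gcongr

/-! ### Fredholm determinants of bounded kernels on a finite measure space -/

namespace Fredholm

open MeasureTheory

variable {X : Type*} [MeasurableSpace X]

/-- A jointly measurable kernel that is bounded by `M`. -/
structure BddKernel (K : X → X → ℂ) (M : ℝ) : Prop where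
  measurable : Measurable (Function.uncurry K)
  bound : ∀ x y, ‖K x y‖ ≤ M

/-- A measurable function that is bounded by `M`. -/
structure BddFun (b : X → ℂ) (M : ℝ) : Prop where
  measurable : Measurable b
  bound : ∀ x, ‖b x‖ ≤ M

/-- `det [K(x_i, x_j)]`. -/
noncomputable def kdet (K : X → X → ℂ) {k : ℕ} (x : Fin k → X) : ℂ :=
  (Matrix.of fun i j => K (x i) (x j)).det

/-- The matrix `[K(x_i, x_j)]` with the column of index `0` replaced by `b(x_i)`. -/
noncomputable def bmat (K : X → X → ℂ) (b : X → ℂ) {k : ℕ} (x : Fin (k + 1) → X) :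
    Matrix (Fin (k + 1)) (Fin (k + 1)) ℂ :=
  Matrix.of fun i j => if j = 0 then b (x i) else K (x i) (x j)

/-- The `k`-th term of the Fredholm series of the kernel `K`. -/
noncomputable def term (μ : Measure X) (K : X → X → ℂ) (k : ℕ) : ℂ :=
  (k.factorial : ℂ)⁻¹ * ∫ x : Fin k → X, kdet K x ∂Measure.pi fun _ => μ

/-- The Fredholm determinant of the kernel `K`. -/
noncomputable def fdet (μ : Measure X) (K : X → X → ℂ) : ℂ := ∑' k, term μ K k

/-- The `k`-th term of the series `minor`. -/
noncomputable def minorTerm (μ : Measure X) (K : X → X → ℂ) (b : X → ℂ) (k : ℕ) (z : X) : ℂ :=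
  (k.factorial : ℂ)⁻¹ *
    ∫ y : Fin k → X, (bmat K b (Fin.cons z y : Fin (k + 1) → X)).det ∂Measure.pi fun _ => μ

/-- The first Fredholm minor of `K` paired with `b`: Cramer's numerator for the equation
`φ + ∫ K(·, w) φ(w) dw = b`. -/
noncomputable def minor (μ : Measure X) (K : X → X → ℂ) (b : X → ℂ) (z : X) : ℂ :=
  ∑' k, minorTerm μ K b k z

section bounds

variable {K : X → X → ℂ} {b : X → ℂ} {M : ℝ}

theorem BddKernel.nonneg [Nonempty X] (hK : BddKernel K M) : 0 ≤ M :=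
  (norm_nonneg _).trans (hK.bound (Classical.arbitrary X) (Classical.arbitrary X))

theorem BddKernel.mono {M' : ℝ} (hK : BddKernel K M) (h : M ≤ M') : BddKernel K M' :=
  ⟨hK.measurable, fun x y => (hK.bound x y).trans h⟩

theorem BddFun.mono {M' : ℝ} (hb : BddFun b M) (h : M ≤ M') : BddFun b M' :=
  ⟨hb.measurable, fun x => (hb.bound x).trans h⟩

theorem BddKernel.right (hK : BddKernel K M) (y : X) : BddFun (fun x => K x y) M :=
  ⟨hK.measurable.comp (measurable_id.prodMk measurable_const), fun x => hK.bound x y⟩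

theorem BddKernel.left (hK : BddKernel K M) (x : X) : BddFun (K x) M :=
  ⟨hK.measurable.comp (measurable_const.prodMk measurable_id), fun y => hK.bound x y⟩

theorem BddKernel.swap (hK : BddKernel K M) : BddKernel (fun x y => K y x) M :=
  ⟨hK.measurable.comp measurable_swap, fun x y => hK.bound y x⟩

theorem BddKernel.add_smul {U : X → X → ℂ} {M' R : ℝ} (hK : BddKernel K M) (hU : BddKernel U M')
    {ε : ℂ} (hε : ‖ε‖ ≤ R) :
    BddKernel (fun x y => K x y + ε * U x y) (M + R * M') := by
  refine ⟨hK.measurable.add (hU.measurable.const_mul ε), fun x y => ?_⟩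
  refine (norm_add_le _ _).trans (add_le_add (hK.bound x y) ?_)
  rw [norm_mul]
  exact mul_le_mul hε (hU.bound x y) (norm_nonneg _) ((norm_nonneg _).trans hε)

theorem measurable_det {Y : Type*} [MeasurableSpace Y] {k : ℕ} {A : Y → Matrix (Fin k) (Fin k) ℂ}
    (hA : ∀ i j, Measurable fun y => A y i j) : Measurable fun y => (A y).det := by
  simp only [Matrix.det_apply']
  refine Finset.measurable_sum _ fun σ _ => Measurable.const_mul ?_ _
  exact Finset.measurable_prod _ fun i _ => hA _ _

theorem measurable_kdet (hK : BddKernel K M) (k : ℕ) :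
    Measurable (kdet K : (Fin k → X) → ℂ) :=
  measurable_det fun i j => hK.measurable.comp
    ((measurable_pi_apply i).prodMk (measurable_pi_apply j) :
      Measurable fun x : Fin k → X => (x i, x j))

theorem norm_kdet_le (hK : BddKernel K M) {k : ℕ} (x : Fin k → X) :
    ‖kdet K x‖ ≤ (Real.sqrt k * M) ^ k :=
  norm_det_le_of_norm_entries_le _ fun _ _ => hK.bound _ _

theorem measurable_bmat_det (hK : BddKernel K M) (hb : Measurable b) (k : ℕ) :
    Measurable fun x : Fin (k + 1) → X => (bmat K b x).det := by
  refine measurable_det fun i j => ?_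
  by_cases hj : j = 0
  · simpa [bmat, hj, Function.comp_def] using hb.comp (measurable_pi_apply i)
  · simpa [bmat, hj, Function.comp_def, Function.uncurry] using hK.measurable.comp
      ((measurable_pi_apply i).prodMk (measurable_pi_apply j) :
        Measurable fun x : Fin (k + 1) → X => (x i, x j))

theorem norm_bmat_det_le (hK : BddKernel K M) (hb : BddFun b M) {k : ℕ} (x : Fin (k + 1) → X) :
    ‖(bmat K b x).det‖ ≤ (Real.sqrt (k + 1 : ℕ) * M) ^ (k + 1) := by
  refine norm_det_le_of_norm_entries_le _ fun i j => ?_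
  by_cases hj : j = 0
  · simpa [bmat, hj] using hb.bound _
  · simpa [bmat, hj] using hK.bound _ _

theorem measurable_cons {k : ℕ} :
    Measurable fun p : X × (Fin k → X) => (Fin.cons p.1 p.2 : Fin (k + 1) → X) := by
  refine measurable_pi_lambda _ fun i => ?_
  refine Fin.cases ?_ (fun j => ?_) i
  · simpa using measurable_fst
  · simpa [Function.comp_def] using (measurable_pi_apply j).comp measurable_snd

variable {μ : Measure X} [IsFiniteMeasure μ]

theorem integrable_of_bound {Y : Type*} [MeasurableSpace Y] {ν : Measure Y} [IsFiniteMeasure ν]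
    {g : Y → ℂ} (hg : Measurable g) {C : ℝ} (h : ∀ y, ‖g y‖ ≤ C) : Integrable g ν :=
  Integrable.of_bound hg.aestronglyMeasurable C (Eventually.of_forall h)

theorem integrable_kdet (hK : BddKernel K M) (k : ℕ) :
    Integrable (kdet K : (Fin k → X) → ℂ) (Measure.pi fun _ => μ) :=
  integrable_of_bound (measurable_kdet hK k) (norm_kdet_le hK)

theorem norm_integral_pi_le {k : ℕ} {g : (Fin k → X) → ℂ} {C : ℝ} (h : ∀ y, ‖g y‖ ≤ C) :
    ‖∫ y, g y ∂Measure.pi fun _ => μ‖ ≤ C * μ.real univ ^ k := by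
  refine (norm_integral_le_of_norm_le_const (Eventually.of_forall h)).trans (le_of_eq ?_)
  simp [Measure.real, Measure.pi_univ]

theorem norm_term_le (hK : BddKernel K M) (k : ℕ) :
    ‖term μ K k‖ ≤ hadamardBound (M * μ.real univ) k := by
  unfold term hadamardBound
  rw [norm_mul, norm_inv, Complex.norm_natCast, ← mul_assoc (Real.sqrt k), mul_pow _ (μ.real univ)]
  gcongr
  exact norm_integral_pi_le (norm_kdet_le hK)

theorem summable_term [Nonempty X] (hK : BddKernel K M) : Summable (term μ K) :=
  Summable.of_norm_bounded (summable_hadamardBound (mul_nonneg hK.nonneg measureReal_nonneg))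
    (norm_term_le hK)

/-- A majorant of the terms of the Fredholm minors. -/
noncomputable def minorBound (C : ℝ) (k : ℕ) : ℝ := hadamardBound (2 * C) (k + 1)

theorem summable_minorBound {C : ℝ} (hC : 0 ≤ C) : Summable (minorBound C) :=
  (summable_nat_add_iff 1).2 (summable_hadamardBound (by positivity))

theorem norm_minorTerm_le [Nonempty X] (hK : BddKernel K M) (hb : BddFun b M) (k : ℕ) (z : X) :
    ‖minorTerm μ K b k z‖ ≤ minorBound (M * (1 + μ.real univ)) k := by
  have hM := hK.nonneg
  have hμ : 0 ≤ μ.real univ := measureReal_nonneg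
  refine le_trans ?_ (inv_factorial_mul_le_hadamardBound (by positivity) k)
  unfold minorTerm
  rw [norm_mul, norm_inv, Complex.norm_natCast]
  gcongr
  refine (norm_integral_pi_le fun y => norm_bmat_det_le hK hb _).trans ?_
  rw [← mul_assoc (Real.sqrt _), mul_pow _ (1 + _)]
  gcongr
  calc μ.real univ ^ k ≤ (1 + μ.real univ) ^ k := by gcongr; linarith
    _ ≤ (1 + μ.real univ) ^ (k + 1) := pow_le_pow_right₀ (by linarith) (by omega)

theorem summable_minorTerm [Nonempty X] (hK : BddKernel K M) (hb : BddFun b M) (z : X) :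
    Summable fun k => minorTerm μ K b k z :=
  Summable.of_norm_bounded (summable_minorBound (mul_nonneg hK.nonneg (by positivity)))
    fun k => norm_minorTerm_le hK hb k z

theorem measurable_minorTerm (hK : BddKernel K M) (hb : Measurable b) (k : ℕ) :
    Measurable (minorTerm μ K b k) := by
  unfold minorTerm
  refine Measurable.const_mul ?_ _
  refine StronglyMeasurable.measurable (StronglyMeasurable.integral_prod_right
    (f := fun z (y : Fin k → X) => (bmat K b (Fin.cons z y : Fin (k + 1) → X)).det) ?_)
  exact ((measurable_bmat_det hK hb k).comp measurable_cons).stronglyMeasurable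

/-- The first minors are bounded and measurable. -/
theorem exists_bddFun_minor [Nonempty X] (hK : BddKernel K M) (hb : BddFun b M) :
    ∃ C, BddFun (minor μ K b) C := by
  refine ⟨∑' k, minorBound (M * (1 + μ.real univ)) k, ?_, fun z => ?_⟩
  · exact measurable_of_tendsto_metrizable
      (fun n => Finset.measurable_sum (Finset.range n) fun k _ =>
        measurable_minorTerm (μ := μ) hK hb.measurable k)
      (tendsto_pi_nhds.2 fun z => by
        simpa [Finset.sum_apply, minor] using
          (summable_minorTerm (μ := μ) hK hb z).hasSum.tendsto_sum_nat)
  · exact tsum_of_norm_bounded (summable_minorBound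
      (mul_nonneg hK.nonneg (by positivity))).hasSum fun k => norm_minorTerm_le hK hb k z

end bounds

end Fredholm

set_option linter.unusedSectionVars false

namespace Fredholm

open MeasureTheory

variable {X : Type*} [MeasurableSpace X]

section identities

variable {K : X → X → ℂ} {b : X → ℂ} {M : ℝ} {μ : Measure X} [IsFiniteMeasure μ]

theorem integral_insertNth {k : ℕ} (j : Fin (k + 1)) (g : (Fin (k + 1) → X) → ℂ)
    (hg : Integrable g (Measure.pi fun _ => μ)) :
    ∫ y, g y ∂Measure.pi (fun _ => μ) =
      ∫ w, ∫ y : Fin k → X, g (j.insertNth w y) ∂Measure.pi (fun _ => μ) ∂μ := by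
  have hmp := (measurePreserving_piFinSuccAbove (fun _ : Fin (k + 1) => μ) j).symm
  have h1 := hmp.integral_comp (MeasurableEquiv.measurableEmbedding _) g
  rw [← h1, integral_prod]
  · rfl
  · exact hmp.integrable_comp_of_integrable hg

/-- Moving the point of index `j` to the front permutes the rows cyclically. -/
theorem insertNth_eq_cons_comp {k : ℕ} (j : Fin (k + 1)) (w : X) (y : Fin k → X) :
    (Fin.cons w y : Fin (k + 1) → X) = (j.insertNth w y : Fin (k + 1) → X) ∘ j.cycleRange.symm := by
  funext i
  refine Fin.cases ?_ (fun l => ?_) i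
  · simp
  · simp

/-- The `j`-th off-diagonal term in the expansion of `bmat` along the row of index `0`. -/
theorem bmat_minor {k : ℕ} (z w : X) (j : Fin (k + 1)) (y : Fin k → X) :
    (-1) ^ ((j.succ : Fin (k + 2)) : ℕ) * (bmat K b (Fin.cons z (j.insertNth w y) :
        Fin (k + 2) → X)) 0 j.succ *
      ((bmat K b (Fin.cons z (j.insertNth w y) : Fin (k + 2) → X)).submatrix
        Fin.succ j.succ.succAbove).det =
    -(K z w * (bmat K b (Fin.cons w y : Fin (k + 1) → X)).det) := by
  have h1 : bmat K b (Fin.cons w y : Fin (k + 1) → X) =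
      ((bmat K b (Fin.cons z (j.insertNth w y) : Fin (k + 2) → X)).submatrix
        Fin.succ j.succ.succAbove).submatrix j.cycleRange.symm id := by
    ext r c
    have hpt : ∀ i, (Fin.cons w y : Fin (k + 1) → X) i =
        (j.insertNth w y : Fin (k + 1) → X) (j.cycleRange.symm i) :=
      fun i => congrFun (insertNth_eq_cons_comp j w y) i
    refine Fin.cases ?_ (fun c => ?_) c
    · simp only [bmat, Matrix.of_apply, Matrix.submatrix_apply, id_eq,
        Fin.succ_succAbove_zero, hpt, Fin.cons_succ, if_true]
    · simp only [bmat, Matrix.of_apply, Matrix.submatrix_apply, Fin.succ_succAbove_succ, hpt r,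
        Fin.cons_succ, Fin.succ_ne_zero, if_false, id_eq, Fin.insertNth_apply_succAbove]
  rw [h1, Matrix.det_permute]
  have h2 : (bmat K b (Fin.cons z (j.insertNth w y) : Fin (k + 2) → X)) 0 j.succ = K z w := by
    simp [bmat]
  rw [h2, Equiv.Perm.sign_symm, Fin.sign_cycleRange, Fin.val_succ, pow_succ]
  push_cast
  ring

/-- Expansion of the minors along the first row. -/
theorem minorTerm_succ (hK : BddKernel K M) (hb : BddFun b M) (k : ℕ) (z : X) :
    minorTerm μ K b (k + 1) z =
      b z * term μ K (k + 1) - ∫ w, K z w * minorTerm μ K b k w ∂μ := by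
  have hM : 0 ≤ M := (norm_nonneg _).trans (hb.bound z)
  set T : Fin (k + 1) → (Fin (k + 1) → X) → ℂ := fun j x =>
    (-1) ^ ((j.succ : Fin (k + 2)) : ℕ) * (bmat K b (Fin.cons z x : Fin (k + 2) → X)) 0 j.succ *
      ((bmat K b (Fin.cons z x : Fin (k + 2) → X)).submatrix Fin.succ j.succ.succAbove).det with hT
  have hexp : ∀ x : Fin (k + 1) → X, (bmat K b (Fin.cons z x : Fin (k + 2) → X)).det =
      b z * kdet K x + ∑ j, T j x := by
    intro x
    rw [Matrix.det_succ_row_zero, Fin.sum_univ_succ]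
    congr 1
    have : (bmat K b (Fin.cons z x : Fin (k + 2) → X)).submatrix Fin.succ (Fin.succAbove 0) =
        Matrix.of fun i j => K (x i) (x j) := by
      ext i j
      simp [bmat]
    rw [this]
    simp [bmat, kdet]
  have hentry : ∀ i j : Fin (k + 2), Measurable fun x : Fin (k + 1) → X =>
      bmat K b (Fin.cons z x : Fin (k + 2) → X) i j := by
    intro i j
    have hc : Measurable fun x : Fin (k + 1) → X => (Fin.cons z x : Fin (k + 2) → X) :=
      measurable_cons.comp (measurable_const.prodMk measurable_id)
    have hi : ∀ i, Measurable fun x : Fin (k + 1) → X => (Fin.cons z x : Fin (k + 2) → X) i :=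
      fun i => (measurable_pi_apply i).comp hc
    by_cases hj : j = 0
    · simpa [bmat, hj, Function.comp_def] using hb.measurable.comp (hi i)
    · simpa [bmat, hj, Function.comp_def, Function.uncurry] using
        hK.measurable.comp ((hi i).prodMk (hi j))
  have hbd : ∀ (x : Fin (k + 1) → X) (i j : Fin (k + 2)),
      ‖bmat K b (Fin.cons z x : Fin (k + 2) → X) i j‖ ≤ M := by
    intro x i j
    by_cases hj : j = 0
    · simpa [bmat, hj] using hb.bound _
    · simpa [bmat, hj] using hK.bound _ _
  have hTint : ∀ j, Integrable (T j) (Measure.pi fun _ => μ) := by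
    intro j
    refine integrable_of_bound (C := M * (Real.sqrt (k + 1 : ℕ) * M) ^ (k + 1)) ?_ fun x => ?_
    · exact ((hentry _ _).const_mul _).mul (measurable_det fun _ _ => hentry _ _)
    · simp only [hT, norm_mul, norm_pow, norm_neg, norm_one, one_pow, one_mul]
      gcongr
      · exact hbd _ _ _
      · exact norm_det_le_of_norm_entries_le _ fun _ _ => hbd _ _ _
  have hTval : ∀ j, ∫ x, T j x ∂Measure.pi (fun _ => μ) =
      -((k.factorial : ℂ) * ∫ w, K z w * minorTerm μ K b k w ∂μ) := by
    intro j
    rw [integral_insertNth j _ (hTint j), ← integral_const_mul, ← integral_neg]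
    refine integral_congr_ae (Eventually.of_forall fun w => ?_)
    simp only [hT, bmat_minor, integral_neg, integral_const_mul, minorTerm]
    have : (k.factorial : ℂ) ≠ 0 := by exact_mod_cast k.factorial_ne_zero
    field_simp
  change ((k + 1).factorial : ℂ)⁻¹ * _ = b z * (((k + 1).factorial : ℂ)⁻¹ * _) - _
  simp_rw [hexp]
  rw [integral_add ((integrable_kdet hK _).const_mul _) (integrable_finsetSum _ fun j _ => hTint j),
    integral_finsetSum _ fun j _ => hTint j, integral_const_mul]
  simp_rw [hTval]
  rw [Finset.sum_const, Finset.card_univ, Fintype.card_fin, nsmul_eq_mul, mul_add,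
    mul_left_comm, sub_eq_add_neg]
  congr 1
  have h1 : (k.factorial : ℂ) ≠ 0 := by exact_mod_cast k.factorial_ne_zero
  have h2 : ((k + 1 : ℕ) : ℂ) ≠ 0 := by exact_mod_cast k.succ_ne_zero
  rw [Nat.factorial_succ, Nat.cast_mul]
  field_simp

theorem term_zero (K : X → X → ℂ) : term μ K 0 = 1 := by
  simp [term, kdet, Measure.real]

theorem minorTerm_zero (K : X → X → ℂ) (b : X → ℂ) (z : X) : minorTerm μ K b 0 z = b z := by
  simp [minorTerm, bmat, Measure.real]

/-- **Fredholm's identity**: the first minor solves the integral equation up to the factor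
`fdet μ K`. -/
theorem minor_add_integral [Nonempty X] (hK : BddKernel K M) (hb : BddFun b M) (z : X) :
    minor μ K b z + ∫ w, K z w * minor μ K b w ∂μ = fdet μ K * b z := by
  have hM := hK.nonneg
  have hsb : Summable (minorBound (M * (1 + μ.real univ))) :=
    summable_minorBound (by positivity)
  have hmeas : ∀ k, Measurable fun w => K z w * minorTerm μ K b k w := fun k =>
    (hK.left z).measurable.mul (measurable_minorTerm hK hb.measurable k)
  have hle : ∀ k w, ‖K z w * minorTerm μ K b k w‖ ≤ M * minorBound (M * (1 + μ.real univ)) k := by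
    intro k w
    rw [norm_mul]
    exact mul_le_mul (hK.bound _ _) (norm_minorTerm_le hK hb k w) (norm_nonneg _) hM
  have hI : HasSum (fun k => ∫ w, K z w * minorTerm μ K b k w ∂μ)
      (∫ w, K z w * minor μ K b w ∂μ) := by
    have := hasSum_integral_of_summable_integral_norm (μ := μ)
      (F := fun k w => K z w * minorTerm μ K b k w)
      (fun k => integrable_of_bound (hmeas k) (hle k)) ?_
    · simpa only [tsum_mul_left, minor] using this
    · refine Summable.of_nonneg_of_le (fun k => integral_nonneg fun _ => norm_nonneg _)
        (fun k => ?_) ((hsb.mul_left M).mul_right (μ.real univ))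
      refine (le_abs_self _).trans ?_
      have h := norm_integral_le_of_norm_le_const (μ := μ)
        (f := fun w => ‖K z w * minorTerm μ K b k w‖)
        (C := M * minorBound (M * (1 + μ.real univ)) k)
        (Eventually.of_forall fun w => by rw [norm_norm]; exact hle k w)
      exact h
  have hD : HasSum (fun k => b z * term μ K k) (b z * fdet μ K) :=
    (summable_term hK).hasSum.mul_left _
  have hP := (summable_minorTerm (μ := μ) hK hb z).hasSum
  have h1 := (hasSum_nat_add_iff' 1).2 hP
  have h2 := (hasSum_nat_add_iff' 1).2 hD
  simp only [Finset.range_one, Finset.sum_singleton, minorTerm_zero, term_zero, mul_one] at h1 h2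
  have h3 := h2.sub hI
  simp_rw [← minorTerm_succ hK hb] at h3
  have h4 := h1.unique h3
  unfold minor at *
  linear_combination h4

theorem kdet_swap (K : X → X → ℂ) {k : ℕ} (x : Fin k → X) :
    kdet (fun s t => K t s) x = kdet K x := by
  unfold kdet
  rw [← Matrix.det_transpose]
  rfl

theorem fdet_swap (K : X → X → ℂ) : fdet μ (fun s t => K t s) = fdet μ K := by
  unfold fdet term
  simp_rw [kdet_swap]

end identities

end Fredholm

/-! ### Integral equations and multiplicativity of the Fredholm determinant -/

namespace Fredholm

open MeasureTheory

variable {X : Type*} [MeasurableSpace X]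

section resolvent

variable {K : X → X → ℂ} {b : X → ℂ} {M : ℝ} {μ : Measure X} [IsFiniteMeasure μ] [Nonempty X]

/-- If the Fredholm determinant does not vanish, the integral equation is solvable. -/
theorem exists_solution (hK : BddKernel K M) (hD : fdet μ K ≠ 0) {C : ℝ} (hb : BddFun b C) :
    ∃ φ C', BddFun φ C' ∧ ∀ z, φ z + ∫ w, K z w * φ w ∂μ = b z := by
  have hK' := hK.mono (le_max_left M C)
  have hb' := hb.mono (le_max_right M C)
  obtain ⟨C', hC'⟩ := exists_bddFun_minor (μ := μ) hK' hb'
  refine ⟨fun z => (fdet μ K)⁻¹ * minor μ K b z, ‖(fdet μ K)⁻¹‖ * C',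
    ⟨hC'.measurable.const_mul _, fun x => ?_⟩, fun z => ?_⟩
  · rw [norm_mul]
    exact mul_le_mul_of_nonneg_left (hC'.bound x) (norm_nonneg _)
  · simp_rw [mul_left_comm _ (fdet μ K)⁻¹]
    rw [integral_const_mul, ← mul_add, minor_add_integral hK' hb', inv_mul_cancel_left₀ hD]

theorem BddFun.integrable {φ : X → ℂ} {C : ℝ} (hφ : BddFun φ C) : Integrable φ μ :=
  integrable_of_bound hφ.measurable hφ.bound

theorem BddFun.mul {φ ψ : X → ℂ} {C C' : ℝ} (hφ : BddFun φ C) (hψ : BddFun ψ C') :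
    BddFun (fun x => φ x * ψ x) (C * C') :=
  ⟨hφ.measurable.mul hψ.measurable, fun x => by
    rw [norm_mul]
    exact mul_le_mul (hφ.bound x) (hψ.bound x) (norm_nonneg _) ((norm_nonneg _).trans (hφ.bound x))⟩

theorem BddFun.add {φ ψ : X → ℂ} {C C' : ℝ} (hφ : BddFun φ C) (hψ : BddFun ψ C') :
    BddFun (fun x => φ x + ψ x) (C + C') :=
  ⟨hφ.measurable.add hψ.measurable, fun x =>
    (norm_add_le _ _).trans (add_le_add (hφ.bound x) (hψ.bound x))⟩

theorem BddFun.const_mul {φ : X → ℂ} {C : ℝ} (hφ : BddFun φ C) (c : ℂ) :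
    BddFun (fun x => c * φ x) (‖c‖ * C) :=
  ⟨hφ.measurable.const_mul c, fun x => by
    rw [norm_mul]; exact mul_le_mul_of_nonneg_left (hφ.bound x) (norm_nonneg _)⟩

theorem bddFun_integral (hK : BddKernel K M) {φ : X → ℂ} {C : ℝ} (hφ : BddFun φ C) :
    BddFun (fun z => ∫ w, K z w * φ w ∂μ) (M * C * μ.real univ) := by
  refine ⟨StronglyMeasurable.measurable (StronglyMeasurable.integral_prod_right
    (f := fun z w => K z w * φ w) ?_), fun z => ?_⟩
  · exact (hK.measurable.mul (hφ.measurable.comp measurable_snd)).stronglyMeasurable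
  · exact norm_integral_le_of_norm_le_const (Eventually.of_forall ((hK.left z).mul hφ).bound)

theorem integral_mul_integral_swap (hK : BddKernel K M) {φ ψ : X → ℂ} {C C' : ℝ}
    (hφ : BddFun φ C) (hψ : BddFun ψ C') :
    ∫ z, ψ z * ∫ w, K z w * φ w ∂μ ∂μ = ∫ w, (∫ z, K z w * ψ z ∂μ) * φ w ∂μ := by
  simp_rw [← integral_const_mul, ← integral_mul_const]
  rw [integral_integral_swap]
  · refine integral_congr_ae (Eventually.of_forall fun w => ?_)
    refine integral_congr_ae (Eventually.of_forall fun z => ?_)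
    simp only
    ring
  · refine integrable_of_bound (C := C' * (M * C)) ?_ fun p => ?_
    · exact (hψ.measurable.comp measurable_fst).mul
        (hK.measurable.mul (hφ.measurable.comp measurable_snd))
    · simp only [Function.uncurry, norm_mul]
      have := hK.nonneg
      have h1 := hφ.bound p.2
      have h2 := hψ.bound p.1
      have h3 := (norm_nonneg _).trans h1
      have h4 := (norm_nonneg _).trans h2
      gcongr
      exact hK.bound _ _

/-- If the Fredholm determinant does not vanish, the homogeneous equation has only the zero
solution: pair it with a solution of the transposed equation. -/
theorem eq_zero_of_add_integral_eq_zero (hK : BddKernel K M) (hD : fdet μ K ≠ 0) {φ : X → ℂ} {C : ℝ}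
    (hφ : BddFun φ C) (h : ∀ z, φ z + ∫ w, K z w * φ w ∂μ = 0) : ∀ z, φ z = 0 := by
  have hconj : BddFun (fun x => (starRingEnd ℂ) (φ x)) C :=
    ⟨Complex.continuous_conj.measurable.comp hφ.measurable, fun x => by
      rw [RCLike.norm_conj]; exact hφ.bound x⟩
  rw [← fdet_swap] at hD
  obtain ⟨ψ, C', hψ, hψe⟩ := exists_solution hK.swap hD hconj
  have h1 : ∫ w, (starRingEnd ℂ) (φ w) * φ w ∂μ = 0 := by
    simp_rw [← hψe, add_mul]
    rw [integral_add (hψ.mul hφ).integrable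
      ((bddFun_integral hK.swap hψ).mul hφ).integrable, ← integral_mul_integral_swap hK hφ hψ,
      ← integral_add (hψ.mul hφ).integrable (hψ.mul (bddFun_integral hK hφ)).integrable]
    simp_rw [← mul_add, h, mul_zero, integral_zero]
  have h2 : ∫ w, ‖φ w‖ ^ 2 ∂μ = 0 := by
    have : ∀ w, (starRingEnd ℂ) (φ w) * φ w = ((‖φ w‖ ^ 2 : ℝ) : ℂ) := fun w => by
      rw [Complex.conj_mul']; push_cast; rfl
    simp_rw [this] at h1
    rw [integral_complex_ofReal] at h1
    exact_mod_cast h1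
  rw [integral_eq_zero_iff_of_nonneg (fun _ => by positivity)] at h2
  · intro z
    have h3 : ∫ w, K z w * φ w ∂μ = 0 := by
      rw [← integral_zero X ℂ (μ := μ)]
      refine integral_congr_ae ?_
      filter_upwards [h2] with w hw
      have : φ w = 0 := by simpa using hw
      rw [this, mul_zero]
    simpa [h3] using h z
  · refine Integrable.of_bound (C := C ^ 2) (hφ.measurable.norm.pow_const 2).aestronglyMeasurable
      (Eventually.of_forall fun w => ?_)
    rw [norm_pow, norm_norm]
    exact pow_le_pow_left₀ (norm_nonneg _) (hφ.bound w) 2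

end resolvent

section derivative

variable {K U : X → X → ℂ} {M M' : ℝ} {μ : Measure X} [IsFiniteMeasure μ] [Nonempty X]

/-- Jacobi's formula: a determinant is differentiated column by column. -/
theorem hasDerivAt_det_add_mul {k : ℕ} (A B : Matrix (Fin k) (Fin k) ℂ) (ε : ℂ) :
    HasDerivAt (fun ε => (Matrix.of fun i j => A i j + ε * B i j).det)
      (∑ j, ((Matrix.of fun i j => A i j + ε * B i j).updateCol j fun i => B i j).det) ε := by
  have h : ∀ j, ((Matrix.of fun i j => A i j + ε * B i j).updateCol j fun i => B i j).det =
      ∑ σ : Equiv.Perm (Fin k), (Equiv.Perm.sign σ : ℂ) *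
        ((∏ i ∈ Finset.univ.erase j, (A (σ i) i + ε * B (σ i) i)) * B (σ j) j) := by
    intro j
    rw [Matrix.det_apply']
    refine Finset.sum_congr rfl fun σ _ => ?_
    rw [← Finset.prod_erase_mul _ _ (Finset.mem_univ j)]
    congr 2
    · refine Finset.prod_congr rfl fun i hi => ?_
      rw [Matrix.updateCol_ne (Finset.ne_of_mem_erase hi)]
      rfl
    · rw [Matrix.updateCol_self]
  simp_rw [h, Matrix.det_apply']
  rw [Finset.sum_comm]
  refine HasDerivAt.fun_sum fun σ _ => ?_
  rw [← Finset.mul_sum]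
  refine HasDerivAt.const_mul _ ?_
  have := HasDerivAt.fun_finsetProd (u := Finset.univ)
    (f := fun (i : Fin k) (ε : ℂ) => A (σ i) i + ε * B (σ i) i) (f' := fun i => B (σ i) i) (x := ε)
    (fun i _ => by simpa using ((hasDerivAt_id ε).mul_const (B (σ i) i)).const_add (A (σ i) i))
  simpa using this

/-- The derivative of the `k + 1`-st Fredholm term. -/
theorem hasDerivAt_term (hK : BddKernel K M) (hU : BddKernel U M') (k : ℕ) (ε : ℂ) :
    HasDerivAt (fun ε => term μ (fun x y => K x y + ε * U x y) (k + 1))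
      (∫ x, minorTerm μ (fun x y => K x y + ε * U x y) (fun s => U s x) k x ∂μ) ε := by
  have hM := hK.nonneg
  have hM' := hU.nonneg
  set R : ℝ := ‖ε‖ + 1 with hR
  set B : ℝ := M + R * M' + M' with hB
  have hBnn : 0 ≤ B := by positivity
  have hKε : ∀ ε' ∈ Metric.ball ε 1, BddKernel (fun x y => K x y + ε' * U x y) B := by
    intro ε' hε'
    refine (hK.add_smul hU (R := R) ?_).mono (by linarith)
    have : ‖ε' - ε‖ < 1 := by simpa [dist_eq_norm] using hε'
    calc ‖ε'‖ = ‖ε + (ε' - ε)‖ := by ring_nf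
      _ ≤ ‖ε‖ + ‖ε' - ε‖ := norm_add_le _ _
      _ ≤ R := by linarith
  have hε0 : ε ∈ Metric.ball ε 1 := Metric.mem_ball_self one_pos
  have hUB : BddKernel U B := hU.mono (by nlinarith [norm_nonneg ε])
  set G : ℂ → Fin (k + 1) → (Fin (k + 1) → X) → ℂ := fun ε' j x =>
    ((Matrix.of fun i j => K (x i) (x j) + ε' * U (x i) (x j)).updateCol j
      fun i => U (x i) (x j)).det with hG
  have hGm : ∀ ε' j, Measurable (G ε' j) := by
    intro ε' j
    refine measurable_det fun i l => ?_
    have hp : ∀ l, Measurable fun x : Fin (k + 1) → X => (x i, x l) := fun l =>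
      (measurable_pi_apply i).prodMk (measurable_pi_apply l)
    by_cases hl : l = j
    · subst hl
      simpa [Matrix.updateCol_self, Function.comp_def, Function.uncurry] using
        hU.measurable.comp (hp l)
    · simpa [Matrix.updateCol_ne hl, Function.comp_def, Function.uncurry, Pi.add_def] using
        (hK.measurable.comp (hp l)).add ((hU.measurable.comp (hp l)).const_mul ε')
  have hGb : ∀ ε' ∈ Metric.ball ε 1, ∀ j x, ‖G ε' j x‖ ≤ (Real.sqrt (k + 1 : ℕ) * B) ^ (k + 1) := by
    intro ε' hε' j x
    refine norm_det_le_of_norm_entries_le _ fun i l => ?_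
    by_cases hl : l = j
    · subst hl
      rw [Matrix.updateCol_self]
      exact hUB.bound _ _
    · rw [Matrix.updateCol_ne hl]
      exact (hKε ε' hε').bound _ _
  have hder := (hasDerivAt_integral_of_dominated_loc_of_deriv_le
    (μ := Measure.pi fun _ : Fin (k + 1) => μ)
    (F := fun ε' x => kdet (fun x y => K x y + ε' * U x y) x)
    (F' := fun ε' x => ∑ j, G ε' j x) (x₀ := ε)
    (bound := fun _ => ∑ _j : Fin (k + 1), (Real.sqrt (k + 1 : ℕ) * B) ^ (k + 1))
    (Metric.ball_mem_nhds ε one_pos)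
    (by
      filter_upwards [Metric.ball_mem_nhds ε one_pos] with ε' hε'
      exact (measurable_kdet (hKε ε' hε') _).aestronglyMeasurable)
    (integrable_kdet (hKε ε hε0) _)
    (Finset.measurable_sum _ fun j _ => hGm ε j).aestronglyMeasurable
    (Eventually.of_forall fun x ε' hε' => norm_sum_le_of_le _ fun j _ => hGb ε' hε' j x)
    (integrable_const _)
    (Eventually.of_forall fun x ε' _ => hasDerivAt_det_add_mul
      (Matrix.of fun i j => K (x i) (x j)) (Matrix.of fun i j => U (x i) (x j)) ε')).2
  have hmain : ((k + 1).factorial : ℂ)⁻¹ * ∫ x, ∑ j, G ε j x ∂Measure.pi (fun _ => μ) =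
      ∫ x, minorTerm μ (fun x y => K x y + ε * U x y) (fun s => U s x) k x ∂μ := by
    have hGi : ∀ j, Integrable (G ε j) (Measure.pi fun _ => μ) := fun j =>
      integrable_of_bound (hGm ε j) (hGb ε hε0 j)
    have hcol : ∀ j w (y : Fin k → X), G ε j (j.insertNth w y) =
        (bmat (fun x y => K x y + ε * U x y) (fun s => U s w)
          (Fin.cons w y : Fin (k + 1) → X)).det := by
      intro j w y
      have hpt : ∀ i, (Fin.cons w y : Fin (k + 1) → X) i =
          (j.insertNth w y : Fin (k + 1) → X) (j.cycleRange.symm i) :=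
        fun i => congrFun (insertNth_eq_cons_comp j w y) i
      rw [hG]
      simp only
      rw [← Matrix.det_submatrix_equiv_self j.cycleRange.symm]
      congr 1
      ext r c
      refine Fin.cases ?_ (fun c => ?_) c
      · simp only [bmat, Matrix.submatrix_apply, Fin.cycleRange_symm_zero, Matrix.updateCol_self,
          Matrix.of_apply, if_true, hpt, Fin.insertNth_apply_same]
      · have hne : j.succAbove c ≠ j := Fin.succAbove_ne j c
        simp only [bmat, Matrix.submatrix_apply, Fin.cycleRange_symm_succ,
          Matrix.updateCol_ne hne, Matrix.of_apply, Fin.succ_ne_zero, if_false, hpt]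
    rw [integral_finsetSum _ fun j _ => hGi j]
    have hj : ∀ j, ∫ x, G ε j x ∂Measure.pi (fun _ => μ) = (k.factorial : ℂ) *
        ∫ x, minorTerm μ (fun x y => K x y + ε * U x y) (fun s => U s x) k x ∂μ := by
      intro j
      rw [integral_insertNth j _ (hGi j), ← integral_const_mul]
      refine integral_congr_ae (Eventually.of_forall fun w => ?_)
      have : (k.factorial : ℂ) ≠ 0 := by exact_mod_cast k.factorial_ne_zero
      simp only [hcol, minorTerm]
      field_simp
    simp_rw [hj]
    rw [Finset.sum_const, Finset.card_univ, Fintype.card_fin, nsmul_eq_mul]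
    have h1 : (k.factorial : ℂ) ≠ 0 := by exact_mod_cast k.factorial_ne_zero
    have h2 : ((k + 1 : ℕ) : ℂ) ≠ 0 := by exact_mod_cast k.succ_ne_zero
    rw [Nat.factorial_succ, Nat.cast_mul]
    field_simp
  rw [← hmain]
  exact hder.const_mul _

theorem measurable_minorTerm_diag (hK : BddKernel K M) (hU : BddKernel U M') (k : ℕ) :
    Measurable fun x => minorTerm μ K (fun s => U s x) k x := by
  unfold minorTerm
  refine Measurable.const_mul ?_ _
  refine StronglyMeasurable.measurable (StronglyMeasurable.integral_prod_right
    (f := fun x (y : Fin k → X) =>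
      (bmat K (fun s => U s x) (Fin.cons x y : Fin (k + 1) → X)).det) ?_)
  refine (measurable_det fun i j => ?_).stronglyMeasurable
  have hi : ∀ i, Measurable fun p : X × (Fin k → X) => (Fin.cons p.1 p.2 : Fin (k + 1) → X) i :=
    fun i => (measurable_pi_apply i).comp measurable_cons
  by_cases hj : j = 0
  · simpa [bmat, hj, Function.comp_def, Function.uncurry] using
      hU.measurable.comp ((hi i).prodMk measurable_fst)
  · simpa [bmat, hj, Function.comp_def, Function.uncurry] using
      hK.measurable.comp ((hi i).prodMk (hi j))

/-- The derivative of the Fredholm determinant in the direction of a kernel. -/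
theorem hasDerivAt_fdet (hK : BddKernel K M) (hU : BddKernel U M') (ε : ℂ) :
    HasDerivAt (fun ε => fdet μ (fun x y => K x y + ε * U x y))
      (∫ x, minor μ (fun x y => K x y + ε * U x y) (fun s => U s x) x ∂μ) ε := by
  have hM := hK.nonneg
  have hM' := hU.nonneg
  set B : ℝ := M + (‖ε‖ + 1) * M' + M' with hB
  have hBnn : 0 ≤ B := by positivity
  have hKε : ∀ ε' ∈ Metric.ball ε 1, BddKernel (fun x y => K x y + ε' * U x y) B := by
    intro ε' hε'
    refine (hK.add_smul hU (R := ‖ε‖ + 1) ?_).mono (by linarith)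
    have : ‖ε' - ε‖ < 1 := by simpa [dist_eq_norm] using hε'
    calc ‖ε'‖ = ‖ε + (ε' - ε)‖ := by ring_nf
      _ ≤ ‖ε‖ + ‖ε' - ε‖ := norm_add_le _ _
      _ ≤ ‖ε‖ + 1 := by linarith
  have hUB : BddKernel U B := hU.mono (by nlinarith [norm_nonneg ε])
  have hε0 : ε ∈ Metric.ball ε 1 := Metric.mem_ball_self one_pos
  have hsb : Summable (minorBound (B * (1 + μ.real univ))) :=
    summable_minorBound (by positivity)
  have hle : ∀ ε' ∈ Metric.ball ε 1, ∀ k x,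
      ‖minorTerm μ (fun x y => K x y + ε' * U x y) (fun s => U s x) k x‖ ≤
        minorBound (B * (1 + μ.real univ)) k :=
    fun ε' hε' k x => norm_minorTerm_le (hKε ε' hε') (hUB.right x) k x
  have hder := hasDerivAt_tsum_of_isPreconnected
    (u := fun k => minorBound (B * (1 + μ.real univ)) k * μ.real univ)
    (g := fun k ε' => term μ (fun x y => K x y + ε' * U x y) (k + 1))
    (g' := fun k ε' => ∫ x, minorTerm μ (fun x y => K x y + ε' * U x y) (fun s => U s x) k x ∂μ)
    (hsb.mul_right _) Metric.isOpen_ball (convex_ball ε 1).isPreconnected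
    (fun k ε' _ => hasDerivAt_term hK hU k ε')
    (fun k ε' hε' => norm_integral_le_of_norm_le_const (Eventually.of_forall (hle ε' hε' k)))
    hε0 ((summable_nat_add_iff 1).2 (summable_term (hKε ε hε0))) hε0
  have hI := hasSum_integral_of_summable_integral_norm (μ := μ)
    (F := fun k x => minorTerm μ (fun x y => K x y + ε * U x y) (fun s => U s x) k x)
    (fun k => integrable_of_bound (measurable_minorTerm_diag (hKε ε hε0) hU k) (hle ε hε0 k)) (by
      refine Summable.of_nonneg_of_le (fun k => integral_nonneg fun _ => norm_nonneg _)
        (fun k => ?_) (hsb.mul_right (μ.real univ))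
      refine (le_abs_self _).trans ?_
      exact norm_integral_le_of_norm_le_const (μ := μ)
        (f := fun x => ‖minorTerm μ (fun x y => K x y + ε * U x y) (fun s => U s x) k x‖)
        (Eventually.of_forall fun w => by rw [norm_norm]; exact hle ε hε0 k w))
  rw [hI.tsum_eq] at hder
  have hcongr : (fun ε' => fdet μ (fun x y => K x y + ε' * U x y)) =ᶠ[𝓝 ε]
      fun ε' => 1 + ∑' k, term μ (fun x y => K x y + ε' * U x y) (k + 1) := by
    filter_upwards [Metric.ball_mem_nhds ε one_pos] with ε' hε'
    unfold fdet
    rw [(summable_term (hKε ε' hε')).tsum_eq_zero_add, term_zero]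
  exact (hder.const_add 1).congr_of_eventuallyEq hcongr

/-- **Multiplicativity of the Fredholm determinant.** If `(I + K) W = U`, then
`det (I + K + U) = det (I + K) det (I + W)`. Along `K + ε U` and `ε W` the two logarithmic
derivatives agree, since both are the trace of the same solution operator. -/
theorem fdet_add_eq_mul {W : X → X → ℂ} {M'' : ℝ} (hK : BddKernel K M) (hU : BddKernel U M')
    (hW : BddKernel W M'') (hD : fdet μ K ≠ 0)
    (h : ∀ x y, W x y + ∫ w, K x w * W w y ∂μ = U x y) :
    fdet μ (fun x y => K x y + U x y) = fdet μ K * fdet μ W := by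
  have hzero : BddKernel (fun _ _ : X => (0 : ℂ)) 0 := ⟨measurable_const, fun _ _ => by simp⟩
  set f : ℂ → ℂ := fun ε => fdet μ (fun x y => K x y + ε * U x y) with hf
  set g : ℂ → ℂ := fun ε => fdet μ (fun x y => 0 + ε * W x y) with hg
  have hf' := hasDerivAt_fdet (μ := μ) hK hU
  have hg' := hasDerivAt_fdet (μ := μ) hzero hW
  have hKε : ∀ ε, BddKernel (fun x y => K x y + ε * U x y) (M + ‖ε‖ * M') := fun ε =>
    hK.add_smul hU le_rfl
  have hWε : ∀ ε, BddKernel (fun x y => 0 + ε * W x y) (0 + ‖ε‖ * M'') := fun ε =>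
    hzero.add_smul hW le_rfl
  have hf0 : f 0 = fdet μ K := by simp [hf]
  have hg0 : g 0 = 1 := by
    simp only [hg, zero_mul, add_zero, fdet]
    rw [tsum_eq_single 0, term_zero]
    intro k hk
    obtain ⟨k, rfl⟩ := Nat.exists_eq_succ_of_ne_zero hk
    have : ∀ x : Fin (k + 1) → X, kdet (fun _ _ => (0 : ℂ)) x = 0 := fun x =>
      Matrix.det_eq_zero_of_row_eq_zero 0 fun _ => rfl
    simp [term, this]
  have hkey : ∀ ε, f ε ≠ 0 → ∀ x, g ε * minor μ (fun x y => K x y + ε * U x y) (fun s => U s x) x =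
      f ε * minor μ (fun x y => 0 + ε * W x y) (fun s => W s x) x := by
    intro ε hε x
    set B := max (M + ‖ε‖ * M') (max M' (max M'' (‖ε‖ * M''))) with hB
    have hKB := (hKε ε).mono (le_max_left _ _ : _ ≤ B)
    have hUB : BddKernel U B := hU.mono ((le_max_left _ _).trans (le_max_right _ _))
    have hWB : BddKernel W B := hW.mono
      ((le_max_left _ _).trans ((le_max_right _ _).trans (le_max_right _ _)))
    have hWεB : BddKernel (fun x y => 0 + ε * W x y) B := (hWε ε).mono (by
      rw [zero_add]
      exact (le_max_right _ _).trans ((le_max_right _ _).trans (le_max_right _ _)))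
    obtain ⟨C1, h1⟩ := exists_bddFun_minor (μ := μ) hKB (hUB.right x)
    obtain ⟨C2, h2⟩ := exists_bddFun_minor (μ := μ) hWεB (hWB.right x)
    have e1 := minor_add_integral (μ := μ) hKB (hUB.right x)
    have e2 := minor_add_integral (μ := μ) hWεB (hWB.right x)
    set m1 := minor μ (fun x y => K x y + ε * U x y) (fun s => U s x)
    set m2 := minor μ (fun x y => 0 + ε * W x y) (fun s => W s x)
    have e2' : ∀ z, m2 z + ε * ∫ w, W z w * m2 w ∂μ = g ε * W z x := by
      intro z
      rw [← integral_const_mul, ← e2 z]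
      simp only [zero_add, mul_assoc]
    -- `m2` solves the equation of `m1`, because `(I + K) (I + ε W) = I + K + ε U`
    have e3 : ∀ z, m2 z + ∫ w, (K z w + ε * U z w) * m2 w ∂μ = g ε * U z x := by
      intro z
      have i1 : ∫ w, (K z w + ε * U z w) * m2 w ∂μ =
          ∫ w, K z w * m2 w ∂μ + ε * ∫ w, U z w * m2 w ∂μ := by
        rw [← integral_const_mul, ← integral_add ((hK.left z).mul h2).integrable
          (((hU.left z).mul h2).integrable.const_mul ε)]
        refine integral_congr_ae (Eventually.of_forall fun w => ?_)
        simp only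
        ring
      have i2 : ∫ w, U z w * m2 w ∂μ =
          ∫ w, W z w * m2 w ∂μ + ∫ v, K z v * ∫ w, W v w * m2 w ∂μ ∂μ := by
        rw [integral_mul_integral_swap hW h2 (hK.left z), ← integral_add
          ((hW.left z).mul h2).integrable]
        · refine integral_congr_ae (Eventually.of_forall fun w => ?_)
          simp only
          rw [← h z w, add_mul]
          simp only [mul_comm]
        · exact ((bddFun_integral (μ := μ) hW.swap (hK.left z)).mul h2).integrable
      have i3 : ∫ w, K z w * m2 w ∂μ + ε * ∫ v, K z v * ∫ w, W v w * m2 w ∂μ ∂μ =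
          g ε * ∫ w, K z w * W w x ∂μ := by
        rw [← integral_const_mul, ← integral_const_mul,
          ← integral_add ((hK.left z).mul h2).integrable
          (((hK.left z).mul (bddFun_integral hW h2)).integrable.const_mul ε)]
        refine integral_congr_ae (Eventually.of_forall fun w => ?_)
        simp only
        rw [mul_left_comm, ← mul_add, e2' w]
        ring
      rw [i1, i2]
      linear_combination i3 + e2' z + g ε * h z x
    have hdiff := eq_zero_of_add_integral_eq_zero hKB hε
      (φ := fun z => g ε * m1 z + (-f ε) * m2 z) ((h1.const_mul _).add (h2.const_mul _)) (by
        intro z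
        have i1 : ∫ w, (K z w + ε * U z w) * (g ε * m1 w + (-f ε) * m2 w) ∂μ =
            g ε * ∫ w, (K z w + ε * U z w) * m1 w ∂μ +
              (-f ε) * ∫ w, (K z w + ε * U z w) * m2 w ∂μ := by
          rw [← integral_const_mul, ← integral_const_mul, ← integral_add
            (((hKB.left z).mul h1).integrable.const_mul _)
            (((hKB.left z).mul h2).integrable.const_mul _)]
          refine integral_congr_ae (Eventually.of_forall fun w => ?_)
          simp only
          ring
        rw [i1]
        linear_combination g ε * e1 z - f ε * e3 z)
    linear_combination hdiff x
  have hfd : Differentiable ℂ f := fun ε => (hf' ε).differentiableAt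
  have hgd : Differentiable ℂ g := fun ε => (hg' ε).differentiableAt
  have hfne : ∀ᶠ ε in 𝓝 (0 : ℂ), f ε ≠ 0 := hfd.continuous.continuousAt.eventually_ne (by rwa [hf0])
  have hgne : ∀ᶠ ε in 𝓝 (0 : ℂ), g ε ≠ 0 :=
    hgd.continuous.continuousAt.eventually_ne (by rw [hg0]; exact one_ne_zero)
  obtain ⟨r, hr, hball⟩ := Metric.eventually_nhds_iff_ball.1 (hfne.and hgne)
  have hconst : ∀ ε ∈ Metric.ball (0 : ℂ) r, f ε / g ε = f 0 / g 0 := by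
    intro ε hε
    refine (convex_ball (0 : ℂ) r).is_const_of_fderivWithin_eq_zero (𝕜 := ℂ)
      (f := fun ε => f ε / g ε) ?_ ?_ hε (Metric.mem_ball_self hr)
    · exact fun z hz => ((hfd z).div (hgd z) (hball z hz).2).differentiableWithinAt
    · intro z hz
      have hd := (hf' z).div (hg' z) (hball z hz).2
      have hz0 : (∫ x, minor μ (fun x y => K x y + z * U x y) (fun s => U s x) x ∂μ) * g z =
          f z * ∫ x, minor μ (fun x y => 0 + z * W x y) (fun s => W s x) x ∂μ := by
        rw [← integral_const_mul, ← integral_mul_const]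
        refine integral_congr_ae (Eventually.of_forall fun x => ?_)
        have := hkey z (hball z hz).1 x
        simp only
        rw [← this]; ring
      have h0 : HasDerivAt (fun ε => f ε / g ε) 0 z := by
        refine hd.congr_deriv ?_
        rw [div_eq_zero_iff]
        left
        linear_combination hz0
      rw [fderivWithin_of_isOpen Metric.isOpen_ball hz]
      exact h0.hasFDerivAt.fderiv.trans (by ext; simp)
  have heq : Set.EqOn f (fun ε => f 0 * g ε) univ := by
    refine AnalyticOnNhd.eqOn_of_preconnected_of_eventuallyEq (𝕜 := ℂ) (z₀ := 0) ?_ ?_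
      isPreconnected_univ (mem_univ _) ?_
    · exact fun z _ => hfd.analyticAt z
    · exact fun z _ => (hgd.const_mul (f 0)).analyticAt z
    · filter_upwards [Metric.ball_mem_nhds (0 : ℂ) hr] with ε hε
      have := hconst ε hε
      rw [hg0, div_one, div_eq_iff (hball ε hε).2] at this
      exact this
  have := heq (mem_univ 1)
  simpa [hf, hg] using this

end derivative

end Fredholm

/-! ### Local structure of the curve -/

namespace PiecewiseSmoothCurve

variable (J : PiecewiseSmoothCurve)

theorem pieces_pos' : (0 : ℝ) < J.pieces := by exact_mod_cast J.pieces_pos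

theorem one_le_pieces : (1 : ℝ) ≤ J.pieces := by exact_mod_cast J.pieces_pos

variable {J}

theorem Icc_subset_of_lt {i : ℕ} (hi : i < J.pieces) :
    Icc (i : ℝ) (i + 1) ⊆ Icc (0 : ℝ) J.pieces := by
  have : (i : ℝ) + 1 ≤ J.pieces := by exact_mod_cast hi
  exact Icc_subset_Icc (by positivity) this

/-- A function that is continuous on every piece of the parameter interval is continuous. -/
theorem continuousOn_of_pieces {E : Type*} [TopologicalSpace E] {g : ℝ → E}
    (h : ∀ i < J.pieces, ContinuousOn g (Icc (i : ℝ) (i + 1))) :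
    ContinuousOn g (Icc (0 : ℝ) J.pieces) := by
  have : ∀ k : ℕ, k ≤ J.pieces → ContinuousOn g (Icc (0 : ℝ) k) := by
    intro k
    induction k with
    | zero => intro _; simp
    | succ k ih =>
      intro hk
      have hu : Icc (0 : ℝ) (k + 1 : ℕ) = Icc (0 : ℝ) k ∪ Icc (k : ℝ) (k + 1) := by
        rw [Icc_union_Icc_eq_Icc (by positivity) (by linarith)]
        push_cast; rfl
      rw [hu]
      exact (ih (by omega)).union_of_isClosed (h k (by omega)) isClosed_Icc isClosed_Icc
  exact this _ le_rfl

theorem continuousOn_toFun : ContinuousOn J.toFun (Icc (0 : ℝ) J.pieces) :=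
  continuousOn_of_pieces fun i hi => (J.smooth i hi).continuousOn

/-- A function that is `C`-Lipschitz on every piece of the parameter interval is `C`-Lipschitz. -/
theorem lipschitz_of_pieces {g : ℝ → ℂ} {C : ℝ}
    (h : ∀ i < J.pieces, ∀ s ∈ Icc (i : ℝ) (i + 1), ∀ t ∈ Icc (i : ℝ) (i + 1),
      ‖g s - g t‖ ≤ C * |s - t|) :
    ∀ s ∈ Icc (0 : ℝ) J.pieces, ∀ t ∈ Icc (0 : ℝ) J.pieces, ‖g s - g t‖ ≤ C * |s - t| := by
  have key : ∀ k : ℕ, k ≤ J.pieces → ∀ s ∈ Icc (0 : ℝ) k, ∀ t ∈ Icc (0 : ℝ) k, s ≤ t →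
      ‖g s - g t‖ ≤ C * (t - s) := by
    intro k
    induction k with
    | zero =>
      intro _ s hs t ht _
      simp at hs ht
      simp [hs, ht]
    | succ k ih =>
      intro hk s hs t ht hst
      push_cast at hs ht
      have hp : ∀ s ∈ Icc (k : ℝ) (k + 1), ∀ t ∈ Icc (k : ℝ) (k + 1), s ≤ t →
          ‖g s - g t‖ ≤ C * (t - s) := fun s hs t ht hst => by
        have := h k (by omega) s hs t ht
        rwa [abs_sub_comm, abs_of_nonneg (by linarith)] at this
      rcases le_total t (k : ℝ) with htk | htk
      · exact ih (by omega) s ⟨hs.1, hst.trans htk⟩ t ⟨ht.1, htk⟩ hst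
      · rcases le_total (k : ℝ) s with hks | hks
        · exact hp s ⟨hks, hs.2⟩ t ⟨htk, ht.2⟩ hst
        · have h1 := ih (by omega) s ⟨hs.1, hks⟩ k ⟨by positivity, le_rfl⟩ hks
          have h2 := hp k ⟨le_rfl, by linarith⟩ t ⟨htk, ht.2⟩ htk
          have h3 := norm_sub_le_norm_sub_add_norm_sub (g s) (g k) (g t)
          linarith
  intro s hs t ht
  rcases le_total s t with hst | hst
  · rw [abs_sub_comm, abs_of_nonneg (by linarith)]
    exact key _ le_rfl s hs t ht hst
  · rw [abs_of_nonneg (by linarith), norm_sub_rev]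
    exact key _ le_rfl t ht s hs hst

theorem exists_lipschitz_of_smooth {g : ℝ → ℂ}
    (h : ∀ i < J.pieces, ContDiffOn ℝ ∞ g (Icc (i : ℝ) (i + 1))) :
    ∃ C, 0 ≤ C ∧ ∀ s ∈ Icc (0 : ℝ) J.pieces, ∀ t ∈ Icc (0 : ℝ) J.pieces,
      ‖g s - g t‖ ≤ C * |s - t| := by
  have h1 : ∀ i < J.pieces, ∃ C : NNReal, LipschitzOnWith C g (Icc (i : ℝ) (i + 1)) :=
    fun i hi => (h i hi).exists_lipschitzOnWith (by simp) (convex_Icc _ _) isCompact_Icc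
  choose! C hC using h1
  refine ⟨∑ i ∈ Finset.range J.pieces, (C i : ℝ), by positivity, lipschitz_of_pieces ?_⟩
  intro i hi s hs t ht
  have h2 := (hC i hi).dist_le_mul s hs t ht
  rw [dist_eq_norm, Real.dist_eq] at h2
  refine h2.trans ?_
  gcongr
  exact Finset.single_le_sum (f := fun i => (C i : ℝ)) (fun _ _ => NNReal.coe_nonneg _)
    (Finset.mem_range.2 hi)

theorem deriv_eq_of_mem_Ioo {g : ℝ → ℂ} {i : ℕ} {t : ℝ} (ht : t ∈ Ioo (i : ℝ) (i + 1)) :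
    deriv g t = derivWithin g (Icc (i : ℝ) (i + 1)) t :=
  (derivWithin_of_mem_nhds (Icc_mem_nhds ht.1 ht.2)).symm

theorem hasDerivAt_of_smooth {g : ℝ → ℂ}
    (h : ∀ i < J.pieces, ContDiffOn ℝ ∞ g (Icc (i : ℝ) (i + 1))) {i : ℕ} (hi : i < J.pieces)
    {t : ℝ} (ht : t ∈ Ioo (i : ℝ) (i + 1)) : HasDerivAt g (deriv g t) t :=
  (((h i hi).differentiableOn (by simp)).differentiableAt (Icc_mem_nhds ht.1 ht.2)).hasDerivAt

theorem continuousOn_derivWithin {g : ℝ → ℂ}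
    (h : ∀ i < J.pieces, ContDiffOn ℝ ∞ g (Icc (i : ℝ) (i + 1))) {i : ℕ} (hi : i < J.pieces) :
    ContinuousOn (derivWithin g (Icc (i : ℝ) (i + 1))) (Icc (i : ℝ) (i + 1)) :=
  (h i hi).continuousOn_derivWithin (uniqueDiffOn_Icc (by linarith)) (by simp)

theorem exists_bound_deriv {g : ℝ → ℂ}
    (h : ∀ i < J.pieces, ContDiffOn ℝ ∞ g (Icc (i : ℝ) (i + 1))) :
    ∃ M, 0 ≤ M ∧ ∀ t ∈ Icc (0 : ℝ) J.pieces, ‖deriv g t‖ ≤ M := by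
  have h1 : ∀ i < J.pieces, ∃ M, ∀ t ∈ Icc (i : ℝ) (i + 1), ‖deriv g t‖ ≤ M := by
    intro i hi
    obtain ⟨M, hM⟩ := isCompact_Icc.exists_bound_of_continuousOn (continuousOn_derivWithin h hi)
    refine ⟨max M (max ‖deriv g i‖ ‖deriv g (i + 1)‖), fun t ht => ?_⟩
    rcases eq_or_lt_of_le ht.1 with h0 | h0
    · rw [← h0]; simp
    rcases eq_or_lt_of_le ht.2 with h2 | h2
    · rw [h2]; simp
    · rw [deriv_eq_of_mem_Ioo ⟨h0, h2⟩]
      exact (hM t ht).trans (le_max_left _ _)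
  choose! M hM using h1
  refine ⟨∑ i ∈ Finset.range J.pieces, |M i|, by positivity, fun t ht => ?_⟩
  obtain ⟨i, hi, hti⟩ : ∃ i < J.pieces, t ∈ Icc (i : ℝ) (i + 1) := by
    rcases eq_or_lt_of_le ht.2 with h2 | h2
    · refine ⟨J.pieces - 1, Nat.sub_lt J.pieces_pos one_pos, ?_⟩
      rw [Nat.cast_pred J.pieces_pos, h2]
      constructor <;> simp
    · exact ⟨⌊t⌋₊, (Nat.floor_lt ht.1).2 h2, Nat.floor_le ht.1, (Nat.lt_floor_add_one t).le⟩
  refine ((hM i hi t hti).trans (le_abs_self _)).trans ?_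
  exact Finset.single_le_sum (f := fun i => |M i|) (fun _ _ => abs_nonneg _)
    (Finset.mem_range.2 hi)

theorem exists_direction {u w : ℂ} (hu : u ≠ 0) (hw : w ≠ 0) (h : ¬ SameRay ℝ u (-w)) :
    ∃ d : ℂ, d ≠ 0 ∧ 0 < (u / d).re ∧ 0 < (w / d).re := by
  have hu' : (0 : ℝ) < ‖u‖ := norm_pos_iff.2 hu
  have hw' : (0 : ℝ) < ‖w‖ := norm_pos_iff.2 hw
  -- the sum of the unit vectors
  set d : ℂ := (‖w‖ : ℂ) * u + (‖u‖ : ℂ) * w with hd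
  have hre : ∀ v : ℂ, (v / d).re = (v.re * d.re + v.im * d.im) / Complex.normSq d := by
    intro v
    rw [Complex.div_re]; ring
  have hinner : -(‖u‖ * ‖w‖) < u.re * w.re + u.im * w.im := by
    by_contra hcon
    apply h
    rw [sameRay_iff_norm_smul_eq]
    have hn1 : ‖u‖ ^ 2 = u.re ^ 2 + u.im ^ 2 := by
      rw [← Complex.normSq_eq_norm_sq, Complex.normSq_apply]; ring
    have hn2 : ‖w‖ ^ 2 = w.re ^ 2 + w.im ^ 2 := by
      rw [← Complex.normSq_eq_norm_sq, Complex.normSq_apply]; ring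
    have hz : (‖u‖ * w.re + ‖w‖ * u.re) ^ 2 + (‖u‖ * w.im + ‖w‖ * u.im) ^ 2 ≤ 0 := by
      have : (‖u‖ * w.re + ‖w‖ * u.re) ^ 2 + (‖u‖ * w.im + ‖w‖ * u.im) ^ 2 =
          2 * (‖u‖ * ‖w‖) * (‖u‖ * ‖w‖ + (u.re * w.re + u.im * w.im)) := by
        linear_combination (-‖u‖ ^ 2) * hn2 - ‖w‖ ^ 2 * hn1
      rw [this]
      have h2 : 0 < ‖u‖ * ‖w‖ := by positivity
      nlinarith
    have h1 : ‖u‖ * w.re + ‖w‖ * u.re = 0 := by nlinarith [sq_nonneg (‖u‖ * w.im + ‖w‖ * u.im)]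
    have h2 : ‖u‖ * w.im + ‖w‖ * u.im = 0 := by nlinarith [sq_nonneg (‖u‖ * w.re + ‖w‖ * u.re)]
    rw [norm_neg]
    apply Complex.ext
    · simp; linarith
    · simp; linarith
  have hn1 : ‖u‖ ^ 2 = u.re ^ 2 + u.im ^ 2 := by
    rw [← Complex.normSq_eq_norm_sq, Complex.normSq_apply]; ring
  have hn2 : ‖w‖ ^ 2 = w.re ^ 2 + w.im ^ 2 := by
    rw [← Complex.normSq_eq_norm_sq, Complex.normSq_apply]; ring
  have hdu : 0 < u.re * d.re + u.im * d.im := by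
    have : u.re * d.re + u.im * d.im = ‖u‖ * (‖u‖ * ‖w‖ + (u.re * w.re + u.im * w.im)) := by
      simp only [hd, Complex.add_re, Complex.add_im, Complex.re_ofReal_mul, Complex.im_ofReal_mul]
      linear_combination (-‖w‖) * hn1
    rw [this]
    exact mul_pos hu' (by linarith)
  have hdw : 0 < w.re * d.re + w.im * d.im := by
    have : w.re * d.re + w.im * d.im = ‖w‖ * (‖u‖ * ‖w‖ + (u.re * w.re + u.im * w.im)) := by
      simp only [hd, Complex.add_re, Complex.add_im, Complex.re_ofReal_mul, Complex.im_ofReal_mul]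
      linear_combination (-‖u‖) * hn2
    rw [this]
    exact mul_pos hw' (by linarith)
  have hd0 : d ≠ 0 := by
    intro h0
    simp [h0] at hdu
  refine ⟨d, hd0, ?_, ?_⟩
  · rw [hre]; exact div_pos hdu (Complex.normSq_pos.2 hd0)
  · rw [hre]; exact div_pos hdw (Complex.normSq_pos.2 hd0)

/-- The one-sided tangent vectors exist and do not vanish (from the right). -/
theorem tendsto_deriv_right {i : ℕ} (hi : i < J.pieces) {t : ℝ} (ht : t ∈ Ico (i : ℝ) (i + 1)) :
    Tendsto (deriv J.toFun) (𝓝[>] t) (𝓝 (derivWithin J.toFun (Icc (i : ℝ) (i + 1)) t)) := by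
  have h1 := (continuousOn_derivWithin J.smooth hi) t ⟨ht.1, ht.2.le⟩
  have hmem : Ioo t (i + 1) ∈ 𝓝[>] t := Ioo_mem_nhdsGT ht.2
  have h2 : Tendsto (derivWithin J.toFun (Icc (i : ℝ) (i + 1))) (𝓝[>] t)
      (𝓝 (derivWithin J.toFun (Icc (i : ℝ) (i + 1)) t)) :=
    h1.tendsto.mono_left (nhdsWithin_le_of_mem (mem_of_superset hmem fun s hs =>
      ⟨ht.1.trans hs.1.le, hs.2.le⟩))
  refine h2.congr' ?_
  filter_upwards [hmem] with s hs
  exact (deriv_eq_of_mem_Ioo ⟨ht.1.trans_lt hs.1, hs.2⟩).symm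

theorem tendsto_deriv_left {i : ℕ} (hi : i < J.pieces) {t : ℝ} (ht : t ∈ Ioc (i : ℝ) (i + 1)) :
    Tendsto (deriv J.toFun) (𝓝[<] t) (𝓝 (derivWithin J.toFun (Icc (i : ℝ) (i + 1)) t)) := by
  have h1 := (continuousOn_derivWithin J.smooth hi) t ⟨ht.1.le, ht.2⟩
  have hmem : Ioo (i : ℝ) t ∈ 𝓝[<] t := Ioo_mem_nhdsLT ht.1
  have h2 : Tendsto (derivWithin J.toFun (Icc (i : ℝ) (i + 1))) (𝓝[<] t)
      (𝓝 (derivWithin J.toFun (Icc (i : ℝ) (i + 1)) t)) :=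
    h1.tendsto.mono_left (nhdsWithin_le_of_mem (mem_of_superset hmem fun s hs =>
      ⟨hs.1.le, hs.2.le.trans ht.2⟩))
  refine h2.congr' ?_
  filter_upwards [hmem] with s hs
  exact (deriv_eq_of_mem_Ioo ⟨hs.1, hs.2.trans_le ht.2⟩).symm

end PiecewiseSmoothCurve

namespace PiecewiseSmoothCurve

variable {J : PiecewiseSmoothCurve}

/-- A piece of the curve around its point `p`, parametrised by `[l, r]` with `0` corresponding to
`p`, whose tangents make an angle with the direction `d` that is bounded away from `π / 2`: after
division by `d` the piece is a Lipschitz graph over the real axis. The parameter `t < 0` stands for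
the parameter `tL + t` of the curve, and `t ≥ 0` for `tR + t`; these differ only if `p` is the base
point of a closed curve, where `tL = pieces` and `tR = 0`. If `p` is an end point, then `l = 0` or
`r = 0`. -/
structure LocalArc (J : PiecewiseSmoothCurve) (p : ℂ) where
  /-- parameter of `p` as an end of the incoming piece -/
  tL : ℝ
  /-- parameter of `p` as an end of the outgoing piece -/
  tR : ℝ
  /-- left end of the parameter interval -/
  l : ℝ
  /-- right end of the parameter interval -/
  r : ℝ
  /-- lower bound for the slope in the direction `d` -/
  κ : ℝ
  /-- the direction of the arc -/
  d : ℂ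
  /-- lower bound for the distance between `p` and the rest of the curve -/
  ρ : ℝ
  l_nonpos : l ≤ 0
  r_nonneg : 0 ≤ r
  l_lt_r : l < r
  memL : tL ∈ Icc (0 : ℝ) J.pieces
  memR : tR ∈ Icc (0 : ℝ) J.pieces
  ptL : J.toFun tL = p
  ptR : J.toFun tR = p
  eq_or : tL = tR ∨ (tL = J.pieces ∧ tR = 0 ∧ r ≤ J.pieces + l)
  left_ge : 0 ≤ tL + l
  right_le : tR + r ≤ J.pieces
  left_piece : ∀ t ∈ Ioo (tL + l) tL, ∃ i < J.pieces, t ∈ Ioo (i : ℝ) (i + 1)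
  right_piece : ∀ t ∈ Ioo tR (tR + r), ∃ i < J.pieces, t ∈ Ioo (i : ℝ) (i + 1)
  κ_pos : 0 < κ
  d_ne : d ≠ 0
  left_slope : ∀ t ∈ Ioo (tL + l) tL, κ ≤ (deriv J.toFun t / d).re
  right_slope : ∀ t ∈ Ioo tR (tR + r), κ ≤ (deriv J.toFun t / d).re
  ρ_pos : 0 < ρ
  far : ∀ t ∈ Icc (0 : ℝ) J.pieces, t ∉ Ioc (tL + l) tL → t ∉ Ico tR (tR + r) →
    ρ ≤ ‖J.toFun t - p‖
  two_sided : p ∈ J.interior → l < 0 ∧ 0 < r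

/-- A local arc from tangent bounds in one-sided neighbourhoods of the parameters of `p`. -/
theorem nonempty_localArc_of_eventually {p : ℂ} {tL tR κ : ℝ} {d : ℂ}
    (memL : tL ∈ Icc (0 : ℝ) J.pieces) (memR : tR ∈ Icc (0 : ℝ) J.pieces)
    (ptL : J.toFun tL = p) (ptR : J.toFun tR = p)
    (eq_or : tL = tR ∨ (tL = J.pieces ∧ tR = 0))
    (hinj : ∀ t ∈ Icc (0 : ℝ) J.pieces, J.toFun t = p → t = tL ∨ t = tR)
    (hd : d ≠ 0) (hκ : 0 < κ)
    (hL : tL = 0 ∨ ∀ᶠ t in 𝓝[<] tL, κ ≤ (deriv J.toFun t / d).re ∧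
      ∃ i < J.pieces, t ∈ Ioo (i : ℝ) (i + 1))
    (hR : tR = J.pieces ∨ ∀ᶠ t in 𝓝[>] tR, κ ≤ (deriv J.toFun t / d).re ∧
      ∃ i < J.pieces, t ∈ Ioo (i : ℝ) (i + 1))
    (hint : p ∈ J.interior → tL ≠ 0 ∧ tR ≠ J.pieces) : Nonempty (LocalArc J p) := by
  have hn := J.one_le_pieces
  obtain ⟨a, ha, hLa⟩ : ∃ a > 0, tL = 0 ∨ (a ≤ tL ∧ ∀ t ∈ Ioo (tL - a) tL,
      κ ≤ (deriv J.toFun t / d).re ∧ ∃ i < J.pieces, t ∈ Ioo (i : ℝ) (i + 1)) := by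
    by_cases h0 : tL = 0
    · exact ⟨1, one_pos, Or.inl h0⟩
    · have hpos : 0 < tL := lt_of_le_of_ne memL.1 (Ne.symm h0)
      obtain ⟨u, hu, hsub⟩ := mem_nhdsLT_iff_exists_Ioo_subset.1 (hL.resolve_left h0)
      have hu' : u < tL := hu
      refine ⟨min (tL - u) tL, lt_min (by linarith) hpos, Or.inr ⟨min_le_right _ _, fun t ht => ?_⟩⟩
      refine hsub ⟨?_, ht.2⟩
      have := min_le_left (tL - u) tL
      linarith [ht.1]
  obtain ⟨b, hb, hRb⟩ : ∃ b > 0, tR = J.pieces ∨ (tR + b ≤ J.pieces ∧ ∀ t ∈ Ioo tR (tR + b),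
      κ ≤ (deriv J.toFun t / d).re ∧ ∃ i < J.pieces, t ∈ Ioo (i : ℝ) (i + 1)) := by
    by_cases h0 : tR = J.pieces
    · exact ⟨1, one_pos, Or.inl h0⟩
    · have hpos : tR < J.pieces := lt_of_le_of_ne memR.2 h0
      obtain ⟨u, hu, hsub⟩ := mem_nhdsGT_iff_exists_Ioo_subset.1 (hR.resolve_left h0)
      have hu' : tR < u := hu
      refine ⟨min (u - tR) (J.pieces - tR), lt_min (by linarith) (by linarith), Or.inr
        ⟨by linarith [min_le_right (u - tR) (J.pieces - tR)], fun t ht => ?_⟩⟩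
      refine hsub ⟨ht.1, ?_⟩
      have := min_le_left (u - tR) (J.pieces - tR)
      linarith [ht.2]
  set c : ℝ := min (min a b) (1 / 2) with hc
  have hc0 : 0 < c := lt_min (lt_min ha hb) (by norm_num)
  have hca : c ≤ a := (min_le_left _ _).trans (min_le_left _ _)
  have hcb : c ≤ b := (min_le_left _ _).trans (min_le_right _ _)
  have hch : c ≤ 1 / 2 := min_le_right _ _
  -- outside the `c`-neighbourhood of the parameters of `p` the curve stays away from `p`
  obtain ⟨ρ, hρ, hfar⟩ : ∃ ρ > 0, ∀ t ∈ Icc (0 : ℝ) J.pieces, c ≤ |t - tL| → c ≤ |t - tR| →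
      ρ ≤ ‖J.toFun t - p‖ := by
    set S : Set ℝ := Icc (0 : ℝ) J.pieces ∩ {t | c ≤ |t - tL| ∧ c ≤ |t - tR|} with hS
    have hScl : IsClosed {t : ℝ | c ≤ |t - tL| ∧ c ≤ |t - tR|} :=
      IsClosed.and (isClosed_le continuous_const (continuous_id.sub continuous_const).abs)
        (isClosed_le continuous_const (continuous_id.sub continuous_const).abs)
    have hScomp : IsCompact S := isCompact_Icc.inter_right hScl
    rcases S.eq_empty_or_nonempty with h0 | h0
    · refine ⟨1, one_pos, fun t ht h1 h2 => ?_⟩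
      have h3 : t ∈ S := ⟨ht, h1, h2⟩
      rw [h0] at h3
      exact absurd h3 (notMem_empty t)
    · obtain ⟨t0, ht0, hmin⟩ := hScomp.exists_isMinOn h0
        (f := fun t => ‖J.toFun t - p‖)
        ((continuousOn_toFun.mono inter_subset_left).sub continuousOn_const).norm
      refine ⟨‖J.toFun t0 - p‖, ?_, fun t ht h1 h2 => hmin ⟨ht, h1, h2⟩⟩
      rw [gt_iff_lt, norm_pos_iff, sub_ne_zero]
      intro heq
      rcases hinj t0 ht0.1 heq with h | h
      · have := ht0.2.1
        rw [h, sub_self, abs_zero] at this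
        linarith
      · have := ht0.2.2
        rw [h, sub_self, abs_zero] at this
        linarith
  have hLR : tL = 0 → tR = 0 := by
    intro h
    rcases eq_or with h1 | ⟨h1, h2⟩
    · rw [← h1, h]
    · exact h2
  have hRL : tR = J.pieces → tL = J.pieces := by
    intro h
    rcases eq_or with h1 | ⟨h1, h2⟩
    · rw [h1, h]
    · exact h1
  set l : ℝ := if tL = 0 then 0 else -c with hl
  set r : ℝ := if tR = J.pieces then 0 else c with hr
  have hlc : -c ≤ l := by rw [hl]; split_ifs <;> linarith
  have hrc : r ≤ c := by rw [hr]; split_ifs <;> linarith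
  have hl0 : l ≤ 0 := by rw [hl]; split_ifs <;> linarith
  have hr0 : 0 ≤ r := by rw [hr]; split_ifs <;> linarith
  refine ⟨⟨tL, tR, l, r, κ, d, ρ, hl0, hr0, ?_, memL, memR, ptL, ptR, ?_, ?_, ?_, ?_, ?_, hκ, hd,
    ?_, ?_, hρ, ?_, ?_⟩⟩
  · by_cases h : tL = 0
    · have : tR ≠ J.pieces := by rw [hLR h]; linarith
      simp [hl, hr, h, this, hc0]
    · rw [hl, if_neg h]; linarith
  · rcases eq_or with h | ⟨h1, h2⟩
    · exact Or.inl h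
    · exact Or.inr ⟨h1, h2, by linarith⟩
  · by_cases h : tL = 0
    · simp [hl, h]
    · rw [hl, if_neg h]
      linarith [(hLa.resolve_left h).1]
  · by_cases h : tR = J.pieces
    · simp [hr, h]
    · rw [hr, if_neg h]
      linarith [(hRb.resolve_left h).1]
  · intro t ht
    by_cases h : tL = 0
    · simp [hl, h] at ht
    · exact ((hLa.resolve_left h).2 t ⟨by linarith [ht.1], ht.2⟩).2
  · intro t ht
    by_cases h : tR = J.pieces
    · simp [hr, h] at ht
    · exact ((hRb.resolve_left h).2 t ⟨ht.1, by linarith [ht.2]⟩).2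
  · intro t ht
    by_cases h : tL = 0
    · simp [hl, h] at ht
    · exact ((hLa.resolve_left h).2 t ⟨by linarith [ht.1], ht.2⟩).1
  · intro t ht
    by_cases h : tR = J.pieces
    · simp [hr, h] at ht
    · exact ((hRb.resolve_left h).2 t ⟨ht.1, by linarith [ht.2]⟩).1
  · intro t ht h1 h2
    -- a point within `c` on the wrong side of an end would leave the parameter interval
    have hA : t ≤ tL → c ≤ tL - t := by
      intro htl
      by_contra hcon
      push Not at hcon
      by_cases h : tL = 0
      · have ht0 : t = 0 := le_antisymm (by linarith) ht.1
        have hR0 : tR ≠ J.pieces := by rw [hLR h]; linarith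
        exact h2 ⟨by rw [hLR h, ht0], by rw [hLR h, hr, if_neg hR0]; linarith⟩
      · exact h1 ⟨by rw [hl, if_neg h]; linarith, htl⟩
    have hB : tR ≤ t → c ≤ t - tR := by
      intro htr
      by_contra hcon
      push Not at hcon
      by_cases h : tR = J.pieces
      · have ht0 : t = J.pieces := le_antisymm ht.2 (by linarith)
        have hL0 : tL ≠ 0 := by rw [hRL h]; linarith
        exact h1 ⟨by rw [hRL h, ht0, hl, if_neg hL0]; linarith, by rw [hRL h, ht0]⟩
      · exact h2 ⟨htr, by rw [hr, if_neg h]; linarith⟩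
    rcases eq_or with h | ⟨h3, h4⟩
    · subst h
      have : c ≤ |t - tL| := by
        rcases le_total t tL with h5 | h5
        · rw [abs_sub_comm]; exact (hA h5).trans (le_abs_self _)
        · exact (hB h5).trans (le_abs_self _)
      exact hfar t ht this this
    · refine hfar t ht ?_ ?_
      · rw [abs_sub_comm]; exact (hA (by rw [h3]; exact ht.2)).trans (le_abs_self _)
      · exact (hB (by rw [h4]; exact ht.1)).trans (le_abs_self _)
  · intro hp
    obtain ⟨h1, h2⟩ := hint hp
    simp [hl, hr, h1, h2, hc0]

theorem eventually_right {i : ℕ} (hi : i < J.pieces) {t κ : ℝ} {d : ℂ}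
    (ht : t ∈ Ico (i : ℝ) (i + 1))
    (h : κ < (derivWithin J.toFun (Icc (i : ℝ) (i + 1)) t / d).re) :
    ∀ᶠ s in 𝓝[>] t, κ ≤ (deriv J.toFun s / d).re ∧ ∃ i < J.pieces, s ∈ Ioo (i : ℝ) (i + 1) := by
  have h1 := Complex.continuous_re.continuousAt.tendsto.comp
    ((tendsto_deriv_right hi ht).div_const d)
  filter_upwards [h1.eventually (lt_mem_nhds h), Ioo_mem_nhdsGT ht.2] with s hs hs'
  exact ⟨le_of_lt hs, i, hi, ht.1.trans_lt hs'.1, hs'.2⟩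

theorem eventually_left {i : ℕ} (hi : i < J.pieces) {t κ : ℝ} {d : ℂ}
    (ht : t ∈ Ioc (i : ℝ) (i + 1))
    (h : κ < (derivWithin J.toFun (Icc (i : ℝ) (i + 1)) t / d).re) :
    ∀ᶠ s in 𝓝[<] t, κ ≤ (deriv J.toFun s / d).re ∧ ∃ i < J.pieces, s ∈ Ioo (i : ℝ) (i + 1) := by
  have h1 := Complex.continuous_re.continuousAt.tendsto.comp
    ((tendsto_deriv_left hi ht).div_const d)
  filter_upwards [h1.eventually (lt_mem_nhds h), Ioo_mem_nhdsLT ht.1] with s hs hs'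
  exact ⟨le_of_lt hs, i, hi, hs'.1, hs'.2.trans_le ht.2⟩

theorem eq_of_toFun_eq {s t : ℝ} (hs : s ∈ Icc (0 : ℝ) J.pieces) (ht : t ∈ Icc (0 : ℝ) J.pieces)
    (h : J.toFun s = J.toFun t) :
    s = t ∨ (s = 0 ∧ t = J.pieces) ∨ (t = 0 ∧ s = J.pieces) := by
  rcases lt_trichotomy s t with h1 | h1 | h1
  · exact Or.inr (Or.inl (J.simple s hs t ht h1 h))
  · exact Or.inl h1
  · exact Or.inr (Or.inr (J.simple t ht s hs h1 h.symm))

/-- Two tangents that do not form a cusp bound the slope of a local arc. -/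
theorem nonempty_localArc_of_tangents {p : ℂ} {tL tR : ℝ} {i j : ℕ} (hi : i < J.pieces)
    (hj : j < J.pieces) (htL : tL ∈ Ioc (i : ℝ) (i + 1)) (htR : tR ∈ Ico (j : ℝ) (j + 1))
    (ptL : J.toFun tL = p) (ptR : J.toFun tR = p)
    (eq_or : tL = tR ∨ (tL = J.pieces ∧ tR = 0))
    (hinj : ∀ t ∈ Icc (0 : ℝ) J.pieces, J.toFun t = p → t = tL ∨ t = tR)
    (hcusp : ¬ SameRay ℝ (derivWithin J.toFun (Icc (i : ℝ) (i + 1)) tL)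
      (-(derivWithin J.toFun (Icc (j : ℝ) (j + 1)) tR))) : Nonempty (LocalArc J p) := by
  obtain ⟨d, hd, h1, h2⟩ := exists_direction (J.regular i hi tL ⟨htL.1.le, htL.2⟩)
    (J.regular j hj tR ⟨htR.1, htR.2.le⟩) hcusp
  have memL := Icc_subset_of_lt hi ⟨htL.1.le, htL.2⟩
  have memR := Icc_subset_of_lt hj ⟨htR.1, htR.2.le⟩
  obtain ⟨κ, hκ, hκ'⟩ := exists_between (lt_min h1 h2)
  refine nonempty_localArc_of_eventually memL memR ptL ptR eq_or hinj hd hκ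
    (Or.inr (eventually_left hi htL (hκ'.trans_le (min_le_left _ _))))
    (Or.inr (eventually_right hj htR (hκ'.trans_le (min_le_right _ _)))) fun _ => ⟨?_, ?_⟩
  · have : (0 : ℝ) ≤ i := by positivity
    exact (this.trans_lt htL.1).ne'
  · have : (j : ℝ) + 1 ≤ J.pieces := by exact_mod_cast hj
    exact (htR.2.trans_le this).ne

theorem not_sameRay_neg_self {u : ℂ} (hu : u ≠ 0) : ¬ SameRay ℝ u (-u) := by
  intro h
  exact hu (self_eq_neg.1 (h.eq_of_norm_eq (norm_neg u).symm))

/-- Every point of the curve lies on a local arc. -/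
theorem nonempty_localArc {p : ℂ} (hp : p ∈ J.carrier) : Nonempty (LocalArc J p) := by
  obtain ⟨t0, ht0, rfl⟩ := hp
  have hn := J.one_le_pieces
  have hn0 := J.pieces_pos'
  have hpos := J.pieces_pos
  have h0n : ((J.pieces - 1 : ℕ) : ℝ) = J.pieces - 1 := Nat.cast_pred hpos
  have hlast : J.pieces - 1 < J.pieces := Nat.sub_lt hpos one_pos
  have mem0 : (0 : ℝ) ∈ Icc (0 : ℝ) J.pieces := ⟨le_rfl, hn0.le⟩
  have memn : (J.pieces : ℝ) ∈ Icc (0 : ℝ) J.pieces := ⟨hn0.le, le_rfl⟩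
  by_cases hend : t0 = 0 ∨ t0 = J.pieces
  · by_cases hcl : J.toFun 0 = J.toFun J.pieces
    · -- base point of a closed curve
      have hp : J.toFun t0 = J.toFun 0 := by
        rcases hend with rfl | rfl
        · rfl
        · exact hcl.symm
      rw [hp]
      refine nonempty_localArc_of_tangents (tL := J.pieces) (tR := 0) (i := J.pieces - 1) (j := 0)
        hlast hpos ?_ ?_ hcl.symm rfl (Or.inr ⟨rfl, rfl⟩) ?_ ?_
      · rw [h0n]; constructor <;> linarith
      · constructor <;> simp
      · intro t ht h
        rcases eq_of_toFun_eq ht mem0 h with h | ⟨_, h⟩ | ⟨_, h⟩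
        · exact Or.inr h
        · exact absurd h hn0.ne
        · exact Or.inl h
      · have := J.no_cusp_closed hcl
        rw [h0n]
        simpa using this
    · rcases hend with rfl | rfl
      · -- initial point
        have hu : derivWithin J.toFun (Icc ((0 : ℕ) : ℝ) ((0 : ℕ) + 1)) 0 ≠ 0 :=
          J.regular 0 hpos 0 (by simp)
        refine nonempty_localArc_of_eventually (κ := 1 / 2) mem0 mem0 rfl rfl (Or.inl rfl) ?_ hu
          (by norm_num) (Or.inl rfl) (Or.inr (eventually_right hpos (by simp) ?_)) ?_
        · intro t ht h
          rcases eq_of_toFun_eq ht mem0 h with h1 | ⟨_, h1⟩ | ⟨_, h1⟩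
          · exact Or.inl h1
          · exact absurd h1 hn0.ne
          · exact absurd (by rw [← h, h1]) hcl
        · rw [div_self hu]; norm_num
        · intro h
          exact absurd (show J.toFun 0 ∈ J.boundary from ⟨hcl, Or.inl rfl⟩) h.2
      · -- final point
        have hu : derivWithin J.toFun (Icc ((J.pieces - 1 : ℕ) : ℝ) ((J.pieces - 1 : ℕ) + 1))
            J.pieces ≠ 0 := J.regular _ hlast _ (by rw [h0n]; constructor <;> linarith)
        refine nonempty_localArc_of_eventually (κ := 1 / 2) memn memn rfl rfl (Or.inl rfl) ?_ hu
          (by norm_num) (Or.inr (eventually_left hlast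
            (by rw [h0n]; constructor <;> linarith) ?_)) (Or.inl rfl) ?_
        · intro t ht h
          rcases eq_of_toFun_eq ht memn h with h1 | ⟨h1, _⟩ | ⟨h1, _⟩
          · exact Or.inl h1
          · exact absurd (by rw [← h, h1]) hcl
          · exact absurd h1.symm hn0.ne
        · rw [div_self hu]; norm_num
        · intro h
          exact absurd (show J.toFun J.pieces ∈ J.boundary from ⟨hcl, Or.inr rfl⟩) h.2
  · push Not at hend
    have hinj : ∀ t ∈ Icc (0 : ℝ) J.pieces, J.toFun t = J.toFun t0 → t = t0 ∨ t = t0 := by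
      intro t ht h
      rcases eq_of_toFun_eq ht ht0 h with h1 | ⟨_, h1⟩ | ⟨h1, _⟩
      · exact Or.inl h1
      · exact absurd h1 hend.2
      · exact absurd h1 hend.1
    have ht0' : 0 < t0 := lt_of_le_of_ne ht0.1 (Ne.symm hend.1)
    have ht0n : t0 < J.pieces := lt_of_le_of_ne ht0.2 hend.2
    have hfl : ⌊t0⌋₊ < J.pieces := (Nat.floor_lt ht0.1).2 ht0n
    have hfl1 := Nat.floor_le ht0.1
    have hfl2 := Nat.lt_floor_add_one t0
    rcases eq_or_lt_of_le hfl1 with heq | hlt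
    · -- a point where two pieces meet
      obtain ⟨k, hk⟩ : ∃ k, ⌊t0⌋₊ = k + 1 := by
        refine Nat.exists_eq_succ_of_ne_zero fun h => ?_
        rw [h] at heq
        simp at heq
        linarith
      rw [hk] at heq hfl
      push_cast at heq
      refine nonempty_localArc_of_tangents (tL := t0) (tR := t0) (i := k) (j := k + 1) (by omega) hfl
        ?_ ?_ rfl rfl (Or.inl rfl) hinj ?_
      · constructor <;> linarith
      · push_cast; constructor <;> linarith
      · have := J.no_cusp k hfl
        rw [← heq]
        push_cast
        rw [show (k : ℝ) + 1 + 1 = k + 2 by ring]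
        exact this
    · exact nonempty_localArc_of_tangents (tL := t0) (tR := t0) hfl hfl ⟨hlt, hfl2.le⟩
        ⟨hfl1, hfl2⟩ rfl rfl (Or.inl rfl) hinj
        (not_sameRay_neg_self (J.regular _ hfl t0 ⟨hfl1, hfl2.le⟩))

end PiecewiseSmoothCurve

namespace PiecewiseSmoothCurve

open MeasureTheory

variable {J : PiecewiseSmoothCurve} {p : ℂ}

namespace LocalArc

variable (A : LocalArc J p)

/-- The parameter on the curve that belongs to a parameter of the local arc. -/
noncomputable def π (t : ℝ) : ℝ := if t < 0 then A.tL + t else A.tR + t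

/-- The parametrisation of the local arc. -/
noncomputable def arc (t : ℝ) : ℂ := J.toFun (A.π t)

/-- The derivative of the parametrisation of the local arc. -/
noncomputable def dir (t : ℝ) : ℂ := deriv J.toFun (A.π t)

/-- The parameters of the curve off the local arc. -/
def rest : Set ℝ := Icc (0 : ℝ) J.pieces \ (Ioc (A.tL + A.l) A.tL ∪ Ico A.tR (A.tR + A.r))

/-- The parameters of the smooth points of the local arc. -/
def par : Set ℝ := Ioo A.l A.r \ {0}

theorem π_of_neg {t : ℝ} (h : t < 0) : A.π t = A.tL + t := if_pos h

theorem π_of_nonneg {t : ℝ} (h : 0 ≤ t) : A.π t = A.tR + t := if_neg (not_lt.2 h)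

theorem measurable_π : Measurable A.π :=
  Measurable.ite measurableSet_Iio (measurable_const_add _) (measurable_const_add _)

theorem measurable_dir : Measurable A.dir := (measurable_deriv J.toFun).comp A.measurable_π

theorem measurableSet_rest : MeasurableSet A.rest :=
  measurableSet_Icc.diff (measurableSet_Ioc.union measurableSet_Ico)

theorem measurableSet_par : MeasurableSet A.par :=
  measurableSet_Ioo.diff (measurableSet_singleton _)

theorem zero_mem : (0 : ℝ) ∈ Icc A.l A.r := ⟨A.l_nonpos, A.r_nonneg⟩

theorem arc_zero : A.arc 0 = p := by
  rw [arc, A.π_of_nonneg le_rfl, add_zero, A.ptR]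

theorem π_mem {t : ℝ} (ht : t ∈ Icc A.l A.r) : A.π t ∈ Icc (0 : ℝ) J.pieces := by
  rcases lt_or_ge t 0 with h | h
  · rw [A.π_of_neg h]
    exact ⟨by linarith [A.left_ge, ht.1], by linarith [A.memL.2]⟩
  · rw [A.π_of_nonneg h]
    exact ⟨by linarith [A.memR.1], by linarith [A.right_le, ht.2]⟩

theorem arc_mem {t : ℝ} (ht : t ∈ Icc A.l A.r) : A.arc t ∈ J.carrier :=
  ⟨_, A.π_mem ht, rfl⟩

/-- A function that is Lipschitz in the parameter of the curve is Lipschitz along the local arc. -/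
theorem lipschitz_comp_π {F : ℝ → ℂ} {C : ℝ}
    (hF : ∀ s ∈ Icc (0 : ℝ) J.pieces, ∀ t ∈ Icc (0 : ℝ) J.pieces, ‖F s - F t‖ ≤ C * |s - t|)
    (hcl : J.toFun 0 = J.toFun J.pieces → F 0 = F J.pieces) :
    ∀ s ∈ Icc A.l A.r, ∀ t ∈ Icc A.l A.r, ‖F (A.π s) - F (A.π t)‖ ≤ C * |s - t| := by
  have hLR : F A.tL = F A.tR := by
    rcases A.eq_or with h | ⟨h1, h2, _⟩
    · rw [h]
    · rw [h1, h2]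
      refine (hcl ?_).symm
      rw [← h1, ← h2, A.ptL, A.ptR]
  have key : ∀ s ∈ Icc A.l A.r, ∀ t ∈ Icc A.l A.r, s ≤ t →
      ‖F (A.π s) - F (A.π t)‖ ≤ C * |s - t| := by
    intro s hs t ht hst
    rcases lt_or_ge s 0 with h1 | h1
    · rcases lt_or_ge t 0 with h2 | h2
      · have := hF _ (A.π_mem hs) _ (A.π_mem ht)
        rw [A.π_of_neg h1, A.π_of_neg h2] at this ⊢
        simpa using this
      · have e1 := hF _ (A.π_mem hs) _ A.memL
        have e2 := hF _ A.memR _ (A.π_mem ht)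
        rw [A.π_of_neg h1] at e1 ⊢
        rw [A.π_of_nonneg h2] at e2 ⊢
        have e3 := norm_sub_le_norm_sub_add_norm_sub (F (A.tL + s)) (F A.tL) (F (A.tR + t))
        rw [hLR] at e3 e1
        simp only [add_sub_cancel_left, sub_add_cancel_left, abs_neg] at e1 e2
        rw [abs_of_neg h1] at e1
        rw [abs_of_nonneg h2] at e2
        rw [abs_of_nonpos (by linarith)]
        linarith
    · have h2 := h1.trans hst
      have := hF _ (A.π_mem hs) _ (A.π_mem ht)
      rw [A.π_of_nonneg h1, A.π_of_nonneg h2] at this ⊢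
      simpa using this
  intro s hs t ht
  rcases le_total s t with h | h
  · exact key s hs t ht h
  · rw [norm_sub_rev, abs_sub_comm]; exact key t ht s hs h

theorem exists_lipschitz_arc : ∃ C, 0 ≤ C ∧ ∀ s ∈ Icc A.l A.r, ∀ t ∈ Icc A.l A.r,
    ‖A.arc s - A.arc t‖ ≤ C * |s - t| := by
  obtain ⟨C, hC0, hC⟩ := exists_lipschitz_of_smooth J.smooth
  exact ⟨C, hC0, A.lipschitz_comp_π hC id⟩

theorem continuousOn_arc : ContinuousOn A.arc (Icc A.l A.r) := by
  obtain ⟨C, hC0, hC⟩ := A.exists_lipschitz_arc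
  refine LipschitzOnWith.continuousOn (K := ⟨C, hC0⟩) (LipschitzOnWith.of_dist_le_mul ?_)
  intro s hs t ht
  rw [dist_eq_norm, Real.dist_eq]
  exact hC s hs t ht

theorem π_mem_of_par {t : ℝ} (ht : t ∈ A.par) :
    (t < 0 ∧ A.π t ∈ Ioo (A.tL + A.l) A.tL) ∨ (0 < t ∧ A.π t ∈ Ioo A.tR (A.tR + A.r)) := by
  rcases lt_or_gt_of_ne ht.2 with h | h
  · exact Or.inl ⟨h, by rw [A.π_of_neg h]; exact ⟨by linarith [ht.1.1], by linarith⟩⟩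
  · exact Or.inr ⟨h, by rw [A.π_of_nonneg h.le]; exact ⟨by linarith, by linarith [ht.1.2]⟩⟩

theorem piece_of_par {t : ℝ} (ht : t ∈ A.par) : ∃ i < J.pieces, A.π t ∈ Ioo (i : ℝ) (i + 1) := by
  rcases A.π_mem_of_par ht with ⟨_, h⟩ | ⟨_, h⟩
  · exact A.left_piece _ h
  · exact A.right_piece _ h

theorem slope {t : ℝ} (ht : t ∈ A.par) : A.κ ≤ (A.dir t / A.d).re := by
  rcases A.π_mem_of_par ht with ⟨_, h⟩ | ⟨_, h⟩
  · exact A.left_slope _ h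
  · exact A.right_slope _ h

theorem hasDerivAt_π {t : ℝ} (ht : t ≠ 0) : HasDerivAt A.π 1 t := by
  rcases lt_or_gt_of_ne ht with h | h
  · refine ((hasDerivAt_id t).const_add A.tL).congr_of_eventuallyEq ?_
    filter_upwards [Iio_mem_nhds h] with s hs
    exact A.π_of_neg hs
  · refine ((hasDerivAt_id t).const_add A.tR).congr_of_eventuallyEq ?_
    filter_upwards [Ioi_mem_nhds h] with s hs
    exact A.π_of_nonneg (le_of_lt hs)

theorem hasDerivAt_arc {t : ℝ} (ht : t ∈ A.par) : HasDerivAt A.arc (A.dir t) t := by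
  obtain ⟨i, hi, hti⟩ := A.piece_of_par ht
  have h := (hasDerivAt_of_smooth J.smooth hi hti).scomp t (A.hasDerivAt_π ht.2)
  rw [one_smul] at h
  exact h

theorem continuousAt_dir {t : ℝ} (ht : t ∈ A.par) : ContinuousAt A.dir t := by
  obtain ⟨i, hi, hti⟩ := A.piece_of_par ht
  have h1 : ContinuousAt (deriv J.toFun) (A.π t) := by
    refine ((continuousOn_derivWithin J.smooth hi).continuousAt
      (Icc_mem_nhds hti.1 hti.2)).congr ?_
    filter_upwards [Ioo_mem_nhds hti.1 hti.2] with s hs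
    exact (deriv_eq_of_mem_Ioo hs).symm
  exact ContinuousAt.comp (f := A.π) h1 (A.hasDerivAt_π ht.2).continuousAt

theorem exists_bound_dir : ∃ M, 0 ≤ M ∧ ∀ t ∈ Icc A.l A.r, ‖A.dir t‖ ≤ M := by
  obtain ⟨M, hM0, hM⟩ := exists_bound_deriv J.smooth
  exact ⟨M, hM0, fun t ht => hM _ (A.π_mem ht)⟩

/-- The real part in the direction of the arc grows at least with slope `κ`. -/
theorem le_re_arc_sub {s t : ℝ} (hs : s ∈ Icc A.l A.r) (ht : t ∈ Icc A.l A.r) (hst : s ≤ t) :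
    A.κ * (t - s) ≤ ((A.arc t - A.arc s) / A.d).re := by
  have hcont : ContinuousOn (fun u => (A.arc u / A.d).re - A.κ * u) (Icc A.l A.r) :=
    (Complex.continuous_re.comp_continuousOn (A.continuousOn_arc.div_const _)).sub
      (continuousOn_const.mul continuousOn_id)
  have hder : ∀ u ∈ A.par, HasDerivAt (fun u => (A.arc u / A.d).re - A.κ * u)
      ((A.dir u / A.d).re - A.κ) u := by
    intro u hu
    have h1 : HasDerivAt (fun u => (A.arc u / A.d).re) (A.dir u / A.d).re u := by
      have := Complex.reCLM.hasFDerivAt.comp_hasDerivAt u ((A.hasDerivAt_arc hu).div_const A.d)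
      exact this
    have h2 := h1.sub ((hasDerivAt_id u).const_mul A.κ)
    rw [mul_one] at h2
    exact h2
  have hmono : ∀ a b, A.l ≤ a → b ≤ A.r → (b ≤ 0 ∨ 0 ≤ a) → a ≤ b →
      (A.arc a / A.d).re - A.κ * a ≤ (A.arc b / A.d).re - A.κ * b := by
    intro a b ha hb h0 hab
    have hpar : ∀ u ∈ Ioo a b, u ∈ A.par := fun u hu =>
      ⟨⟨ha.trans_lt hu.1, hu.2.trans_le hb⟩, by
        rcases h0 with h0 | h0
        · exact (hu.2.trans_le h0).ne
        · exact (h0.trans_lt hu.1).ne'⟩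
    refine monotoneOn_of_deriv_nonneg (convex_Icc a b) (hcont.mono (Icc_subset_Icc ha hb)) ?_ ?_
      (left_mem_Icc.2 hab) (right_mem_Icc.2 hab) hab
    · intro u hu
      rw [interior_Icc] at hu
      exact (hder u (hpar u hu)).differentiableAt.differentiableWithinAt
    · intro u hu
      rw [interior_Icc] at hu
      rw [(hder u (hpar u hu)).deriv]
      linarith [A.slope (hpar u hu)]
  have hfin : (A.arc s / A.d).re - A.κ * s ≤ (A.arc t / A.d).re - A.κ * t := by
    rcases le_total t 0 with h | h
    · exact hmono s t hs.1 ht.2 (Or.inl h) hst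
    rcases le_total 0 s with h' | h'
    · exact hmono s t hs.1 ht.2 (Or.inr h') hst
    · exact (hmono s 0 hs.1 A.r_nonneg (Or.inl le_rfl) h').trans
        (hmono 0 t A.l_nonpos ht.2 (Or.inr le_rfl) h)
  rw [sub_div, Complex.sub_re]
  linarith

theorem mul_abs_le_abs_re {s t : ℝ} (hs : s ∈ Icc A.l A.r) (ht : t ∈ Icc A.l A.r) :
    A.κ * |t - s| ≤ |((A.arc t - A.arc s) / A.d).re| := by
  rcases le_total s t with h | h
  · rw [abs_of_nonneg (by linarith : 0 ≤ t - s)]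
    exact (A.le_re_arc_sub hs ht h).trans (le_abs_self _)
  · rw [abs_sub_comm, abs_of_nonneg (by linarith : 0 ≤ s - t)]
    have := A.le_re_arc_sub ht hs h
    rw [← neg_sub (A.arc t), neg_div, Complex.neg_re] at this
    exact this.trans (neg_le_abs _)

/-- The distance of a point of the arc to a point vertically above or below the arc is at least of
the order of the difference of the parameters. -/
theorem le_norm_arc_sub {s t : ℝ} (hs : s ∈ Icc A.l A.r) (ht : t ∈ Icc A.l A.r) (y : ℝ) :
    A.κ * ‖A.d‖ * |t - s| ≤ ‖A.arc t - (A.arc s + Complex.I * y * A.d)‖ := by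
  have hd : 0 < ‖A.d‖ := norm_pos_iff.2 A.d_ne
  have h1 := A.mul_abs_le_abs_re hs ht
  have h2 : ((A.arc t - (A.arc s + Complex.I * y * A.d)) / A.d).re =
      ((A.arc t - A.arc s) / A.d).re := by
    rw [← sub_sub, sub_div, mul_div_assoc, div_self A.d_ne, mul_one, Complex.sub_re]
    simp
  rw [← h2] at h1
  have h3 := h1.trans (Complex.abs_re_le_norm _)
  rw [norm_div, le_div_iff₀ hd] at h3
  linarith

theorem le_norm_arc_sub_arc {s t : ℝ} (hs : s ∈ Icc A.l A.r) (ht : t ∈ Icc A.l A.r) :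
    A.κ * ‖A.d‖ * |t - s| ≤ ‖A.arc t - A.arc s‖ := by
  simpa using A.le_norm_arc_sub hs ht 0

theorem κd_pos : 0 < A.κ * ‖A.d‖ := mul_pos A.κ_pos (norm_pos_iff.2 A.d_ne)

theorem injOn_π : InjOn A.π A.par := by
  intro s hs t ht h
  rcases A.π_mem_of_par hs with ⟨h1, h1'⟩ | ⟨h1, h1'⟩ <;>
    rcases A.π_mem_of_par ht with ⟨h2, h2'⟩ | ⟨h2, h2'⟩
  · rw [A.π_of_neg h1, A.π_of_neg h2] at h; linarith
  · rw [h] at h1'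
    rcases A.eq_or with h3 | ⟨h3, h4, h5⟩
    · linarith [h1'.2, h2'.1]
    · linarith [h1'.1, h2'.2]
  · rw [h] at h1'
    rcases A.eq_or with h3 | ⟨h3, h4, h5⟩
    · linarith [h1'.1, h2'.2]
    · linarith [h1'.2, h2'.1]
  · rw [A.π_of_nonneg h1.le, A.π_of_nonneg h2.le] at h; linarith

theorem disjoint_rest : Disjoint A.rest (A.π '' A.par) := by
  rw [Set.disjoint_left]
  rintro _ h ⟨t, ht, rfl⟩
  rcases A.π_mem_of_par ht with ⟨_, h1⟩ | ⟨_, h1⟩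
  · exact h.2 (Or.inl ⟨h1.1, h1.2.le⟩)
  · exact h.2 (Or.inr ⟨h1.1.le, h1.2⟩)

theorem cover {t : ℝ} (ht : t ∈ Icc (0 : ℝ) J.pieces) :
    t ∈ A.rest ∨ t ∈ A.π '' A.par ∨ t = A.tL ∨ t = A.tR := by
  by_cases h : t ∈ Ioc (A.tL + A.l) A.tL
  · rcases eq_or_lt_of_le h.2 with h1 | h1
    · exact Or.inr (Or.inr (Or.inl h1))
    · refine Or.inr (Or.inl ⟨t - A.tL, ⟨⟨by linarith [h.1], by linarith [A.r_nonneg]⟩, ?_⟩, ?_⟩)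
      · exact (sub_neg.2 h1).ne
      · rw [A.π_of_neg (sub_neg.2 h1)]; ring
  by_cases h' : t ∈ Ico A.tR (A.tR + A.r)
  · rcases eq_or_lt_of_le h'.1 with h1 | h1
    · exact Or.inr (Or.inr (Or.inr h1.symm))
    · refine Or.inr (Or.inl ⟨t - A.tR, ⟨⟨by linarith [A.l_nonpos], by linarith [h'.2]⟩, ?_⟩, ?_⟩)
      · exact (sub_pos.2 h1).ne'
      · rw [A.π_of_nonneg (sub_pos.2 h1).le]; ring
  · exact Or.inl ⟨ht, fun hcon => hcon.elim h h'⟩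

/-- Points of the curve near `p` lie on the local arc. -/
theorem exists_arc_eq {z : ℂ} (hz : z ∈ J.carrier) (h : ‖z - p‖ < A.ρ) :
    ∃ t ∈ Icc A.l A.r, A.arc t = z := by
  obtain ⟨t, ht, rfl⟩ := hz
  rcases A.cover ht with h1 | ⟨s, hs, rfl⟩ | h1 | h1
  · exact absurd h (not_lt.2 (A.far t ht (fun h2 => h1.2 (Or.inl h2)) fun h2 => h1.2 (Or.inr h2)))
  · exact ⟨s, Ioo_subset_Icc_self hs.1, rfl⟩
  · exact ⟨0, A.zero_mem, by rw [A.arc_zero, h1, A.ptL]⟩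
  · exact ⟨0, A.zero_mem, by rw [A.arc_zero, h1, A.ptR]⟩

theorem far_rest {t : ℝ} (ht : t ∈ A.rest) : A.ρ ≤ ‖J.toFun t - p‖ :=
  A.far t ht.1 (fun h => ht.2 (Or.inl h)) fun h => ht.2 (Or.inr h)

theorem far_rest' {t : ℝ} (ht : t ∈ A.rest) {z : ℂ} (hz : ‖z - p‖ ≤ A.ρ / 2) :
    A.ρ / 2 ≤ ‖J.toFun t - z‖ := by
  have h1 := A.far_rest ht
  have h2 := norm_sub_le_norm_sub_add_norm_sub (J.toFun t) z p
  linarith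

theorem image_par_subset : A.π '' A.par ⊆ Icc (0 : ℝ) J.pieces := by
  rintro _ ⟨t, ht, rfl⟩
  exact A.π_mem (Ioo_subset_Icc_self ht.1)

theorem measurableSet_image : MeasurableSet (A.π '' A.par) :=
  A.measurableSet_par.image_of_measurable_injOn A.measurable_π A.injOn_π

theorem Icc_ae_eq : (Icc (0 : ℝ) J.pieces : Set ℝ) =ᵐ[volume] (A.rest ∪ A.π '' A.par : Set ℝ) := by
  have hcount : ({A.tL, A.tR} : Set ℝ).Countable := (Set.toFinite _).countable
  have hnull : ∀ᵐ t ∂(volume : Measure ℝ), t ∉ ({A.tL, A.tR} : Set ℝ) :=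
    hcount.ae_notMem _
  filter_upwards [hnull] with t ht
  refine propext ⟨fun h => ?_, fun h => ?_⟩
  · rcases A.cover h with h1 | h1 | h1 | h1
    · exact Or.inl h1
    · exact Or.inr h1
    · exact absurd (Or.inl h1) ht
    · exact absurd (Or.inr h1) ht
  · rcases h with h1 | h1
    · exact h1.1
    · exact A.image_par_subset h1

theorem par_ae_eq : A.par =ᵐ[volume] (Ioo A.l A.r : Set ℝ) :=
  sdiff_ae_eq_self.2 (measure_mono_null inter_subset_right (by simp))

theorem hasDerivWithinAt_π : ∀ t ∈ A.par, HasDerivWithinAt A.π 1 A.par t := fun _ ht =>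
  (A.hasDerivAt_π ht.2).hasDerivWithinAt

theorem integrableOn_arc {g : ℝ → ℂ} (hg : IntegrableOn g (Icc (0 : ℝ) J.pieces)) :
    IntegrableOn (fun t => g (A.π t)) (Ioo A.l A.r) := by
  have h1 := (integrableOn_image_iff_integrableOn_abs_deriv_smul A.measurableSet_par
    A.hasDerivWithinAt_π A.injOn_π g).1 (hg.mono_set A.image_par_subset)
  rw [IntegrableOn, Measure.restrict_congr_set A.par_ae_eq] at h1
  simpa [IntegrableOn] using h1

theorem integrableOn_rest {g : ℝ → ℂ} (hg : IntegrableOn g (Icc (0 : ℝ) J.pieces)) :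
    IntegrableOn g A.rest := hg.mono_set sdiff_subset

/-- An integral along the curve splits into the part along the local arc and the rest. -/
theorem integral_eq {g : ℝ → ℂ} (hg : IntegrableOn g (Icc (0 : ℝ) J.pieces)) :
    ∫ t in Icc (0 : ℝ) J.pieces, g t = (∫ t in Ioo A.l A.r, g (A.π t)) + ∫ t in A.rest, g t := by
  rw [setIntegral_congr_set A.Icc_ae_eq, setIntegral_union A.disjoint_rest A.measurableSet_image
    (A.integrableOn_rest hg) (hg.mono_set A.image_par_subset),
    integral_image_eq_integral_abs_deriv_smul A.measurableSet_par A.hasDerivWithinAt_π A.injOn_π,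
    setIntegral_congr_set A.par_ae_eq, add_comm]
  simp

theorem lintegral_eq (g : ℝ → ENNReal) :
    ∫⁻ t in Icc (0 : ℝ) J.pieces, g t =
      (∫⁻ t in Ioo A.l A.r, g (A.π t)) + ∫⁻ t in A.rest, g t := by
  rw [setLIntegral_congr A.Icc_ae_eq, lintegral_union A.measurableSet_image A.disjoint_rest,
    lintegral_image_eq_lintegral_abs_deriv_mul A.measurableSet_par A.hasDerivWithinAt_π A.injOn_π,
    setLIntegral_congr A.par_ae_eq, add_comm]
  simp

end LocalArc

theorem isCompact_carrier (J : PiecewiseSmoothCurve) : IsCompact J.carrier :=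
  isCompact_Icc.image_of_continuousOn continuousOn_toFun

theorem isClosed_carrier (J : PiecewiseSmoothCurve) : IsClosed J.carrier :=
  J.isCompact_carrier.isClosed

/-- A smooth function on the curve is Lipschitz with respect to the distance in the plane. This uses
that there are no cusps. -/
theorem IsSmooth.exists_lipschitz {h : ℂ → ℂ} (hh : J.IsSmooth h) :
    ∃ C, 0 ≤ C ∧ ∀ z ∈ J.carrier, ∀ w ∈ J.carrier, ‖h z - h w‖ ≤ C * ‖z - w‖ := by
  have hloc : LocallyLipschitzOn J.carrier h := by
    intro p hp
    obtain ⟨A⟩ := nonempty_localArc hp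
    obtain ⟨C, hC0, hC⟩ := exists_lipschitz_of_smooth (J := J) (g := fun t => h (J.toFun t)) hh
    have hC' := A.lipschitz_comp_π hC fun h' => by simp only [h']
    refine ⟨(C / (A.κ * ‖A.d‖)).toNNReal, J.carrier ∩ Metric.ball p A.ρ,
      inter_mem_nhdsWithin _ (Metric.ball_mem_nhds p A.ρ_pos), LipschitzOnWith.of_dist_le_mul ?_⟩
    rintro z ⟨hz, hzp⟩ w ⟨hw, hwp⟩
    obtain ⟨s, hs, rfl⟩ := A.exists_arc_eq hz (by simpa [dist_eq_norm] using hzp)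
    obtain ⟨t, ht, rfl⟩ := A.exists_arc_eq hw (by simpa [dist_eq_norm] using hwp)
    rw [dist_eq_norm, dist_eq_norm, Real.coe_toNNReal _ (div_nonneg hC0 A.κd_pos.le), div_mul_eq_mul_div, le_div_iff₀ A.κd_pos]
    calc ‖h (A.arc s) - h (A.arc t)‖ * (A.κ * ‖A.d‖)
        ≤ C * |s - t| * (A.κ * ‖A.d‖) := by
          have := A.κd_pos.le
          gcongr
          exact hC' s hs t ht
      _ = C * (A.κ * ‖A.d‖ * |s - t|) := by ring
      _ ≤ C * ‖A.arc s - A.arc t‖ := by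
          gcongr
          exact A.le_norm_arc_sub_arc ht hs
  obtain ⟨K, hK⟩ := hloc.exists_lipschitzOnWith_of_compact J.isCompact_carrier
  refine ⟨K, K.2, fun z hz w hw => ?_⟩
  simpa [dist_eq_norm] using hK.dist_le_mul z hz w hw

end PiecewiseSmoothCurve

/-! ### Integrals of singular kernels along the curve -/

namespace PiecewiseSmoothCurve

open MeasureTheory

variable {J : PiecewiseSmoothCurve} {p : ℂ}

theorem integrableOn_inv_sqrt_abs (L : ℝ) :
    IntegrableOn (fun u : ℝ => (Real.sqrt |u|)⁻¹) (Icc (-L) L) := by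
  rcases le_or_gt L 0 with hL | hL
  · refine IntegrableOn.mono_set (t := {0}) (by simp) fun x hx => ?_
    exact le_antisymm (hx.2.trans hL) (by linarith [hx.1])
  have h1 : IntegrableOn (fun u : ℝ => (Real.sqrt |u|)⁻¹) (Ioc 0 L) := by
    have := (intervalIntegral.intervalIntegrable_rpow' (a := 0) (b := L) (r := -(1 / 2))
      (by norm_num)).1
    refine this.congr_fun (fun u hu => ?_) measurableSet_Ioc
    simp only
    rw [abs_of_pos hu.1, Real.sqrt_eq_rpow, Real.rpow_neg hu.1.le]
  have h2 : IntegrableOn (fun u : ℝ => (Real.sqrt |u|)⁻¹) (Ico (-L) 0) := by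
    have h3 := (integrableOn_Ioc_iff_integrableOn_Ioo).1 h1
    have := h3.comp_neg
    simp only [abs_neg, neg_Ioo, neg_zero] at this
    exact (integrableOn_Ico_iff_integrableOn_Ioo).2 this
  refine (h2.union (h1.union (s := Ioc 0 L) (t := {0}) (by simp))).mono_set fun x hx => ?_
  rcases lt_trichotomy x 0 with h | h | h
  · exact Or.inl ⟨hx.1, h⟩
  · exact Or.inr (Or.inr h)
  · exact Or.inr (Or.inl ⟨h, hx.2⟩)

/-- An integrable function on the line that agrees with `1 / √|u|` on `[-L, L]`. -/
noncomputable def sqrtKernel (L : ℝ) : ℝ → ℝ :=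
  (Icc (-L) L).indicator fun u => (Real.sqrt |u|)⁻¹

theorem integrable_sqrtKernel (L : ℝ) : Integrable (sqrtKernel L) :=
  (integrable_indicator_iff measurableSet_Icc).2 (integrableOn_inv_sqrt_abs L)

theorem sqrtKernel_nonneg (L u : ℝ) : 0 ≤ sqrtKernel L u :=
  indicator_nonneg (fun _ _ => by positivity) _

theorem sqrtKernel_apply {L u : ℝ} (h : |u| ≤ L) : sqrtKernel L u = (Real.sqrt |u|)⁻¹ :=
  indicator_of_mem (show u ∈ Icc (-L) L from abs_le.1 h) _

theorem LocalArc.abs_sub_le (A : LocalArc J p) {s t : ℝ} (hs : s ∈ Icc A.l A.r)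
    (ht : t ∈ Icc A.l A.r) : |s - t| ≤ A.r - A.l :=
  abs_le.2 ⟨by linarith [hs.1, ht.2], by linarith [hs.2, ht.1]⟩

theorem measurable_inv_sqrt_norm_sub {E : Type*} [MeasurableSpace E] {μ : Measure E} {g : E → ℂ}
    (hg : AEStronglyMeasurable g μ) (w : ℂ) :
    AEStronglyMeasurable (fun t => (Real.sqrt ‖g t - w‖)⁻¹) μ := by
  have h1 : AEMeasurable (fun t => ‖g t - w‖) μ := (hg.sub aestronglyMeasurable_const).norm.aemeasurable
  exact (h1.sqrt.inv).aestronglyMeasurable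

theorem aestronglyMeasurable_toFun (J : PiecewiseSmoothCurve) :
    AEStronglyMeasurable J.toFun (volume.restrict (Icc (0 : ℝ) J.pieces)) :=
  continuousOn_toFun.aestronglyMeasurable measurableSet_Icc

/-- The kernel `1 / √|λ - w|` is integrable along the curve, uniformly in the point `w` of the
curve. -/
theorem exists_bound_integral_inv_sqrt (J : PiecewiseSmoothCurve) : ∃ C, ∀ w ∈ J.carrier,
    IntegrableOn (fun t => (Real.sqrt ‖J.toFun t - w‖)⁻¹) (Icc (0 : ℝ) J.pieces) ∧
      ∫ t in Icc (0 : ℝ) J.pieces, (Real.sqrt ‖J.toFun t - w‖)⁻¹ ≤ C := by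
  have key : ∃ C : ℝ, ∀ w ∈ J.carrier ∩ J.carrier, ∫⁻ t in Icc (0 : ℝ) J.pieces,
      ENNReal.ofReal (Real.sqrt ‖J.toFun t - w‖)⁻¹ ≤ ENNReal.ofReal C := by
    refine J.isCompact_carrier.induction_on (p := fun S => ∃ C : ℝ, ∀ w ∈ S ∩ J.carrier,
      ∫⁻ t in Icc (0 : ℝ) J.pieces, ENNReal.ofReal (Real.sqrt ‖J.toFun t - w‖)⁻¹ ≤
        ENNReal.ofReal C) ⟨0, by simp⟩ ?_ ?_ ?_
    · rintro S T hST ⟨C, hC⟩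
      exact ⟨C, fun w hw => hC w ⟨hST hw.1, hw.2⟩⟩
    · rintro S T ⟨C, hC⟩ ⟨C', hC'⟩
      refine ⟨max C C', fun w hw => ?_⟩
      rcases hw.1 with h | h
      · exact (hC w ⟨h, hw.2⟩).trans (ENNReal.ofReal_le_ofReal (le_max_left _ _))
      · exact (hC' w ⟨h, hw.2⟩).trans (ENNReal.ofReal_le_ofReal (le_max_right _ _))
    · intro p hp
      obtain ⟨A⟩ := nonempty_localArc hp
      set L := A.r - A.l with hL
      set c := (Real.sqrt (A.κ * ‖A.d‖))⁻¹ with hc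
      have hρ := A.ρ_pos
      refine ⟨J.carrier ∩ Metric.ball p (A.ρ / 2), inter_mem_nhdsWithin _
        (Metric.ball_mem_nhds p (by positivity)), c * (∫ u, sqrtKernel L u) +
          (Real.sqrt (A.ρ / 2))⁻¹ * J.pieces, ?_⟩
      rintro w ⟨⟨hw, hwp⟩, -⟩
      have hwp' : ‖w - p‖ < A.ρ / 2 := by simpa [dist_eq_norm] using hwp
      obtain ⟨τ, hτ, rfl⟩ := A.exists_arc_eq hw (by linarith)
      rw [A.lintegral_eq, ENNReal.ofReal_add
        (mul_nonneg (by positivity) (integral_nonneg fun _ => sqrtKernel_nonneg _ _))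
        (by positivity)]
      refine add_le_add ?_ ?_
      · calc ∫⁻ t in Ioo A.l A.r, ENNReal.ofReal (Real.sqrt ‖J.toFun (A.π t) - A.arc τ‖)⁻¹
            ≤ ∫⁻ t in Ioo A.l A.r, ENNReal.ofReal (c * sqrtKernel L (t - τ)) := by
              refine setLIntegral_mono_ae' measurableSet_Ioo (Eventually.of_forall fun t ht => ?_)
              refine ENNReal.ofReal_le_ofReal ?_
              have ht' := Ioo_subset_Icc_self ht
              rw [sqrtKernel_apply (A.abs_sub_le ht' hτ), hc, ← mul_inv,
                ← Real.sqrt_mul A.κd_pos.le]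
              rcases eq_or_ne t τ with rfl | hne
              · simp [LocalArc.arc]
              have hpos : 0 < A.κ * ‖A.d‖ * |t - τ| :=
                mul_pos A.κd_pos (abs_pos.2 (sub_ne_zero.2 hne))
              gcongr
              exact A.le_norm_arc_sub_arc hτ ht'
          _ ≤ ∫⁻ t, ENNReal.ofReal (c * sqrtKernel L (t - τ)) := setLIntegral_le_lintegral _ _
          _ = ∫⁻ u, ENNReal.ofReal (c * sqrtKernel L u) :=
              lintegral_sub_right_eq_self (fun u => ENNReal.ofReal (c * sqrtKernel L u)) τ
          _ = ENNReal.ofReal (∫ u, c * sqrtKernel L u) :=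
              (ofReal_integral_eq_lintegral_ofReal ((integrable_sqrtKernel L).const_mul c)
                (Eventually.of_forall fun u => mul_nonneg (by positivity)
                  (sqrtKernel_nonneg _ _))).symm
          _ = ENNReal.ofReal (c * ∫ u, sqrtKernel L u) := by rw [integral_const_mul]
      · calc ∫⁻ t in A.rest, ENNReal.ofReal (Real.sqrt ‖J.toFun t - A.arc τ‖)⁻¹
            ≤ ∫⁻ t in A.rest, ENNReal.ofReal (Real.sqrt (A.ρ / 2))⁻¹ := by
              refine setLIntegral_mono_ae' A.measurableSet_rest
                (Eventually.of_forall fun t ht => ENNReal.ofReal_le_ofReal ?_)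
              have := A.far_rest' ht hwp'.le
              gcongr
          _ ≤ ∫⁻ t in Icc (0 : ℝ) J.pieces, ENNReal.ofReal (Real.sqrt (A.ρ / 2))⁻¹ :=
              lintegral_mono_set sdiff_subset
          _ = ENNReal.ofReal ((Real.sqrt (A.ρ / 2))⁻¹ * J.pieces) := by
              rw [setLIntegral_const, Real.volume_Icc, sub_zero,
                ENNReal.ofReal_mul (by positivity)]
  obtain ⟨C, hC⟩ := key
  refine ⟨max C 0, fun w hw => ?_⟩
  have h1 := hC w ⟨hw, hw⟩
  have hnn : 0 ≤ᵐ[volume.restrict (Icc (0 : ℝ) J.pieces)]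
      fun t => (Real.sqrt ‖J.toFun t - w‖)⁻¹ := Eventually.of_forall fun t => by positivity
  have hm := measurable_inv_sqrt_norm_sub J.aestronglyMeasurable_toFun w
  have hint : IntegrableOn (fun t => (Real.sqrt ‖J.toFun t - w‖)⁻¹) (Icc (0 : ℝ) J.pieces) :=
    ⟨hm, (hasFiniteIntegral_iff_ofReal hnn).2 (h1.trans_lt ENNReal.ofReal_lt_top)⟩
  refine ⟨hint, ?_⟩
  rw [← ENNReal.ofReal_le_ofReal_iff (le_max_right _ _), ofReal_integral_eq_lintegral_ofReal hint hnn]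
  exact h1.trans (ENNReal.ofReal_le_ofReal (le_max_left _ _))

theorem IsSmooth.exists_bound {h : ℂ → ℂ} (hh : J.IsSmooth h) :
    ∃ C, 0 ≤ C ∧ ∀ z ∈ J.carrier, ‖h z‖ ≤ C := by
  obtain ⟨K, hK0, hK⟩ := hh.exists_lipschitz
  have hc : ContinuousOn h J.carrier := by
    refine LipschitzOnWith.continuousOn (K := K.toNNReal) (LipschitzOnWith.of_dist_le_mul ?_)
    intro z hz w hw
    rw [dist_eq_norm, dist_eq_norm, Real.coe_toNNReal _ hK0]
    exact hK z hz w hw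
  obtain ⟨C, hC⟩ := J.isCompact_carrier.exists_bound_of_continuousOn hc
  exact ⟨max C 0, le_max_right _ _, fun z hz => (hC z hz).trans (le_max_left _ _)⟩

theorem IsSmooth.continuousOn {h : ℂ → ℂ} (hh : J.IsSmooth h) : ContinuousOn h J.carrier := by
  obtain ⟨K, hK0, hK⟩ := hh.exists_lipschitz
  refine LipschitzOnWith.continuousOn (K := K.toNNReal) (LipschitzOnWith.of_dist_le_mul ?_)
  intro z hz w hw
  rw [dist_eq_norm, dist_eq_norm, Real.coe_toNNReal _ hK0]
  exact hK z hz w hw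

section kernel

variable {N : ℕ} {f e : Fin N → ℂ → ℂ}

/-- A bilinear kernel that vanishes on the diagonal is Lipschitz in the second variable. -/
theorem exists_lipschitz_bilinear (hf : ∀ a, J.IsSmooth (f a)) (he : ∀ a, J.IsSmooth (e a)) :
    ∃ C, 0 ≤ C ∧ ∀ z ∈ J.carrier, ∀ w ∈ J.carrier, ∀ w' ∈ J.carrier,
      ‖∑ a, f a z * e a w - ∑ a, f a z * e a w'‖ ≤ C * ‖w - w'‖ := by
  choose B hB0 hB using fun a => (hf a).exists_bound
  choose C hC0 hC using fun a => (he a).exists_lipschitz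
  refine ⟨∑ a, B a * C a, Finset.sum_nonneg fun a _ => mul_nonneg (hB0 a) (hC0 a), ?_⟩
  intro z hz w hw w' hw'
  rw [← Finset.sum_sub_distrib, Finset.sum_mul]
  refine norm_sum_le_of_le _ fun a _ => ?_
  rw [← mul_sub, norm_mul, mul_assoc]
  exact mul_le_mul (hB a z hz) (hC a w hw w' hw') (norm_nonneg _) (hB0 a)

/-- Off the diagonal the integrable kernel is bounded. -/
theorem exists_bound_quotient (hf : ∀ a, J.IsSmooth (f a)) (he : ∀ a, J.IsSmooth (e a))
    (hfe : ∀ z ∈ J.carrier, ∑ a, f a z * e a z = 0) :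
    ∃ C, 0 ≤ C ∧ ∀ z ∈ J.carrier, ∀ w ∈ J.carrier,
      ‖(∑ a, f a z * e a w) / (z - w)‖ ≤ C := by
  obtain ⟨C, hC0, hC⟩ := exists_lipschitz_bilinear hf he
  refine ⟨C, hC0, fun z hz w hw => ?_⟩
  have h := hC z hz w hw z hz
  rw [hfe z hz, sub_zero] at h
  rw [norm_div]
  refine div_le_of_le_mul₀ (norm_nonneg _) hC0 ?_
  rwa [norm_sub_rev z w]

/-- The integrable kernel is Hölder continuous of order `1 / 2` in the second variable, with a
constant that blows up at the diagonal at an integrable rate. -/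
theorem exists_holder_quotient (hf : ∀ a, J.IsSmooth (f a)) (he : ∀ a, J.IsSmooth (e a))
    (hfe : ∀ z ∈ J.carrier, ∑ a, f a z * e a z = 0) :
    ∃ C, 0 ≤ C ∧ ∀ z ∈ J.carrier, ∀ w ∈ J.carrier, ∀ w' ∈ J.carrier, z ≠ w → z ≠ w' →
      ‖(∑ a, f a z * e a w) / (z - w) - (∑ a, f a z * e a w') / (z - w')‖ ≤
        C * Real.sqrt ‖w - w'‖ * (Real.sqrt ‖z - w‖)⁻¹ := by
  obtain ⟨C, hC0, hC⟩ := exists_lipschitz_bilinear hf he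
  obtain ⟨B, hB0, hB⟩ := exists_bound_quotient hf he hfe
  refine ⟨Real.sqrt (2 * B * (C + B)), by positivity, ?_⟩
  intro z hz w hw w' hw' hzw hzw'
  have h1 : z - w ≠ 0 := sub_ne_zero.2 hzw
  have h2 : z - w' ≠ 0 := sub_ne_zero.2 hzw'
  have hpos : 0 < ‖z - w‖ := norm_pos_iff.2 h1
  set x := ‖(∑ a, f a z * e a w) / (z - w) - (∑ a, f a z * e a w') / (z - w')‖ with hx
  have hx1 : x ≤ 2 * B := by
    refine (norm_sub_le _ _).trans ?_
    linarith [hB z hz w hw, hB z hz w' hw']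
  have hx2 : x ≤ (C + B) * ‖w - w'‖ / ‖z - w‖ := by
    have : (∑ a, f a z * e a w) / (z - w) - (∑ a, f a z * e a w') / (z - w') =
        ((∑ a, f a z * e a w - ∑ a, f a z * e a w') +
          (∑ a, f a z * e a w') / (z - w') * (w - w')) / (z - w) := by
      field_simp
      ring
    rw [hx, this, norm_div]
    gcongr
    refine (norm_add_le _ _).trans ?_
    rw [norm_mul, add_mul]
    gcongr
    · exact hC z hz w hw w' hw'
    · exact hB z hz w' hw'
  rw [← div_eq_mul_inv, ← Real.sqrt_mul (by positivity), ← Real.sqrt_div (by positivity)]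
  apply Real.le_sqrt_of_sq_le
  calc x ^ 2 = x * x := sq x
    _ ≤ 2 * B * ((C + B) * ‖w - w'‖ / ‖z - w‖) :=
        mul_le_mul hx1 hx2 (norm_nonneg _) (by positivity)
    _ = 2 * B * (C + B) * ‖w - w'‖ / ‖z - w‖ := by ring

theorem aestronglyMeasurable_comp_toFun {h : ℂ → ℂ} (hh : ContinuousOn h J.carrier) :
    AEStronglyMeasurable (fun t => h (J.toFun t)) (volume.restrict (Icc (0 : ℝ) J.pieces)) :=
  (hh.comp continuousOn_toFun fun t ht => ⟨t, ht, rfl⟩).aestronglyMeasurable measurableSet_Icc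

theorem finite_fiber (J : PiecewiseSmoothCurve) (w : ℂ) :
    {t | t ∈ Icc (0 : ℝ) J.pieces ∧ J.toFun t = w}.Finite := by
  by_cases h : w ∈ J.carrier
  · obtain ⟨t0, ht0, rfl⟩ := h
    refine (Set.toFinite {t0, 0, (J.pieces : ℝ)}).subset ?_
    rintro t ⟨ht, h⟩
    rcases eq_of_toFun_eq ht ht0 h with h1 | ⟨h1, _⟩ | ⟨_, h1⟩
    · exact Or.inl h1
    · exact Or.inr (Or.inl h1)
    · exact Or.inr (Or.inr h1)
  · convert Set.finite_empty
    ext t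
    simp only [mem_ofPred_eq, mem_empty_iff_false, iff_false]
    rintro ⟨ht, rfl⟩
    exact h ⟨t, ht, rfl⟩

theorem ae_toFun_ne (J : PiecewiseSmoothCurve) (w : ℂ) :
    ∀ᵐ t ∂volume.restrict (Icc (0 : ℝ) J.pieces), J.toFun t ≠ w := by
  rw [ae_restrict_iff' measurableSet_Icc]
  filter_upwards [(J.finite_fiber w).countable.ae_notMem volume] with t ht hI h
  exact ht ⟨hI, h⟩

/-- An integral transform with the integrable kernel is Hölder continuous of order `1 / 2`. -/
theorem exists_holder_transform (hf : ∀ a, J.IsSmooth (f a)) (he : ∀ a, J.IsSmooth (e a))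
    (hfe : ∀ z ∈ J.carrier, ∑ a, f a z * e a z = 0) {φ : ℝ → ℂ}
    (hφ : AEStronglyMeasurable φ (volume.restrict (Icc (0 : ℝ) J.pieces))) {M : ℝ}
    (hM : ∀ t ∈ Icc (0 : ℝ) J.pieces, ‖φ t‖ ≤ M) :
    ∃ C, 0 ≤ C ∧ ∀ w ∈ J.carrier, ∀ w' ∈ J.carrier,
      ‖(∫ t in Icc (0 : ℝ) J.pieces, φ t * ((∑ a, f a (J.toFun t) * e a w) / (J.toFun t - w))) -
        ∫ t in Icc (0 : ℝ) J.pieces, φ t * ((∑ a, f a (J.toFun t) * e a w') / (J.toFun t - w'))‖ ≤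
        C * Real.sqrt ‖w - w'‖ := by
  obtain ⟨C, hC0, hC⟩ := exists_holder_quotient hf he hfe
  obtain ⟨B, hB0, hB⟩ := exists_bound_quotient hf he hfe
  obtain ⟨D, hD⟩ := J.exists_bound_integral_inv_sqrt
  have hM0 : 0 ≤ M := (norm_nonneg _).trans (hM 0 ⟨le_rfl, J.pieces_pos'.le⟩)
  have hD0 : 0 ≤ max D 0 := le_max_right _ _
  refine ⟨M * C * max D 0, by positivity, fun w hw w' hw' => ?_⟩
  have hmeas : ∀ w, AEStronglyMeasurable (fun t => φ t * ((∑ a, f a (J.toFun t) * e a w) /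
      (J.toFun t - w))) (volume.restrict (Icc (0 : ℝ) J.pieces)) := by
    intro w
    refine hφ.mul (AEMeasurable.aestronglyMeasurable (AEMeasurable.div ?_ ?_))
    · exact Finset.aemeasurable_fun_sum _ fun a _ =>
        ((aestronglyMeasurable_comp_toFun (hf a).continuousOn).aemeasurable.mul_const _)
    · exact J.aestronglyMeasurable_toFun.aemeasurable.sub_const _
  have hint : ∀ w ∈ J.carrier, IntegrableOn (fun t => φ t * ((∑ a, f a (J.toFun t) * e a w) /
      (J.toFun t - w))) (Icc (0 : ℝ) J.pieces) := by
    intro w hw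
    refine Integrable.of_bound (hmeas w) (M * B) ?_
    filter_upwards [ae_restrict_mem measurableSet_Icc] with t ht
    rw [norm_mul]
    exact mul_le_mul (hM t ht) (hB _ ⟨t, ht, rfl⟩ w hw) (norm_nonneg _) hM0
  rw [← integral_sub (hint w hw) (hint w' hw')]
  have hle : ∀ᵐ t ∂volume.restrict (Icc (0 : ℝ) J.pieces),
      ‖φ t * ((∑ a, f a (J.toFun t) * e a w) / (J.toFun t - w)) -
        φ t * ((∑ a, f a (J.toFun t) * e a w') / (J.toFun t - w'))‖ ≤
      M * (C * Real.sqrt ‖w - w'‖) * (Real.sqrt ‖J.toFun t - w‖)⁻¹ := by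
    filter_upwards [ae_restrict_mem measurableSet_Icc, J.ae_toFun_ne w, J.ae_toFun_ne w']
      with t ht h1 h2
    rw [← mul_sub, norm_mul, mul_assoc M]
    exact mul_le_mul (hM t ht) (hC _ ⟨t, ht, rfl⟩ w hw w' hw' h1 h2) (norm_nonneg _) hM0
  refine (norm_integral_le_of_norm_le ((hD w hw).1.const_mul _) hle).trans ?_
  rw [integral_const_mul]
  calc M * (C * Real.sqrt ‖w - w'‖) * ∫ t in Icc (0 : ℝ) J.pieces, (Real.sqrt ‖J.toFun t - w‖)⁻¹
      ≤ M * (C * Real.sqrt ‖w - w'‖) * max D 0 := by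
        gcongr
        exact (hD w hw).2.trans (le_max_left _ _)
    _ = M * C * max D 0 * Real.sqrt ‖w - w'‖ := by ring

end kernel

end PiecewiseSmoothCurve

/-! ### The Fredholm determinant of a kernel on the curve in the parameter interval -/

namespace PiecewiseSmoothCurve

open MeasureTheory

variable {J : PiecewiseSmoothCurve} {p : ℂ}

/-- Lebesgue measure on the parameter interval. -/
noncomputable abbrev parMeasure (J : PiecewiseSmoothCurve) : Measure ℝ :=
  volume.restrict (Icc (0 : ℝ) J.pieces)

/-- The parametrisation, continued by constants to the whole line. -/
noncomputable def path (J : PiecewiseSmoothCurve) (t : ℝ) : ℂ :=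
  J.toFun (max 0 (min t J.pieces))

/-- The derivative of the parametrisation, continued by zero to the whole line. -/
noncomputable def vel (J : PiecewiseSmoothCurve) : ℝ → ℂ :=
  (Icc (0 : ℝ) J.pieces).indicator (deriv J.toFun)

/-- A kernel on the curve in terms of the parameters, with the density of `dμ` in the second
variable. -/
noncomputable def pull (J : PiecewiseSmoothCurve) (K : ℂ → ℂ → ℂ) (s t : ℝ) : ℂ :=
  K (J.path s) (J.path t) * J.vel t

theorem clamp_mem (J : PiecewiseSmoothCurve) (t : ℝ) :
    max 0 (min t (J.pieces : ℝ)) ∈ Icc (0 : ℝ) J.pieces :=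
  ⟨le_max_left _ _, max_le J.pieces_pos'.le (min_le_right _ _)⟩

theorem path_mem (J : PiecewiseSmoothCurve) (t : ℝ) : J.path t ∈ J.carrier :=
  ⟨_, J.clamp_mem t, rfl⟩

theorem path_eq {t : ℝ} (ht : t ∈ Icc (0 : ℝ) J.pieces) : J.path t = J.toFun t := by
  rw [path, min_eq_left ht.2, max_eq_right ht.1]

theorem vel_eq {t : ℝ} (ht : t ∈ Icc (0 : ℝ) J.pieces) : J.vel t = deriv J.toFun t :=
  indicator_of_mem ht _

theorem continuous_path (J : PiecewiseSmoothCurve) : Continuous J.path :=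
  continuousOn_toFun.comp_continuous (by fun_prop) J.clamp_mem

theorem measurable_vel (J : PiecewiseSmoothCurve) : Measurable J.vel :=
  (measurable_deriv _).indicator measurableSet_Icc

theorem exists_bound_vel (J : PiecewiseSmoothCurve) : ∃ M, 0 ≤ M ∧ ∀ t, ‖J.vel t‖ ≤ M := by
  obtain ⟨M, hM0, hM⟩ := exists_bound_deriv J.smooth
  refine ⟨M, hM0, fun t => ?_⟩
  by_cases ht : t ∈ Icc (0 : ℝ) J.pieces
  · rw [vel_eq ht]; exact hM t ht
  · rw [vel, indicator_of_notMem ht]; simpa using hM0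

theorem kdet_pull (K : ℂ → ℂ → ℂ) {k : ℕ} (x : Fin k → ℝ) :
    Fredholm.kdet (J.pull K) x =
      (Matrix.of fun i j => K (J.path (x i)) (J.path (x j))).det * ∏ i, J.vel (x i) := by
  unfold Fredholm.kdet pull
  rw [mul_comm, ← Matrix.det_mul_row]
  simp only [Matrix.of_apply, mul_comm]

theorem kdet_pull_swap (K : ℂ → ℂ → ℂ) {k : ℕ} (x : Fin k → ℝ) :
    Fredholm.kdet (J.pull fun z w => K w z) x = Fredholm.kdet (J.pull K) x := by
  rw [kdet_pull, kdet_pull, ← Matrix.det_transpose]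
  rfl

theorem fdet_pull_swap (K : ℂ → ℂ → ℂ) :
    Fredholm.fdet J.parMeasure (J.pull fun z w => K w z) =
      Fredholm.fdet J.parMeasure (J.pull K) := by
  unfold Fredholm.fdet Fredholm.term
  simp_rw [kdet_pull_swap]

theorem fredholmIntegrand_eq (K : ℂ → ℂ → ℂ) {k : ℕ} {x : Fin k → ℝ}
    (hx : x ∈ Set.univ.pi fun _ : Fin k => Icc (0 : ℝ) J.pieces) :
    J.fredholmIntegrand K k x = Fredholm.kdet (J.pull K) x := by
  have hx' : ∀ i, x i ∈ Icc (0 : ℝ) J.pieces := fun i => hx i (mem_univ i)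
  rw [kdet_pull, fredholmIntegrand]
  simp only [path_eq (hx' _), vel_eq (hx' _)]

theorem measurableSet_cube (J : PiecewiseSmoothCurve) (k : ℕ) :
    MeasurableSet (Set.univ.pi fun _ : Fin k => Icc (0 : ℝ) J.pieces) :=
  MeasurableSet.univ_pi fun _ => measurableSet_Icc

theorem restrict_cube (J : PiecewiseSmoothCurve) (k : ℕ) :
    (volume : Measure (Fin k → ℝ)).restrict (Set.univ.pi fun _ : Fin k => Icc (0 : ℝ) J.pieces) =
      Measure.pi fun _ => J.parMeasure := by
  rw [volume_pi, Measure.restrict_pi_pi]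

theorem fredholmTerm_eq (K : ℂ → ℂ → ℂ) (k : ℕ) :
    J.fredholmTerm K k = Fredholm.term J.parMeasure (J.pull K) k := by
  unfold fredholmTerm Fredholm.term
  rw [setIntegral_congr_fun (J.measurableSet_cube k) fun x hx => fredholmIntegrand_eq K hx,
    restrict_cube]

theorem fredholmDet_eq (K : ℂ → ℂ → ℂ) :
    J.fredholmDet K = Fredholm.fdet J.parMeasure (J.pull K) := by
  unfold fredholmDet Fredholm.fdet
  simp_rw [fredholmTerm_eq]

theorem fredholmConverges_of_bddKernel {K : ℂ → ℂ → ℂ} {M : ℝ}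
    (h : Fredholm.BddKernel (J.pull K) M) : J.FredholmConverges K := by
  refine ⟨fun k => ?_, ?_⟩
  · refine IntegrableOn.congr_fun (f := Fredholm.kdet (J.pull K)) ?_
      (fun x hx => (fredholmIntegrand_eq K hx).symm) (J.measurableSet_cube k)
    rw [IntegrableOn, restrict_cube]
    exact Fredholm.integrable_kdet h k
  · have := Fredholm.summable_term (μ := J.parMeasure) h
    refine this.congr fun k => ?_
    rw [fredholmTerm_eq]

/-- A measurable bounded kernel on the curve gives a bounded kernel in the parameters. -/
theorem exists_bddKernel_pull {K : ℂ → ℂ → ℂ} {C : ℝ}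
    (hm : Measurable fun p : ℝ × ℝ => K (J.path p.1) (J.path p.2))
    (hC : ∀ z ∈ J.carrier, ∀ w ∈ J.carrier, ‖K z w‖ ≤ C) :
    ∃ M, Fredholm.BddKernel (J.pull K) M := by
  obtain ⟨M, hM0, hM⟩ := J.exists_bound_vel
  refine ⟨C * M, hm.mul (J.measurable_vel.comp measurable_snd), fun s t => ?_⟩
  rw [pull, norm_mul]
  have h := hC _ (J.path_mem s) _ (J.path_mem t)
  exact mul_le_mul h (hM t) (norm_nonneg _) ((norm_nonneg _).trans h)

theorem exists_bddKernel_of_continuousOn {K : ℂ → ℂ → ℂ}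
    (hK : ContinuousOn (Function.uncurry K) (J.carrier ×ˢ J.carrier)) :
    ∃ M, Fredholm.BddKernel (J.pull K) M := by
  obtain ⟨C, hC⟩ := (J.isCompact_carrier.prod J.isCompact_carrier).exists_bound_of_continuousOn hK
  refine exists_bddKernel_pull (C := C) ?_ fun z hz w hw => hC (z, w) ⟨hz, hw⟩
  have : Continuous fun p : ℝ × ℝ => Function.uncurry K (J.path p.1, J.path p.2) :=
    hK.comp_continuous ((J.continuous_path.comp continuous_fst).prodMk
      (J.continuous_path.comp continuous_snd)) fun p => ⟨J.path_mem _, J.path_mem _⟩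
  exact this.measurable

theorem exists_bddFun_comp_path {b : ℂ → ℂ} (hb : ContinuousOn b J.carrier) :
    ∃ M, Fredholm.BddFun (fun t => b (J.path t)) M := by
  obtain ⟨C, hC⟩ := J.isCompact_carrier.exists_bound_of_continuousOn hb
  exact ⟨C, (hb.comp_continuous J.continuous_path J.path_mem).measurable,
    fun t => hC _ (J.path_mem t)⟩

theorem contourIntegral_eq (J : PiecewiseSmoothCurve) (h : ℂ → ℂ) :
    J.contourIntegral h = ∫ t, h (J.path t) * J.vel t ∂J.parMeasure := by
  refine setIntegral_congr_fun measurableSet_Icc fun t ht => ?_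
  simp only [path_eq ht, vel_eq ht]

/-- Solvability of the integral equation on the curve. -/
theorem exists_solution_curve {K : ℂ → ℂ → ℂ} {M : ℝ} (hK : Fredholm.BddKernel (J.pull K) M)
    (hD : Fredholm.fdet J.parMeasure (J.pull K) ≠ 0) {b : ℂ → ℂ} {C : ℝ}
    (hb : Fredholm.BddFun (fun t => b (J.path t)) C) :
    ∃ F : ℂ → ℂ, (∃ C', Fredholm.BddFun (fun t => F (J.path t)) C') ∧
      ∀ z ∈ J.carrier, F z + J.contourIntegral (fun w => K z w * F w) = b z := by
  obtain ⟨φ, C', hφ, h⟩ := Fredholm.exists_solution hK hD hb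
  have hF : ∀ s, b (J.path s) - ∫ t, K (J.path s) (J.path t) * J.vel t * φ t ∂J.parMeasure = φ s :=
    fun s => by rw [← h s]; exact add_sub_cancel_right _ _
  refine ⟨fun z => b z - ∫ t, K z (J.path t) * J.vel t * φ t ∂J.parMeasure, ⟨C', ?_⟩, ?_⟩
  · simp only [hF]; exact hφ
  · rintro _ ⟨s, hs, rfl⟩
    rw [← path_eq hs, contourIntegral_eq]
    simp only [hF]
    rw [← h s]
    congr 1
    refine integral_congr_ae (Eventually.of_forall fun t => ?_)
    simp only [pull]
    ring

/-- Uniqueness for the integral equation on the curve. -/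
theorem eqOn_of_solution_curve {K : ℂ → ℂ → ℂ} {M : ℝ} (hK : Fredholm.BddKernel (J.pull K) M)
    (hD : Fredholm.fdet J.parMeasure (J.pull K) ≠ 0) {b F G : ℂ → ℂ} {C C' : ℝ}
    (hFb : Fredholm.BddFun (fun t => F (J.path t)) C)
    (hGb : Fredholm.BddFun (fun t => G (J.path t)) C')
    (hF : ∀ z ∈ J.carrier, F z + J.contourIntegral (fun w => K z w * F w) = b z)
    (hG : ∀ z ∈ J.carrier, G z + J.contourIntegral (fun w => K z w * G w) = b z) :
    EqOn F G J.carrier := by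
  have key := Fredholm.eq_zero_of_add_integral_eq_zero hK hD
    (hFb.add (hGb.const_mul (-1))) (fun s => by
      have h1 := hF _ (J.path_mem s)
      have h2 := hG _ (J.path_mem s)
      rw [contourIntegral_eq] at h1 h2
      have h3 : ∫ t, J.pull K s t * (F (J.path t) + -1 * G (J.path t)) ∂J.parMeasure =
          ∫ t, K (J.path s) (J.path t) * F (J.path t) * J.vel t ∂J.parMeasure -
            ∫ t, K (J.path s) (J.path t) * G (J.path t) * J.vel t ∂J.parMeasure := by
        rw [← integral_sub]
        · refine integral_congr_ae (Eventually.of_forall fun t => ?_)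
          simp only [pull]
          ring
        · refine ((hK.left s).mul hFb).integrable.congr (Eventually.of_forall fun t => ?_)
          simp only [pull]
          ring
        · refine ((hK.left s).mul hGb).integrable.congr (Eventually.of_forall fun t => ?_)
          simp only [pull]
          ring
      rw [h3]
      linear_combination h1 - h2)
  rintro _ ⟨s, hs, rfl⟩
  rw [← path_eq hs]
  linear_combination key s

/-- At a smooth point of the curve, the derivative along the curve is the quotient of the
derivatives with respect to the parameter. -/
theorem IsSmooth.hasDerivWithinAt {h : ℂ → ℂ} (hh : J.IsSmooth h) {i : ℕ} (hi : i < J.pieces)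
    {t : ℝ} (ht : t ∈ Ioo (i : ℝ) (i + 1)) :
    HasDerivWithinAt h (deriv (fun t => h (J.toFun t)) t / deriv J.toFun t) J.carrier
      (J.toFun t) := by
  have htI := Icc_subset_of_lt hi (Ioo_subset_Icc_self ht)
  obtain ⟨A⟩ := nonempty_localArc (p := J.toFun t) ⟨t, htI, rfl⟩
  have ht0 : 0 < t := lt_of_le_of_lt (by positivity) ht.1
  have htn : t < J.pieces := ht.2.trans_le (by exact_mod_cast hi)
  have hRL : A.tR = t ∧ A.tL = t := by
    constructor
    · rcases eq_of_toFun_eq A.memR htI A.ptR with h1 | ⟨_, h1⟩ | ⟨h1, _⟩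
      · exact h1
      · exact absurd h1 htn.ne
      · exact absurd h1 ht0.ne'
    · rcases eq_of_toFun_eq A.memL htI A.ptL with h1 | ⟨_, h1⟩ | ⟨h1, _⟩
      · exact h1
      · exact absurd h1 htn.ne
      · exact absurd h1 ht0.ne'
  have hπ : ∀ s, A.π s = t + s := by
    intro s
    unfold LocalArc.π
    rw [hRL.1, hRL.2, ite_self]
  have hv : deriv J.toFun t ≠ 0 := by
    rw [deriv_eq_of_mem_Ioo ht]
    exact J.regular i hi t (Ioo_subset_Icc_self ht)
  set v := deriv J.toFun t
  set u := deriv (fun t => h (J.toFun t)) t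
  have h1 := (hasDerivAt_of_smooth J.smooth hi ht).isLittleO
  have h2 := (hasDerivAt_of_smooth (g := fun t => h (J.toFun t)) hh hi ht).isLittleO
  -- the combination of the two expansions in which the linear terms cancel
  have h3 : (fun s => h (J.toFun s) - h (J.toFun t) - (J.toFun s - J.toFun t) * (u / v)) =o[𝓝 t]
      fun s => s - t := by
    refine (h2.sub (h1.const_mul_left (u / v))).congr_left fun s => ?_
    simp only [Complex.real_smul]
    field_simp
    ring
  rw [hasDerivWithinAt_iff_isLittleO, Asymptotics.isLittleO_iff]
  intro c hc
  obtain ⟨δ, hδ, hball⟩ := Metric.eventually_nhds_iff.1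
    (Asymptotics.isLittleO_iff.1 h3 (mul_pos hc A.κd_pos))
  have hmem : J.carrier ∩ Metric.ball (J.toFun t) (min A.ρ (A.κ * ‖A.d‖ * δ)) ∈
      𝓝[J.carrier] (J.toFun t) := inter_mem_nhdsWithin _
    (Metric.ball_mem_nhds _ (lt_min A.ρ_pos (mul_pos A.κd_pos hδ)))
  filter_upwards [hmem] with z ⟨hz, hzb⟩
  have hzb' : ‖z - J.toFun t‖ < min A.ρ (A.κ * ‖A.d‖ * δ) := by simpa [dist_eq_norm] using hzb
  obtain ⟨s, hs, rfl⟩ := A.exists_arc_eq hz (hzb'.trans_le (min_le_left _ _))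
  have h4 := A.le_norm_arc_sub_arc A.zero_mem hs
  rw [A.arc_zero, sub_zero] at h4
  have h5 : |s| < δ := by
    have := h4.trans_lt (hzb'.trans_le (min_le_right _ _))
    exact lt_of_mul_lt_mul_left this A.κd_pos.le
  have h6 := hball (y := t + s) (by simpa [Real.dist_eq] using h5)
  rw [← hπ s] at h6
  rw [smul_eq_mul]
  refine h6.trans ?_
  rw [hπ, add_sub_cancel_left, Real.norm_eq_abs, mul_assoc]
  exact mul_le_mul_of_nonneg_left h4 hc.le

theorem accPt_carrier (hp : p ∈ J.carrier) : AccPt p (𝓟 J.carrier) := by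
  obtain ⟨A⟩ := nonempty_localArc hp
  rw [accPt_iff_frequently]
  have hne : (𝓝[A.par] (0 : ℝ)).NeBot := by
    rw [← mem_closure_iff_nhdsWithin_neBot]
    have h1 : closure (Ioo A.l A.r) = Icc A.l A.r := closure_Ioo A.l_lt_r.ne
    have h2 : (0 : ℝ) ∈ closure (Ioo A.l A.r ∩ {0}ᶜ) := by
      have : Dense ({0}ᶜ : Set ℝ) := dense_compl_singleton 0
      exact closure_minimal (this.open_subset_closure_inter isOpen_Ioo) isClosed_closure
        (h1 ▸ A.zero_mem)
    exact h2
  have hc : Tendsto A.arc (𝓝[A.par] 0) (𝓝 p) := by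
    have := (A.continuousOn_arc 0 A.zero_mem).tendsto.mono_left
      (nhdsWithin_mono 0 (sdiff_subset.trans Ioo_subset_Icc_self : A.par ⊆ Icc A.l A.r))
    rwa [A.arc_zero] at this
  refine hc.frequently (Eventually.frequently ?_)
  filter_upwards [self_mem_nhdsWithin] with t ht
  have ht' := Ioo_subset_Icc_self ht.1
  refine ⟨?_, A.arc_mem ht'⟩
  have h4 := A.le_norm_arc_sub_arc A.zero_mem ht'
  rw [A.arc_zero, sub_zero] at h4
  have : 0 < ‖A.arc t - p‖ := (mul_pos A.κd_pos (abs_pos.2 ht.2)).trans_le h4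
  exact sub_ne_zero.1 (norm_pos_iff.1 this)

theorem norm_derivWithin_le {h : ℂ → ℂ} {C : ℝ} (hC0 : 0 ≤ C)
    (hC : ∀ z ∈ J.carrier, ∀ w ∈ J.carrier, ‖h z - h w‖ ≤ C * ‖z - w‖) (hp : p ∈ J.carrier) :
    ‖derivWithin h J.carrier p‖ ≤ C := by
  by_cases hd : DifferentiableWithinAt ℂ h J.carrier p
  · have h1 := hasDerivWithinAt_iff_tendsto_slope.1 hd.hasDerivWithinAt
    have : (𝓝[J.carrier \ {p}] p).NeBot :=
      accPt_principal_iff_nhdsWithin.1 (accPt_carrier hp)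
    refine le_of_tendsto h1.norm ?_
    filter_upwards [self_mem_nhdsWithin] with z hz
    have hne : 0 < ‖z - p‖ := norm_pos_iff.2 (sub_ne_zero.2 hz.2)
    rw [slope_def_field, norm_div, div_le_iff₀ hne]
    exact hC z hz.1 p hp
  · rw [derivWithin_zero_of_not_differentiableWithinAt hd]
    simpa using hC0

theorem IsSmooth.measurable_derivWithin {h : ℂ → ℂ} (hh : J.IsSmooth h) :
    Measurable fun t => derivWithin h J.carrier (J.path t) := by
  set g : ℝ → ℂ := fun t => if t ≤ 0 then derivWithin h J.carrier (J.toFun 0) else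
    if J.pieces ≤ t then derivWithin h J.carrier (J.toFun J.pieces) else
    deriv (fun t => h (J.toFun t)) t / deriv J.toFun t with hg
  have hgm : Measurable g := Measurable.ite measurableSet_Iic measurable_const
    (Measurable.ite measurableSet_Ici measurable_const
      ((measurable_deriv _).div (measurable_deriv _)))
  refine hgm.measurable_of_countable_ne ((countable_range fun n : ℕ => (n : ℝ)).mono ?_)
  intro t ht
  by_contra hn
  apply ht
  simp only [hg]
  split_ifs with h1 h2
  · rw [path, min_eq_left (h1.trans J.pieces_pos'.le), max_eq_left h1]
  · rw [path, min_eq_right h2, max_eq_right J.pieces_pos'.le]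
  · push Not at h1 h2
    have hfl : (⌊t⌋₊ : ℝ) < t := lt_of_le_of_ne (Nat.floor_le h1.le) fun h => hn ⟨_, h⟩
    have hmem : t ∈ Ioo (⌊t⌋₊ : ℝ) (⌊t⌋₊ + 1) := ⟨hfl, Nat.lt_floor_add_one t⟩
    have hlt : ⌊t⌋₊ < J.pieces := (Nat.floor_lt h1.le).2 h2
    rw [path_eq ⟨h1.le, h2.le⟩]
    have hu : UniqueDiffWithinAt ℂ J.carrier (J.toFun t) :=
      (accPt_carrier ⟨t, ⟨h1.le, h2.le⟩, rfl⟩).uniqueDiffWithinAt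
    exact ((hh.hasDerivWithinAt hlt hmem).derivWithin hu).symm

/-- The integrable kernel is bounded and measurable in the parameters. -/
theorem exists_bddKernel_integrableKernel {N : ℕ} {f e : Fin N → ℂ → ℂ}
    (hf : ∀ a, J.IsSmooth (f a)) (he : ∀ a, J.IsSmooth (e a))
    (hfe : ∀ z ∈ J.carrier, ∑ a, f a z * e a z = 0) :
    (∃ C, ∀ z ∈ J.carrier, ∀ w ∈ J.carrier, ‖J.integrableKernel f e z w‖ ≤ C) ∧
    Measurable fun p : ℝ × ℝ => J.integrableKernel f e (J.path p.1) (J.path p.2) := by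
  constructor
  · obtain ⟨B, hB0, hB⟩ := exists_bound_quotient hf he hfe
    choose L hL0 hL using fun a => (hf a).exists_lipschitz
    choose E hE0 hE using fun a => (he a).exists_bound
    refine ⟨max B (∑ a, L a * E a), fun z hz w hw => ?_⟩
    unfold integrableKernel
    split_ifs with h
    · refine (norm_sum_le_of_le _ fun a _ => ?_).trans (le_max_right _ _)
      rw [norm_mul]
      exact mul_le_mul (norm_derivWithin_le (hL0 a) (hL a) hz) (hE a z hz) (norm_nonneg _) (hL0 a)
    · exact (hB z hz w hw).trans (le_max_left _ _)
  · unfold integrableKernel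
    have h1 : Measurable fun p : ℝ × ℝ => J.path p.1 :=
      J.continuous_path.measurable.comp measurable_fst
    have h2 : Measurable fun p : ℝ × ℝ => J.path p.2 :=
      J.continuous_path.measurable.comp measurable_snd
    have hc : ∀ {h : ℂ → ℂ}, J.IsSmooth h → Measurable fun t => h (J.path t) := fun hh =>
      (hh.continuousOn.comp_continuous J.continuous_path J.path_mem).measurable
    refine Measurable.ite (measurableSet_eq_fun h1 h2) ?_ (Measurable.div ?_ (h1.sub h2))
    · exact Finset.measurable_sum _ fun a _ =>
        ((hf a).measurable_derivWithin.comp measurable_fst).mul ((hc (he a)).comp measurable_fst)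
    · exact Finset.measurable_sum _ fun a _ =>
        ((hc (hf a)).comp measurable_fst).mul ((hc (he a)).comp measurable_snd)

end PiecewiseSmoothCurve

/-! ### Cauchy integrals along a local arc -/

namespace PiecewiseSmoothCurve

open MeasureTheory

variable {J : PiecewiseSmoothCurve} {p : ℂ}

/-- A Cauchy integral is holomorphic away from the path of integration. -/
theorem differentiableAt_cauchyIntegral {α : Type*} [MeasurableSpace α] {μ : Measure α}
    {φ ψ : α → ℂ} (hφ : Integrable φ μ) (hψ : AEStronglyMeasurable ψ μ) {z0 : ℂ} {δ : ℝ}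
    (hδ : 0 < δ) (h : ∀ᵐ t ∂μ, δ ≤ ‖ψ t - z0‖) :
    DifferentiableAt ℂ (fun z => ∫ t, φ t / (ψ t - z) ∂μ) z0 := by
  have hm : ∀ z, AEStronglyMeasurable (fun t => φ t / (ψ t - z)) μ := fun z =>
    (hφ.aestronglyMeasurable.aemeasurable.div (hψ.aemeasurable.sub_const z)).aestronglyMeasurable
  have hle : ∀ᵐ t ∂μ, ∀ z ∈ Metric.ball z0 (δ / 2), δ / 2 ≤ ‖ψ t - z‖ := by
    filter_upwards [h] with t ht z hz
    have h1 : ‖z - z0‖ < δ / 2 := by simpa [dist_eq_norm] using hz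
    have h2 := norm_sub_le_norm_sub_add_norm_sub (ψ t) z z0
    linarith
  have hz0 : z0 ∈ Metric.ball z0 (δ / 2) := Metric.mem_ball_self (by positivity)
  refine (hasDerivAt_integral_of_dominated_loc_of_deriv_le (μ := μ)
    (F := fun z t => φ t / (ψ t - z)) (F' := fun z t => φ t / (ψ t - z) ^ 2) (x₀ := z0)
    (s := Metric.ball z0 (δ / 2)) (bound := fun t => ‖φ t‖ / (δ / 2) ^ 2)
    (Metric.ball_mem_nhds z0 (by positivity))
    (Eventually.of_forall hm) ?_ ?_ ?_ (hφ.norm.div_const _) ?_).2.differentiableAt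
  · refine (hφ.norm.div_const (δ / 2)).mono' (hm z0) ?_
    filter_upwards [hle] with t ht
    rw [norm_div]
    have := ht z0 hz0
    gcongr
  · exact (hφ.aestronglyMeasurable.aemeasurable.div
      ((hψ.aemeasurable.sub_const z0).pow_const 2)).aestronglyMeasurable
  · filter_upwards [hle] with t ht z hz
    rw [norm_div, norm_pow]
    have := ht z hz
    gcongr
  · filter_upwards [hle] with t ht z hz
    have hne : ψ t - z ≠ 0 := norm_pos_iff.1 ((half_pos hδ).trans_le (ht z hz))
    have h1 : HasDerivAt (fun z => ψ t - z) (-1) z := by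
      simpa using (hasDerivAt_id z).const_sub (ψ t)
    have h2 := (hasDerivAt_const z (φ t)).div h1 hne
    simp only [zero_mul, zero_sub, mul_neg, mul_one, neg_neg] at h2
    exact h2

namespace LocalArc

variable (A : LocalArc J p)

/-- The point at height `y` above the point of parameter `τ` of the arc. -/
noncomputable def pt (τ y : ℝ) : ℂ := A.arc τ + Complex.I * y * A.d

/-- The points near the arc on its left (`σ = 1`) or on its right (`σ = -1`). -/
def side (σ : ℝ) : Set ℂ := {z | ∃ τ ∈ Ioo A.l A.r, ∃ y, 0 < σ * y ∧ z = A.pt τ y}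

theorem pt_zero (τ : ℝ) : A.pt τ 0 = A.arc τ := by simp [pt]

theorem pt_sub_div (τ y : ℝ) (z : ℂ) :
    (z - A.pt τ y) / A.d = (z - A.arc τ) / A.d - Complex.I * y := by
  have := A.d_ne
  rw [pt]
  field_simp
  ring

theorem dir_div_integrableOn {g : ℝ → ℂ} (hg : ContinuousOn g (Icc A.l A.r)) :
    IntegrableOn (fun s => A.dir s * g s) (Ioo A.l A.r) := by
  obtain ⟨M, hM0, hM⟩ := A.exists_bound_dir
  obtain ⟨C, hC⟩ := isCompact_Icc.exists_bound_of_continuousOn hg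
  refine Integrable.of_bound (C := M * C) (A.measurable_dir.aestronglyMeasurable.mul
    ((hg.mono Ioo_subset_Icc_self).aestronglyMeasurable measurableSet_Ioo)) ?_
  filter_upwards [ae_restrict_mem measurableSet_Ioo] with s hs
  rw [norm_mul]
  exact mul_le_mul (hM s (Ioo_subset_Icc_self hs)) (hC s (Ioo_subset_Icc_self hs)) (norm_nonneg _) hM0

/-- The Cauchy integral of a constant along the arc is a difference of logarithms, for every branch
that is holomorphic along the arc. -/
theorem integral_dir_div {z c : ℂ}
    (hs : ∀ s ∈ Icc A.l A.r, (A.arc s - z) / c ∈ Complex.slitPlane) :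
    ∫ s in Ioo A.l A.r, A.dir s / (A.arc s - z) =
      Complex.log ((A.arc A.r - z) / c) - Complex.log ((A.arc A.l - z) / c) := by
  have hne : ∀ s ∈ Icc A.l A.r, A.arc s - z ≠ 0 ∧ c ≠ 0 := by
    intro s h
    have := Complex.slitPlane_ne_zero (hs s h)
    exact ⟨fun h0 => this (by simp [h0]), fun h0 => this (by simp [h0])⟩
  have hint : IntegrableOn (fun s => A.dir s / (A.arc s - z)) (Ioo A.l A.r) := by
    simp_rw [div_eq_mul_inv]
    exact A.dir_div_integrableOn ((A.continuousOn_arc.sub continuousOn_const).inv₀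
      fun s h => (hne s h).1)
  have key := MeasureTheory.integral_eq_of_hasDerivAt_off_countable_of_le
    (fun s => Complex.log ((A.arc s - z) / c)) (fun s => A.dir s / (A.arc s - z)) A.l_lt_r.le
    (countable_singleton 0)
    (((A.continuousOn_arc.sub continuousOn_const).div_const c).clog hs)
    (fun s hs' => by
      have h1 := ((A.hasDerivAt_arc hs').sub_const z).div_const c
      have h2 := h1.clog_real (hs s (Ioo_subset_Icc_self hs'.1))
      refine h2.congr_deriv ?_
      obtain ⟨h3, h4⟩ := hne s (Ioo_subset_Icc_self hs'.1)
      field_simp)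
    ((intervalIntegrable_iff_integrableOn_Ioo_of_le A.l_lt_r.le).2 hint)
  rw [← key, intervalIntegral.integral_of_le A.l_lt_r.le, integral_Ioc_eq_integral_Ioo]

theorem mem_slitPlane_of_re_ne_zero {w c : ℂ} (h : (w / c).re ≠ 0) {σ : ℝ} (hσ : σ ≠ 0) :
    w / (-(σ * Complex.I * c)) ∈ Complex.slitPlane := by
  rw [Complex.mem_slitPlane_iff]
  right
  have hσ' : (σ : ℂ) ≠ 0 := by exact_mod_cast hσ
  have : w / (-(σ * Complex.I * c)) = ((σ⁻¹ : ℝ) : ℂ) * (Complex.I * (w / c)) := by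
    push_cast
    rcases eq_or_ne c 0 with rfl | hc
    · simp
    rw [div_eq_iff (by simp [hσ', hc])]
    field_simp
    rw [Complex.I_sq]; ring
  rw [this, Complex.im_ofReal_mul, Complex.I_mul_im]
  exact mul_ne_zero (inv_ne_zero hσ) h

theorem mem_slitPlane_of_side {σ : ℝ} {τ y : ℝ} (hτ : τ ∈ Icc A.l A.r) (hy : 0 < σ * y) :
    ∀ s ∈ Icc A.l A.r, (A.arc s - A.pt τ y) / (-(σ * Complex.I * A.d)) ∈ Complex.slitPlane := by
  intro s hs
  have hσ : σ ≠ 0 := fun h => by simp [h] at hy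
  have hσ' : (σ : ℂ) ≠ 0 := by exact_mod_cast hσ
  rcases eq_or_ne s τ with rfl | hne
  · rw [Complex.mem_slitPlane_iff]
    left
    have : (A.arc s - A.pt s y) / (-(σ * Complex.I * A.d)) = ((y / σ : ℝ) : ℂ) := by
      have := A.d_ne
      rw [pt]
      push_cast
      field_simp
      ring
    rw [this, Complex.ofReal_re]
    have : y / σ = σ * y / σ ^ 2 := by field_simp
    rw [this]
    positivity
  · refine mem_slitPlane_of_re_ne_zero ?_ hσ
    rw [pt_sub_div]
    have h1 := A.mul_abs_le_abs_re hτ hs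
    have h2 : 0 < A.κ * |s - τ| := mul_pos A.κ_pos (abs_pos.2 (sub_ne_zero.2 hne))
    have h3 := abs_pos.1 (h2.trans_le h1)
    simpa using h3

/-- The regularised Cauchy integral along the arc, where the value of the density at the point of
parameter `τ` is subtracted. -/
noncomputable def regInt (h : ℂ → ℂ) (τ : ℝ) (z : ℂ) : ℂ :=
  ∫ s in Ioo A.l A.r, (h (A.arc s) - h (A.arc τ)) * A.dir s / (A.arc s - z)

section holder

variable {h : ℂ → ℂ} {C : ℝ}

/-- The integrand of the regularised Cauchy integral is dominated by `1 / √|s - τ|`. -/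
theorem exists_bound_regInt (hC0 : 0 ≤ C)
    (hh : ∀ z ∈ J.carrier, ∀ w ∈ J.carrier, ‖h z - h w‖ ≤ C * Real.sqrt ‖z - w‖) :
    ∃ B, 0 ≤ B ∧ ∀ τ ∈ Icc A.l A.r, ∀ s ∈ Icc A.l A.r, ∀ z : ℂ,
      A.κ * ‖A.d‖ * |s - τ| ≤ ‖A.arc s - z‖ →
      ‖(h (A.arc s) - h (A.arc τ)) * A.dir s / (A.arc s - z)‖ ≤ B * sqrtKernel (A.r - A.l) (s - τ) := by
  obtain ⟨M, hM0, hM⟩ := A.exists_bound_dir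
  obtain ⟨L, hL0, hL⟩ := A.exists_lipschitz_arc
  have hκ := A.κd_pos
  refine ⟨C * Real.sqrt L * M / (A.κ * ‖A.d‖), by positivity, fun τ hτ s hs z hz => ?_⟩
  rw [sqrtKernel_apply (A.abs_sub_le hs hτ)]
  rcases eq_or_ne s τ with rfl | hne
  · simp
  have hpos : 0 < |s - τ| := abs_pos.2 (sub_ne_zero.2 hne)
  have h1 : ‖h (A.arc s) - h (A.arc τ)‖ ≤ C * (Real.sqrt L * Real.sqrt |s - τ|) := by
    refine (hh _ (A.arc_mem hs) _ (A.arc_mem hτ)).trans ?_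
    rw [← Real.sqrt_mul hL0]
    gcongr
    exact hL s hs τ hτ
  rw [norm_div, norm_mul]
  calc ‖h (A.arc s) - h (A.arc τ)‖ * ‖A.dir s‖ / ‖A.arc s - z‖
      ≤ C * (Real.sqrt L * Real.sqrt |s - τ|) * M / (A.κ * ‖A.d‖ * |s - τ|) := by
        gcongr
        exact hM s hs
    _ = C * Real.sqrt L * M / (A.κ * ‖A.d‖) * (Real.sqrt |s - τ| / |s - τ|) := by
        field_simp
    _ = C * Real.sqrt L * M / (A.κ * ‖A.d‖) * (Real.sqrt |s - τ|)⁻¹ := by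
        rw [Real.sqrt_div_self']
        simp

theorem continuousOn_of_holder
    (hh : ∀ z ∈ J.carrier, ∀ w ∈ J.carrier, ‖h z - h w‖ ≤ C * Real.sqrt ‖z - w‖) :
    ContinuousOn h J.carrier := by
  intro z hz
  rw [ContinuousWithinAt, tendsto_iff_norm_sub_tendsto_zero]
  have h1 : Tendsto (fun w => C * Real.sqrt ‖w - z‖) (𝓝[J.carrier] z) (𝓝 0) := by
    have : Continuous fun w : ℂ => C * Real.sqrt ‖w - z‖ := by fun_prop
    have h2 := this.tendsto z
    simp only [sub_self, norm_zero, Real.sqrt_zero, mul_zero] at h2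
    exact h2.mono_left nhdsWithin_le_nhds
  refine squeeze_zero' (Eventually.of_forall fun _ => norm_nonneg _) ?_ h1
  filter_upwards [self_mem_nhdsWithin] with w hw
  exact hh w hw z hz

theorem aestronglyMeasurable_regInt (hc : ContinuousOn h J.carrier) (τ : ℝ) (z : ℂ) :
    AEStronglyMeasurable (fun s => (h (A.arc s) - h (A.arc τ)) * A.dir s / (A.arc s - z))
      (volume.restrict (Ioo A.l A.r)) := by
  have h1 : ContinuousOn (fun s => h (A.arc s)) (Ioo A.l A.r) :=
    (hc.comp A.continuousOn_arc fun s hs => A.arc_mem hs).mono Ioo_subset_Icc_self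
  have h2 := h1.aestronglyMeasurable (μ := volume) measurableSet_Ioo
  have h3 := (A.continuousOn_arc.mono Ioo_subset_Icc_self).aestronglyMeasurable (μ := volume)
    measurableSet_Ioo
  exact (((h2.aemeasurable.sub_const _).mul A.measurable_dir.aemeasurable).div
    (h3.aemeasurable.sub_const z)).aestronglyMeasurable

theorem integrableOn_regInt (hC0 : 0 ≤ C)
    (hh : ∀ z ∈ J.carrier, ∀ w ∈ J.carrier, ‖h z - h w‖ ≤ C * Real.sqrt ‖z - w‖) {τ : ℝ}
    (hτ : τ ∈ Icc A.l A.r) {z : ℂ}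
    (hz : ∀ s ∈ Icc A.l A.r, A.κ * ‖A.d‖ * |s - τ| ≤ ‖A.arc s - z‖) :
    IntegrableOn (fun s => (h (A.arc s) - h (A.arc τ)) * A.dir s / (A.arc s - z)) (Ioo A.l A.r) := by
  obtain ⟨B, hB0, hB⟩ := A.exists_bound_regInt hC0 hh
  refine Integrable.mono' (((integrable_sqrtKernel (A.r - A.l)).comp_sub_right τ).const_mul
    B).integrableOn (A.aestronglyMeasurable_regInt (continuousOn_of_holder hh) τ z) ?_
  filter_upwards [ae_restrict_mem measurableSet_Ioo] with s hs
  have hs' := Ioo_subset_Icc_self hs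
  exact hB τ hτ s hs' z (hz s hs')

theorem exists_norm_regInt_le (hC0 : 0 ≤ C)
    (hh : ∀ z ∈ J.carrier, ∀ w ∈ J.carrier, ‖h z - h w‖ ≤ C * Real.sqrt ‖z - w‖) :
    ∃ B, ∀ τ ∈ Icc A.l A.r, ∀ z : ℂ,
      (∀ s ∈ Icc A.l A.r, A.κ * ‖A.d‖ * |s - τ| ≤ ‖A.arc s - z‖) → ‖A.regInt h τ z‖ ≤ B := by
  obtain ⟨B, hB0, hB⟩ := A.exists_bound_regInt hC0 hh
  refine ⟨B * ∫ u, sqrtKernel (A.r - A.l) u, fun τ hτ z hz => ?_⟩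
  have hint := ((integrable_sqrtKernel (A.r - A.l)).comp_sub_right τ).const_mul B
  refine (norm_integral_le_of_norm_le hint.integrableOn ?_).trans ?_
  · filter_upwards [ae_restrict_mem measurableSet_Ioo] with s hs
    have hs' := Ioo_subset_Icc_self hs
    exact hB τ hτ s hs' z (hz s hs')
  · refine (setIntegral_le_integral hint (Eventually.of_forall fun s =>
      mul_nonneg hB0 (sqrtKernel_nonneg _ _))).trans (le_of_eq ?_)
    rw [integral_const_mul, integral_sub_right_eq_self (fun u => sqrtKernel (A.r - A.l) u) τ]

/-- The regularised Cauchy integral is continuous up to the arc, from both sides and along it. -/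
theorem tendsto_regInt (hC0 : 0 ≤ C)
    (hh : ∀ z ∈ J.carrier, ∀ w ∈ J.carrier, ‖h z - h w‖ ≤ C * Real.sqrt ‖z - w‖) {τ₀ : ℝ}
    (hτ₀ : τ₀ ∈ Ioo A.l A.r) :
    Tendsto (fun q : ℝ × ℝ => A.regInt h q.1 (A.pt q.1 q.2)) (𝓝 (τ₀, 0))
      (𝓝 (A.regInt h τ₀ (A.arc τ₀))) := by
  obtain ⟨B, hB0, hB⟩ := A.exists_bound_regInt hC0 hh
  have hhc := continuousOn_of_holder hh
  -- the singularity is moved to the origin by a translation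
  set g : ℝ × ℝ → ℝ → ℂ := fun q s =>
    (Ioo A.l A.r).indicator
      (fun s => (h (A.arc s) - h (A.arc q.1)) * A.dir s / (A.arc s - A.pt q.1 q.2)) s with hg
  have hshift : ∀ q : ℝ × ℝ, A.regInt h q.1 (A.pt q.1 q.2) = ∫ u, g q (u + q.1) := by
    intro q
    rw [integral_add_right_eq_self (g q) q.1, hg, integral_indicator measurableSet_Ioo]
    rfl
  have h0 : A.regInt h τ₀ (A.arc τ₀) = ∫ u, g (τ₀, 0) (u + τ₀) := by
    rw [← hshift (τ₀, 0), A.pt_zero]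
  simp_rw [hshift]
  rw [h0]
  have hτI : ∀ᶠ q : ℝ × ℝ in 𝓝 (τ₀, 0), q.1 ∈ Ioo A.l A.r :=
    continuous_fst.continuousAt.eventually_mem (Ioo_mem_nhds hτ₀.1 hτ₀.2)
  refine tendsto_integral_filter_of_dominated_convergence
    (fun u => B * sqrtKernel (A.r - A.l) u) ?_ ?_ ((integrable_sqrtKernel _).const_mul B) ?_
  · refine Eventually.of_forall fun q => ?_
    have h1 : AEStronglyMeasurable (g q) volume :=
      (aestronglyMeasurable_indicator_iff measurableSet_Ioo).2
        (A.aestronglyMeasurable_regInt hhc q.1 _)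
    exact h1.comp_measurePreserving (measurePreserving_add_right volume q.1)
  · filter_upwards [hτI] with q hq
    refine Eventually.of_forall fun u => ?_
    simp only [hg]
    by_cases hu : u + q.1 ∈ Ioo A.l A.r
    · rw [indicator_of_mem hu]
      have := hB q.1 (Ioo_subset_Icc_self hq) _ (Ioo_subset_Icc_self hu) (A.pt q.1 q.2)
        (A.le_norm_arc_sub (Ioo_subset_Icc_self hq) (Ioo_subset_Icc_self hu) q.2)
      simpa using this
    · rw [indicator_of_notMem hu, norm_zero]
      exact mul_nonneg hB0 (sqrtKernel_nonneg _ _)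
  · have hbad : ∀ᵐ u : ℝ, u ∉ ({0, A.l - τ₀, A.r - τ₀, -τ₀} : Set ℝ) :=
      (Set.toFinite _).countable.ae_notMem _
    filter_upwards [hbad] with u hu
    simp only [mem_insert_iff, mem_singleton_iff, not_or] at hu
    obtain ⟨hu0, hul, hur, huτ⟩ := hu
    have hcont : Tendsto (fun q : ℝ × ℝ => u + q.1) (𝓝 (τ₀, 0)) (𝓝 (u + τ₀)) :=
      (continuous_const.add continuous_fst).tendsto (τ₀, (0 : ℝ))
    by_cases hmem : u + τ₀ ∈ Ioo A.l A.r
    · have hpar : u + τ₀ ∈ A.par := ⟨hmem, fun h => huτ (by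
        have : u + τ₀ = 0 := h
        linarith)⟩
      have hcarc : ∀ t ∈ Ioo A.l A.r, ContinuousAt A.arc t := fun t ht =>
        A.continuousOn_arc.continuousAt (Icc_mem_nhds ht.1 ht.2)
      have hcharc : ∀ t ∈ Ioo A.l A.r, ContinuousAt (fun s => h (A.arc s)) t := fun t ht =>
        (hhc.comp A.continuousOn_arc fun s hs => A.arc_mem hs).continuousAt
          (Icc_mem_nhds ht.1 ht.2)
      have hfst : Tendsto (fun q : ℝ × ℝ => q.1) (𝓝 (τ₀, 0)) (𝓝 τ₀) :=
        continuous_fst.tendsto (τ₀, (0 : ℝ))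
      have hpt : Tendsto (fun q : ℝ × ℝ => A.pt q.1 q.2) (𝓝 (τ₀, 0)) (𝓝 (A.pt τ₀ 0)) := by
        unfold pt
        refine ((hcarc τ₀ hτ₀).tendsto.comp hfst).add ?_
        have : Continuous fun q : ℝ × ℝ => Complex.I * (q.2 : ℂ) * A.d := by fun_prop
        exact this.tendsto (τ₀, (0 : ℝ))
      have hne : A.arc (u + τ₀) - A.pt τ₀ 0 ≠ 0 := by
        have h1 := A.le_norm_arc_sub_arc (Ioo_subset_Icc_self hτ₀) (Ioo_subset_Icc_self hmem)
        rw [add_sub_cancel_right] at h1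
        rw [A.pt_zero]
        exact norm_pos_iff.1 ((mul_pos A.κd_pos (abs_pos.2 hu0)).trans_le h1)
      have hlim : Tendsto (fun q : ℝ × ℝ => (h (A.arc (u + q.1)) - h (A.arc q.1)) *
          A.dir (u + q.1) / (A.arc (u + q.1) - A.pt q.1 q.2)) (𝓝 (τ₀, 0))
          (𝓝 ((h (A.arc (u + τ₀)) - h (A.arc τ₀)) * A.dir (u + τ₀) /
            (A.arc (u + τ₀) - A.pt τ₀ 0))) :=
        ((((hcharc _ hmem).tendsto.comp hcont).sub ((hcharc _ hτ₀).tendsto.comp hfst)).mul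
          ((A.continuousAt_dir hpar).tendsto.comp hcont)).div
          (((hcarc _ hmem).tendsto.comp hcont).sub hpt) hne
      have heq : g (τ₀, 0) (u + τ₀) = (h (A.arc (u + τ₀)) - h (A.arc τ₀)) * A.dir (u + τ₀) /
            (A.arc (u + τ₀) - A.pt τ₀ 0) := by
        simp only [hg]
        rw [indicator_of_mem hmem]
      rw [heq]
      refine hlim.congr' ?_
      filter_upwards [hcont.eventually (Ioo_mem_nhds hmem.1 hmem.2)] with q hq
      simp only [hg]
      rw [indicator_of_mem (show u + q.1 ∈ Ioo A.l A.r from hq)]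
    · have hout : u + τ₀ ∈ (Icc A.l A.r)ᶜ := by
        intro hcon
        rcases eq_or_lt_of_le hcon.1 with h1 | h1
        · exact hul (by linarith)
        rcases eq_or_lt_of_le hcon.2 with h2 | h2
        · exact hur (by linarith)
        exact hmem ⟨h1, h2⟩
      have heq : g (τ₀, 0) (u + τ₀) = 0 := indicator_of_notMem hmem _
      rw [heq]
      refine tendsto_const_nhds.congr' ?_
      filter_upwards [hcont.eventually (isClosed_Icc.isOpen_compl.mem_nhds hout)] with q hq
      exact (indicator_of_notMem (fun hq' => hq (Ioo_subset_Icc_self hq')) _).symm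

end holder

end LocalArc

end PiecewiseSmoothCurve

/-! ### Boundary values of Cauchy integrals -/

namespace PiecewiseSmoothCurve

open MeasureTheory

variable {J : PiecewiseSmoothCurve} {p : ℂ} {h : ℂ → ℂ} {C : ℝ}

/-- The Cauchy integral `∫_J h(w) / (w - z) dw`. -/
noncomputable def cauchy (J : PiecewiseSmoothCurve) (h : ℂ → ℂ) (z : ℂ) : ℂ :=
  J.contourIntegral fun w => h w / (w - z)

theorem cauchy_eq (h : ℂ → ℂ) (z : ℂ) : J.cauchy h z =
    ∫ t in Icc (0 : ℝ) J.pieces, h (J.toFun t) * deriv J.toFun t / (J.toFun t - z) := by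
  unfold cauchy contourIntegral
  refine integral_congr_ae (Eventually.of_forall fun t => ?_)
  simp only
  ring

theorem integrableOn_mul_deriv (hc : ContinuousOn h J.carrier) :
    IntegrableOn (fun t => h (J.toFun t) * deriv J.toFun t) (Icc (0 : ℝ) J.pieces) := by
  obtain ⟨M, hM0, hM⟩ := exists_bound_deriv J.smooth
  have hcont : ContinuousOn (fun t => h (J.toFun t)) (Icc (0 : ℝ) J.pieces) :=
    hc.comp continuousOn_toFun fun t ht => ⟨t, ht, rfl⟩
  obtain ⟨C, hC⟩ := isCompact_Icc.exists_bound_of_continuousOn hcont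
  refine Integrable.of_bound (C := C * M) ((hcont.aestronglyMeasurable measurableSet_Icc).mul
    (measurable_deriv J.toFun).aestronglyMeasurable) ?_
  filter_upwards [ae_restrict_mem measurableSet_Icc] with t ht
  rw [norm_mul]
  exact mul_le_mul (hC t ht) (hM t ht) (norm_nonneg _) ((norm_nonneg _).trans (hC t ht))

theorem exists_le_norm_sub {z : ℂ} (hz : z ∉ J.carrier) :
    ∃ δ > 0, ∀ t ∈ Icc (0 : ℝ) J.pieces, δ ≤ ‖J.toFun t - z‖ := by
  obtain ⟨δ, hδ, hsub⟩ := Metric.isOpen_iff.1 J.isClosed_carrier.isOpen_compl z hz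
  refine ⟨δ, hδ, fun t ht => ?_⟩
  by_contra! hlt
  exact hsub (show J.toFun t ∈ Metric.ball z δ by simpa [dist_eq_norm] using hlt) ⟨t, ht, rfl⟩

theorem differentiableOn_cauchy (hc : ContinuousOn h J.carrier) :
    DifferentiableOn ℂ (J.cauchy h) J.carrierᶜ := by
  intro z hz
  obtain ⟨δ, hδ, hle⟩ := exists_le_norm_sub hz
  have := differentiableAt_cauchyIntegral (integrableOn_mul_deriv hc) J.aestronglyMeasurable_toFun hδ
    ((ae_restrict_mem measurableSet_Icc).mono hle)
  rw [show J.cauchy h = _ from funext (cauchy_eq h)]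
  exact this.differentiableWithinAt

theorem cauchy_isBigO (hc : ContinuousOn h J.carrier) :
    J.cauchy h =O[Bornology.cobounded ℂ] (fun z => z⁻¹) := by
  obtain ⟨R, hR⟩ := J.isCompact_carrier.isBounded.exists_norm_le
  have hi := integrableOn_mul_deriv hc
  refine Asymptotics.IsBigO.of_bound
    ((∫ t in Icc (0 : ℝ) J.pieces, ‖h (J.toFun t) * deriv J.toFun t‖) * 2) ?_
  have h1 : ∀ᶠ z : ℂ in Bornology.cobounded ℂ, max 1 (2 * R) ≤ ‖z‖ :=
    tendsto_norm_cobounded_atTop.eventually_ge_atTop _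
  filter_upwards [h1] with z hz
  have hz1 : 1 ≤ ‖z‖ := (le_max_left _ _).trans hz
  have hz2 : 2 * R ≤ ‖z‖ := (le_max_right _ _).trans hz
  rw [cauchy_eq, norm_inv, mul_assoc, ← integral_mul_const]
  refine norm_integral_le_of_norm_le (hi.norm.mul_const _) ?_
  filter_upwards [ae_restrict_mem measurableSet_Icc] with t ht
  rw [norm_div, div_eq_mul_inv]
  refine mul_le_mul_of_nonneg_left ?_ (norm_nonneg _)
  have h2 := hR _ (show J.toFun t ∈ J.carrier from ⟨t, ht, rfl⟩)
  have h3 : ‖z‖ / 2 ≤ ‖J.toFun t - z‖ := by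
    have := norm_sub_norm_le z (J.toFun t)
    rw [norm_sub_rev] at this
    linarith
  calc ‖J.toFun t - z‖⁻¹ ≤ (‖z‖ / 2)⁻¹ := by gcongr
    _ = 2 * ‖z‖⁻¹ := by rw [inv_div, div_eq_mul_inv]

namespace LocalArc

variable (A : LocalArc J p)

/-- The part of the Cauchy integral that comes from the curve off the local arc. -/
noncomputable def restInt (h : ℂ → ℂ) (z : ℂ) : ℂ :=
  ∫ t in A.rest, h (J.toFun t) * deriv J.toFun t / (J.toFun t - z)

theorem continuousAt_restInt (hc : ContinuousOn h J.carrier) {z : ℂ} (hz : ‖z - p‖ < A.ρ / 2) :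
    ContinuousAt (A.restInt h) z := by
  refine (differentiableAt_cauchyIntegral (A.integrableOn_rest (integrableOn_mul_deriv hc))
    (J.aestronglyMeasurable_toFun.mono_measure (Measure.restrict_mono sdiff_subset le_rfl))
    (half_pos A.ρ_pos) ?_).continuousAt
  filter_upwards [ae_restrict_mem A.measurableSet_rest] with t ht
  exact A.far_rest' ht hz.le

/-- Decomposition of the Cauchy integral into a logarithm, a regularised integral and a
holomorphic part. -/
theorem cauchy_eq_add (hc : ContinuousOn h J.carrier) {z : ℂ} (hz : z ∉ J.carrier) (τ : ℝ) :
    J.cauchy h z = h (A.arc τ) * (∫ s in Ioo A.l A.r, A.dir s / (A.arc s - z)) + A.regInt h τ z +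
      A.restInt h z := by
  obtain ⟨δ, hδ, hle⟩ := exists_le_norm_sub hz
  have hi : IntegrableOn (fun t => h (J.toFun t) * deriv J.toFun t / (J.toFun t - z))
      (Icc (0 : ℝ) J.pieces) := by
    have hi := integrableOn_mul_deriv hc
    refine Integrable.mono' (hi.norm.div_const δ) ((hi.aestronglyMeasurable.aemeasurable.div
      (J.aestronglyMeasurable_toFun.aemeasurable.sub_const z)).aestronglyMeasurable) ?_
    filter_upwards [ae_restrict_mem measurableSet_Icc] with t ht
    rw [norm_div]
    have := hle t ht
    gcongr
  have h1 : IntegrableOn (fun s => A.dir s / (A.arc s - z)) (Ioo A.l A.r) := by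
    simp_rw [div_eq_mul_inv]
    refine A.dir_div_integrableOn ((A.continuousOn_arc.sub continuousOn_const).inv₀ fun s hs => ?_)
    exact norm_pos_iff.1 (hδ.trans_le (hle _ (A.π_mem hs)))
  have h2 := A.integrableOn_arc hi
  rw [cauchy_eq, A.integral_eq hi]
  refine congrArg (· + A.restInt h z) ?_
  rw [regInt, ← integral_const_mul, ← integral_add (h1.const_mul _)]
  · refine integral_congr_ae (Eventually.of_forall fun s => ?_)
    simp only [arc, dir]
    ring
  · refine (h2.sub (h1.const_mul (h (A.arc τ)))).congr (Eventually.of_forall fun s => ?_)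
    simp only [arc, dir, Pi.sub_apply]
    ring

/-- Points off the arc in the neighbourhood of `p` are not on the curve. -/
theorem pt_notMem {τ y : ℝ} (hτ : τ ∈ Icc A.l A.r) (hy : y ≠ 0) (hp : ‖A.pt τ y - p‖ < A.ρ) :
    A.pt τ y ∉ J.carrier := by
  intro hcon
  obtain ⟨s, hs, hs'⟩ := A.exists_arc_eq hcon hp
  have h1 := A.le_norm_arc_sub hτ hs y
  rw [← pt, ← hs', sub_self, norm_zero] at h1
  have h2 : |s - τ| ≤ 0 := nonpos_of_mul_nonpos_right h1 A.κd_pos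
  have h3 : s = τ := sub_eq_zero.1 (abs_eq_zero.1 (le_antisymm h2 (abs_nonneg _)))
  rw [h3, pt] at hs'
  have h4 : Complex.I * (y : ℂ) * A.d = 0 := by
    have := hs'
    linear_combination -this
  have := A.d_ne
  simp [hy, this] at h4

theorem exists_abs_le_norm_pt_sub : ∃ K, 0 < K ∧ ∀ τ ∈ Icc A.l A.r, ∀ τ₀ ∈ Icc A.l A.r, ∀ y : ℝ,
    |τ - τ₀| ≤ K * ‖A.pt τ y - A.arc τ₀‖ ∧ |y| ≤ K * ‖A.pt τ y - A.arc τ₀‖ := by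
  obtain ⟨L, hL0, hL⟩ := A.exists_lipschitz_arc
  have hκ := A.κd_pos
  have hd : 0 < ‖A.d‖ := norm_pos_iff.2 A.d_ne
  set k := (A.κ * ‖A.d‖)⁻¹ with hk
  have hk0 : 0 < k := inv_pos.2 hκ
  refine ⟨k + (1 + L * k) / ‖A.d‖, by positivity, fun τ hτ τ₀ hτ₀ y => ?_⟩
  have h1 := A.le_norm_arc_sub hτ hτ₀ y
  rw [← pt, norm_sub_rev, abs_sub_comm] at h1
  have h2 : |τ - τ₀| ≤ k * ‖A.pt τ y - A.arc τ₀‖ := by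
    rw [hk, inv_mul_eq_div, le_div_iff₀ hκ]
    linarith
  have hn := norm_nonneg (A.pt τ y - A.arc τ₀)
  have hn2 : 0 ≤ (1 + L * k) / ‖A.d‖ := by positivity
  have h3 : |y| * ‖A.d‖ = ‖A.pt τ y - A.arc τ‖ := by
    rw [pt, add_sub_cancel_left]
    simp
  have h4 := norm_sub_le_norm_sub_add_norm_sub (A.pt τ y) (A.arc τ₀) (A.arc τ)
  have h5 := hL τ₀ hτ₀ τ hτ
  rw [abs_sub_comm] at h5
  constructor
  · nlinarith
  · have h6 : |y| ≤ (1 + L * k) / ‖A.d‖ * ‖A.pt τ y - A.arc τ₀‖ := by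
      rw [div_mul_eq_mul_div, le_div_iff₀ hd, h3]
      have := mul_le_mul_of_nonneg_left h2 hL0
      nlinarith
    nlinarith

/-- The approach to the arc from one side, in coordinates along and across the arc. -/
theorem nhds_inf_side_le {σ τ₀ : ℝ} (hτ₀ : τ₀ ∈ Icc A.l A.r) :
    𝓝 (A.arc τ₀) ⊓ 𝓟 (A.side σ) ≤
      map (fun q : ℝ × ℝ => A.pt q.1 q.2)
        (𝓝 (τ₀, 0) ⊓ 𝓟 {q | q.1 ∈ Ioo A.l A.r ∧ 0 < σ * q.2}) := by
  obtain ⟨K, hK, hle⟩ := A.exists_abs_le_norm_pt_sub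
  intro S hS
  rw [mem_map, mem_inf_principal, Metric.mem_nhds_iff] at hS
  obtain ⟨ε, hε, hsub⟩ := hS
  rw [mem_inf_principal, Metric.mem_nhds_iff]
  refine ⟨ε / K, by positivity, ?_⟩
  rintro z hz ⟨τ, hτ, y, hy, rfl⟩
  obtain ⟨h1, h2⟩ := hle τ (Ioo_subset_Icc_self hτ) τ₀ hτ₀ y
  have h3 : ‖A.pt τ y - A.arc τ₀‖ * K < ε := by
    rw [← lt_div_iff₀ hK]
    simpa [dist_eq_norm] using hz
  have h4 : ((τ, y) : ℝ × ℝ) ∈ Metric.ball ((τ₀, 0) : ℝ × ℝ) ε := by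
    rw [Metric.mem_ball, Prod.dist_eq]
    simp only [Real.dist_eq, sub_zero]
    exact max_lt (by linarith) (by linarith)
  exact hsub h4 ⟨hτ, hy⟩

/-- The boundary value of the Cauchy integral at the point of parameter `τ` of the arc. -/
noncomputable def bval (h : ℂ → ℂ) (σ τ : ℝ) : ℂ :=
  h (A.arc τ) * (Complex.log ((A.arc A.r - A.arc τ) / (-(σ * Complex.I * A.d))) -
    Complex.log ((A.arc A.l - A.arc τ) / (-(σ * Complex.I * A.d)))) +
    A.regInt h τ (A.arc τ) + A.restInt h (A.arc τ)

theorem arc_right_div {τ : ℝ} (hτ : τ ∈ Ioo A.l A.r) : 0 < ((A.arc A.r - A.arc τ) / A.d).re :=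
  (mul_pos A.κ_pos (sub_pos.2 hτ.2)).trans_le
    (A.le_re_arc_sub (Ioo_subset_Icc_self hτ) (right_mem_Icc.2 A.l_lt_r.le) hτ.2.le)

theorem arc_left_div {τ : ℝ} (hτ : τ ∈ Ioo A.l A.r) : ((A.arc A.l - A.arc τ) / A.d).re < 0 := by
  have h1 := (mul_pos A.κ_pos (sub_pos.2 hτ.1)).trans_le
    (A.le_re_arc_sub (left_mem_Icc.2 A.l_lt_r.le) (Ioo_subset_Icc_self hτ) hτ.1.le)
  rw [← neg_sub, neg_div, Complex.neg_re] at h1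
  linarith

theorem continuousAt_arc {τ : ℝ} (hτ : τ ∈ Ioo A.l A.r) : ContinuousAt A.arc τ :=
  A.continuousOn_arc.continuousAt (Icc_mem_nhds hτ.1 hτ.2)

/-- The boundary value is the limit of the explicit expression for the Cauchy integral, jointly in
the coordinates along and across the arc. -/
theorem tendsto_bval_aux (hC0 : 0 ≤ C)
    (hh : ∀ z ∈ J.carrier, ∀ w ∈ J.carrier, ‖h z - h w‖ ≤ C * Real.sqrt ‖z - w‖) {σ τ₀ : ℝ}
    (hσ : σ ≠ 0) (hτ₀ : τ₀ ∈ Ioo A.l A.r) (hp : ‖A.arc τ₀ - p‖ < A.ρ / 2) :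
    Tendsto (fun q : ℝ × ℝ => h (A.arc q.1) *
      (Complex.log ((A.arc A.r - A.pt q.1 q.2) / (-(σ * Complex.I * A.d))) -
      Complex.log ((A.arc A.l - A.pt q.1 q.2) / (-(σ * Complex.I * A.d)))) +
      A.regInt h q.1 (A.pt q.1 q.2) + A.restInt h (A.pt q.1 q.2)) (𝓝 (τ₀, 0))
      (𝓝 (A.bval h σ τ₀)) := by
  have hhc := continuousOn_of_holder hh
  have hfst : Tendsto (fun q : ℝ × ℝ => q.1) (𝓝 (τ₀, 0)) (𝓝 τ₀) :=
    continuous_fst.tendsto (τ₀, (0 : ℝ))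
  have hpt : Tendsto (fun q : ℝ × ℝ => A.pt q.1 q.2) (𝓝 (τ₀, 0)) (𝓝 (A.arc τ₀)) := by
    rw [← A.pt_zero τ₀]
    unfold pt
    refine ((A.continuousAt_arc hτ₀).tendsto.comp hfst).add ?_
    have : Continuous fun q : ℝ × ℝ => Complex.I * (q.2 : ℂ) * A.d := by fun_prop
    exact this.tendsto (τ₀, (0 : ℝ))
  have hharc : ContinuousAt (fun s => h (A.arc s)) τ₀ :=
    (hhc.comp A.continuousOn_arc fun s hs => A.arc_mem hs).continuousAt
      (Icc_mem_nhds hτ₀.1 hτ₀.2)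
  have hlog : ∀ b : ℂ, ((b - A.arc τ₀) / A.d).re ≠ 0 →
      Tendsto (fun q : ℝ × ℝ => Complex.log ((b - A.pt q.1 q.2) / (-(σ * Complex.I * A.d))))
        (𝓝 (τ₀, 0)) (𝓝 (Complex.log ((b - A.arc τ₀) / (-(σ * Complex.I * A.d))))) := fun b hb =>
    ((tendsto_const_nhds.sub hpt).div_const _).clog (mem_slitPlane_of_re_ne_zero hb hσ)
  unfold bval
  exact (((hharc.tendsto.comp hfst).mul ((hlog _ (A.arc_right_div hτ₀).ne').sub
    (hlog _ (A.arc_left_div hτ₀).ne))).add (A.tendsto_regInt hC0 hh hτ₀)).add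
    ((A.continuousAt_restInt hhc hp).tendsto.comp hpt)

theorem tendsto_bval (hC0 : 0 ≤ C)
    (hh : ∀ z ∈ J.carrier, ∀ w ∈ J.carrier, ‖h z - h w‖ ≤ C * Real.sqrt ‖z - w‖) {σ τ₀ : ℝ}
    (hσ : σ ≠ 0) (hτ₀ : τ₀ ∈ Ioo A.l A.r) (hp : ‖A.arc τ₀ - p‖ < A.ρ / 2) :
    Tendsto (A.bval h σ) (𝓝 τ₀) (𝓝 (A.bval h σ τ₀)) := by
  have h1 : Tendsto (fun τ : ℝ => (τ, (0 : ℝ))) (𝓝 τ₀) (𝓝 (τ₀, 0)) :=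
    (Continuous.prodMk_left (0 : ℝ)).tendsto τ₀
  refine ((A.tendsto_bval_aux hC0 hh hσ hτ₀ hp).comp h1).congr fun τ => ?_
  simp only [Function.comp, pt_zero, bval]

theorem tendsto_cauchy (hC0 : 0 ≤ C)
    (hh : ∀ z ∈ J.carrier, ∀ w ∈ J.carrier, ‖h z - h w‖ ≤ C * Real.sqrt ‖z - w‖) {σ τ₀ : ℝ}
    (hσ : σ ≠ 0) (hτ₀ : τ₀ ∈ Ioo A.l A.r) (hp : ‖A.arc τ₀ - p‖ < A.ρ / 2) :
    Tendsto (J.cauchy h) (𝓝 (A.arc τ₀) ⊓ 𝓟 (A.side σ)) (𝓝 (A.bval h σ τ₀)) := by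
  refine Tendsto.mono_left ?_ (A.nhds_inf_side_le (Ioo_subset_Icc_self hτ₀))
  rw [tendsto_map'_iff]
  refine ((A.tendsto_bval_aux hC0 hh hσ hτ₀ hp).mono_left inf_le_left).congr' ?_
  have hpt : Tendsto (fun q : ℝ × ℝ => A.pt q.1 q.2) (𝓝 (τ₀, 0)) (𝓝 (A.arc τ₀)) := by
    rw [← A.pt_zero τ₀]
    unfold pt
    refine ((A.continuousAt_arc hτ₀).tendsto.comp (continuous_fst.tendsto (τ₀, (0 : ℝ)))).add ?_
    have : Continuous fun q : ℝ × ℝ => Complex.I * (q.2 : ℂ) * A.d := by fun_prop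
    exact this.tendsto (τ₀, (0 : ℝ))
  have hball : ∀ᶠ z in 𝓝 (A.arc τ₀), ‖z - p‖ < A.ρ / 2 :=
    (continuous_id.sub continuous_const).norm.continuousAt.eventually_lt continuousAt_const hp
  filter_upwards [(hpt.eventually hball).filter_mono inf_le_left,
    mem_inf_of_right (mem_principal_self _)] with q hq hq'
  have hq2 : q.2 ≠ 0 := fun h0 => by simp [h0] at hq'
  have hmem := Ioo_subset_Icc_self hq'.1
  have hnot := A.pt_notMem hmem hq2 (hq.trans (half_lt_self A.ρ_pos))
  simp only [Function.comp]
  rw [A.cauchy_eq_add (continuousOn_of_holder hh) hnot q.1,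
    A.integral_dir_div (A.mem_slitPlane_of_side hmem hq'.2)]

end LocalArc

theorem log_neg_of_im_pos {w : ℂ} (hw : 0 < w.im) :
    Complex.log (-w) = Complex.log w - Real.pi * Complex.I := by
  rw [Complex.log, Complex.log, norm_neg, Complex.arg_neg_eq_arg_sub_pi_of_im_pos hw]
  push_cast; ring

theorem log_neg_of_im_neg {w : ℂ} (hw : w.im < 0) :
    Complex.log (-w) = Complex.log w + Real.pi * Complex.I := by
  rw [Complex.log, Complex.log, norm_neg, Complex.arg_neg_eq_arg_add_pi_of_im_neg hw]
  push_cast; ring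

namespace LocalArc

variable (A : LocalArc J p)

theorem im_div_I_mul {a c : ℂ} (hc : c ≠ 0) : (a / (Complex.I * c)).im = -(a / c).re := by
  have : a / (Complex.I * c) = -(Complex.I * (a / c)) := by
    have := Complex.I_ne_zero
    field_simp
    rw [Complex.I_sq]; ring
  rw [this, Complex.neg_im, Complex.I_mul_im]

/-- The Sokhotski–Plemelj jump relation. -/
theorem bval_sub_bval {τ : ℝ} (hτ : τ ∈ Ioo A.l A.r) :
    A.bval h 1 τ - A.bval h (-1) τ = 2 * Real.pi * Complex.I * h (A.arc τ) := by
  have h1 := A.arc_right_div hτ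
  have h2 := A.arc_left_div hτ
  have e1 : ∀ a : ℂ, a / (-(((1 : ℝ) : ℂ) * Complex.I * A.d)) = -(a / (Complex.I * A.d)) := by
    intro a
    rw [Complex.ofReal_one, one_mul, div_neg]
  have e2 : ∀ a : ℂ, a / (-(((-1 : ℝ) : ℂ) * Complex.I * A.d)) = a / (Complex.I * A.d) := by
    intro a
    congr 1
    push_cast
    ring
  unfold bval
  rw [e1, e1, e2, e2, log_neg_of_im_neg (by rw [im_div_I_mul A.d_ne]; linarith),
    log_neg_of_im_pos (by rw [im_div_I_mul A.d_ne]; linarith)]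
  ring

/-- Where the density vanishes, the Cauchy integral has no jump and its boundary value is the
integral itself. -/
theorem bval_eq_cauchy {τ : ℝ} (h0 : h (A.arc τ) = 0) (σ : ℝ)
    (hi : IntegrableOn (fun t => h (J.toFun t) * deriv J.toFun t / (J.toFun t - A.arc τ))
      (Icc (0 : ℝ) J.pieces)) : A.bval h σ τ = J.cauchy h (A.arc τ) := by
  rw [cauchy_eq, A.integral_eq hi, bval, h0, regInt, restInt, zero_mul, zero_add, h0]
  simp only [sub_zero]
  rfl

/-- Points near an inner point of the arc lie vertically above or below the arc. -/
theorem eventually_exists_pt {τ₀ : ℝ} (hτ₀ : τ₀ ∈ Ioo A.l A.r) :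
    ∀ᶠ z in 𝓝 (A.arc τ₀), ∃ τ ∈ Ioo A.l A.r, ∃ y, z = A.pt τ y := by
  have hcont : ContinuousOn (fun s => (A.arc s / A.d).re) (Icc A.l A.r) :=
    Complex.continuous_re.comp_continuousOn (A.continuousOn_arc.div_const _)
  have hre : Continuous fun z : ℂ => (z / A.d).re := by
    have : Continuous fun z : ℂ => z / A.d := continuous_id.div_const _
    exact Complex.continuous_re.comp this
  have h1 := A.arc_right_div hτ₀
  have h2 := A.arc_left_div hτ₀
  rw [sub_div, Complex.sub_re] at h1 h2
  filter_upwards [hre.continuousAt.eventually_mem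
    (Ioo_mem_nhds (by linarith : (A.arc A.l / A.d).re < (A.arc τ₀ / A.d).re)
      (by linarith : (A.arc τ₀ / A.d).re < (A.arc A.r / A.d).re))] with z hz
  obtain ⟨τ, hτ, hτz⟩ := intermediate_value_Ioo A.l_lt_r.le hcont hz
  refine ⟨τ, hτ, ((z - A.arc τ) / A.d).im, ?_⟩
  have hd := A.d_ne
  have h3 : (z - A.arc τ) / A.d = Complex.I * (((z - A.arc τ) / A.d).im : ℂ) := by
    apply Complex.ext
    · simp only [sub_div, Complex.sub_re, Complex.mul_re, Complex.I_re, Complex.I_im,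
        Complex.ofReal_re, Complex.ofReal_im]
      simp only at hτz
      rw [hτz]; ring
    · simp
  rw [pt, ← h3, div_mul_cancel₀ _ hd]
  ring

/-- Near an inner point, the complement of the curve consists of the two sides of the arc. -/
theorem nhdsWithin_le_sup_side {τ₀ : ℝ} (hτ₀ : τ₀ ∈ Ioo A.l A.r) :
    𝓝[J.carrierᶜ] (A.arc τ₀) ≤
      (𝓝 (A.arc τ₀) ⊓ 𝓟 (A.side 1)) ⊔ (𝓝 (A.arc τ₀) ⊓ 𝓟 (A.side (-1))) := by
  rw [← inf_sup_left, sup_principal]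
  refine le_inf nhdsWithin_le_nhds (le_principal_iff.2 ?_)
  filter_upwards [(A.eventually_exists_pt hτ₀).filter_mono nhdsWithin_le_nhds,
    self_mem_nhdsWithin] with z ⟨τ, hτ, y, hz⟩ hzJ
  rcases lt_trichotomy y 0 with h | h | h
  · exact Or.inr ⟨τ, hτ, y, by linarith, hz⟩
  · rw [h, A.pt_zero] at hz
    exact absurd (hz ▸ A.arc_mem (Ioo_subset_Icc_self hτ)) hzJ
  · exact Or.inl ⟨τ, hτ, y, by linarith, hz⟩

theorem hasDerivAt_arc_of_smooth {i : ℕ} (hi : i < J.pieces) {t : ℝ} (ht : t ∈ Ioo (i : ℝ) (i + 1))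
    {τ₀ : ℝ} (hτ₀ : τ₀ ∈ Ioo A.l A.r) (h : A.arc τ₀ = J.toFun t) :
    HasDerivAt A.arc (deriv J.toFun t) τ₀ := by
  have hi' : (i : ℝ) + 1 ≤ J.pieces := by exact_mod_cast hi
  have hi0 : (0 : ℝ) ≤ i := Nat.cast_nonneg i
  have ht' : t ∈ Icc (0 : ℝ) J.pieces := ⟨by linarith [ht.1], by linarith [ht.2]⟩
  have huniq : ∀ s ∈ Icc (0 : ℝ) J.pieces, J.toFun s = J.toFun t → s = t := by
    intro s hs hst
    rcases lt_trichotomy s t with h1 | h1 | h1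
    · exact absurd (J.simple s hs t ht' h1 hst).2 (by linarith [ht.2])
    · exact h1
    · exact absurd (J.simple t ht' s hs h1 hst.symm).1 (by linarith [ht.1])
  rcases eq_or_ne τ₀ 0 with rfl | hne
  · rw [A.arc_zero] at h
    have hL := huniq _ A.memL (A.ptL.trans h)
    have hR := huniq _ A.memR (A.ptR.trans h)
    have hπ : A.arc = fun s => J.toFun (t + s) := by
      funext s
      unfold arc π
      rw [hL, hR, ite_self]
    have h1 : HasDerivAt J.toFun (deriv J.toFun t) (t + 0) := by
      rw [add_zero]; exact hasDerivAt_of_smooth J.smooth hi ht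
    have h2 := h1.scomp (0 : ℝ) ((hasDerivAt_id (0 : ℝ)).const_add t)
    rw [one_smul] at h2
    rw [hπ]
    exact h2
  · have h1 := huniq _ (A.π_mem (Ioo_subset_Icc_self hτ₀)) h
    have h2 := A.hasDerivAt_arc (t := τ₀) ⟨hτ₀, hne⟩
    rwa [dir, h1] at h2

theorem re_pos_of_hasDerivAt {τ₀ : ℝ} {D : ℂ} (hτ₀ : τ₀ ∈ Ioo A.l A.r)
    (hD : HasDerivAt A.arc D τ₀) : 0 < (D / A.d).re := by
  refine A.κ_pos.trans_le ?_
  have h1 : HasDerivAt (fun u => (A.arc u / A.d).re) (D / A.d).re τ₀ :=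
    Complex.reCLM.hasFDerivAt.comp_hasDerivAt τ₀ (hD.div_const A.d)
  refine ge_of_tendsto (h1.tendsto_slope.mono_left (nhdsWithin_mono τ₀ fun x hx => ne_of_gt hx :
    𝓝[>] τ₀ ≤ 𝓝[≠] τ₀)) ?_
  filter_upwards [Ioo_mem_nhdsGT hτ₀.2] with s hs
  have h2 := A.le_re_arc_sub (Ioo_subset_Icc_self hτ₀)
    (show s ∈ Icc A.l A.r from ⟨by linarith [hτ₀.1, hs.1], hs.2.le⟩) hs.1.le
  rw [slope_def_field, le_div_iff₀ (by linarith [hs.1])]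
  rw [sub_div, Complex.sub_re] at h2
  exact h2

/-- A non-tangential approach from one side of the curve ends up on that side of the arc. -/
theorem sideCone_le {i : ℕ} (hi : i < J.pieces) {t : ℝ} (ht : t ∈ Ioo (i : ℝ) (i + 1))
    {τ₀ : ℝ} (hτ₀ : τ₀ ∈ Ioo A.l A.r) (h : A.arc τ₀ = J.toFun t) {σ δ : ℝ} (hσ : |σ| = 1)
    (hδ : 0 < δ) : J.sideCone σ t δ ≤ 𝓝 (A.arc τ₀) ⊓ 𝓟 (A.side σ) := by
  have hder := A.hasDerivAt_arc_of_smooth hi ht hτ₀ h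
  set D := deriv J.toFun t with hD
  have hDd := A.re_pos_of_hasDerivAt hτ₀ hder
  have hd := A.d_ne
  have hD0 : D ≠ 0 := fun h0 => by simp [h0] at hDd
  obtain ⟨K, hK, hle⟩ := A.exists_abs_le_norm_pt_sub
  have hpos : 0 < (A.d / D).re := by
    have : A.d / D = (D / A.d)⁻¹ := by rw [inv_div]
    rw [this, Complex.inv_re]
    refine div_pos hDd (Complex.normSq_pos.2 (div_ne_zero hD0 hd))
  -- the deviation of the arc from its tangent is less than the opening of the cone
  have hsmall := hder.isLittleO.bound (c := δ * ‖D‖ / K) (by positivity)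
  rw [Metric.eventually_nhds_iff] at hsmall
  obtain ⟨ε, hε, hsmall⟩ := hsmall
  rw [sideCone, ← h]
  refine le_inf inf_le_left (le_principal_iff.2 ?_)
  filter_upwards [(A.eventually_exists_pt hτ₀).filter_mono inf_le_left,
    mem_inf_of_left (Metric.ball_mem_nhds (A.arc τ₀) (by positivity : 0 < ε / K)),
    mem_inf_of_right (mem_principal_self _)] with z ⟨τ, hτ, y, hz⟩ hball hcone
  refine ⟨τ, hτ, y, ?_, hz⟩
  obtain ⟨h1, -⟩ := hle τ (Ioo_subset_Icc_self hτ) τ₀ (Ioo_subset_Icc_self hτ₀) y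
  rw [← hz] at h1
  have h2 : ‖z - A.arc τ₀‖ * K < ε := by
    rw [← lt_div_iff₀ hK]; simpa [dist_eq_norm] using hball
  have h3 := hsmall (y := τ) (by rw [Real.dist_eq]; linarith)
  have h4 : (z - A.arc τ₀) / D = (A.arc τ - A.arc τ₀ - (τ - τ₀) • D) / D + ((τ - τ₀ : ℝ) : ℂ) +
      ((y : ℝ) : ℂ) * (Complex.I * (A.d / D)) := by
    rw [hz, pt, Complex.real_smul]
    field_simp
    ring
  have h5 : ((z - A.arc τ₀) / D).im =
      ((A.arc τ - A.arc τ₀ - (τ - τ₀) • D) / D).im + y * (A.d / D).re := by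
    rw [h4]
    simp only [Complex.add_im, Complex.ofReal_im, add_zero, Complex.im_ofReal_mul, Complex.I_mul_im]
  have h6 : |((A.arc τ - A.arc τ₀ - (τ - τ₀) • D) / D).im| ≤ δ * ‖z - A.arc τ₀‖ := by
    refine (Complex.abs_im_le_norm _).trans ?_
    rw [norm_div, div_le_iff₀ (norm_pos_iff.2 hD0)]
    refine h3.trans ?_
    rw [Real.norm_eq_abs]
    calc δ * ‖D‖ / K * |τ - τ₀| ≤ δ * ‖D‖ / K * (K * ‖z - A.arc τ₀‖) := by gcongr
      _ = δ * ‖z - A.arc τ₀‖ * ‖D‖ := by field_simp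
  have h7 : δ * ‖z - A.arc τ₀‖ < σ * ((z - A.arc τ₀) / D).im := hcone
  rw [h5] at h7
  have h8 : σ * ((A.arc τ - A.arc τ₀ - (τ - τ₀) • D) / D).im ≤ δ * ‖z - A.arc τ₀‖ := by
    refine (le_abs_self _).trans ?_
    rw [abs_mul, hσ, one_mul]
    exact h6
  have h9 : 0 < σ * y * (A.d / D).re := by nlinarith
  exact pos_of_mul_pos_left h9 hpos.le

end LocalArc

theorem deriv_ne_zero {i : ℕ} (hi : i < J.pieces) {t : ℝ} (ht : t ∈ Ioo (i : ℝ) (i + 1)) :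
    deriv J.toFun t ≠ 0 := by
  rw [deriv_eq_of_mem_Ioo ht]
  exact J.regular i hi t (Ioo_subset_Icc_self ht)

/-- Narrow approach regions are not empty, so that boundary values are unique. -/
theorem exists_sideCone_neBot {i : ℕ} (hi : i < J.pieces) {t : ℝ} (ht : t ∈ Ioo (i : ℝ) (i + 1))
    {σ : ℝ} (hσ : |σ| = 1) : ∃ δ > 0, (J.sideCone σ t δ).NeBot := by
  have hD := deriv_ne_zero hi ht
  set D := deriv J.toFun t with hDdef
  have hDn : 0 < ‖D‖ := norm_pos_iff.2 hD
  have hσ2 : σ * σ = 1 := by rw [← abs_mul_abs_self, hσ, one_mul]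
  refine ⟨(2 * ‖D‖)⁻¹, by positivity, ?_⟩
  have ht : Tendsto (fun s : ℝ => J.toFun t + s * (σ * Complex.I * D)) (𝓝[>] 0)
      (J.sideCone σ t (2 * ‖D‖)⁻¹) := by
    rw [sideCone]
    refine tendsto_inf.2 ⟨?_, tendsto_principal.2 ?_⟩
    · have : Continuous fun s : ℝ => J.toFun t + s * (σ * Complex.I * D) := by fun_prop
      have h2 := this.tendsto 0
      simp only [Complex.ofReal_zero, zero_mul, add_zero] at h2
      exact h2.mono_left nhdsWithin_le_nhds
    · filter_upwards [self_mem_nhdsWithin] with s hs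
      have hs' : 0 < s := hs
      simp only [add_sub_cancel_left]
      rw [← hDdef]
      have h1 : (s : ℂ) * (σ * Complex.I * D) / D = ((s * σ : ℝ) : ℂ) * Complex.I := by
        push_cast; field_simp
      rw [h1, Complex.im_ofReal_mul, Complex.I_im, mul_one, norm_mul, norm_mul, norm_mul,
        Complex.norm_real, Complex.norm_real, Complex.norm_I, Real.norm_eq_abs, Real.norm_eq_abs, hσ,
        abs_of_pos hs']
      have h2 : (2 * ‖D‖)⁻¹ * (s * (1 * 1 * ‖D‖)) = s / 2 := by field_simp
      rw [h2]
      nlinarith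
  exact ht.neBot

/-- A choice of a local arc at every point of the curve. -/
noncomputable def localArc {p : ℂ} (hp : p ∈ J.carrier) : LocalArc J p :=
  Classical.choice (nonempty_localArc hp)

open Classical in
/-- The boundary values of the Cauchy integral of `h` on the side `σ` of the curve. -/
noncomputable def cauchyBdry (J : PiecewiseSmoothCurve) (h : ℂ → ℂ) (σ : ℝ) (q : ℂ) : ℂ :=
  if hq : q ∈ J.carrier then (localArc hq).bval h σ 0 else 0

theorem interior_subset : J.interior ⊆ J.carrier := sdiff_subset

theorem LocalArc.zero_mem_Ioo (A : LocalArc J p) (hp : p ∈ J.interior) : (0 : ℝ) ∈ Ioo A.l A.r :=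
  A.two_sided hp

theorem toFun_mem_interior {i : ℕ} (hi : i < J.pieces) {t : ℝ} (ht : t ∈ Ioo (i : ℝ) (i + 1)) :
    J.toFun t ∈ J.interior := by
  have hi' : (i : ℝ) + 1 ≤ J.pieces := by exact_mod_cast hi
  have hi0 : (0 : ℝ) ≤ i := Nat.cast_nonneg i
  have hn := J.one_le_pieces
  have ht' : t ∈ Icc (0 : ℝ) J.pieces := ⟨by linarith [ht.1], by linarith [ht.2]⟩
  refine ⟨⟨t, ht', rfl⟩, ?_⟩
  rintro ⟨-, h | h⟩
  · exact absurd (J.simple 0 ⟨le_rfl, by linarith⟩ t ht' (by linarith [ht.1]) h.symm).2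
      (by linarith [ht.2])
  · exact absurd (J.simple t ht' J.pieces ⟨by linarith, le_rfl⟩ (by linarith [ht.2]) h).1
      (by linarith [ht.1])

section boundary

variable (hC0 : 0 ≤ C)
  (hh : ∀ z ∈ J.carrier, ∀ w ∈ J.carrier, ‖h z - h w‖ ≤ C * Real.sqrt ‖z - w‖)
include hC0 hh

theorem tendsto_cauchy_sideCone {σ : ℝ} (hσ : |σ| = 1) {i : ℕ} (hi : i < J.pieces) {t : ℝ}
    (ht : t ∈ Ioo (i : ℝ) (i + 1)) {δ : ℝ} (hδ : 0 < δ) :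
    Tendsto (J.cauchy h) (J.sideCone σ t δ) (𝓝 (J.cauchyBdry h σ (J.toFun t))) := by
  have hint := toFun_mem_interior hi ht
  have hmem := interior_subset hint
  rw [cauchyBdry, dif_pos hmem]
  set A := localArc hmem
  have h0 := A.zero_mem_Ioo hint
  have hρ := A.ρ_pos
  have h1 := A.tendsto_cauchy hC0 hh (σ := σ) (fun h => by simp [h] at hσ) h0
    (by rw [A.arc_zero, sub_self, norm_zero]; linarith)
  exact h1.mono_left (A.sideCone_le hi ht h0 A.arc_zero hσ hδ)

/-- The boundary values do not depend on the local arc that is used to compute them. -/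
theorem cauchyBdry_arc (A : LocalArc J p) {σ : ℝ} (hσ : |σ| = 1) {τ : ℝ} (hτ : τ ∈ A.par)
    (hp : ‖A.arc τ - p‖ < A.ρ / 2) : J.cauchyBdry h σ (A.arc τ) = A.bval h σ τ := by
  obtain ⟨i, hi, ht⟩ := A.piece_of_par hτ
  obtain ⟨δ, hδ, hne⟩ := exists_sideCone_neBot hi ht hσ
  have h1 := tendsto_cauchy_sideCone hC0 hh hσ hi ht hδ
  have h2 := (A.tendsto_cauchy hC0 hh (σ := σ) (fun h => by simp [h] at hσ) hτ.1 hp).mono_left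
    (A.sideCone_le hi ht hτ.1 rfl hσ hδ)
  exact tendsto_nhds_unique h1 h2

theorem continuousOn_cauchyBdry {σ : ℝ} (hσ : |σ| = 1) :
    ContinuousOn (J.cauchyBdry h σ) J.interior := by
  intro q hq
  have hmem := interior_subset hq
  set A := localArc hmem with hA
  have h0 := A.zero_mem_Ioo hq
  have hρ := A.ρ_pos
  have hq0 : J.cauchyBdry h σ q = A.bval h σ 0 := by rw [cauchyBdry, dif_pos hmem]
  have hlim := A.tendsto_bval hC0 hh (σ := σ) (fun h => by simp [h] at hσ) h0
    (by rw [A.arc_zero, sub_self, norm_zero]; linarith)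
  obtain ⟨K, hK, hle⟩ := A.exists_abs_le_norm_pt_sub
  rw [ContinuousWithinAt, hq0]
  intro S hS
  have hS' := hlim hS
  rw [mem_map, Metric.mem_nhds_iff] at hS'
  obtain ⟨ε, hε, hsub⟩ := hS'
  obtain ⟨ε', hε', hsub'⟩ := Metric.mem_nhds_iff.1 (Ioo_mem_nhds h0.1 h0.2)
  rw [mem_map]
  filter_upwards [self_mem_nhdsWithin, mem_nhdsWithin_of_mem_nhds (Metric.ball_mem_nhds q
    (by positivity : 0 < min (A.ρ / 2) (min (ε / K) (ε' / K))))] with z hz hzq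
  rw [Metric.mem_ball, dist_eq_norm, lt_min_iff, lt_min_iff] at hzq
  obtain ⟨h1, h2, h3⟩ := hzq
  obtain ⟨τ, hτ, rfl⟩ := A.exists_arc_eq (interior_subset hz) (h1.trans (half_lt_self hρ))
  have h4 := (hle τ hτ 0 A.zero_mem 0).1
  rw [A.pt_zero, A.arc_zero, sub_zero] at h4
  rw [lt_div_iff₀ hK] at h2 h3
  have h5 : τ ∈ Ioo A.l A.r := hsub' (by
    rw [Metric.mem_ball, Real.dist_eq, sub_zero]; linarith)
  have h6 : A.bval h σ τ ∈ S := hsub (by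
    rw [Metric.mem_ball, Real.dist_eq, sub_zero]; linarith)
  rw [mem_preimage]
  rcases eq_or_ne τ 0 with h7 | h7
  · rw [h7, A.arc_zero, hq0, ← h7]
    exact h6
  · rw [cauchyBdry_arc hC0 hh A hσ ⟨h5, h7⟩ h1]
    exact h6

omit hC0 hh in
theorem cauchyBdry_sub {q : ℂ} (hq : q ∈ J.interior) :
    J.cauchyBdry h 1 q - J.cauchyBdry h (-1) q = 2 * Real.pi * Complex.I * h q := by
  have hmem := interior_subset hq
  rw [cauchyBdry, cauchyBdry, dif_pos hmem, dif_pos hmem,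
    (localArc hmem).bval_sub_bval ((localArc hmem).zero_mem_Ioo hq), LocalArc.arc_zero]

omit hC0 hh in
theorem cauchyBdry_eq_cauchy {q : ℂ} (hq : q ∈ J.interior) (h0 : h q = 0) (σ : ℝ)
    (hi : IntegrableOn (fun t => h (J.toFun t) * deriv J.toFun t / (J.toFun t - q))
      (Icc (0 : ℝ) J.pieces)) : J.cauchyBdry h σ q = J.cauchy h q := by
  have hmem := interior_subset hq
  have h1 := (localArc hmem).bval_eq_cauchy (τ := 0) (h := h) (by rwa [LocalArc.arc_zero]) σ
    (by rwa [LocalArc.arc_zero])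
  rw [cauchyBdry, dif_pos hmem, h1, LocalArc.arc_zero]

theorem exists_cauchy_bound {q : ℂ} (hq : q ∈ J.interior) :
    ∃ M : ℝ, ∀ᶠ z in 𝓝[J.carrierᶜ] q, ‖J.cauchy h z‖ ≤ M := by
  have hmem := interior_subset hq
  set A := localArc hmem
  have h0 := A.zero_mem_Ioo hq
  have hρ := A.ρ_pos
  have hb : ∀ σ : ℝ, σ ≠ 0 → ∀ᶠ z in 𝓝 (A.arc 0) ⊓ 𝓟 (A.side σ),
      ‖J.cauchy h z‖ ≤ ‖A.bval h σ 0‖ + 1 := fun σ hσ =>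
    ((A.tendsto_cauchy hC0 hh hσ h0 (by rw [A.arc_zero, sub_self, norm_zero]; linarith)).norm
      ).eventually_le_const (by linarith)
  refine ⟨max (‖A.bval h 1 0‖ + 1) (‖A.bval h (-1) 0‖ + 1), ?_⟩
  have hle := A.nhdsWithin_le_sup_side h0
  rw [A.arc_zero] at hle
  refine Filter.Eventually.filter_mono hle (eventually_sup.2 ⟨?_, ?_⟩)
  · have := hb 1 one_ne_zero
    rw [A.arc_zero] at this
    exact this.mono fun z hz => hz.trans (le_max_left _ _)
  · have := hb (-1) (by norm_num)
    rw [A.arc_zero] at this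
    exact this.mono fun z hz => hz.trans (le_max_right _ _)

end boundary

end PiecewiseSmoothCurve

/-! ### Logarithmic growth of Cauchy integrals at the end points -/

namespace PiecewiseSmoothCurve

open MeasureTheory

variable {J : PiecewiseSmoothCurve} {p : ℂ} {h : ℂ → ℂ} {C : ℝ}

theorem norm_log_le (w : ℂ) : ‖Complex.log w‖ ≤ |Real.log ‖w‖| + Real.pi := by
  have h1 := Complex.norm_le_abs_re_add_abs_im (Complex.log w)
  rw [Complex.log_re, Complex.log_im] at h1
  linarith [Complex.abs_arg_le_pi w]

namespace LocalArc

variable (A : LocalArc J p)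

theorem eventually_abs_log_le (q c : ℂ) (hc : c ≠ 0) :
    ∃ K, ∀ᶠ z in 𝓝[≠] p, ∀ c' : ℂ, ‖c'‖ = ‖c‖ →
      ‖Complex.log ((q - z) / c')‖ ≤ K + |Real.log ‖z - p‖| := by
  have hcn : ‖c‖ ≠ 0 := norm_ne_zero_iff.2 hc
  have key : ∀ z, q - z ≠ 0 → ∀ c' : ℂ, ‖c'‖ = ‖c‖ → ‖Complex.log ((q - z) / c')‖ ≤
      |Real.log ‖q - z‖| + |Real.log ‖c‖| + Real.pi := by
    intro z hz c' hc'
    refine (norm_log_le _).trans ?_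
    rw [norm_div, hc', Real.log_div (norm_ne_zero_iff.2 hz) hcn]
    have := abs_sub (Real.log ‖q - z‖) (Real.log ‖c‖)
    linarith
  by_cases hqp : q = p
  · refine ⟨|Real.log ‖c‖| + Real.pi, ?_⟩
    filter_upwards [self_mem_nhdsWithin] with z hz c' hc'
    have h1 := key z (by rw [hqp]; exact sub_ne_zero.2 (Ne.symm hz)) c' hc'
    rw [hqp, norm_sub_rev p z] at h1
    rw [hqp]
    linarith
  · have hqp' : q - p ≠ 0 := sub_ne_zero.2 hqp
    refine ⟨|Real.log ‖q - p‖| + 1 + |Real.log ‖c‖| + Real.pi, ?_⟩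
    have hcont : ContinuousAt (fun z => |Real.log ‖q - z‖|) p := by
      have hcq : ContinuousAt (fun z => ‖q - z‖) p := by fun_prop
      exact (hcq.log (norm_ne_zero_iff.2 hqp')).abs
    filter_upwards [(hcont.eventually_lt continuousAt_const
      (lt_add_one |Real.log ‖q - p‖|)).filter_mono nhdsWithin_le_nhds,
      (continuousAt_const.sub continuousAt_id |>.eventually_ne hqp').filter_mono
        nhdsWithin_le_nhds] with z hz1 hz2 c' hc'
    have h1 := key z hz2 c' hc'
    have := abs_nonneg (Real.log ‖z - p‖)
    linarith

/-- Every point near `p` and off the curve has a foot point on the arc, and a branch of the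
logarithm that is holomorphic along the arc as seen from the point. -/
theorem eventually_exists_branch : ∀ᶠ z in 𝓝[J.carrierᶜ] p, ∃ τ ∈ Icc A.l A.r, ∃ c : ℂ,
    ‖c‖ = ‖A.d‖ ∧ (∀ s ∈ Icc A.l A.r, (A.arc s - z) / c ∈ Complex.slitPlane) ∧
    ∀ s ∈ Icc A.l A.r, A.κ * ‖A.d‖ * |s - τ| ≤ ‖A.arc s - z‖ := by
  have hd := A.d_ne
  have hdn : 0 < ‖A.d‖ := norm_pos_iff.2 hd
  have hcont : ContinuousOn (fun s => ((A.arc s - p) / A.d).re) (Icc A.l A.r) :=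
    Complex.continuous_re.comp_continuousOn ((A.continuousOn_arc.sub continuousOn_const).div_const _)
  have hre : Continuous fun z : ℂ => ((z - p) / A.d).re := by
    have : Continuous fun z : ℂ => (z - p) / A.d := (continuous_id.sub continuous_const).div_const _
    exact Complex.continuous_re.comp this
  have hrep : ((p - p) / A.d).re = 0 := by simp
  have hle : ∀ s ∈ Icc A.l A.r, ∀ t ∈ Icc A.l A.r, s ≤ t →
      A.κ * (t - s) ≤ ((A.arc t - p) / A.d).re - ((A.arc s - p) / A.d).re := by
    intro s hs t ht hst
    refine (A.le_re_arc_sub hs ht hst).trans (le_of_eq ?_)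
    rw [← Complex.sub_re, ← sub_div, sub_sub_sub_cancel_right]
  have hlmem := left_mem_Icc.2 A.l_lt_r.le
  have hrmem := right_mem_Icc.2 A.l_lt_r.le
  have h0 : ((A.arc 0 - p) / A.d).re = 0 := by rw [A.arc_zero, hrep]
  have hR : ∀ᶠ z in 𝓝 p, ((z - p) / A.d).re ≤ ((A.arc A.r - p) / A.d).re ∨ A.r = 0 := by
    rcases eq_or_lt_of_le A.r_nonneg with h | h
    · exact Eventually.of_forall fun _ => Or.inr h.symm
    · have h1 := hle 0 A.zero_mem A.r hrmem A.r_nonneg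
      rw [h0, sub_zero, sub_zero] at h1
      have h2 := (mul_pos A.κ_pos h).trans_le h1
      filter_upwards [hre.continuousAt.eventually_lt continuousAt_const (by rwa [hrep])]
        with z hz using Or.inl hz.le
  have hL : ∀ᶠ z in 𝓝 p, ((A.arc A.l - p) / A.d).re ≤ ((z - p) / A.d).re ∨ A.l = 0 := by
    rcases eq_or_lt_of_le A.l_nonpos with h | h
    · exact Eventually.of_forall fun _ => Or.inr h
    · have h1 := hle A.l hlmem 0 A.zero_mem A.l_nonpos
      rw [h0] at h1
      have h2 := mul_pos A.κ_pos (neg_pos.2 h)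
      filter_upwards [continuousAt_const.eventually_lt hre.continuousAt
        (show ((A.arc A.l - p) / A.d).re < _ by rw [hrep]; linarith)] with z hz using Or.inl hz.le
  have hcomp : ∀ s z, ((A.arc s - z) / A.d).re =
      ((A.arc s - p) / A.d).re - ((z - p) / A.d).re := by
    intro s z
    rw [← Complex.sub_re, ← sub_div, sub_sub_sub_cancel_right]
  have hdist : ∀ s z (x : ℝ), x ≤ |((A.arc s - z) / A.d).re| → x * ‖A.d‖ ≤ ‖A.arc s - z‖ := by
    intro s z x hx
    have := hx.trans (Complex.abs_re_le_norm _)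
    rwa [norm_div, le_div_iff₀ hdn] at this
  filter_upwards [hR.filter_mono nhdsWithin_le_nhds, hL.filter_mono nhdsWithin_le_nhds,
    self_mem_nhdsWithin] with z hzR hzL hzJ
  by_cases hr : ((z - p) / A.d).re ≤ ((A.arc A.r - p) / A.d).re
  · by_cases hl : ((A.arc A.l - p) / A.d).re ≤ ((z - p) / A.d).re
    · -- the foot point lies on the arc
      obtain ⟨τ, hτ, hτz⟩ := intermediate_value_Icc A.l_lt_r.le hcont ⟨hl, hr⟩
      obtain ⟨y, hy⟩ : ∃ y : ℝ, z = A.pt τ y := by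
        refine ⟨((z - A.arc τ) / A.d).im, ?_⟩
        have h3 : (z - A.arc τ) / A.d = Complex.I * (((z - A.arc τ) / A.d).im : ℂ) := by
          apply Complex.ext
          · have h4 := hcomp τ z
            simp only at hτz
            rw [hτz, sub_self, ← neg_sub, neg_div, Complex.neg_re, neg_eq_zero] at h4
            rw [h4]
            simp
          · simp
        rw [pt, ← h3, div_mul_cancel₀ _ hd]
        ring
      have hy0 : y ≠ 0 := by
        rintro rfl
        rw [A.pt_zero] at hy
        exact hzJ (hy ▸ A.arc_mem hτ)
      have hfin : ∀ s ∈ Icc A.l A.r, A.κ * ‖A.d‖ * |s - τ| ≤ ‖A.arc s - z‖ := fun s hs => by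
        rw [hy]; exact A.le_norm_arc_sub hτ hs y
      rcases lt_or_gt_of_ne hy0 with h | h
      · refine ⟨τ, hτ, -(((-1 : ℝ) : ℂ) * Complex.I * A.d), by simp, ?_, hfin⟩
        rw [hy]
        exact A.mem_slitPlane_of_side hτ (by linarith)
      · refine ⟨τ, hτ, -(((1 : ℝ) : ℂ) * Complex.I * A.d), by simp, ?_, hfin⟩
        rw [hy]
        exact A.mem_slitPlane_of_side hτ (by linarith)
    · have hl0 := hzL.resolve_left hl
      rw [hl0, h0] at hl
      refine ⟨0, A.zero_mem, A.d, rfl, fun s hs => ?_, fun s hs => ?_⟩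
      · rw [Complex.mem_slitPlane_iff]
        left
        rw [hcomp]
        have := hle 0 A.zero_mem s hs (hl0 ▸ hs.1)
        rw [h0] at this
        have h2 := mul_nonneg A.κ_pos.le (sub_nonneg.2 (hl0 ▸ hs.1 : 0 ≤ s))
        linarith
      · rw [sub_zero, mul_assoc, mul_comm ‖A.d‖, ← mul_assoc]
        refine hdist s z _ ?_
        have := hle 0 A.zero_mem s hs (hl0 ▸ hs.1)
        rw [h0] at this
        rw [hcomp, abs_of_nonneg (hl0 ▸ hs.1 : 0 ≤ s)]
        exact le_trans (by linarith) (le_abs_self _)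
  · have hr0 := hzR.resolve_left hr
    rw [hr0, h0] at hr
    refine ⟨0, A.zero_mem, -A.d, by simp, fun s hs => ?_, fun s hs => ?_⟩
    · rw [Complex.mem_slitPlane_iff]
      left
      rw [div_neg, Complex.neg_re, hcomp]
      have := hle s hs 0 A.zero_mem (hr0 ▸ hs.2)
      rw [h0] at this
      have h2 := mul_nonneg A.κ_pos.le (sub_nonneg.2 (hr0 ▸ hs.2 : s ≤ 0))
      linarith
    · rw [sub_zero, mul_assoc, mul_comm ‖A.d‖, ← mul_assoc]
      refine hdist s z _ ?_
      have := hle s hs 0 A.zero_mem (hr0 ▸ hs.2)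
      rw [h0] at this
      rw [hcomp, abs_of_nonpos (hr0 ▸ hs.2 : s ≤ 0)]
      exact le_trans (by linarith) (neg_le_abs _)

end LocalArc

/-- The logarithm of the distance to a point is large near the point. -/
theorem eventually_one_le_abs_log (p : ℂ) : ∀ᶠ z in 𝓝[≠] p, 1 ≤ |Real.log ‖z - p‖| := by
  have h1 : Tendsto (fun z : ℂ => ‖z - p‖) (𝓝[≠] p) (𝓝[>] 0) := by
    refine tendsto_nhdsWithin_iff.2 ⟨?_, ?_⟩
    · have : Continuous fun z : ℂ => ‖z - p‖ := by fun_prop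
      have h2 := this.tendsto p
      simp only [sub_self, norm_zero] at h2
      exact h2.mono_left nhdsWithin_le_nhds
    · filter_upwards [self_mem_nhdsWithin] with z hz
      exact norm_pos_iff.2 (sub_ne_zero.2 hz)
  have h2 := (tendsto_abs_atBot_atTop.comp (Real.tendsto_log_nhdsGT_zero.comp h1))
  exact h2.eventually_ge_atTop 1

theorem cauchy_isBigO_log (hC0 : 0 ≤ C)
    (hh : ∀ z ∈ J.carrier, ∀ w ∈ J.carrier, ‖h z - h w‖ ≤ C * Real.sqrt ‖z - w‖)
    (hp : p ∈ J.carrier) :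
    J.cauchy h =O[𝓝[J.carrierᶜ] p] fun z => Real.log ‖z - p‖ := by
  set A := localArc hp
  have hhc := LocalArc.continuousOn_of_holder hh
  have hsub : J.carrierᶜ ⊆ {p}ᶜ := fun z hz hzp => hz (by rw [show z = p from hzp]; exact hp)
  have hle : 𝓝[J.carrierᶜ] p ≤ 𝓝[≠] p := nhdsWithin_mono p hsub
  obtain ⟨H, hH⟩ := J.isCompact_carrier.exists_bound_of_continuousOn hhc
  have hH0 : 0 ≤ H := (norm_nonneg _).trans (hH p hp)
  obtain ⟨B, hB⟩ := A.exists_norm_regInt_le hC0 hh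
  obtain ⟨K1, hK1⟩ := LocalArc.eventually_abs_log_le (p := p) (A.arc A.r) A.d A.d_ne
  obtain ⟨K2, hK2⟩ := LocalArc.eventually_abs_log_le (p := p) (A.arc A.l) A.d A.d_ne
  have hρ := A.ρ_pos
  have hrest : ∀ᶠ z in 𝓝 p, ‖A.restInt h z‖ ≤ ‖A.restInt h p‖ + 1 :=
    (A.continuousAt_restInt hhc (by rw [sub_self, norm_zero]; linarith)).norm.tendsto
      |>.eventually_le_const (by linarith)
  refine Asymptotics.IsBigO.of_bound
    (H * (|K1| + |K2| + 2) + |B| + (‖A.restInt h p‖ + 1)) ?_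
  filter_upwards [hle hK1, hle hK2, hrest.filter_mono nhdsWithin_le_nhds,
    hle (eventually_one_le_abs_log p), A.eventually_exists_branch, self_mem_nhdsWithin]
    with z h1 h2 h3 h4 ⟨τ, hτ, c, hc, hslit, hdist⟩ hzJ
  rw [A.cauchy_eq_add hhc hzJ τ, A.integral_dir_div hslit, Real.norm_eq_abs]
  have e1 := h1 c hc
  have e2 := h2 c hc
  have e3 := hB τ hτ z hdist
  have e4 := hH _ (A.arc_mem hτ)
  set x := |Real.log ‖z - p‖|
  have e5 : ‖Complex.log ((A.arc A.r - z) / c) - Complex.log ((A.arc A.l - z) / c)‖ ≤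
      (|K1| + |K2| + 2) * x := by
    have := norm_sub_le (Complex.log ((A.arc A.r - z) / c)) (Complex.log ((A.arc A.l - z) / c))
    have := le_abs_self K1
    have := le_abs_self K2
    have := mul_le_mul_of_nonneg_left h4 (abs_nonneg K1)
    have := mul_le_mul_of_nonneg_left h4 (abs_nonneg K2)
    nlinarith
  have e6 : ‖h (A.arc τ) * (Complex.log ((A.arc A.r - z) / c) -
      Complex.log ((A.arc A.l - z) / c))‖ ≤ H * ((|K1| + |K2| + 2) * x) := by
    rw [norm_mul]
    exact mul_le_mul e4 e5 (norm_nonneg _) hH0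
  have e7 := norm_add₃_le (a := h (A.arc τ) * (Complex.log ((A.arc A.r - z) / c) -
      Complex.log ((A.arc A.l - z) / c))) (b := A.regInt h τ z) (c := A.restInt h z)
  have e8 : ‖A.regInt h τ z‖ ≤ |B| * x := by
    have := le_abs_self B
    have := mul_le_mul_of_nonneg_left h4 (abs_nonneg B)
    linarith
  have e9 : ‖A.restInt h z‖ ≤ (‖A.restInt h p‖ + 1) * x := by
    have := mul_le_mul_of_nonneg_left h4 (by positivity : 0 ≤ ‖A.restInt h p‖ + 1)
    linarith
  refine e7.trans ?_
  linarith

end PiecewiseSmoothCurve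

/-! ### Hölder continuous densities and the integral equations -/

namespace PiecewiseSmoothCurve

open MeasureTheory

variable {J : PiecewiseSmoothCurve} {p : ℂ} {N : ℕ} {f e : Fin N → ℂ → ℂ}

/-- Hölder continuity of order `1 / 2` on the curve. -/
def IsHolder (J : PiecewiseSmoothCurve) (h : ℂ → ℂ) : Prop :=
  ∃ C, 0 ≤ C ∧ ∀ z ∈ J.carrier, ∀ w ∈ J.carrier, ‖h z - h w‖ ≤ C * Real.sqrt ‖z - w‖

theorem IsHolder.continuousOn {h : ℂ → ℂ} (hh : J.IsHolder h) : ContinuousOn h J.carrier := by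
  obtain ⟨C, -, hC⟩ := hh
  exact LocalArc.continuousOn_of_holder hC

theorem IsSmooth.isHolder {h : ℂ → ℂ} (hh : J.IsSmooth h) : J.IsHolder h := by
  obtain ⟨K, hK0, hK⟩ := hh.exists_lipschitz
  obtain ⟨R, hR⟩ := J.isCompact_carrier.isBounded.exists_norm_le
  refine ⟨K * Real.sqrt (2 * R), by positivity, fun z hz w hw => (hK z hz w hw).trans ?_⟩
  have h1 : ‖z - w‖ ≤ 2 * R := (norm_sub_le z w).trans (by linarith [hR z hz, hR w hw])
  calc K * ‖z - w‖ = K * (Real.sqrt ‖z - w‖ * Real.sqrt ‖z - w‖) := by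
        rw [Real.mul_self_sqrt (norm_nonneg _)]
    _ ≤ K * (Real.sqrt (2 * R) * Real.sqrt ‖z - w‖) := by gcongr
    _ = _ := by ring

theorem IsHolder.sub {h g : ℂ → ℂ} (hh : J.IsHolder h) (hg : J.IsHolder g) :
    J.IsHolder fun z => h z - g z := by
  obtain ⟨C, hC0, hC⟩ := hh
  obtain ⟨D, hD0, hD⟩ := hg
  refine ⟨C + D, by positivity, fun z hz w hw => ?_⟩
  calc ‖h z - g z - (h w - g w)‖ = ‖(h z - h w) - (g z - g w)‖ := by congr 1; ring
    _ ≤ ‖h z - h w‖ + ‖g z - g w‖ := norm_sub_le _ _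
    _ ≤ _ := by rw [add_mul]; exact add_le_add (hC z hz w hw) (hD z hz w hw)

theorem IsHolder.mul {h g : ℂ → ℂ} (hh : J.IsHolder h) (hg : J.IsHolder g) :
    J.IsHolder fun z => h z * g z := by
  obtain ⟨H, hH⟩ := J.isCompact_carrier.exists_bound_of_continuousOn hh.continuousOn
  obtain ⟨G, hG⟩ := J.isCompact_carrier.exists_bound_of_continuousOn hg.continuousOn
  obtain ⟨C, hC0, hC⟩ := hh
  obtain ⟨D, hD0, hD⟩ := hg
  refine ⟨|H| * D + C * |G|, by positivity, fun z hz w hw => ?_⟩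
  have h1 := (hH z hz).trans (le_abs_self H)
  have h2 := (hG w hw).trans (le_abs_self G)
  calc ‖h z * g z - h w * g w‖ = ‖h z * (g z - g w) + (h z - h w) * g w‖ := by congr 1; ring
    _ ≤ ‖h z‖ * ‖g z - g w‖ + ‖h z - h w‖ * ‖g w‖ := by
        rw [← norm_mul, ← norm_mul]; exact norm_add_le _ _
    _ ≤ |H| * (D * Real.sqrt ‖z - w‖) + (C * Real.sqrt ‖z - w‖) * |G| := by
        refine add_le_add (mul_le_mul h1 (hD z hz w hw) (norm_nonneg _) (abs_nonneg _))
          (mul_le_mul (hC z hz w hw) h2 (norm_nonneg _) (by positivity))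
    _ = _ := by ring

theorem aestronglyMeasurable_and_bounded_mul_deriv {F : ℂ → ℂ} {C : ℝ}
    (hF : Fredholm.BddFun (fun t => F (J.path t)) C) :
    (AEStronglyMeasurable (fun t => F (J.toFun t) * deriv J.toFun t) J.parMeasure) ∧
      ∃ M, ∀ t ∈ Icc (0 : ℝ) J.pieces, ‖F (J.toFun t) * deriv J.toFun t‖ ≤ M := by
  constructor
  · refine (hF.measurable.mul J.measurable_vel).aestronglyMeasurable.congr ?_
    filter_upwards [ae_restrict_mem measurableSet_Icc] with t ht
    rw [Pi.mul_apply, path_eq ht, vel_eq ht]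
  · obtain ⟨M, hM0, hM⟩ := exists_bound_deriv J.smooth
    refine ⟨C * M, fun t ht => ?_⟩
    have h1 := hF.bound t
    rw [path_eq ht] at h1
    rw [norm_mul]
    exact mul_le_mul h1 (hM t ht) (norm_nonneg _) ((norm_nonneg _).trans h1)

theorem contourIntegral_kernel_left (F : ℂ → ℂ) (q : ℂ) :
    J.contourIntegral (fun w => J.integrableKernel f e w q * F w) =
      ∫ t in Icc (0 : ℝ) J.pieces, F (J.toFun t) * deriv J.toFun t *
        ((∑ a, f a (J.toFun t) * e a q) / (J.toFun t - q)) := by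
  refine integral_congr_ae ?_
  filter_upwards [J.ae_toFun_ne q] with t ht
  rw [integrableKernel, if_neg ht]
  ring

theorem contourIntegral_kernel_right (F : ℂ → ℂ) (q : ℂ) :
    J.contourIntegral (fun w => J.integrableKernel f e q w * F w) =
      -∫ t in Icc (0 : ℝ) J.pieces, F (J.toFun t) * deriv J.toFun t *
        ((∑ a, e a (J.toFun t) * f a q) / (J.toFun t - q)) := by
  rw [← integral_neg]
  refine integral_congr_ae ?_
  filter_upwards [J.ae_toFun_ne q] with t ht
  rw [integrableKernel, if_neg ht.symm, ← neg_sub (J.toFun t) q, div_neg]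
  simp_rw [mul_comm (f _ q)]
  ring

/-- Bounded solutions of the transposed equation are Hölder continuous. -/
theorem isHolder_of_transposed (hf : ∀ a, J.IsSmooth (f a)) (he : ∀ a, J.IsSmooth (e a))
    (hfe : ∀ z ∈ J.carrier, ∑ a, f a z * e a z = 0) {F b : ℂ → ℂ} {C : ℝ}
    (hF : Fredholm.BddFun (fun t => F (J.path t)) C) (hb : J.IsSmooth b)
    (heq : ∀ z ∈ J.carrier,
      F z + J.contourIntegral (fun w => J.integrableKernel f e w z * F w) = b z) :
    J.IsHolder F := by
  obtain ⟨hm, M, hM⟩ := aestronglyMeasurable_and_bounded_mul_deriv hF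
  have h1 : J.IsHolder fun z => ∫ t in Icc (0 : ℝ) J.pieces, F (J.toFun t) * deriv J.toFun t *
        ((∑ a, f a (J.toFun t) * e a z) / (J.toFun t - z)) :=
    exists_holder_transform hf he hfe hm hM
  obtain ⟨D, hD0, hD⟩ := hb.isHolder.sub h1
  refine ⟨D, hD0, fun z hz w hw => ?_⟩
  have e1 := heq z hz
  have e2 := heq w hw
  rw [contourIntegral_kernel_left] at e1 e2
  rw [eq_sub_of_add_eq e1, eq_sub_of_add_eq e2]
  exact hD z hz w hw

/-- Bounded solutions of the equation are Hölder continuous. -/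
theorem isHolder_of_equation (hf : ∀ a, J.IsSmooth (f a)) (he : ∀ a, J.IsSmooth (e a))
    (hfe : ∀ z ∈ J.carrier, ∑ a, f a z * e a z = 0) {F b : ℂ → ℂ} {C : ℝ}
    (hF : Fredholm.BddFun (fun t => F (J.path t)) C) (hb : J.IsSmooth b)
    (heq : ∀ z ∈ J.carrier,
      F z + J.contourIntegral (fun w => J.integrableKernel f e z w * F w) = b z) :
    J.IsHolder F := by
  obtain ⟨hm, M, hM⟩ := aestronglyMeasurable_and_bounded_mul_deriv hF
  obtain ⟨D, hD0, hD⟩ := exists_holder_transform he hf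
    (fun z hz => by simp_rw [mul_comm (e _ z)]; exact hfe z hz) hm.neg
    (fun t ht => by rw [Pi.neg_apply, norm_neg]; exact hM t ht)
  have h1 : J.IsHolder fun z => ∫ t in Icc (0 : ℝ) J.pieces, -(F (J.toFun t) * deriv J.toFun t) *
        ((∑ a, e a (J.toFun t) * f a z) / (J.toFun t - z)) := ⟨D, hD0, hD⟩
  obtain ⟨D, hD0, hD⟩ := hb.isHolder.sub h1
  refine ⟨D, hD0, fun z hz w hw => ?_⟩
  have e1 := heq z hz
  have e2 := heq w hw
  rw [contourIntegral_kernel_right, ← integral_neg] at e1 e2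
  rw [eq_sub_of_add_eq e1, eq_sub_of_add_eq e2]
  simpa only [neg_mul] using hD z hz w hw

theorem exists_bddKernel_pull_integrableKernel (hf : ∀ a, J.IsSmooth (f a))
    (he : ∀ a, J.IsSmooth (e a)) (hfe : ∀ z ∈ J.carrier, ∑ a, f a z * e a z = 0) :
    (∃ M, Fredholm.BddKernel (J.pull (J.integrableKernel f e)) M) ∧
      ∃ M, Fredholm.BddKernel (J.pull fun z w => J.integrableKernel f e w z) M := by
  obtain ⟨⟨C, hC⟩, hm⟩ := exists_bddKernel_integrableKernel hf he hfe
  exact ⟨exists_bddKernel_pull hm hC,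
    exists_bddKernel_pull (hm.comp measurable_swap) fun z hz w hw => hC w hw z hz⟩

/-- A component of `F_R`: for a smooth right-hand side the transposed Fredholm equation is solvable,
and the solution is Hölder, which the boundary values of its Cauchy integral require. -/
theorem exists_transposed_solution (hf : ∀ a, J.IsSmooth (f a))
    (he : ∀ a, J.IsSmooth (e a)) (hfe : ∀ z ∈ J.carrier, ∑ a, f a z * e a z = 0)
    (hdet : J.fredholmDet (J.integrableKernel f e) ≠ 0) {b : ℂ → ℂ} (hb : J.IsSmooth b) :
    ∃ F, J.IsHolder F ∧ ∀ z ∈ J.carrier,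
      F z + J.contourIntegral (fun w => J.integrableKernel f e w z * F w) = b z := by
  obtain ⟨-, M, hM⟩ := exists_bddKernel_pull_integrableKernel hf he hfe
  obtain ⟨B, hB⟩ := exists_bddFun_comp_path hb.continuousOn
  obtain ⟨F, ⟨C, hC⟩, hF⟩ := exists_solution_curve hM
    (by rw [fdet_pull_swap, ← fredholmDet_eq]; exact hdet) hB
  exact ⟨F, isHolder_of_transposed hf he hfe hC hb hF, hF⟩

/-- A component of `F_L`: for a smooth right-hand side the Fredholm equation has a Hölder
solution. -/
theorem exists_solution_equation (hf : ∀ a, J.IsSmooth (f a))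
    (he : ∀ a, J.IsSmooth (e a)) (hfe : ∀ z ∈ J.carrier, ∑ a, f a z * e a z = 0)
    (hdet : J.fredholmDet (J.integrableKernel f e) ≠ 0) {b : ℂ → ℂ} (hb : J.IsSmooth b) :
    ∃ F, J.IsHolder F ∧ ∀ z ∈ J.carrier,
      F z + J.contourIntegral (fun w => J.integrableKernel f e z w * F w) = b z := by
  obtain ⟨⟨M, hM⟩, -⟩ := exists_bddKernel_pull_integrableKernel hf he hfe
  obtain ⟨B, hB⟩ := exists_bddFun_comp_path hb.continuousOn
  obtain ⟨F, ⟨C, hC⟩, hF⟩ := exists_solution_curve hM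
    (by rw [← fredholmDet_eq]; exact hdet) hB
  exact ⟨F, isHolder_of_equation hf he hfe hC hb hF, hF⟩

theorem IsLeftSolution.isHolder (hf : ∀ a, J.IsSmooth (f a)) (he : ∀ a, J.IsSmooth (e a))
    (hfe : ∀ z ∈ J.carrier, ∑ a, f a z * e a z = 0) {F : Fin N → ℂ → ℂ}
    (hF : J.IsLeftSolution f e F) (a : Fin N) : J.IsHolder (F a) := by
  obtain ⟨C, hC⟩ := exists_bddFun_comp_path (hF.continuousOn a)
  exact isHolder_of_equation hf he hfe hC (hf a) (hF.equation a)

theorem IsLeftSolution.eqOn (hf : ∀ a, J.IsSmooth (f a)) (he : ∀ a, J.IsSmooth (e a))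
    (hfe : ∀ z ∈ J.carrier, ∑ a, f a z * e a z = 0)
    (hdet : J.fredholmDet (J.integrableKernel f e) ≠ 0) {F F' : Fin N → ℂ → ℂ}
    (hF : J.IsLeftSolution f e F) (hF' : J.IsLeftSolution f e F') (a : Fin N) :
    EqOn (F' a) (F a) J.carrier := by
  obtain ⟨⟨M, hM⟩, -⟩ := exists_bddKernel_pull_integrableKernel hf he hfe
  obtain ⟨C, hC⟩ := exists_bddFun_comp_path (hF.continuousOn a)
  obtain ⟨C', hC'⟩ := exists_bddFun_comp_path (hF'.continuousOn a)
  exact eqOn_of_solution_curve hM (by rw [← fredholmDet_eq]; exact hdet) hC' hC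
    (hF'.equation a) (hF.equation a)

/-! ### Cauchy integrals of solutions of the integral equations -/

theorem LocalArc.integrableOn_restInt (A : LocalArc J p) {h : ℂ → ℂ} (hc : ContinuousOn h J.carrier) :
    IntegrableOn (fun t => h (J.toFun t) * deriv J.toFun t / (J.toFun t - p)) A.rest := by
  have hi := A.integrableOn_rest (integrableOn_mul_deriv hc)
  have hm : AEStronglyMeasurable J.toFun (volume.restrict A.rest) :=
    J.aestronglyMeasurable_toFun.mono_measure (Measure.restrict_mono sdiff_subset le_rfl)
  refine Integrable.mono' (hi.norm.div_const A.ρ) ((hi.aestronglyMeasurable.aemeasurable.div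
      (hm.aemeasurable.sub_const p)).aestronglyMeasurable) ?_
  filter_upwards [ae_restrict_mem A.measurableSet_rest] with t ht
  rw [norm_div]
  have := A.far_rest ht
  have := A.ρ_pos
  gcongr

theorem cauchyBdry_sum {g : Fin N → ℂ → ℂ} (hg : ∀ j, J.IsHolder (g j)) (c : Fin N → ℂ) (σ : ℝ)
    (q : ℂ) : J.cauchyBdry (fun w => ∑ j, g j w * c j) σ q = ∑ j, J.cauchyBdry (g j) σ q * c j := by
  by_cases hq : q ∈ J.carrier
  · simp only [cauchyBdry, dif_pos hq]
    set A := localArc hq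
    have h1 : A.regInt (fun w => ∑ j, g j w * c j) 0 (A.arc 0) =
        ∑ j, A.regInt (g j) 0 (A.arc 0) * c j := by
      unfold LocalArc.regInt
      simp_rw [← integral_mul_const]
      rw [← integral_finsetSum]
      · refine integral_congr_ae (Eventually.of_forall fun s => ?_)
        simp only
        rw [← Finset.sum_sub_distrib, Finset.sum_mul, Finset.sum_div]
        exact Finset.sum_congr rfl fun j _ => by ring
      · intro j _
        obtain ⟨C, hC0, hC⟩ := hg j
        exact (A.integrableOn_regInt hC0 hC A.zero_mem
          fun s hs => A.le_norm_arc_sub_arc A.zero_mem hs).mul_const _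
    have h2 : A.restInt (fun w => ∑ j, g j w * c j) (A.arc 0) =
        ∑ j, A.restInt (g j) (A.arc 0) * c j := by
      unfold LocalArc.restInt
      simp_rw [← integral_mul_const]
      rw [← integral_finsetSum]
      · refine integral_congr_ae (Eventually.of_forall fun s => ?_)
        simp only
        rw [Finset.sum_mul, Finset.sum_div]
        exact Finset.sum_congr rfl fun j _ => by ring
      · intro j _
        have := A.integrableOn_restInt (hg j).continuousOn
        rw [A.arc_zero]
        exact this.mul_const _
    unfold LocalArc.bval
    rw [h1, h2, Finset.sum_mul, ← Finset.sum_add_distrib, ← Finset.sum_add_distrib]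
    exact Finset.sum_congr rfl fun j _ => by ring
  · simp [cauchyBdry, dif_neg hq]

/-- On the curve, the boundary values of the Cauchy integrals of `F f_j`, contracted with `e`, are
given by the integral operator. -/
theorem sum_cauchyBdry_mul (hf : ∀ a, J.IsSmooth (f a)) (he : ∀ a, J.IsSmooth (e a))
    (hfe : ∀ z ∈ J.carrier, ∑ a, f a z * e a z = 0) {F : ℂ → ℂ} (hF : J.IsHolder F) (σ : ℝ) {q : ℂ}
    (hq : q ∈ J.interior) : ∑ j, J.cauchyBdry (fun w => F w * f j w) σ q * e j q =
      ∫ t in Icc (0 : ℝ) J.pieces, F (J.toFun t) * deriv J.toFun t *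
        ((∑ a, f a (J.toFun t) * e a q) / (J.toFun t - q)) := by
  rw [← cauchyBdry_sum (g := fun j w => F w * f j w) fun j => hF.mul (hf j).isHolder]
  have hval : ∀ w, ∑ j, F w * f j w * e j q = F w * ∑ j, f j w * e j q := fun w => by
    rw [Finset.mul_sum]; exact Finset.sum_congr rfl fun j _ => by ring
  simp_rw [hval]
  have hqJ := interior_subset hq
  obtain ⟨B, hB0, hB⟩ := exists_bound_quotient hf he hfe
  obtain ⟨C, hC⟩ := exists_bddFun_comp_path hF.continuousOn
  obtain ⟨hm, M, hM⟩ := aestronglyMeasurable_and_bounded_mul_deriv hC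
  rw [cauchyBdry_eq_cauchy hq (by simp only [hfe q hqJ, mul_zero]), cauchy_eq]
  · refine integral_congr_ae (Eventually.of_forall fun t => ?_)
    simp only
    ring
  · have hs : AEStronglyMeasurable (fun t => (∑ a, f a (J.toFun t) * e a q)) J.parMeasure := by
      have : ContinuousOn (fun w => ∑ a, f a w * e a q) J.carrier :=
        continuousOn_finsetSum _ fun a _ => (hf a).continuousOn.mul continuousOn_const
      exact aestronglyMeasurable_comp_toFun this
    refine Integrable.of_bound (C := M * B) ?_ ?_
    · refine (hm.aemeasurable.mul (hs.aemeasurable.div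
        (J.aestronglyMeasurable_toFun.aemeasurable.sub_const q))).aestronglyMeasurable.congr ?_
      refine Eventually.of_forall fun t => ?_
      simp only [Pi.mul_apply, Pi.div_apply]
      ring
    · filter_upwards [ae_restrict_mem measurableSet_Icc] with t ht
      have h1 := hM t ht
      have h2 := hB (J.toFun t) ⟨t, ht, rfl⟩ q hqJ
      calc _ = ‖F (J.toFun t) * deriv J.toFun t *
          ((∑ a, f a (J.toFun t) * e a q) / (J.toFun t - q))‖ := by congr 1; ring
        _ ≤ M * B := by
          rw [norm_mul]
          exact mul_le_mul h1 h2 (norm_nonneg _) ((norm_nonneg _).trans h1)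

theorem sum_cauchyBdry_transposed (hf : ∀ a, J.IsSmooth (f a)) (he : ∀ a, J.IsSmooth (e a))
    (hfe : ∀ z ∈ J.carrier, ∑ a, f a z * e a z = 0) {F b : ℂ → ℂ} (hF : J.IsHolder F)
    (heq : ∀ z ∈ J.carrier,
      F z + J.contourIntegral (fun w => J.integrableKernel f e w z * F w) = b z) (σ : ℝ) {q : ℂ}
    (hq : q ∈ J.interior) :
    ∑ j, J.cauchyBdry (fun w => F w * f j w) σ q * e j q = b q - F q := by
  rw [sum_cauchyBdry_mul hf he hfe hF σ hq, ← contourIntegral_kernel_left, ← heq q (interior_subset hq)]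
  ring

theorem sum_cauchyBdry_equation (hf : ∀ a, J.IsSmooth (f a)) (he : ∀ a, J.IsSmooth (e a))
    (hfe : ∀ z ∈ J.carrier, ∑ a, f a z * e a z = 0) {F b : ℂ → ℂ} (hF : J.IsHolder F)
    (heq : ∀ z ∈ J.carrier,
      F z + J.contourIntegral (fun w => J.integrableKernel f e z w * F w) = b z) (σ : ℝ) {q : ℂ}
    (hq : q ∈ J.interior) :
    ∑ j, J.cauchyBdry (fun w => F w * e j w) σ q * f j q = F q - b q := by
  rw [sum_cauchyBdry_mul he hf (fun z hz => by simp_rw [mul_comm (e _ z)]; exact hfe z hz) hF σ hq,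
    ← heq q (interior_subset hq), contourIntegral_kernel_right]
  ring

/-! ### The solution of the Riemann–Hilbert problem and its inverse -/

/-- The matrix `I - ∫_J F_R(μ) E_Lᵀ(μ) / (μ - z) dμ`. -/
noncomputable def rhpMatrix (J : PiecewiseSmoothCurve) (f FR : Fin N → ℂ → ℂ) (z : ℂ) :
    Matrix (Fin N) (Fin N) ℂ :=
  1 - Matrix.of fun i j => J.cauchy (fun w => FR i w * f j w) z

/-- The matrix `I + ∫_J E_R(μ) F_Lᵀ(μ) / (μ - z) dμ`. -/
noncomputable def rhpInverse (J : PiecewiseSmoothCurve) (e FL : Fin N → ℂ → ℂ) (z : ℂ) :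
    Matrix (Fin N) (Fin N) ℂ :=
  1 + Matrix.of fun j k => J.cauchy (fun w => FL k w * e j w) z

theorem mul_jumpMatrix (A : Matrix (Fin N) (Fin N) ℂ) (f e : Fin N → ℂ → ℂ) (q : ℂ) (i j : Fin N) :
    (A * jumpMatrix f e q) i j =
      A i j + 2 * Real.pi * Complex.I * (∑ k, A i k * e k q) * f j q := by
  rw [jumpMatrix, Matrix.mul_add, Matrix.mul_one, Matrix.mul_smul, Matrix.mul_vecMulVec,
    Matrix.add_apply, Matrix.smul_apply, Matrix.vecMulVec_apply, smul_eq_mul, Matrix.mulVec,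
    dotProduct]
  ring

theorem jumpMatrix_mul (A : Matrix (Fin N) (Fin N) ℂ) (f e : Fin N → ℂ → ℂ) (q : ℂ) (i j : Fin N) :
    (jumpMatrix f e q * A) i j =
      A i j + 2 * Real.pi * Complex.I * e i q * (∑ k, A k j * f k q) := by
  rw [jumpMatrix, Matrix.add_mul, Matrix.one_mul, Matrix.smul_mul, Matrix.vecMulVec_mul,
    Matrix.add_apply, Matrix.smul_apply, Matrix.vecMulVec_apply, smul_eq_mul, Matrix.vecMul,
    dotProduct]
  simp_rw [mul_comm (f _ q)]
  ring

section solution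

variable {h : Fin N → Fin N → ℂ → ℂ} {s : ℂ}

/-- Cauchy integrals have non-tangential boundary values on both sides of the curve. -/
theorem isBoundaryValue_cauchy (hh : ∀ i j, J.IsHolder (h i j)) (s : ℂ) {σ : ℝ} (hσ : |σ| = 1) :
    J.IsBoundaryValue σ
      (fun z => 1 + s • Matrix.of fun i j => J.cauchy (h i j) z)
      (fun z => 1 + s • Matrix.of fun i j => J.cauchyBdry (h i j) σ z) := by
  constructor
  · refine continuousOn_pi.2 fun i => continuousOn_pi.2 fun j => ?_
    obtain ⟨C, hC0, hC⟩ := hh i j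
    exact continuousOn_const.add (continuousOn_const.mul (continuousOn_cauchyBdry hC0 hC hσ))
  · intro i hi t ht δ hδ
    refine tendsto_pi_nhds.2 fun k => tendsto_pi_nhds.2 fun l => ?_
    obtain ⟨C, hC0, hC⟩ := hh k l
    exact tendsto_const_nhds.add
      (tendsto_const_nhds.mul (tendsto_cauchy_sideCone hC0 hC hσ hi ht hδ))

theorem cauchyEntry_apply (i j : Fin N) (z : ℂ) :
    (1 + s • Matrix.of fun i j => J.cauchy (h i j) z : Matrix (Fin N) (Fin N) ℂ) i j =
      (1 : Matrix (Fin N) (Fin N) ℂ) i j + s * J.cauchy (h i j) z := rfl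

theorem cauchyEntry_differentiableOn (hh : ∀ i j, J.IsHolder (h i j)) (i j : Fin N) :
    DifferentiableOn ℂ (fun z => (1 + s • Matrix.of fun i j => J.cauchy (h i j) z :
      Matrix (Fin N) (Fin N) ℂ) i j) J.carrierᶜ :=
  (differentiableOn_const _).add ((differentiableOn_cauchy (hh i j).continuousOn).const_mul s)

theorem cauchyEntry_bounded (hh : ∀ i j, J.IsHolder (h i j)) (i j : Fin N) {q : ℂ}
    (hq : q ∈ J.interior) : ∃ M : ℝ, ∀ᶠ z in 𝓝[J.carrierᶜ] q,
      ‖(1 + s • Matrix.of fun i j => J.cauchy (h i j) z : Matrix (Fin N) (Fin N) ℂ) i j‖ ≤ M := by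
  obtain ⟨C, hC0, hC⟩ := hh i j
  obtain ⟨M, hM⟩ := exists_cauchy_bound hC0 hC hq
  refine ⟨‖(1 : Matrix (Fin N) (Fin N) ℂ) i j‖ + ‖s‖ * M, hM.mono fun z hz => ?_⟩
  rw [cauchyEntry_apply]
  refine (norm_add_le _ _).trans ?_
  rw [norm_mul]
  gcongr

theorem cauchyEntry_endpoint (hh : ∀ i j, J.IsHolder (h i j)) (i j : Fin N) {q : ℂ}
    (hq : q ∈ J.carrier) : (fun z => (1 + s • Matrix.of fun i j => J.cauchy (h i j) z :
      Matrix (Fin N) (Fin N) ℂ) i j) =O[𝓝[J.carrierᶜ] q] fun z => Real.log ‖z - q‖ := by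
  obtain ⟨C, hC0, hC⟩ := hh i j
  have hsub : J.carrierᶜ ⊆ {q}ᶜ := fun z hz hzq => hz (by rw [show z = q from hzq]; exact hq)
  refine Asymptotics.IsBigO.add ?_ ((cauchy_isBigO_log hC0 hC hq).const_mul_left s)
  refine Asymptotics.IsBigO.of_bound ‖(1 : Matrix (Fin N) (Fin N) ℂ) i j‖ ?_
  filter_upwards [nhdsWithin_mono q hsub (eventually_one_le_abs_log q)] with z hz
  rw [Real.norm_eq_abs]
  exact le_mul_of_one_le_right (norm_nonneg _) hz

theorem cauchyEntry_infinity (hh : ∀ i j, J.IsHolder (h i j)) (i j : Fin N) :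
    (fun z => (1 + s • Matrix.of fun i j => J.cauchy (h i j) z :
      Matrix (Fin N) (Fin N) ℂ) i j - (1 : Matrix (Fin N) (Fin N) ℂ) i j)
      =O[Bornology.cobounded ℂ] (fun z => z⁻¹) := by
  refine ((cauchy_isBigO (hh i j).continuousOn).const_mul_left s).congr_left fun z => ?_
  rw [cauchyEntry_apply]
  ring

end solution

theorem rhpMatrix_eq (f FR : Fin N → ℂ → ℂ) : J.rhpMatrix f FR = fun z =>
    1 + (-1 : ℂ) • Matrix.of fun i j => J.cauchy (fun w => FR i w * f j w) z := by
  funext z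
  rw [rhpMatrix, neg_one_smul, ← sub_eq_add_neg]

theorem rhpInverse_eq (e FL : Fin N → ℂ → ℂ) : J.rhpInverse e FL = fun z =>
    1 + (1 : ℂ) • Matrix.of fun i j => J.cauchy (fun w => FL j w * e i w) z := by
  funext z
  rw [rhpInverse, one_smul]

theorem one_sum_mul (i : Fin N) (x : Fin N → ℂ) :
    ∑ k, (1 : Matrix (Fin N) (Fin N) ℂ) i k * x k = x i := by
  simp [Matrix.one_apply]

theorem isRHPSolution_rhpMatrix (hf : ∀ a, J.IsSmooth (f a)) (he : ∀ a, J.IsSmooth (e a))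
    (hfe : ∀ z ∈ J.carrier, ∑ a, f a z * e a z = 0) {FR : Fin N → ℂ → ℂ}
    (hFR : ∀ i, J.IsHolder (FR i)) (heq : ∀ i, ∀ z ∈ J.carrier,
      FR i z + J.contourIntegral (fun w => J.integrableKernel f e w z * FR i w) = e i z) :
    J.IsRHPSolution f e (J.rhpMatrix f FR) := by
  have hh : ∀ i j, J.IsHolder fun w => FR i w * f j w := fun i j => (hFR i).mul (hf j).isHolder
  rw [rhpMatrix_eq]
  refine ⟨cauchyEntry_differentiableOn hh, fun q hq i j => cauchyEntry_bounded hh i j hq,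
    ⟨_, _, isBoundaryValue_cauchy hh _ (by simp), isBoundaryValue_cauchy hh _ (by simp),
      fun q hq => ?_⟩, fun q hq i j => cauchyEntry_endpoint hh i j ?_, cauchyEntry_infinity hh⟩
  · ext i j
    rw [mul_jumpMatrix]
    have h1 : ∑ k, (1 + (-1 : ℂ) • Matrix.of fun i j =>
        J.cauchyBdry (fun w => FR i w * f j w) 1 q : Matrix (Fin N) (Fin N) ℂ) i k * e k q =
        FR i q := by
      have h2 := sum_cauchyBdry_transposed hf he hfe (hFR i) (heq i) 1 hq
      simp only [Matrix.add_apply, Matrix.smul_apply, Matrix.of_apply, smul_eq_mul, add_mul,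
        Finset.sum_add_distrib, one_sum_mul, neg_mul, one_mul, Finset.sum_neg_distrib, h2]
      ring
    have h3 := cauchyBdry_sub (h := fun w => FR i w * f j w) hq
    rw [h1]
    simp only [Matrix.add_apply, Matrix.smul_apply, Matrix.of_apply, smul_eq_mul]
    linear_combination h3
  · rcases hq.2 with h | h
    · exact ⟨0, ⟨le_rfl, J.pieces_pos'.le⟩, h.symm⟩
    · exact ⟨J.pieces, ⟨J.pieces_pos'.le, le_rfl⟩, h.symm⟩

/-- The boundary values of the inverse satisfy the inverse jump condition. -/
theorem rhpInverse_jump (hf : ∀ a, J.IsSmooth (f a)) (he : ∀ a, J.IsSmooth (e a))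
    (hfe : ∀ z ∈ J.carrier, ∑ a, f a z * e a z = 0) {FL : Fin N → ℂ → ℂ}
    (hFL : ∀ i, J.IsHolder (FL i)) (heq : ∀ i, ∀ z ∈ J.carrier,
      FL i z + J.contourIntegral (fun w => J.integrableKernel f e z w * FL i w) = f i z) :
    ∃ Mp Mm : ℂ → Matrix (Fin N) (Fin N) ℂ, J.IsBoundaryValue 1 (J.rhpInverse e FL) Mp ∧
      J.IsBoundaryValue (-1) (J.rhpInverse e FL) Mm ∧
      ∀ q ∈ J.interior, Mp q = jumpMatrix f e q * Mm q := by
  have hh : ∀ i j, J.IsHolder fun w => FL j w * e i w := fun i j => (hFL j).mul (he i).isHolder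
  rw [rhpInverse_eq]
  refine ⟨_, _, isBoundaryValue_cauchy hh _ (by simp), isBoundaryValue_cauchy hh _ (by simp),
      fun q hq => ?_⟩
  ext i j
  rw [jumpMatrix_mul]
  have h1 : ∑ k, (1 + (1 : ℂ) • Matrix.of fun i j =>
      J.cauchyBdry (fun w => FL j w * e i w) (-1) q : Matrix (Fin N) (Fin N) ℂ) k j * f k q =
      FL j q := by
    have h2 := sum_cauchyBdry_equation hf he hfe (hFL j) (heq j) (-1) hq
    have h4 : ∑ k, (1 : Matrix (Fin N) (Fin N) ℂ) k j * f k q = f j q := by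
      simp [Matrix.one_apply]
    simp only [Matrix.add_apply, Matrix.smul_apply, Matrix.of_apply, smul_eq_mul, add_mul,
      Finset.sum_add_distrib, h4, one_mul, h2]
    ring
  have h3 := cauchyBdry_sub (h := fun w => FL j w * e i w) hq
  rw [h1]
  simp only [Matrix.add_apply, Matrix.smul_apply, Matrix.of_apply, smul_eq_mul]
  linear_combination h3

end PiecewiseSmoothCurve

/-! ### Cauchy's formula for rectangles that are crossed by the curve -/

namespace PiecewiseSmoothCurve

open MeasureTheory

variable {J : PiecewiseSmoothCurve} {p : ℂ}

namespace LocalArc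

variable (A : LocalArc J p)

theorem continuousOn_uncurry_pt : ContinuousOn (fun q : ℝ × ℝ => A.pt q.1 q.2)
    (Icc A.l A.r ×ˢ univ) := by
  unfold pt
  refine (A.continuousOn_arc.comp continuousOn_fst fun q hq => hq.1).add ?_
  have : Continuous fun q : ℝ × ℝ => Complex.I * (q.2 : ℂ) * A.d := by fun_prop
  exact this.continuousOn

theorem hasDerivAt_pt_right (t y : ℝ) : HasDerivAt (A.pt t) (Complex.I * A.d) y := by
  unfold pt
  have h1 : HasDerivAt (fun y : ℝ => (y : ℂ)) 1 y := Complex.ofRealCLM.hasDerivAt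
  have h2 := ((h1.const_mul Complex.I).mul_const A.d).const_add (A.arc t)
  simpa using h2

theorem continuous_pt (t : ℝ) : Continuous (A.pt t) := by unfold pt; fun_prop

section rectangle

variable {a b : ℝ} (ha : A.l ≤ a) (hb : b ≤ A.r)
include ha hb

/-- The fundamental theorem of calculus along a vertical translate of the arc. -/
theorem integral_dir_mul (hab : a ≤ b) {F F' : ℂ → ℂ} {y : ℝ}
    (hF : ∀ t ∈ Icc a b, HasDerivAt F (F' (A.pt t y)) (A.pt t y))
    (hF' : ContinuousOn (fun t => F' (A.pt t y)) (Icc a b)) :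
    ∫ t in Ioo a b, A.dir t * F' (A.pt t y) = F (A.pt b y) - F (A.pt a y) := by
  have hsub : Icc a b ⊆ Icc A.l A.r := Icc_subset_Icc ha hb
  have hc : ContinuousOn (fun t => A.pt t y) (Icc a b) := by
    unfold pt
    exact (A.continuousOn_arc.mono hsub).add continuousOn_const
  obtain ⟨M, hM0, hM⟩ := A.exists_bound_dir
  obtain ⟨C, hC⟩ := isCompact_Icc.exists_bound_of_continuousOn hF'
  have hint : IntegrableOn (fun t => A.dir t * F' (A.pt t y)) (Ioo a b) := by
    refine Integrable.of_bound (C := M * C) (A.measurable_dir.aestronglyMeasurable.mul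
      ((hF'.mono Ioo_subset_Icc_self).aestronglyMeasurable measurableSet_Ioo)) ?_
    filter_upwards [ae_restrict_mem measurableSet_Ioo] with s hs
    have hs' := Ioo_subset_Icc_self hs
    rw [norm_mul]
    exact mul_le_mul (hM s (hsub hs')) (hC s hs') (norm_nonneg _) hM0
  have key := MeasureTheory.integral_eq_of_hasDerivAt_off_countable_of_le
    (fun t => F (A.pt t y)) (fun t => A.dir t * F' (A.pt t y)) hab
    (countable_singleton 0)
    (fun t ht => ((hF t ht).continuousAt.comp_continuousWithinAt (f := fun t => A.pt t y) (hc t ht)))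
    (fun s hs' => by
      have hpar : s ∈ A.par := ⟨⟨ha.trans_lt hs'.1.1, hs'.1.2.trans_le hb⟩, hs'.2⟩
      have h1 : HasDerivAt (fun t => A.pt t y) (A.dir s) s :=
        (A.hasDerivAt_arc hpar).add_const _
      have h2 := (hF s (Ioo_subset_Icc_self hs'.1)).scomp s h1
      rwa [smul_eq_mul] at h2)
    ((intervalIntegrable_iff_integrableOn_Ioo_of_le hab).2 hint)
  rw [← key, intervalIntegral.integral_of_le hab, integral_Ioc_eq_integral_Ioo]

omit ha hb in
theorem integral_vert_mul {F F' : ℂ → ℂ} {t s₁ s₂ : ℝ} (h12 : s₁ ≤ s₂)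
    (hF : ∀ y ∈ Icc s₁ s₂, HasDerivAt F (F' (A.pt t y)) (A.pt t y))
    (hF' : ContinuousOn (fun y => F' (A.pt t y)) (Icc s₁ s₂)) :
    ∫ y in s₁..s₂, Complex.I * A.d * F' (A.pt t y) = F (A.pt t s₂) - F (A.pt t s₁) := by
  refine intervalIntegral.integral_eq_sub_of_hasDerivAt (f := fun y => F (A.pt t y)) (fun y hy => ?_)
    (ContinuousOn.intervalIntegrable ?_)
  · rw [uIcc_of_le h12] at hy
    have h2 := (hF y hy).scomp y (A.hasDerivAt_pt_right t y)
    rwa [smul_eq_mul] at h2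
  · rw [uIcc_of_le h12]
    exact continuousOn_const.mul hF'

/-- Cauchy's theorem for a rectangle whose horizontal sides are translates of the arc. -/
theorem integral_dir_sub_of_differentiableOn (hab : a ≤ b) {s₁ s₂ : ℝ} (h12 : s₁ ≤ s₂)
    {f : ℂ → ℂ} {V : Set ℂ} (hV : IsOpen V) (hf : DifferentiableOn ℂ f V)
    (hVm : ∀ t ∈ Icc a b, ∀ y ∈ Icc s₁ s₂, A.pt t y ∈ V) :
    (∫ t in Ioo a b, A.dir t * f (A.pt t s₂)) - ∫ t in Ioo a b, A.dir t * f (A.pt t s₁) =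
      (∫ y in s₁..s₂, Complex.I * A.d * f (A.pt b y)) -
        ∫ y in s₁..s₂, Complex.I * A.d * f (A.pt a y) := by
  have hsub : Icc a b ⊆ Icc A.l A.r := Icc_subset_Icc ha hb
  have hder : ∀ z ∈ V, HasDerivAt f (deriv f z) z := fun z hz =>
    (hf.differentiableAt (hV.mem_nhds hz)).hasDerivAt
  have hf'c : ContinuousOn (deriv f) V := (hf.deriv hV).continuousOn
  have hptc : ContinuousOn (fun q : ℝ × ℝ => A.pt q.1 q.2) (Icc a b ×ˢ Icc s₁ s₂) :=
    A.continuousOn_uncurry_pt.mono fun q hq => ⟨hsub hq.1, mem_univ _⟩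
  have hc2 : ContinuousOn (fun q : ℝ × ℝ => deriv f (A.pt q.1 q.2)) (Icc a b ×ˢ Icc s₁ s₂) :=
    hf'c.comp hptc fun q hq => hVm _ hq.1 _ hq.2
  have hfc2 : ContinuousOn (fun q : ℝ × ℝ => f (A.pt q.1 q.2)) (Icc a b ×ˢ Icc s₁ s₂) :=
    hf.continuousOn.comp hptc fun q hq => hVm _ hq.1 _ hq.2
  have hrow : ∀ {g : ℝ × ℝ → ℂ}, ContinuousOn g (Icc a b ×ˢ Icc s₁ s₂) → ∀ y ∈ Icc s₁ s₂,
      ContinuousOn (fun t => g (t, y)) (Icc a b) := fun hg y hy =>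
    hg.comp (Continuous.prodMk_left y).continuousOn fun t ht => ⟨ht, hy⟩
  have hcol : ∀ {g : ℝ × ℝ → ℂ}, ContinuousOn g (Icc a b ×ˢ Icc s₁ s₂) → ∀ t ∈ Icc a b,
      ContinuousOn (fun y => g (t, y)) (Icc s₁ s₂) := fun hg t ht =>
    hg.comp (Continuous.prodMk_right t).continuousOn fun y hy => ⟨ht, hy⟩
  obtain ⟨M, hM0, hM⟩ := A.exists_bound_dir
  obtain ⟨C, hC⟩ := (isCompact_Icc.prod isCompact_Icc).exists_bound_of_continuousOn hc2
  obtain ⟨C', hC'⟩ := (isCompact_Icc.prod isCompact_Icc).exists_bound_of_continuousOn hfc2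
  have hsint : ∀ y ∈ Icc s₁ s₂, IntegrableOn (fun t => A.dir t * f (A.pt t y)) (Ioo a b) := by
    intro y hy
    refine Integrable.of_bound (C := M * C') (A.measurable_dir.aestronglyMeasurable.mul
      (((hrow hfc2 y hy).mono Ioo_subset_Icc_self).aestronglyMeasurable measurableSet_Ioo)) ?_
    filter_upwards [ae_restrict_mem measurableSet_Ioo] with t ht
    have ht' := Ioo_subset_Icc_self ht
    rw [norm_mul]
    exact mul_le_mul (hM t (hsub ht')) (hC' (t, y) ⟨ht', hy⟩) (norm_nonneg _) hM0
  have hvint : ∀ t ∈ Icc a b, IntervalIntegrable (fun y => Complex.I * A.d * f (A.pt t y))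
      volume s₁ s₂ := fun t ht => ContinuousOn.intervalIntegrable (by
    rw [uIcc_of_le h12]
    exact continuousOn_const.mul (hcol hfc2 t ht))
  rw [← integral_sub (hsint s₂ (right_mem_Icc.2 h12)) (hsint s₁ (left_mem_Icc.2 h12)),
    ← intervalIntegral.integral_sub (hvint b (right_mem_Icc.2 hab)) (hvint a (left_mem_Icc.2 hab))]
  have e1 : ∫ t in Ioo a b, (A.dir t * f (A.pt t s₂) - A.dir t * f (A.pt t s₁)) =
      ∫ t in Ioo a b, ∫ y in Ioc s₁ s₂, A.dir t * (Complex.I * A.d * deriv f (A.pt t y)) := by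
    refine setIntegral_congr_fun measurableSet_Ioo fun t ht => ?_
    have ht' := Ioo_subset_Icc_self ht
    rw [integral_const_mul, ← intervalIntegral.integral_of_le h12,
      A.integral_vert_mul h12 (F := f) (fun y hy => hder _ (hVm t ht' y hy)) (hcol hc2 t ht')]
    ring
  have e2 : ∫ y in s₁..s₂, (Complex.I * A.d * f (A.pt b y) - Complex.I * A.d * f (A.pt a y)) =
      ∫ y in Ioc s₁ s₂, ∫ t in Ioo a b, A.dir t * (Complex.I * A.d * deriv f (A.pt t y)) := by
    rw [intervalIntegral.integral_of_le h12]
    refine setIntegral_congr_fun measurableSet_Ioc fun y hy => ?_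
    have hy' := Ioc_subset_Icc_self hy
    have h1 := A.integral_dir_mul ha hb hab (F := f) (fun t ht => hder _ (hVm t ht y hy'))
      (hrow hc2 y hy')
    rw [← mul_sub, ← h1, ← integral_const_mul]
    exact integral_congr_ae (Eventually.of_forall fun t => by simp only; ring)
  rw [e1, e2]
  refine integral_integral_swap ?_
  rw [Measure.prod_restrict]
  have hm1 : AEStronglyMeasurable (fun q : ℝ × ℝ => A.dir q.1)
      (((volume : Measure ℝ).prod volume).restrict (Ioo a b ×ˢ Ioc s₁ s₂)) :=
    (A.measurable_dir.comp measurable_fst).aestronglyMeasurable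
  have hm2 : AEStronglyMeasurable (fun q : ℝ × ℝ => Complex.I * A.d * deriv f (A.pt q.1 q.2))
      (((volume : Measure ℝ).prod volume).restrict (Ioo a b ×ˢ Ioc s₁ s₂)) :=
    ((continuousOn_const.mul hc2).mono
      (prod_mono Ioo_subset_Icc_self Ioc_subset_Icc_self)).aestronglyMeasurable
      (measurableSet_Ioo.prod measurableSet_Ioc)
  have hfin : IsFiniteMeasure (((volume : Measure ℝ).prod volume).restrict
      (Ioo a b ×ˢ Ioc s₁ s₂)) := by
    rw [← Measure.prod_restrict]; infer_instance
  refine Integrable.of_bound (C := M * (‖Complex.I * A.d‖ * C)) (hm1.mul hm2) ?_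
  filter_upwards [ae_restrict_mem (measurableSet_Ioo.prod measurableSet_Ioc)] with q hq
  have hq1 := Ioo_subset_Icc_self hq.1
  rw [Function.uncurry, norm_mul, norm_mul]
  refine mul_le_mul (hM _ (hsub hq1)) (mul_le_mul_of_nonneg_left
    (hC q ⟨hq1, Ioc_subset_Icc_self hq.2⟩) (norm_nonneg _)) (by positivity) hM0

/-- The integral of `φ` along the positively oriented boundary of a rectangle around the arc. -/
noncomputable def rect (a b S : ℝ) (φ : ℂ → ℂ) : ℂ :=
  (∫ t in Ioo a b, A.dir t * φ (A.pt t (-S))) + (∫ y in -S..S, Complex.I * A.d * φ (A.pt b y)) -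
    (∫ t in Ioo a b, A.dir t * φ (A.pt t S)) - ∫ y in -S..S, Complex.I * A.d * φ (A.pt a y)

/-- Cauchy's theorem for a bounded function that is holomorphic off the arc and has the same
boundary values on both sides. -/
theorem rect_eq_zero (hab : a ≤ b) {S M : ℝ} (hS : 0 < S) {f : ℂ → ℂ} {V : Set ℂ} (hV : IsOpen V)
    (hf : DifferentiableOn ℂ f V)
    (hVm : ∀ t ∈ Icc a b, ∀ y ∈ Icc (-S) S, y ≠ 0 → A.pt t y ∈ V)
    (hM : ∀ t ∈ Icc a b, ∀ y ∈ Icc (-S) S, y ≠ 0 → ‖f (A.pt t y)‖ ≤ M)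
    (hlim : ∀ t ∈ Ioo a b, t ≠ 0 → ∃ G, Tendsto (fun y => f (A.pt t y)) (𝓝[>] 0) (𝓝 G) ∧
      Tendsto (fun y => f (A.pt t y)) (𝓝[<] 0) (𝓝 G)) : A.rect a b S f = 0 := by
  have hsub : Icc a b ⊆ Icc A.l A.r := Icc_subset_Icc ha hb
  have hM0 : 0 ≤ M := (norm_nonneg _).trans
    (hM a (left_mem_Icc.2 hab) S ⟨by linarith, le_rfl⟩ hS.ne')
  obtain ⟨D, hD0, hD⟩ := A.exists_bound_dir
  choose! G hG using hlim
  set L := ∫ t in Ioo a b, A.dir t * G t with hL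
  -- the integrals along translates of the arc converge to the same limit from both sides
  have hI : ∀ l : Filter ℝ, l.IsCountablyGenerated → l ≤ 𝓝[≠] 0 →
      (∀ t ∈ Ioo a b, t ≠ 0 → Tendsto (fun y => f (A.pt t y)) l (𝓝 (G t))) →
      Tendsto (fun y => ∫ t in Ioo a b, A.dir t * f (A.pt t y)) l (𝓝 L) := by
    intro l _ hl hGl
    have hev : ∀ᶠ y in l, y ∈ Icc (-S) S ∧ y ≠ 0 := by
      have h1 : ∀ᶠ y : ℝ in 𝓝[≠] 0, y ∈ Icc (-S) S ∧ y ≠ 0 :=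
        Filter.Eventually.and (mem_nhdsWithin_of_mem_nhds (Icc_mem_nhds (by linarith : -S < 0) hS))
          self_mem_nhdsWithin
      exact h1.filter_mono hl
    refine tendsto_integral_filter_of_dominated_convergence (fun _ => D * M) ?_ ?_
      (integrable_const _) ?_
    · filter_upwards [hev] with y hy
      have hc : ContinuousOn (fun t => f (A.pt t y)) (Ioo a b) :=
        hf.continuousOn.comp (A.continuousOn_uncurry_pt.comp
          (Continuous.prodMk_left y).continuousOn fun t ht =>
            ⟨hsub (Ioo_subset_Icc_self ht), mem_univ _⟩)
          fun t ht => hVm t (Ioo_subset_Icc_self ht) y hy.1 hy.2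
      exact A.measurable_dir.aestronglyMeasurable.mul (hc.aestronglyMeasurable measurableSet_Ioo)
    · filter_upwards [hev] with y hy
      filter_upwards [ae_restrict_mem measurableSet_Ioo] with t ht
      have ht' := Ioo_subset_Icc_self ht
      rw [norm_mul]
      exact mul_le_mul (hD t (hsub ht')) (hM t ht' y hy.1 hy.2) (norm_nonneg _) hD0
    · have h0 : ∀ᵐ t ∂(volume : Measure ℝ), t ∉ ({0} : Set ℝ) :=
        (countable_singleton 0).ae_notMem _
      filter_upwards [ae_restrict_mem measurableSet_Ioo, ae_restrict_of_ae h0] with t ht ht0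
      exact tendsto_const_nhds.mul (hGl t ht ht0)
  have hIp := hI (𝓝[>] 0) inferInstance (nhdsWithin_mono _ fun x hx => ne_of_gt hx)
    fun t ht h0 => (hG t ht h0).1
  have hIm := hI (𝓝[<] 0) inferInstance (nhdsWithin_mono _ fun x hx => ne_of_lt hx)
    fun t ht h0 => (hG t ht h0).2
  -- the vertical sides
  have hvint : ∀ t ∈ Icc a b, ∀ s₁ ∈ Icc (-S) S, ∀ s₂ ∈ Icc (-S) S,
      IntervalIntegrable (fun y => Complex.I * A.d * f (A.pt t y)) volume s₁ s₂ := by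
    intro t ht s₁ hs₁ s₂ hs₂
    rw [intervalIntegrable_iff]
    have hsub' : uIoc s₁ s₂ ⊆ Icc (-S) S := uIoc_subset_uIcc.trans
      (uIcc_subset_Icc hs₁ hs₂)
    have h1 : IntegrableOn (fun y => Complex.I * A.d * f (A.pt t y)) (Icc (-S) S \ {0}) := by
      have hms : MeasurableSet (Icc (-S) S \ {0}) :=
        measurableSet_Icc.diff (measurableSet_singleton 0)
      have hc : ContinuousOn (fun y => Complex.I * A.d * f (A.pt t y)) (Icc (-S) S \ {0}) :=
        continuousOn_const.mul (hf.continuousOn.comp (A.continuous_pt t).continuousOn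
          fun y hy => hVm t ht y hy.1 hy.2)
      have hfin : IsFiniteMeasure ((volume : Measure ℝ).restrict (Icc (-S) S \ {0})) :=
        ⟨by
          rw [Measure.restrict_apply_univ]
          exact (measure_mono sdiff_subset).trans_lt (by simp)⟩
      refine Integrable.of_bound (C := ‖Complex.I * A.d‖ * M) (hc.aestronglyMeasurable hms) ?_
      filter_upwards [ae_restrict_mem hms] with y hy
      rw [norm_mul]
      exact mul_le_mul_of_nonneg_left (hM t ht y hy.1 hy.2) (norm_nonneg _)
    have h2 : (Icc (-S) S \ {0} : Set ℝ) =ᵐ[volume] Icc (-S) S :=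
      sdiff_ae_eq_self.2 (measure_mono_null inter_subset_right (by simp))
    rw [IntegrableOn, Measure.restrict_congr_set h2] at h1
    exact IntegrableOn.mono_set h1 hsub'
  have h0mem : (0 : ℝ) ∈ Icc (-S) S := ⟨by linarith, hS.le⟩
  have hSmem : S ∈ Icc (-S) S := ⟨by linarith, le_rfl⟩
  have hSmem' : -S ∈ Icc (-S) S := ⟨le_rfl, by linarith⟩
  have hsmall : ∀ t ∈ Icc a b, Tendsto (fun ε => ∫ y in (0 : ℝ)..ε, Complex.I * A.d * f (A.pt t y))
      (𝓝 0) (𝓝 0) := by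
    intro t ht
    have h1 : Tendsto (fun ε : ℝ => ‖Complex.I * A.d‖ * M * |ε - 0|) (𝓝 0) (𝓝 0) := by
      have : Continuous fun ε : ℝ => ‖Complex.I * A.d‖ * M * |ε - 0| := by fun_prop
      simpa using this.tendsto 0
    refine squeeze_zero_norm' ?_ h1
    filter_upwards [Icc_mem_nhds (by linarith : -S < 0) hS] with ε hε
    refine intervalIntegral.norm_integral_le_of_norm_le_const_ae ?_
    have h0 : ∀ᵐ y ∂(volume : Measure ℝ), y ∉ ({0} : Set ℝ) :=
        (countable_singleton 0).ae_notMem _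
    filter_upwards [h0] with y hy0 hy
    rw [norm_mul]
    exact mul_le_mul_of_nonneg_left (hM t ht y ((uIoc_subset_uIcc.trans
      (uIcc_subset_Icc h0mem hε)) hy) hy0) (norm_nonneg _)
  have hamem := left_mem_Icc.2 hab
  have hbmem := right_mem_Icc.2 hab
  have hvlim : ∀ s ∈ Icc (-S) S, Tendsto (fun ε =>
      (∫ y in ε..s, Complex.I * A.d * f (A.pt b y)) - ∫ y in ε..s, Complex.I * A.d * f (A.pt a y))
      (𝓝 0) (𝓝 ((∫ y in (0 : ℝ)..s, Complex.I * A.d * f (A.pt b y)) -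
        ∫ y in (0 : ℝ)..s, Complex.I * A.d * f (A.pt a y))) := by
    intro s hs
    have h1 : ∀ t ∈ Icc a b, Tendsto (fun ε => ∫ y in ε..s, Complex.I * A.d * f (A.pt t y)) (𝓝 0)
        (𝓝 (∫ y in (0 : ℝ)..s, Complex.I * A.d * f (A.pt t y))) := by
      intro t ht
      have h2 := (tendsto_const_nhds (x := ∫ y in (0 : ℝ)..s, Complex.I * A.d * f (A.pt t y))).sub
        (hsmall t ht)
      rw [sub_zero] at h2
      refine h2.congr' ?_
      filter_upwards [Icc_mem_nhds (by linarith : -S < 0) hS] with ε hε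
      rw [sub_eq_iff_eq_add, add_comm]
      exact (intervalIntegral.integral_add_adjacent_intervals (hvint t ht 0 h0mem ε hε)
        (hvint t ht ε hε s hs)).symm
    exact (h1 b hbmem).sub (h1 a hamem)
  have eq1 : (∫ t in Ioo a b, A.dir t * f (A.pt t S)) - L =
      (∫ y in (0 : ℝ)..S, Complex.I * A.d * f (A.pt b y)) -
        ∫ y in (0 : ℝ)..S, Complex.I * A.d * f (A.pt a y) := by
    refine tendsto_nhds_unique (f := fun ε => (∫ t in Ioo a b, A.dir t * f (A.pt t S)) -
      ∫ t in Ioo a b, A.dir t * f (A.pt t ε)) (l := 𝓝[>] 0) (tendsto_const_nhds.sub hIp) ?_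
    refine ((hvlim S hSmem).mono_left nhdsWithin_le_nhds).congr' ?_
    filter_upwards [Ioo_mem_nhdsGT hS] with ε hε
    exact (A.integral_dir_sub_of_differentiableOn ha hb hab hε.2.le hV hf fun t ht y hy =>
      hVm t ht y ⟨by linarith [hy.1, hε.1], hy.2⟩ (hε.1.trans_le hy.1).ne').symm
  have eq2 : (∫ t in Ioo a b, A.dir t * f (A.pt t (-S))) - L =
      (∫ y in (0 : ℝ)..(-S), Complex.I * A.d * f (A.pt b y)) -
        ∫ y in (0 : ℝ)..(-S), Complex.I * A.d * f (A.pt a y) := by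
    refine tendsto_nhds_unique (f := fun ε => (∫ t in Ioo a b, A.dir t * f (A.pt t (-S))) -
      ∫ t in Ioo a b, A.dir t * f (A.pt t ε)) (l := 𝓝[<] 0) (tendsto_const_nhds.sub hIm) ?_
    refine ((hvlim (-S) hSmem').mono_left nhdsWithin_le_nhds).congr' ?_
    filter_upwards [Ioo_mem_nhdsLT (by linarith : -S < 0)] with ε hε
    have := A.integral_dir_sub_of_differentiableOn ha hb hab hε.1.le hV hf fun t ht y hy =>
      hVm t ht y ⟨hy.1, by linarith [hy.2, hε.2]⟩ (hy.2.trans_lt hε.2).ne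
    rw [intervalIntegral.integral_symm (-S) ε, intervalIntegral.integral_symm (-S) ε]
    linear_combination this
  have e3 : ∀ t ∈ Icc a b, ∫ y in -S..S, Complex.I * A.d * f (A.pt t y) =
      (∫ y in (0 : ℝ)..S, Complex.I * A.d * f (A.pt t y)) -
        ∫ y in (0 : ℝ)..(-S), Complex.I * A.d * f (A.pt t y) := fun t ht => by
    rw [intervalIntegral.integral_symm (-S) 0, sub_neg_eq_add, add_comm]
    exact (intervalIntegral.integral_add_adjacent_intervals (hvint t ht _ hSmem' _ h0mem)
        (hvint t ht _ h0mem _ hSmem)).symm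
  rw [rect, e3 a hamem, e3 b hbmem]
  linear_combination eq2 - eq1

end rectangle

end LocalArc

theorem log_I_mul {v : ℂ} (hv : 0 < v.re) :
    Complex.log (Complex.I * v) = Complex.log v + Real.pi / 2 * Complex.I := by
  have hv0 : v ≠ 0 := fun h => by simp [h] at hv
  have h1 := abs_lt.1 (Complex.abs_arg_lt_pi_div_two_iff.2 (Or.inl hv))
  rw [Complex.log_mul Complex.I_ne_zero hv0, Complex.log_I]
  · ring
  · rw [Complex.arg_I]
    exact ⟨by linarith [h1.1, Real.pi_pos], by linarith [h1.2]⟩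

theorem log_neg_I_mul {v : ℂ} (hv : 0 < v.re) :
    Complex.log (-Complex.I * v) = Complex.log v - Real.pi / 2 * Complex.I := by
  have hv0 : v ≠ 0 := fun h => by simp [h] at hv
  have h1 := abs_lt.1 (Complex.abs_arg_lt_pi_div_two_iff.2 (Or.inl hv))
  rw [Complex.log_mul (neg_ne_zero.2 Complex.I_ne_zero) hv0, Complex.log_neg_I]
  · ring
  · rw [Complex.arg_neg_I]
    exact ⟨by linarith [h1.1], by linarith [h1.2, Real.pi_pos]⟩

namespace LocalArc

variable (A : LocalArc J p)

/-- The winding number of the boundary of the rectangle around its inner points. -/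
theorem rect_inv {a b S : ℝ} (ha : A.l ≤ a) (hb : b ≤ A.r) {τ y₀ : ℝ} (hτ : τ ∈ Ioo a b)
    (hy₀ : y₀ ∈ Ioo (-S) S) :
    A.rect a b S (fun z => (z - A.pt τ y₀)⁻¹) = 2 * Real.pi * Complex.I := by
  have hab : a ≤ b := (hτ.1.trans hτ.2).le
  have hS : -S ≤ S := (hy₀.1.trans hy₀.2).le
  have hsub : Icc a b ⊆ Icc A.l A.r := Icc_subset_Icc ha hb
  have hd := A.d_ne
  have hτm := hsub (Ioo_subset_Icc_self hτ)
  set z₀ := A.pt τ y₀ with hz₀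
  have hlog : ∀ c z : ℂ, (z - z₀) / c ∈ Complex.slitPlane →
      HasDerivAt (fun z => Complex.log ((z - z₀) / c)) ((z - z₀)⁻¹) z := by
    intro c z hz
    have hne := Complex.slitPlane_ne_zero hz
    have h1 : z - z₀ ≠ 0 := fun h => hne (by simp [h])
    have h2 : c ≠ 0 := fun h => hne (by simp [h])
    have h3 := (((hasDerivAt_id z).sub_const z₀).div_const c).clog hz
    refine h3.congr_deriv ?_
    simp only [id]
    field_simp
  have hptc : ∀ y, ContinuousOn (fun t => A.pt t y) (Icc a b) := fun y =>
    A.continuousOn_uncurry_pt.comp (Continuous.prodMk_left y).continuousOn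
      fun t ht => ⟨hsub ht, mem_univ _⟩
  have hhor : ∀ (c : ℂ) (y : ℝ), (∀ t ∈ Icc a b, (A.pt t y - z₀) / c ∈ Complex.slitPlane) →
      ∫ t in Ioo a b, A.dir t * (A.pt t y - z₀)⁻¹ =
        Complex.log ((A.pt b y - z₀) / c) - Complex.log ((A.pt a y - z₀) / c) := fun c y h =>
    A.integral_dir_mul ha hb hab (F := fun z => Complex.log ((z - z₀) / c))
      (F' := fun z => (z - z₀)⁻¹) (fun t ht => hlog c _ (h t ht))
      (((hptc y).sub continuousOn_const).inv₀ fun t ht h0 =>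
        Complex.slitPlane_ne_zero (h t ht) (by rw [show A.pt t y - z₀ = 0 from h0, zero_div]))
  have hver : ∀ (c : ℂ) (t : ℝ), (∀ y ∈ Icc (-S) S, (A.pt t y - z₀) / c ∈ Complex.slitPlane) →
      ∫ y in -S..S, Complex.I * A.d * (A.pt t y - z₀)⁻¹ =
        Complex.log ((A.pt t S - z₀) / c) - Complex.log ((A.pt t (-S) - z₀) / c) := fun c t h =>
    A.integral_vert_mul hS (F := fun z => Complex.log ((z - z₀) / c))
      (F' := fun z => (z - z₀)⁻¹) (fun y hy => hlog c _ (h y hy))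
      (((A.continuous_pt t).continuousOn.sub continuousOn_const).inv₀ fun y hy h0 =>
        Complex.slitPlane_ne_zero (h y hy) (by rw [show A.pt t y - z₀ = 0 from h0, zero_div]))
  have hshift : ∀ t y, A.pt t y - z₀ = A.arc t - A.pt τ (y₀ - y) := by
    intro t y
    simp only [hz₀, pt]
    push_cast
    ring
  have hre : ∀ t y, ((A.pt t y - z₀) / A.d).re = ((A.arc t - A.arc τ) / A.d).re := by
    intro t y
    rw [hshift, pt_sub_div]
    simp
  have hpos : ∀ y, 0 < ((A.pt b y - z₀) / A.d).re := fun y => by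
    rw [hre]
    exact (mul_pos A.κ_pos (sub_pos.2 hτ.2)).trans_le
      (A.le_re_arc_sub hτm (hsub (right_mem_Icc.2 hab)) hτ.2.le)
  have hneg : ∀ y, 0 < ((A.pt a y - z₀) / (-A.d)).re := fun y => by
    rw [div_neg, Complex.neg_re, hre, ← Complex.neg_re, ← neg_div, neg_sub]
    exact (mul_pos A.κ_pos (sub_pos.2 hτ.1)).trans_le
      (A.le_re_arc_sub (hsub (left_mem_Icc.2 hab)) hτm hτ.1.le)
  have hbot := hhor (-(((1 : ℝ) : ℂ) * Complex.I * A.d)) (-S) fun t ht => by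
    rw [hshift]
    exact A.mem_slitPlane_of_side hτm (by linarith [hy₀.1]) t (hsub ht)
  have htop := hhor (-(((-1 : ℝ) : ℂ) * Complex.I * A.d)) S fun t ht => by
    rw [hshift]
    exact A.mem_slitPlane_of_side hτm (by linarith [hy₀.2]) t (hsub ht)
  have hright := hver A.d b fun y _ => Complex.mem_slitPlane_iff.2 (Or.inl (hpos y))
  have hleft := hver (-A.d) a fun y _ => Complex.mem_slitPlane_iff.2 (Or.inl (hneg y))
  have c1 : ∀ w : ℂ, w / (-(((1 : ℝ) : ℂ) * Complex.I * A.d)) = Complex.I * (w / A.d) := by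
    intro w
    have := Complex.I_ne_zero
    push_cast
    field_simp
    rw [Complex.I_sq]
    ring
  have c2 : ∀ w : ℂ, w / (-(((-1 : ℝ) : ℂ) * Complex.I * A.d)) = -Complex.I * (w / A.d) := by
    intro w
    have := Complex.I_ne_zero
    push_cast
    field_simp
    rw [Complex.I_sq]
    ring
  have c3 : ∀ w : ℂ, Complex.I * (w / A.d) = -Complex.I * (w / (-A.d)) := by
    intro w
    rw [div_neg]; ring
  have c4 : ∀ w : ℂ, -Complex.I * (w / A.d) = Complex.I * (w / (-A.d)) := by
    intro w
    rw [div_neg]; ring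
  rw [rect, hbot, htop, hright, hleft, c1, c1, c2, c2, c3 (A.pt a (-S) - z₀), c4 (A.pt a S - z₀),
    log_I_mul (hpos _), log_neg_I_mul (hpos _), log_I_mul (hneg _), log_neg_I_mul (hneg _)]
  ring

end LocalArc

end PiecewiseSmoothCurve

/-! ### Removable singularities along the curve -/

namespace PiecewiseSmoothCurve

open MeasureTheory

variable {J : PiecewiseSmoothCurve} {p : ℂ}

/-- Expansion of the integral of a difference quotient over a path that avoids the base point. -/
theorem integral_mul_slope {α : Type*} [MeasurableSpace α] {μ : Measure α} {w ψ : α → ℂ}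
    {g f : ℂ → ℂ} {z₀ : ℂ} {δ : ℝ} (hδ : 0 < δ) (hw : Integrable w μ)
    (hwg : Integrable (fun x => w x * g (ψ x)) μ) (hψ : AEStronglyMeasurable ψ μ)
    (h : ∀ᵐ x ∂μ, δ ≤ ‖ψ x - z₀‖) (hf : ∀ z, z ≠ z₀ → f z = (g z - g z₀) / (z - z₀)) :
    ∫ x, w x * f (ψ x) ∂μ =
      (∫ x, w x * g (ψ x) / (ψ x - z₀) ∂μ) - g z₀ * ∫ x, w x * (ψ x - z₀)⁻¹ ∂μ := by
  have hint : ∀ {φ : α → ℂ}, Integrable φ μ → Integrable (fun x => φ x / (ψ x - z₀)) μ := by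
    intro φ hφ
    refine (hφ.norm.div_const δ).mono' (hφ.aestronglyMeasurable.aemeasurable.div
      (hψ.aemeasurable.sub_const z₀)).aestronglyMeasurable ?_
    filter_upwards [h] with x hx
    rw [norm_div]
    gcongr
  have hw' : Integrable (fun x => w x * (ψ x - z₀)⁻¹) μ := by
    simpa only [div_eq_mul_inv] using hint hw
  rw [← integral_const_mul, ← integral_sub (hint hwg) (hw'.const_mul _)]
  refine integral_congr_ae ?_
  filter_upwards [h] with x hx
  have hne : ψ x ≠ z₀ := sub_ne_zero.1 (norm_pos_iff.1 (hδ.trans_le hx))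
  rw [hf _ hne]
  ring

namespace LocalArc

variable (A : LocalArc J p)

/-- Vertical approach to a smooth point of the arc is non-tangential. -/
theorem exists_tendsto_pt_sideCone {t : ℝ} (ht : t ∈ A.par) : ∃ δ > 0,
    Tendsto (A.pt t) (𝓝[>] 0) (J.sideCone 1 (A.π t) δ) ∧
      Tendsto (A.pt t) (𝓝[<] 0) (J.sideCone (-1) (A.π t) δ) := by
  have hd := A.d_ne
  have hsl := A.κ_pos.trans_le (A.slope ht)
  have hD0 : A.dir t ≠ 0 := fun h0 => by simp [h0] at hsl
  have hpos : 0 < (A.d / A.dir t).re := by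
    have : A.d / A.dir t = (A.dir t / A.d)⁻¹ := by rw [inv_div]
    rw [this, Complex.inv_re]
    exact div_pos hsl (Complex.normSq_pos.2 (div_ne_zero hD0 hd))
  have hdn : 0 < ‖A.d‖ := norm_pos_iff.2 hd
  set k := (A.d / A.dir t).re with hk
  have hc : Tendsto (A.pt t) (𝓝 0) (𝓝 (J.toFun (A.π t))) := by
    have := (A.continuous_pt t).tendsto 0
    rwa [A.pt_zero] at this
  have him : ∀ y : ℝ, ((A.pt t y - J.toFun (A.π t)) / deriv J.toFun (A.π t)).im = y * k := by
    intro y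
    have : (A.pt t y - J.toFun (A.π t)) / deriv J.toFun (A.π t) =
        (y : ℂ) * (Complex.I * (A.d / A.dir t)) := by
      change (A.arc t + Complex.I * y * A.d - A.arc t) / A.dir t = _
      ring
    rw [this, Complex.im_ofReal_mul, Complex.I_mul_im]
  have hno : ∀ y : ℝ, ‖A.pt t y - J.toFun (A.π t)‖ = |y| * ‖A.d‖ := by
    intro y
    change ‖A.arc t + Complex.I * y * A.d - A.arc t‖ = _
    rw [add_sub_cancel_left]
    simp
  have hhalf : k / (2 * ‖A.d‖) * ‖A.d‖ = k / 2 := by field_simp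
  refine ⟨k / (2 * ‖A.d‖), by positivity, tendsto_inf.2 ⟨hc.mono_left nhdsWithin_le_nhds,
    tendsto_principal.2 ?_⟩, tendsto_inf.2 ⟨hc.mono_left nhdsWithin_le_nhds,
    tendsto_principal.2 ?_⟩⟩
  · filter_upwards [self_mem_nhdsWithin] with y hy
    have hy' : 0 < y := hy
    change _ * ‖_‖ < 1 * (_ : ℂ).im
    rw [him, hno, abs_of_pos hy']
    nlinarith
  · filter_upwards [self_mem_nhdsWithin] with y hy
    have hy' : y < 0 := hy
    change _ * ‖_‖ < -1 * (_ : ℂ).im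
    rw [him, hno, abs_of_neg hy']
    nlinarith

end LocalArc

/-- Equality of the non-tangential boundary values from both sides. -/
def NoJump (J : PiecewiseSmoothCurve) (g : ℂ → ℂ) : Prop :=
  ∀ i < J.pieces, ∀ t ∈ Ioo (i : ℝ) (i + 1), ∃ G : ℂ, ∀ δ > 0,
    Tendsto g (J.sideCone 1 t δ) (𝓝 G) ∧ Tendsto g (J.sideCone (-1) t δ) (𝓝 G)

/-- A bounded function without jump extends holomorphically across the curve. -/
theorem exists_extension_interior {g : ℂ → ℂ} (hg : DifferentiableOn ℂ g J.carrierᶜ)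
    (hjump : J.NoJump g) (hp : p ∈ J.interior)
    (hbd : ∃ M : ℝ, ∀ᶠ z in 𝓝[J.carrierᶜ] p, ‖g z‖ ≤ M) :
    ∃ ε > 0, ∃ G : ℂ → ℂ, DifferentiableOn ℂ G (Metric.ball p ε) ∧
      ∀ z ∈ Metric.ball p ε, z ∉ J.carrier → g z = G z := by
  set A := localArc (interior_subset hp) with hA
  have h0 := A.zero_mem_Ioo hp
  obtain ⟨M, hM⟩ := hbd
  obtain ⟨η₀, hη₀, hη₀M⟩ := Metric.mem_nhdsWithin_iff.1 hM
  obtain ⟨K, hK, hle⟩ := A.exists_abs_le_norm_pt_sub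
  obtain ⟨L, hL0, hL⟩ := A.exists_lipschitz_arc
  have hd := A.d_ne
  have hdn : 0 < ‖A.d‖ := norm_pos_iff.2 hd
  set η := min η₀ A.ρ with hη
  have hη0 : 0 < η := lt_min hη₀ A.ρ_pos
  -- the rectangle
  set m := min (min (-A.l) A.r) (η / (4 * (L + 1))) with hm
  have hm0 : 0 < m := lt_min (lt_min (by linarith [h0.1]) h0.2) (by positivity)
  have hml : A.l ≤ -m := by
    have := (min_le_left _ (η / (4 * (L + 1)))).trans (min_le_left (-A.l) A.r)
    linarith
  have hmr : m ≤ A.r := (min_le_left _ (η / (4 * (L + 1)))).trans (min_le_right (-A.l) A.r)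
  have hmL : L * m ≤ η / 4 := by
    have h1 : m ≤ η / (4 * (L + 1)) := min_le_right _ _
    rw [le_div_iff₀ (by positivity)] at h1
    nlinarith
  set S := η / (4 * ‖A.d‖) with hS
  have hS0 : 0 < S := by positivity
  have hSd : S * ‖A.d‖ = η / 4 := by rw [hS]; field_simp
  have hsub : Icc (-m) m ⊆ Icc A.l A.r := Icc_subset_Icc hml hmr
  have hmm : -m ≤ m := by linarith
  have hball : ∀ t ∈ Icc (-m) m, ∀ y ∈ Icc (-S) S, A.pt t y ∈ Metric.ball p η := by
    intro t ht y hy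
    rw [Metric.mem_ball, dist_eq_norm]
    have h1 := hL t (hsub ht) 0 A.zero_mem
    rw [A.arc_zero, sub_zero] at h1
    have h2 : |t| ≤ m := abs_le.2 ht
    have h3 : |y| ≤ S := abs_le.2 hy
    have h4 : A.pt t y - p = (A.arc t - p) + Complex.I * y * A.d := by rw [LocalArc.pt]; ring
    have h5 := norm_add_le (A.arc t - p) (Complex.I * y * A.d)
    rw [← h4] at h5
    have h6 : ‖Complex.I * (y : ℂ) * A.d‖ = |y| * ‖A.d‖ := by simp
    have h7 := mul_le_mul_of_nonneg_left h2 hL0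
    have h8 := mul_le_mul_of_nonneg_right h3 hdn.le
    linarith
  set V := Metric.ball p η ∩ J.carrierᶜ with hV
  have hVo : IsOpen V := Metric.isOpen_ball.inter J.isClosed_carrier.isOpen_compl
  have hVg : DifferentiableOn ℂ g V := hg.mono inter_subset_right
  have hVM : ∀ z ∈ V, ‖g z‖ ≤ M := fun z hz =>
    hη₀M ⟨Metric.ball_subset_ball (min_le_left _ _) hz.1, hz.2⟩
  have hptV : ∀ t ∈ Icc (-m) m, ∀ y ∈ Icc (-S) S, y ≠ 0 → A.pt t y ∈ V := by
    intro t ht y hy hy0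
    have h1 := hball t ht y hy
    refine ⟨h1, A.pt_notMem (hsub ht) hy0 ?_⟩
    rw [Metric.mem_ball, dist_eq_norm] at h1
    exact h1.trans_le (min_le_right _ _)
  -- the four sides keep their distance from the neighbourhood of `p`
  obtain ⟨ε₀, hε₀, hε₀pt⟩ := Metric.eventually_nhds_iff.1 (A.eventually_exists_pt h0)
  rw [A.arc_zero] at hε₀pt
  set ε₁ := min m S / (2 * K) with hε₁
  have hε₁0 : 0 < ε₁ := by have := lt_min hm0 hS0; positivity
  have hε₁K : 2 * (K * ε₁) = min m S := by rw [hε₁]; field_simp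
  have hfar : ∀ t ∈ Icc (-m) m, ∀ y : ℝ, m ≤ |t| ∨ S ≤ |y| → ∀ z ∈ Metric.ball p ε₁,
      ε₁ ≤ ‖A.pt t y - z‖ := by
    intro t ht y h z hz
    rw [Metric.mem_ball, dist_eq_norm] at hz
    have h1 := hle t (hsub ht) 0 A.zero_mem y
    rw [A.arc_zero, sub_zero] at h1
    have h2 : min m S ≤ K * ‖A.pt t y - p‖ := by
      rcases h with h | h
      · exact (min_le_left _ _).trans (h.trans h1.1)
      · exact (min_le_right _ _).trans (h.trans h1.2)
    have h3 := norm_sub_le_norm_sub_add_norm_sub (A.pt t y) z p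
    rw [← hε₁K] at h2
    have h4 : 2 * ε₁ ≤ ‖A.pt t y - p‖ := by
      by_contra! hcon
      have := mul_lt_mul_of_pos_left hcon hK
      linarith
    linarith
  obtain ⟨B, hB0, hB⟩ := A.exists_bound_dir
  have hptcm : ∀ y, ContinuousOn (fun t => A.pt t y) (Ioo (-m) m) := fun y =>
    A.continuousOn_uncurry_pt.comp (Continuous.prodMk_left y).continuousOn
      fun t ht => ⟨hsub (Ioo_subset_Icc_self ht), mem_univ _⟩
  have hw1 : Integrable A.dir (volume.restrict (Ioo (-m) m)) := by
    refine Integrable.of_bound (C := B) A.measurable_dir.aestronglyMeasurable ?_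
    filter_upwards [ae_restrict_mem measurableSet_Ioo] with t ht using
      hB t (hsub (Ioo_subset_Icc_self ht))
  have hwg1 : ∀ y ∈ Icc (-S) S, y ≠ 0 →
      Integrable (fun t => A.dir t * g (A.pt t y)) (volume.restrict (Ioo (-m) m)) := by
    intro y hy hy0
    have hc : ContinuousOn (fun t => g (A.pt t y)) (Ioo (-m) m) :=
      hVg.continuousOn.comp (hptcm y) fun t ht => hptV t (Ioo_subset_Icc_self ht) y hy hy0
    refine Integrable.of_bound (C := B * M) (A.measurable_dir.aestronglyMeasurable.mul
      (hc.aestronglyMeasurable measurableSet_Ioo)) ?_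
    filter_upwards [ae_restrict_mem measurableSet_Ioo] with t ht
    have ht' := Ioo_subset_Icc_self ht
    rw [norm_mul]
    exact mul_le_mul (hB t (hsub ht')) (hVM _ (hptV t ht' y hy hy0)) (norm_nonneg _) hB0
  have hw2 : Integrable (fun _ : ℝ => Complex.I * A.d) (volume.restrict (Ioc (-S) S)) :=
    integrable_const _
  have hwg2 : ∀ t ∈ Icc (-m) m,
      Integrable (fun y => Complex.I * A.d * g (A.pt t y)) (volume.restrict (Ioc (-S) S)) := by
    intro t ht
    have hms : MeasurableSet (Ioc (-S) S \ {0}) :=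
      measurableSet_Ioc.diff (measurableSet_singleton 0)
    have hae : (Ioc (-S) S \ {0} : Set ℝ) =ᵐ[volume] Ioc (-S) S :=
      sdiff_ae_eq_self.2 (measure_mono_null inter_subset_right (by simp))
    rw [← Measure.restrict_congr_set hae]
    have hfin : IsFiniteMeasure ((volume : Measure ℝ).restrict (Ioc (-S) S \ {0})) := by
      rw [Measure.restrict_congr_set hae]; infer_instance
    have hc : ContinuousOn (fun y => Complex.I * A.d * g (A.pt t y)) (Ioc (-S) S \ {0}) :=
      continuousOn_const.mul (hVg.continuousOn.comp (A.continuous_pt t).continuousOn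
        fun y hy => hptV t ht y (Ioc_subset_Icc_self hy.1) hy.2)
    refine Integrable.of_bound (C := ‖Complex.I * A.d‖ * M) (hc.aestronglyMeasurable hms) ?_
    filter_upwards [ae_restrict_mem hms] with y hy
    rw [norm_mul]
    exact mul_le_mul_of_nonneg_left (hVM _ (hptV t ht y (Ioc_subset_Icc_self hy.1) hy.2))
      (norm_nonneg _)
  have hSS : -S ≤ S := by linarith
  have hSm : S ∈ Icc (-S) S := right_mem_Icc.2 hSS
  have hSm' : -S ∈ Icc (-S) S := left_mem_Icc.2 hSS
  have hmm' : m ∈ Icc (-m) m := right_mem_Icc.2 hmm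
  have hmm'' : -m ∈ Icc (-m) m := left_mem_Icc.2 hmm
  have far1 : ∀ y, S ≤ |y| → ∀ z ∈ Metric.ball p ε₁,
      ∀ᵐ t ∂(volume.restrict (Ioo (-m) m)), ε₁ ≤ ‖A.pt t y - z‖ := by
    intro y hy z hz
    filter_upwards [ae_restrict_mem measurableSet_Ioo] with t ht
    exact hfar t (Ioo_subset_Icc_self ht) y (Or.inr hy) z hz
  have far2 : ∀ t ∈ Icc (-m) m, m ≤ |t| → ∀ z ∈ Metric.ball p ε₁,
      ∀ᵐ y ∂(volume.restrict (Ioc (-S) S)), ε₁ ≤ ‖A.pt t y - z‖ := fun t ht htm z hz =>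
    Eventually.of_forall fun y => hfar t ht y (Or.inl htm) z hz
  have ψ1 : ∀ y, AEStronglyMeasurable (fun t => A.pt t y) (volume.restrict (Ioo (-m) m)) :=
    fun y => (hptcm y).aestronglyMeasurable measurableSet_Ioo
  have ψ2 : ∀ t, AEStronglyMeasurable (A.pt t) (volume.restrict (Ioc (-S) S)) :=
    fun t => (A.continuous_pt t).aestronglyMeasurable
  have aS : S ≤ |S| := le_abs_self S
  have aS' : S ≤ |(-S)| := by rw [abs_neg]; exact aS
  have am : m ≤ |m| := le_abs_self m
  have am' : m ≤ |(-m)| := by rw [abs_neg]; exact am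
  -- Cauchy's formula
  set G : ℂ → ℂ := fun z => (2 * Real.pi * Complex.I)⁻¹ *
    ((∫ t in Ioo (-m) m, A.dir t * g (A.pt t (-S)) / (A.pt t (-S) - z)) +
      (∫ y in Ioc (-S) S, Complex.I * A.d * g (A.pt m y) / (A.pt m y - z)) -
      (∫ t in Ioo (-m) m, A.dir t * g (A.pt t S) / (A.pt t S - z)) -
      ∫ y in Ioc (-S) S, Complex.I * A.d * g (A.pt (-m) y) / (A.pt (-m) y - z)) with hG
  refine ⟨min ε₀ (min ε₁ η), lt_min hε₀ (lt_min hε₁0 hη0), G, ?_, ?_⟩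
  · intro z hz
    have hz1 : z ∈ Metric.ball p ε₁ :=
      Metric.ball_subset_ball ((min_le_right _ _).trans (min_le_left _ _)) hz
    refine DifferentiableAt.differentiableWithinAt (DifferentiableAt.const_mul ?_ _)
    exact (((differentiableAt_cauchyIntegral (hwg1 _ hSm' (by linarith)) (ψ1 _) hε₁0
      (far1 _ aS' z hz1)).add
      (differentiableAt_cauchyIntegral (hwg2 _ hmm') (ψ2 _) hε₁0 (far2 _ hmm' am z hz1))).sub
      (differentiableAt_cauchyIntegral (hwg1 _ hSm (by linarith)) (ψ1 _) hε₁0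
      (far1 _ aS z hz1))).sub
      (differentiableAt_cauchyIntegral (hwg2 _ hmm'') (ψ2 _) hε₁0 (far2 _ hmm'' am' z hz1))
  · intro z₀ hz hzJ
    have hz1 : z₀ ∈ Metric.ball p ε₁ :=
      Metric.ball_subset_ball ((min_le_right _ _).trans (min_le_left _ _)) hz
    have hzV : z₀ ∈ V :=
      ⟨Metric.ball_subset_ball ((min_le_right _ _).trans (min_le_right _ _)) hz, hzJ⟩
    have hVn : V ∈ 𝓝 z₀ := hVo.mem_nhds hzV
    obtain ⟨τ, hτ, y₀, hzpt⟩ := hε₀pt (y := z₀) (Metric.ball_subset_ball (min_le_left _ _) hz)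
    have hcoord := hle τ (Ioo_subset_Icc_self hτ) 0 A.zero_mem y₀
    rw [← hzpt, A.arc_zero, sub_zero, ← dist_eq_norm] at hcoord
    have hlt : K * dist z₀ p < min m S := by
      have h1 := mul_lt_mul_of_pos_left (Metric.mem_ball.1 hz1) hK
      have h2 := lt_min hm0 hS0
      linarith
    have hτm : τ ∈ Ioo (-m) m := abs_lt.1 (hcoord.1.trans_lt (hlt.trans_le (min_le_left _ _)))
    have hy₀S : y₀ ∈ Ioo (-S) S := abs_lt.1 (hcoord.2.trans_lt (hlt.trans_le (min_le_right _ _)))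
    set f := dslope g z₀ with hf
    have hfne : ∀ z, z ≠ z₀ → f z = (g z - g z₀) / (z - z₀) := fun z hz => by
      rw [hf, dslope_of_ne _ hz, slope_def_field]
    have hfd : DifferentiableOn ℂ f V := (Complex.differentiableOn_dslope hVn).2 hVg
    -- the difference quotient is bounded
    obtain ⟨r, hr, hrb⟩ : ∃ r > 0, ∀ z, dist z z₀ < r → ‖f z‖ ≤ ‖f z₀‖ + 1 := by
      have hc : ContinuousAt f z₀ := (hfd.differentiableAt hVn).continuousAt
      exact Metric.eventually_nhds_iff.1 (hc.norm.tendsto.eventually_le_const (by linarith))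
    have hfM : ∀ z ∈ V, ‖f z‖ ≤ max (‖f z₀‖ + 1) (2 * M / r) := by
      intro z hz
      rcases lt_or_ge (dist z z₀) r with h | h
      · exact (hrb z h).trans (le_max_left _ _)
      · refine le_trans ?_ (le_max_right _ _)
        have hne : z ≠ z₀ := fun h1 => by rw [h1, dist_self] at h; linarith
        rw [hfne z hne, norm_div]
        rw [dist_eq_norm] at h
        have h1 := norm_sub_le (g z) (g z₀)
        have h2 := hVM z hz
        have h3 := hVM z₀ hzV
        have h4 : 0 ≤ M := (norm_nonneg _).trans h2
        gcongr
        linarith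
    have hrect := A.rect_eq_zero hml hmr hmm hS0 hVo hfd hptV
      (fun t ht y hy hy0 => hfM _ (hptV t ht y hy hy0)) (fun t ht ht0 => by
        have hpar : t ∈ A.par := ⟨⟨hml.trans_lt ht.1, ht.2.trans_le hmr⟩, ht0⟩
        obtain ⟨i, hi, hti⟩ := A.piece_of_par hpar
        obtain ⟨δ, hδ, hδ1, hδ2⟩ := A.exists_tendsto_pt_sideCone hpar
        obtain ⟨H, hH⟩ := hjump i hi _ hti
        have hne : A.arc t - z₀ ≠ 0 := sub_ne_zero.2 fun h => hzJ
          (h ▸ A.arc_mem (Ioo_subset_Icc_self hpar.1))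
        have hpt : Tendsto (A.pt t) (𝓝 0) (𝓝 (A.arc t)) := by
          have := (A.continuous_pt t).tendsto 0
          rwa [A.pt_zero] at this
        have hev : ∀ᶠ y in 𝓝 (0 : ℝ), (g (A.pt t y) - g z₀) / (A.pt t y - z₀) = f (A.pt t y) := by
          filter_upwards [hpt.eventually_ne (sub_ne_zero.1 hne)] with y hy
          exact (hfne _ hy).symm
        refine ⟨(H - g z₀) / (A.arc t - z₀), ?_, ?_⟩
        · exact ((((hH δ hδ).1.comp hδ1).sub_const _).div
            ((hpt.mono_left nhdsWithin_le_nhds).sub_const _) hne).congr'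
            (hev.filter_mono nhdsWithin_le_nhds)
        · exact ((((hH δ hδ).2.comp hδ2).sub_const _).div
            ((hpt.mono_left nhdsWithin_le_nhds).sub_const _) hne).congr'
            (hev.filter_mono nhdsWithin_le_nhds))
    have hwind := A.rect_inv hml hmr hτm hy₀S
    rw [← hzpt] at hwind
    rw [LocalArc.rect, intervalIntegral.integral_of_le hSS, intervalIntegral.integral_of_le hSS]
      at hrect hwind
    rw [integral_mul_slope hε₁0 hw1 (hwg1 _ hSm' (by linarith)) (ψ1 _) (far1 _ aS' z₀ hz1) hfne,
      integral_mul_slope hε₁0 hw2 (hwg2 _ hmm') (ψ2 _) (far2 _ hmm' am z₀ hz1) hfne,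
      integral_mul_slope hε₁0 hw1 (hwg1 _ hSm (by linarith)) (ψ1 _) (far1 _ aS z₀ hz1) hfne,
      integral_mul_slope hε₁0 hw2 (hwg2 _ hmm'') (ψ2 _) (far2 _ hmm'' am' z₀ hz1) hfne] at hrect
    have hpi : (2 * Real.pi * Complex.I : ℂ) ≠ 0 := Complex.two_pi_I_ne_zero
    rw [hG]
    simp only
    rw [eq_inv_mul_iff_mul_eq₀ hpi, ← hwind]
    linear_combination -hrect

end PiecewiseSmoothCurve

/-! ### Liouville's theorem for functions without jump -/

namespace PiecewiseSmoothCurve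

variable {J : PiecewiseSmoothCurve} {p : ℂ} {g : ℂ → ℂ}

/-- The curve has no inner points as a subset of the plane. -/
theorem neBot_nhdsWithin_compl (J : PiecewiseSmoothCurve) (z : ℂ) : (𝓝[J.carrierᶜ] z).NeBot := by
  by_cases hz : z ∈ J.carrier
  · set A := localArc hz
    have hc : Tendsto (A.pt 0) (𝓝 0) (𝓝 z) := by
      have := (A.continuous_pt 0).tendsto 0
      rwa [A.pt_zero, A.arc_zero] at this
    have ht : Tendsto (A.pt 0) (𝓝[>] 0) (𝓝[J.carrierᶜ] z) := by
      refine tendsto_nhdsWithin_iff.2 ⟨hc.mono_left nhdsWithin_le_nhds, ?_⟩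
      filter_upwards [(hc.eventually (Metric.ball_mem_nhds z A.ρ_pos)).filter_mono
        nhdsWithin_le_nhds, self_mem_nhdsWithin] with y hy hy0
      exact A.pt_notMem A.zero_mem (ne_of_gt hy0) (by simpa [dist_eq_norm] using hy)
    exact ht.neBot
  · rw [J.isClosed_carrier.isOpen_compl.nhdsWithin_eq hz]
    infer_instance

/-- Local holomorphic extendability of a function that is defined off the curve. -/
def ExtendsAt (J : PiecewiseSmoothCurve) (g : ℂ → ℂ) (p : ℂ) : Prop :=
  ∃ ε > 0, ∃ G : ℂ → ℂ, DifferentiableOn ℂ G (Metric.ball p ε) ∧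
    ∀ z ∈ Metric.ball p ε, z ∉ J.carrier → g z = G z

/-- The continuous extension of a function that is defined off the curve. -/
noncomputable def extend (J : PiecewiseSmoothCurve) (g : ℂ → ℂ) (z : ℂ) : ℂ :=
  limUnder (𝓝[J.carrierᶜ] z) g

theorem extend_eq_of_continuousAt {G : ℂ → ℂ} {z : ℂ} (hG : ContinuousAt G z)
    (h : ∀ᶠ w in 𝓝[J.carrierᶜ] z, g w = G w) : J.extend g z = G z := by
  have := J.neBot_nhdsWithin_compl z
  exact ((hG.tendsto.mono_left nhdsWithin_le_nhds).congr' (h.mono fun w hw => hw.symm)).limUnder_eq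

theorem extend_eq (hg : DifferentiableOn ℂ g J.carrierᶜ) {z : ℂ} (hz : z ∉ J.carrier) :
    J.extend g z = g z :=
  extend_eq_of_continuousAt
    (hg.differentiableAt (J.isClosed_carrier.isOpen_compl.mem_nhds hz)).continuousAt
    (Eventually.of_forall fun _ => rfl)

theorem ExtendsAt.differentiableAt_extend (h : J.ExtendsAt g p) :
    DifferentiableAt ℂ (J.extend g) p := by
  obtain ⟨ε, hε, G, hG, hgG⟩ := h
  have hd : ∀ z ∈ Metric.ball p ε, DifferentiableAt ℂ G z := fun z hz =>
    hG.differentiableAt (Metric.isOpen_ball.mem_nhds hz)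
  refine (hd p (Metric.mem_ball_self hε)).congr_of_eventuallyEq ?_
  filter_upwards [Metric.ball_mem_nhds p hε] with z hz
  refine extend_eq_of_continuousAt (hd z hz).continuousAt ?_
  filter_upwards [mem_nhdsWithin_of_mem_nhds (Metric.isOpen_ball.mem_nhds hz),
    self_mem_nhdsWithin] with w hw hwJ using hgG w hw hwJ

theorem extendsAt_of_notMem (hg : DifferentiableOn ℂ g J.carrierᶜ) (hp : p ∉ J.carrier) :
    J.ExtendsAt g p := by
  obtain ⟨ε, hε, hsub⟩ := Metric.isOpen_iff.1 J.isClosed_carrier.isOpen_compl p hp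
  exact ⟨ε, hε, g, hg.mono hsub, fun _ _ _ => rfl⟩

theorem finite_boundary (J : PiecewiseSmoothCurve) : J.boundary.Finite :=
  (Set.toFinite {J.toFun 0, J.toFun J.pieces}).subset fun _ hz => hz.2

theorem boundary_subset : J.boundary ⊆ J.carrier := by
  rintro z ⟨-, h | h⟩
  · exact ⟨0, ⟨le_rfl, J.pieces_pos'.le⟩, h.symm⟩
  · exact ⟨J.pieces, ⟨J.pieces_pos'.le, le_rfl⟩, h.symm⟩

/-- Singularities of logarithmic type at the end points are removable. -/
theorem extendsAt_of_mem_boundary (hg : DifferentiableOn ℂ g J.carrierᶜ)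
    (hint : ∀ q ∈ J.interior, J.ExtendsAt g q)
    (hO : g =O[𝓝[J.carrierᶜ] p] fun z => Real.log ‖z - p‖ ^ 2) : J.ExtendsAt g p := by
  obtain ⟨C, hC⟩ := hO.bound
  obtain ⟨r₁, hr₁, hr₁C⟩ := Metric.mem_nhdsWithin_iff.1 hC
  have hfin : (J.boundary \ {p}).Finite := J.finite_boundary.subset sdiff_subset
  obtain ⟨r₂, hr₂, hr₂b⟩ := Metric.isOpen_iff.1 hfin.isClosed.isOpen_compl p (fun h => h.2 rfl)
  set r := min r₁ r₂ with hr
  have hr0 : 0 < r := lt_min hr₁ hr₂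
  have hext : ∀ z ∈ Metric.ball p r, z ≠ p → DifferentiableAt ℂ (J.extend g) z := by
    intro z hz hzp
    refine ExtendsAt.differentiableAt_extend ?_
    by_cases hzJ : z ∈ J.carrier
    · refine hint z ⟨hzJ, fun hzb => ?_⟩
      exact hr₂b (Metric.ball_subset_ball (min_le_right _ _) hz) ⟨hzb, hzp⟩
    · exact extendsAt_of_notMem hg hzJ
  have hbound : ∀ z ∈ Metric.ball p r, z ≠ p →
      ‖J.extend g z‖ ≤ C * ‖Real.log ‖z - p‖ ^ 2‖ := by
    intro z hz hzp
    have := J.neBot_nhdsWithin_compl z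
    have hlog : ContinuousAt (fun w => C * ‖Real.log ‖w - p‖ ^ 2‖) z := by
      have h1 : ContinuousAt (fun w => ‖w - p‖) z := by fun_prop
      exact continuousAt_const.mul
        ((h1.log (norm_ne_zero_iff.2 (sub_ne_zero.2 hzp))).pow 2).norm
    refine le_of_tendsto_of_tendsto (b := 𝓝[J.carrierᶜ] z)
      ((hext z hz hzp).continuousAt.norm.tendsto.mono_left nhdsWithin_le_nhds)
      (hlog.tendsto.mono_left nhdsWithin_le_nhds) ?_
    filter_upwards [mem_nhdsWithin_of_mem_nhds (Metric.isOpen_ball.mem_nhds hz),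
      self_mem_nhdsWithin] with w hw hwJ
    rw [extend_eq hg hwJ]
    exact hr₁C ⟨Metric.ball_subset_ball (min_le_left _ _) hw, hwJ⟩
  have hnorm : Tendsto (fun z : ℂ => ‖z - p‖) (𝓝[≠] p) (𝓝[>] 0) := by
    refine tendsto_nhdsWithin_iff.2 ⟨?_, ?_⟩
    · have : Continuous fun z : ℂ => ‖z - p‖ := by fun_prop
      have h2 := this.tendsto p
      simp only [sub_self, norm_zero] at h2
      exact h2.mono_left nhdsWithin_le_nhds
    · filter_upwards [self_mem_nhdsWithin] with z hz
      exact norm_pos_iff.2 (sub_ne_zero.2 hz)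
  have ho1 : (fun z => Real.log ‖z - p‖ ^ 2) =o[𝓝[≠] p] fun z => (z - p)⁻¹ := by
    have h1 := (isLittleO_abs_log_rpow_rpow_nhdsGT_zero 2 (neg_one_lt_zero (R := ℝ))).comp_tendsto
      hnorm
    refine (h1.congr_left fun z => ?_).trans_isBigO ?_
    · simp only [Function.comp]
      rw [Real.rpow_two, sq_abs]
    · refine Asymptotics.IsBigO.of_bound 1 (Eventually.of_forall fun z => ?_)
      simp only [Function.comp]
      rw [Real.rpow_neg_one, norm_inv, norm_inv, norm_norm, one_mul]
  have ho2 : (fun z => J.extend g z - J.extend g p) =o[𝓝[≠] p] fun z => (z - p)⁻¹ := by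
    have hb : J.extend g =O[𝓝[≠] p] fun z => Real.log ‖z - p‖ ^ 2 := by
      refine Asymptotics.IsBigO.of_bound C ?_
      filter_upwards [mem_nhdsWithin_of_mem_nhds (Metric.ball_mem_nhds p hr0),
        self_mem_nhdsWithin] with z hz hzp using hbound z hz hzp
    have hone : (fun _ : ℂ => J.extend g p) =O[𝓝[≠] p] fun z => Real.log ‖z - p‖ ^ 2 := by
      refine Asymptotics.IsBigO.of_bound ‖J.extend g p‖ ?_
      filter_upwards [eventually_one_le_abs_log p] with z hz
      rw [norm_pow, Real.norm_eq_abs]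
      exact le_mul_of_one_le_right (norm_nonneg _) (one_le_pow₀ hz)
    exact (hb.sub hone).trans_isLittleO ho1
  have hfinal := Complex.differentiableOn_update_limUnder_of_isLittleO (c := p)
    (Metric.ball_mem_nhds p hr0) (fun z hz => (hext z hz.1 hz.2).differentiableWithinAt) ho2
  refine ⟨r, hr0, _, hfinal, fun z hz hzJ => ?_⟩
  rcases eq_or_ne z p with rfl | hne
  · -- if `p` is not on the curve, the update does not change the function at `p`
    have hc : ContinuousAt (J.extend g) z :=
      (extendsAt_of_notMem hg hzJ).differentiableAt_extend.continuousAt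
    rw [Function.update_self, (hc.tendsto.mono_left nhdsWithin_le_nhds).limUnder_eq,
      extend_eq hg hzJ]
  · rw [Function.update_of_ne hne, extend_eq hg hzJ]

/-- A function that is holomorphic off the curve, without jump, bounded near the inner points,
of logarithmic growth at the end points and with a limit at infinity is constant. -/
theorem eq_const_of_noJump (hg : DifferentiableOn ℂ g J.carrierᶜ) (hjump : J.NoJump g)
    (hbd : ∀ q ∈ J.interior, ∃ M : ℝ, ∀ᶠ z in 𝓝[J.carrierᶜ] q, ‖g z‖ ≤ M)
    (hend : ∀ q ∈ J.boundary, g =O[𝓝[J.carrierᶜ] q] fun z => Real.log ‖z - q‖ ^ 2) {c : ℂ}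
    (hinf : Tendsto g (Bornology.cobounded ℂ) (𝓝 c)) {z : ℂ} (hz : z ∉ J.carrier) : g z = c := by
  have hint : ∀ q ∈ J.interior, J.ExtendsAt g q := fun q hq =>
    exists_extension_interior hg hjump hq (hbd q hq)
  have hall : ∀ q, J.ExtendsAt g q := by
    intro q
    by_cases hq : q ∈ J.carrier
    · by_cases hqb : q ∈ J.boundary
      · exact extendsAt_of_mem_boundary hg hint (hend q hqb)
      · exact hint q ⟨hq, hqb⟩
    · exact extendsAt_of_notMem hg hq
  have hd : Differentiable ℂ (J.extend g) := fun q => (hall q).differentiableAt_extend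
  have hlim : Tendsto (J.extend g) (cocompact ℂ) (𝓝 c) := by
    rw [← Metric.cobounded_eq_cocompact]
    refine hinf.congr' ?_
    filter_upwards [Bornology.isBounded_def.1 J.isCompact_carrier.isBounded] with w hw
    exact (extend_eq hg hw).symm
  rw [← extend_eq hg hz]
  exact hd.apply_eq_of_tendsto_cocompact z hlim

variable {N : ℕ} {f e : Fin N → ℂ → ℂ}

/-- Every solution of the Riemann–Hilbert problem has the inverse
`I + ∫_J E_R(μ) F_Lᵀ(μ) / (μ - z) dμ`. -/
theorem IsRHPSolution.mul_rhpInverse (hf : ∀ a, J.IsSmooth (f a)) (he : ∀ a, J.IsSmooth (e a))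
    (hfe : ∀ z ∈ J.carrier, ∑ a, f a z * e a z = 0) {χ : ℂ → Matrix (Fin N) (Fin N) ℂ}
    (hχ : J.IsRHPSolution f e χ) {FL : Fin N → ℂ → ℂ} (hFL : J.IsLeftSolution f e FL) {z : ℂ}
    (hz : z ∉ J.carrier) : χ z * J.rhpInverse e FL z = 1 := by
  have hFH : ∀ i, J.IsHolder (FL i) := fun i => hFL.isHolder hf he hfe i
  have hh : ∀ i j, J.IsHolder fun w => FL j w * e i w := fun i j => (hFH j).mul (he i).isHolder
  obtain ⟨χp, χm, hχp, hχm, hχj⟩ := hχ.jump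
  obtain ⟨Mp, Mm, hMp, hMm, hMj⟩ := rhpInverse_jump hf he hfe hFH hFL.equation
  have hMd : ∀ i j, DifferentiableOn ℂ (fun z => J.rhpInverse e FL z i j) J.carrierᶜ := by
    rw [rhpInverse_eq]; exact cauchyEntry_differentiableOn hh
  have hMb : ∀ q ∈ J.interior, ∀ i j, ∃ M : ℝ, ∀ᶠ z in 𝓝[J.carrierᶜ] q,
      ‖J.rhpInverse e FL z i j‖ ≤ M := by
    rw [rhpInverse_eq]; exact fun q hq i j => cauchyEntry_bounded hh i j hq
  have hMe : ∀ q ∈ J.boundary, ∀ i j, (fun z => J.rhpInverse e FL z i j)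
      =O[𝓝[J.carrierᶜ] q] fun z => Real.log ‖z - q‖ := by
    rw [rhpInverse_eq]; exact fun q hq i j => cauchyEntry_endpoint hh i j (boundary_subset hq)
  have hMi : ∀ i j, (fun z => J.rhpInverse e FL z i j - (1 : Matrix (Fin N) (Fin N) ℂ) i j)
      =O[Bornology.cobounded ℂ] fun z => z⁻¹ := by
    rw [rhpInverse_eq]; exact cauchyEntry_infinity hh
  have hlim : ∀ {h : ℂ → ℂ} {c : ℂ}, (fun z => h z - c) =O[Bornology.cobounded ℂ] (fun z => z⁻¹) →
      Tendsto h (Bornology.cobounded ℂ) (𝓝 c) := by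
    intro h c hO
    have h1 := hO.trans_tendsto tendsto_inv₀_cobounded
    simpa using h1.add_const c
  ext i j
  refine eq_const_of_noJump (g := fun z => (χ z * J.rhpInverse e FL z) i j) ?_ ?_ ?_ ?_ ?_ hz
  · simp only [Matrix.mul_apply]
    exact DifferentiableOn.fun_sum fun k _ => (hχ.holomorphic i k).mul (hMd k j)
  · intro k hk t ht
    have hmem := toFun_mem_interior hk ht
    refine ⟨(χp (J.toFun t) * Mp (J.toFun t)) i j, fun δ hδ => ?_⟩
    have hentry : ∀ {l : Filter ℂ} {X Y : Matrix (Fin N) (Fin N) ℂ}, Tendsto χ l (𝓝 X) →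
        Tendsto (J.rhpInverse e FL) l (𝓝 Y) →
        Tendsto (fun z => (χ z * J.rhpInverse e FL z) i j) l (𝓝 ((X * Y) i j)) := by
      intro l X Y hX hY
      exact tendsto_pi_nhds.1 (tendsto_pi_nhds.1 (hX.mul hY) i) j
    have hpm : χp (J.toFun t) * Mp (J.toFun t) = χm (J.toFun t) * Mm (J.toFun t) := by
      rw [hχj _ hmem, hMj _ hmem, Matrix.mul_assoc]
    refine ⟨hentry (hχp.2 k hk t ht δ hδ) (hMp.2 k hk t ht δ hδ), ?_⟩
    rw [hpm]
    exact hentry (hχm.2 k hk t ht δ hδ) (hMm.2 k hk t ht δ hδ)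
  · intro q hq
    choose B hB using fun k => hχ.bounded q hq i k
    choose D hD using fun k => hMb q hq k j
    refine ⟨∑ k, B k * D k, ?_⟩
    filter_upwards [eventually_all.2 hB, eventually_all.2 hD] with w hw1 hw2
    rw [Matrix.mul_apply]
    refine norm_sum_le_of_le _ fun k _ => ?_
    rw [norm_mul]
    exact mul_le_mul (hw1 k) (hw2 k) (norm_nonneg _) ((norm_nonneg _).trans (hw1 k))
  · intro q hq
    simp only [Matrix.mul_apply, sq]
    exact Asymptotics.IsBigO.fun_sum fun k _ => (hχ.endpoints q hq i k).mul (hMe q hq k j)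
  · have h1 : (1 : Matrix (Fin N) (Fin N) ℂ) i j =
        ∑ k, (1 : Matrix (Fin N) (Fin N) ℂ) i k * (1 : Matrix (Fin N) (Fin N) ℂ) k j := by
      rw [← Matrix.mul_apply, Matrix.mul_one]
    rw [h1]
    simp only [Matrix.mul_apply]
    exact tendsto_finsetSum _ fun k _ => (hlim (hχ.infinity i k)).mul (hlim (hMi k j))

/-- Uniqueness for the Riemann–Hilbert problem. -/
theorem IsRHPSolution.eqOn (hf : ∀ a, J.IsSmooth (f a)) (he : ∀ a, J.IsSmooth (e a))
    (hfe : ∀ z ∈ J.carrier, ∑ a, f a z * e a z = 0) {χ χ' : ℂ → Matrix (Fin N) (Fin N) ℂ}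
    (hχ : J.IsRHPSolution f e χ) (hχ' : J.IsRHPSolution f e χ') {FL : Fin N → ℂ → ℂ}
    (hFL : J.IsLeftSolution f e FL) : EqOn χ' χ J.carrierᶜ := by
  intro z hz
  have h1 := hχ.mul_rhpInverse hf he hfe hFL hz
  have h2 := hχ'.mul_rhpInverse hf he hfe hFL hz
  exact left_inv_eq_right_inv h2 (mul_eq_one_comm.1 h1)

end PiecewiseSmoothCurve

/-! ### The factorization of the Fredholm determinant -/

namespace PiecewiseSmoothCurve

open MeasureTheory

variable {J : PiecewiseSmoothCurve} {N : ℕ} {f e : Fin N → ℂ → ℂ}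

theorem contourIntegral_congr {g h : ℂ → ℂ} (H : EqOn g h J.carrier) :
    J.contourIntegral g = J.contourIntegral h :=
  setIntegral_congr_fun measurableSet_Icc fun t ht =>
    congrArg (· * deriv J.toFun t) (H ⟨t, ht, rfl⟩)

theorem integrable_comp_path_mul_vel {g : ℂ → ℂ} {C : ℝ}
    (hg : Fredholm.BddFun (fun t => g (J.path t)) C) :
    Integrable (fun t => g (J.path t) * J.vel t) J.parMeasure := by
  obtain ⟨M, -, hM⟩ := J.exists_bound_vel
  exact (hg.mul ⟨J.measurable_vel, hM⟩).integrable

theorem contourIntegral_add {g h : ℂ → ℂ} {C D : ℝ}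
    (hg : Fredholm.BddFun (fun t => g (J.path t)) C)
    (hh : Fredholm.BddFun (fun t => h (J.path t)) D) :
    J.contourIntegral (fun w => g w + h w) = J.contourIntegral g + J.contourIntegral h := by
  simp only [contourIntegral_eq, add_mul]
  exact integral_add (integrable_comp_path_mul_vel hg) (integrable_comp_path_mul_vel hh)

theorem contourIntegral_const_mul (c : ℂ) (g : ℂ → ℂ) :
    J.contourIntegral (fun w => c * g w) = c * J.contourIntegral g := by
  simp only [contourIntegral, mul_assoc]
  exact integral_const_mul _ _

theorem contourIntegral_sum_mul {ι : Type*} (s : Finset ι) {g : ι → ℂ → ℂ} {C : ι → ℝ} (c : ι → ℂ)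
    (hg : ∀ k, Fredholm.BddFun (fun t => g k (J.path t)) (C k)) :
    J.contourIntegral (fun w => ∑ k ∈ s, c k * g k w) =
      ∑ k ∈ s, c k * J.contourIntegral (g k) := by
  simp only [contourIntegral_eq, Finset.sum_mul, mul_assoc]
  rw [integral_finsetSum]
  · simp only [integral_const_mul]
  · exact fun k _ => (integrable_comp_path_mul_vel (hg k)).const_mul _

theorem integrableKernel_mul_sub (hfe : ∀ z ∈ J.carrier, ∑ a, f a z * e a z = 0) {z : ℂ}
    (hz : z ∈ J.carrier) (w : ℂ) :
    J.integrableKernel f e z w * (z - w) = ∑ a, f a z * e a w := by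
  by_cases h : z = w
  · rw [← h, sub_self, mul_zero, hfe z hz]
  · rw [integrableKernel, if_neg h, div_mul_cancel₀ _ (sub_ne_zero.2 h)]

theorem exists_bddFun_integrableKernel (hf : ∀ a, J.IsSmooth (f a)) (he : ∀ a, J.IsSmooth (e a))
    (hfe : ∀ z ∈ J.carrier, ∑ a, f a z * e a z = 0) {z : ℂ} (hz : z ∈ J.carrier) :
    ∃ C, Fredholm.BddFun (fun t => J.integrableKernel f e z (J.path t)) C := by
  obtain ⟨⟨C, hC⟩, hm⟩ := exists_bddKernel_integrableKernel hf he hfe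
  obtain ⟨s, hs, rfl⟩ := hz
  refine ⟨C, ?_, fun t => hC _ ⟨s, hs, rfl⟩ _ (J.path_mem t)⟩
  rw [← path_eq hs]
  exact hm.comp (measurable_const.prodMk measurable_id)

/-- The operator `I + Ṽ` maps `F_L(·) / (· - w)` to `Mᵀ(w) E_L(·) / (· - w)`, where `M` is the
inverse of the solution of the Riemann–Hilbert problem. -/
theorem IsLeftSolution.add_contourIntegral_div (hf : ∀ a, J.IsSmooth (f a))
    (he : ∀ a, J.IsSmooth (e a)) (hfe : ∀ z ∈ J.carrier, ∑ a, f a z * e a z = 0)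
    {F : Fin N → ℂ → ℂ} (hF : J.IsLeftSolution f e F) (k : Fin N) {z w : ℂ} (hz : z ∈ J.carrier)
    (hw : w ∉ J.carrier) :
    F k z / (z - w) + J.contourIntegral (fun μ => J.integrableKernel f e z μ * (F k μ / (μ - w))) =
      (∑ a, f a z * J.rhpInverse e F w a k) / (z - w) := by
  have hne : ∀ μ ∈ J.carrier, μ - w ≠ 0 := fun μ hμ h => hw (sub_eq_zero.1 h ▸ hμ)
  obtain ⟨C, hC⟩ := exists_bddFun_integrableKernel hf he hfe hz
  obtain ⟨D, hD⟩ := exists_bddFun_comp_path (hF.continuousOn k)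
  have hc : ∀ a, ∃ C, Fredholm.BddFun (fun t => F k (J.path t) * e a (J.path t) / (J.path t - w)) C :=
    fun a => exists_bddFun_comp_path (b := fun μ => F k μ * e a μ / (μ - w))
      (((hF.continuousOn k).mul (he a).continuousOn).div
        (continuousOn_id.sub continuousOn_const) hne)
  choose B hB using hc
  have hsum : ∃ C, Fredholm.BddFun (fun t => ∑ a, (z - w)⁻¹ * f a z *
      (F k (J.path t) * e a (J.path t) / (J.path t - w))) C :=
    exists_bddFun_comp_path (b := fun μ => ∑ a, (z - w)⁻¹ * f a z * (F k μ * e a μ / (μ - w)))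
      (continuousOn_finsetSum _ fun a _ => continuousOn_const.mul
        (((hF.continuousOn k).mul (he a).continuousOn).div
          (continuousOn_id.sub continuousOn_const) hne))
  obtain ⟨E, hE⟩ := hsum
  -- partial fractions for `1 / ((z - μ) (μ - w))`
  have hpf : EqOn (fun μ => J.integrableKernel f e z μ * (F k μ / (μ - w)))
      (fun μ => (z - w)⁻¹ * (J.integrableKernel f e z μ * F k μ) +
        ∑ a, (z - w)⁻¹ * f a z * (F k μ * e a μ / (μ - w))) J.carrier := by
    intro μ hμ
    have h1 := integrableKernel_mul_sub hfe hz μ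
    have h2 : ∑ a, (z - w)⁻¹ * f a z * (F k μ * e a μ / (μ - w)) =
        (z - w)⁻¹ * F k μ / (μ - w) * ∑ a, f a z * e a μ := by
      rw [Finset.mul_sum]
      exact Finset.sum_congr rfl fun a _ => by ring
    have h3 := hne μ hμ
    have h4 := hne z hz
    simp only
    rw [h2, ← h1]
    field_simp
    ring
  have heq := hF.equation k z hz
  rw [contourIntegral_congr hpf, contourIntegral_add ((hC.mul hD).const_mul _) hE,
    contourIntegral_const_mul, contourIntegral_sum_mul _ _ hB, eq_sub_of_add_eq' heq]
  have hM : ∑ a, f a z * J.rhpInverse e F w a k =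
      f k z + ∑ a, f a z * J.contourIntegral (fun μ => F k μ * e a μ / (μ - w)) := by
    unfold rhpInverse cauchy
    simp only [Matrix.add_apply, Matrix.of_apply, mul_add, Finset.sum_add_distrib]
    simp [Matrix.one_apply]
  rw [hM, add_div, Finset.sum_div, div_eq_mul_inv, div_eq_mul_inv]
  have h5 : ∑ a, (z - w)⁻¹ * f a z * J.contourIntegral (fun μ => F k μ * e a μ / (μ - w)) =
      ∑ a, f a z * J.contourIntegral (fun μ => F k μ * e a μ / (μ - w)) / (z - w) :=
    Finset.sum_congr rfl fun a _ => by rw [div_eq_mul_inv]; ring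
  rw [h5]
  ring

variable {γ : Fin N → ℂ} {c : Fin N → ℝ} {v : Fin N → Fin N}

/-- The part of the kernel with shifts that is not the integrable kernel. -/
noncomputable def shiftPart (f e : Fin N → ℂ → ℂ) (γ : Fin N → ℂ) (c : Fin N → ℝ)
    (v : Fin N → Fin N) (z w : ℂ) : ℂ :=
  -∑ a, γ a * (f a z * e (v a) w / (z - w + Complex.I * c a))

theorem shiftKernel_eq (z w : ℂ) : J.shiftKernel f e γ c v z w =
    J.integrableKernel f e z w + shiftPart f e γ c v z w := by
  rw [shiftKernel, shiftPart, sub_eq_add_neg]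

theorem factorKernel_eq (χ : ℂ → Matrix (Fin N) (Fin N) ℂ) (F : Fin N → ℂ → ℂ) (z w : ℂ) :
    factorKernel e γ c v χ F z w = ∑ n, -(γ n * e (v n) w) *
      ∑ k, χ (w - Complex.I * c n) k n * (F k z / (z - (w - Complex.I * c n))) := by
  rw [factorKernel, ← Finset.sum_neg_distrib]
  refine Finset.sum_congr rfl fun n _ => ?_
  rw [Matrix.mulVec_single_one, single_one_dotProduct, dotProduct]
  simp only [Matrix.col_apply]
  have h1 : ∑ k, χ (w - Complex.I * c n) k n * (F k z / (z - (w - Complex.I * c n))) =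
      (∑ k, F k z * χ (w - Complex.I * c n) k n) / (z - w + Complex.I * c n) := by
    rw [Finset.sum_div]
    refine Finset.sum_congr rfl fun k _ => ?_
    rw [sub_sub_eq_add_sub, add_sub_right_comm]
    ring
  rw [h1]
  ring

/-- The integral equation `(I + Ṽ) W = V - Ṽ` for the kernel `W`. -/
theorem factorKernel_add_contourIntegral (hf : ∀ a, J.IsSmooth (f a)) (he : ∀ a, J.IsSmooth (e a))
    (hfe : ∀ z ∈ J.carrier, ∑ a, f a z * e a z = 0)
    (hshift : ∀ a, ∀ z ∈ J.carrier, ∀ w ∈ J.carrier, z - w + Complex.I * c a ≠ 0)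
    {χ : ℂ → Matrix (Fin N) (Fin N) ℂ} (hχ : J.IsRHPSolution f e χ)
    {F : Fin N → ℂ → ℂ} (hF : J.IsLeftSolution f e F) {z w : ℂ} (hz : z ∈ J.carrier)
    (hw : w ∈ J.carrier) :
    factorKernel e γ c v χ F z w + J.contourIntegral
      (fun μ => J.integrableKernel f e z μ * factorKernel e γ c v χ F μ w) =
      shiftPart f e γ c v z w := by
  have hout : ∀ n, w - Complex.I * c n ∉ J.carrier := fun n h =>
    hshift n _ h w hw (by ring)
  obtain ⟨C, hC⟩ := exists_bddFun_integrableKernel hf he hfe hz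
  have hB : ∀ n k, ∃ B, Fredholm.BddFun (fun t => F k (J.path t) /
      (J.path t - (w - Complex.I * c n))) B := fun n k =>
    exists_bddFun_comp_path (b := fun μ => F k μ / (μ - (w - Complex.I * c n)))
      ((hF.continuousOn k).div (continuousOn_id.sub continuousOn_const)
        fun μ hμ h => hout n (sub_eq_zero.1 h ▸ hμ))
  choose B hB using hB
  have h1 : (fun μ => J.integrableKernel f e z μ * factorKernel e γ c v χ F μ w) =
      fun μ => ∑ q : Fin N × Fin N, (-(γ q.1 * e (v q.1) w) * χ (w - Complex.I * c q.1) q.2 q.1) *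
        (J.integrableKernel f e z μ * (F q.2 μ / (μ - (w - Complex.I * c q.1)))) := by
    funext μ
    rw [factorKernel_eq, Fintype.sum_prod_type, Finset.mul_sum]
    refine Finset.sum_congr rfl fun n _ => ?_
    rw [Finset.mul_sum, Finset.mul_sum]
    exact Finset.sum_congr rfl fun k _ => by ring
  rw [h1, contourIntegral_sum_mul Finset.univ
    (g := fun (q : Fin N × Fin N) μ => J.integrableKernel f e z μ *
      (F q.2 μ / (μ - (w - Complex.I * c q.1)))) _ fun q => hC.mul (hB q.1 q.2),
    Fintype.sum_prod_type, factorKernel_eq, ← Finset.sum_add_distrib, shiftPart,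
    ← Finset.sum_neg_distrib]
  refine Finset.sum_congr rfl fun n _ => ?_
  have h2 : -(γ n * e (v n) w) *
      ∑ k, χ (w - Complex.I * c n) k n * (F k z / (z - (w - Complex.I * c n))) +
      ∑ k, -(γ n * e (v n) w) * χ (w - Complex.I * c n) k n *
        J.contourIntegral (fun μ => J.integrableKernel f e z μ *
          (F k μ / (μ - (w - Complex.I * c n)))) =
      -(γ n * e (v n) w) * ∑ k, (∑ a, f a z * J.rhpInverse e F (w - Complex.I * c n) a k) /
        (z - (w - Complex.I * c n)) * χ (w - Complex.I * c n) k n := by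
    rw [Finset.mul_sum, Finset.mul_sum, ← Finset.sum_add_distrib]
    refine Finset.sum_congr rfl fun k _ => ?_
    rw [← hF.add_contourIntegral_div hf he hfe k hz (hout n)]
    ring
  have h3 : J.rhpInverse e F (w - Complex.I * c n) * χ (w - Complex.I * c n) = 1 :=
    mul_eq_one_comm.1 (hχ.mul_rhpInverse hf he hfe hF (hout n))
  have h4 : ∑ k, (∑ a, f a z * J.rhpInverse e F (w - Complex.I * c n) a k) /
        (z - (w - Complex.I * c n)) * χ (w - Complex.I * c n) k n =
      f n z / (z - (w - Complex.I * c n)) := by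
    have h5 : ∑ k, (∑ a, f a z * J.rhpInverse e F (w - Complex.I * c n) a k) *
        χ (w - Complex.I * c n) k n = f n z := by
      simp only [Finset.sum_mul]
      rw [Finset.sum_comm]
      simp only [mul_assoc, ← Finset.mul_sum, ← Matrix.mul_apply, h3]
      simp [Matrix.one_apply]
    simp only [div_mul_eq_mul_div]
    rw [← Finset.sum_div, h5]
  rw [h2, h4, sub_sub_eq_add_sub, add_sub_right_comm]
  ring

theorem continuousOn_shiftPart (hf : ∀ a, J.IsSmooth (f a)) (he : ∀ a, J.IsSmooth (e a))
    (hshift : ∀ a, ∀ z ∈ J.carrier, ∀ w ∈ J.carrier, z - w + Complex.I * c a ≠ 0) :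
    ContinuousOn (Function.uncurry (shiftPart f e γ c v)) (J.carrier ×ˢ J.carrier) := by
  unfold shiftPart Function.uncurry
  refine (continuousOn_finsetSum _ fun a _ => continuousOn_const.mul (ContinuousOn.div
    (((hf a).continuousOn.comp continuousOn_fst fun q hq => hq.1).mul
      ((he (v a)).continuousOn.comp continuousOn_snd fun q hq => hq.2)) ?_
    fun q hq => hshift a _ hq.1 _ hq.2)).neg
  fun_prop

theorem continuousOn_factorKernel (he : ∀ a, J.IsSmooth (e a))
    (hshift : ∀ a, ∀ z ∈ J.carrier, ∀ w ∈ J.carrier, z - w + Complex.I * c a ≠ 0)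
    {χ : ℂ → Matrix (Fin N) (Fin N) ℂ} (hχ : J.IsRHPSolution f e χ)
    {F : Fin N → ℂ → ℂ} (hF : J.IsLeftSolution f e F) :
    ContinuousOn (Function.uncurry (factorKernel e γ c v χ F)) (J.carrier ×ˢ J.carrier) := by
  unfold Function.uncurry
  simp only [factorKernel_eq]
  refine continuousOn_finsetSum _ fun n _ => ContinuousOn.mul (continuousOn_const.mul
    ((he (v n)).continuousOn.comp continuousOn_snd fun q hq => hq.2)).neg
    (continuousOn_finsetSum _ fun k _ => ContinuousOn.mul ?_ (ContinuousOn.div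
      ((hF.continuousOn k).comp continuousOn_fst fun q hq => hq.1) ?_ fun q hq h => ?_))
  · refine (hχ.holomorphic k n).continuousOn.comp (f := fun q : ℂ × ℂ => q.2 - Complex.I * c n)
      (by fun_prop) fun q hq h => ?_
    exact hshift n _ h _ hq.2 (by ring)
  · fun_prop
  · refine hshift n _ hq.1 _ hq.2 ?_
    rw [← h]; ring

theorem exists_isLeftSolution (hf : ∀ a, J.IsSmooth (f a)) (he : ∀ a, J.IsSmooth (e a))
    (hfe : ∀ z ∈ J.carrier, ∑ a, f a z * e a z = 0)
    (hdet : J.fredholmDet (J.integrableKernel f e) ≠ 0) : ∃ F, J.IsLeftSolution f e F := by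
  choose F hF hFeq using fun i => exists_solution_equation hf he hfe hdet (hf i)
  exact ⟨F, fun a => (hF a).continuousOn, hFeq⟩

theorem exists_isRHPSolution (hf : ∀ a, J.IsSmooth (f a)) (he : ∀ a, J.IsSmooth (e a))
    (hfe : ∀ z ∈ J.carrier, ∑ a, f a z * e a z = 0)
    (hdet : J.fredholmDet (J.integrableKernel f e) ≠ 0) : ∃ χ, J.IsRHPSolution f e χ := by
  choose F hF hFeq using fun i => exists_transposed_solution hf he hfe hdet (he i)
  exact ⟨_, isRHPSolution_rhpMatrix hf he hfe hF hFeq⟩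

theorem pull_shiftKernel : J.pull (J.shiftKernel f e γ c v) = fun s t =>
    J.pull (J.integrableKernel f e) s t + J.pull (shiftPart f e γ c v) s t := by
  funext s t
  simp only [pull, shiftKernel_eq, add_mul]

theorem fredholmConverges_shiftKernel (hf : ∀ a, J.IsSmooth (f a)) (he : ∀ a, J.IsSmooth (e a))
    (hfe : ∀ z ∈ J.carrier, ∑ a, f a z * e a z = 0)
    (hshift : ∀ a, ∀ z ∈ J.carrier, ∀ w ∈ J.carrier, z - w + Complex.I * c a ≠ 0) :
    J.FredholmConverges (J.shiftKernel f e γ c v) := by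
  obtain ⟨⟨M, hM⟩, -⟩ := exists_bddKernel_pull_integrableKernel hf he hfe
  obtain ⟨M', hM'⟩ := exists_bddKernel_of_continuousOn
    (continuousOn_shiftPart (γ := γ) (v := v) hf he hshift)
  have h1 := hM.add_smul hM' (le_refl ‖(1 : ℂ)‖)
  simp only [one_mul] at h1
  rw [← pull_shiftKernel] at h1
  exact fredholmConverges_of_bddKernel h1

theorem fredholmConverges_factorKernel (he : ∀ a, J.IsSmooth (e a))
    (hshift : ∀ a, ∀ z ∈ J.carrier, ∀ w ∈ J.carrier, z - w + Complex.I * c a ≠ 0)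
    {χ : ℂ → Matrix (Fin N) (Fin N) ℂ} (hχ : J.IsRHPSolution f e χ)
    {F : Fin N → ℂ → ℂ} (hF : J.IsLeftSolution f e F) :
    J.FredholmConverges (factorKernel e γ c v χ F) := by
  obtain ⟨M, hM⟩ := exists_bddKernel_of_continuousOn
    (continuousOn_factorKernel (γ := γ) (v := v) he hshift hχ hF)
  exact fredholmConverges_of_bddKernel hM

theorem fredholmDet_shiftKernel (hf : ∀ a, J.IsSmooth (f a)) (he : ∀ a, J.IsSmooth (e a))
    (hfe : ∀ z ∈ J.carrier, ∑ a, f a z * e a z = 0)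
    (hshift : ∀ a, ∀ z ∈ J.carrier, ∀ w ∈ J.carrier, z - w + Complex.I * c a ≠ 0)
    (hdet : J.fredholmDet (J.integrableKernel f e) ≠ 0)
    {χ : ℂ → Matrix (Fin N) (Fin N) ℂ} (hχ : J.IsRHPSolution f e χ)
    {F : Fin N → ℂ → ℂ} (hF : J.IsLeftSolution f e F) :
    J.fredholmDet (J.shiftKernel f e γ c v) =
      J.fredholmDet (J.integrableKernel f e) * J.fredholmDet (factorKernel e γ c v χ F) := by
  obtain ⟨⟨M, hM⟩, -⟩ := exists_bddKernel_pull_integrableKernel hf he hfe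
  obtain ⟨M', hM'⟩ := exists_bddKernel_of_continuousOn
    (continuousOn_shiftPart (γ := γ) (v := v) hf he hshift)
  obtain ⟨M'', hM''⟩ := exists_bddKernel_of_continuousOn
    (continuousOn_factorKernel (γ := γ) (v := v) he hshift hχ hF)
  rw [fredholmDet_eq] at hdet
  rw [fredholmDet_eq, fredholmDet_eq, fredholmDet_eq, pull_shiftKernel]
  refine Fredholm.fdet_add_eq_mul hM hM' hM'' hdet fun s t => ?_
  have h1 := factorKernel_add_contourIntegral (γ := γ) (v := v) hf he hfe hshift hχ hF
    (J.path_mem s) (J.path_mem t)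
  simp only [pull]
  rw [← h1, contourIntegral_eq, add_mul, ← integral_mul_const]
  congr 1
  refine integral_congr_ae (Eventually.of_forall fun r => ?_)
  simp only
  ring

end PiecewiseSmoothCurve

theorem mainTheorem2 (J : PiecewiseSmoothCurve) (N : ℕ) (f e : Fin N → ℂ → ℂ)
    (hf : ∀ a, J.IsSmooth (f a)) (he : ∀ a, J.IsSmooth (e a))
    (hfe : ∀ z ∈ J.carrier, ∑ a, f a z * e a z = 0)
    (γ : Fin N → ℂ) (c : Fin N → ℝ) (hc : ∀ a, c a ≠ 0) (v : Fin N → Fin N)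
    (hshift : ∀ a, ∀ z ∈ J.carrier, ∀ w ∈ J.carrier, z - w + Complex.I * c a ≠ 0)
    (hdet : J.fredholmDet (J.integrableKernel f e) ≠ 0) :
    (∃ χ, J.IsRHPSolution f e χ ∧
      ∀ χ', J.IsRHPSolution f e χ' → Set.EqOn χ' χ J.carrierᶜ) ∧
    (∃ F, J.IsLeftSolution f e F ∧
      ∀ F', J.IsLeftSolution f e F' → ∀ a, Set.EqOn (F' a) (F a) J.carrier) ∧
    J.FredholmConverges (J.integrableKernel f e) ∧
    J.FredholmConverges (J.shiftKernel f e γ c v) ∧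
    ∀ χ F, J.IsRHPSolution f e χ → J.IsLeftSolution f e F →
      J.FredholmConverges (PiecewiseSmoothCurve.factorKernel e γ c v χ F) ∧
      J.fredholmDet (J.shiftKernel f e γ c v) =
        J.fredholmDet (J.integrableKernel f e) *
          J.fredholmDet (PiecewiseSmoothCurve.factorKernel e γ c v χ F) := by
  obtain ⟨χ, hχ⟩ := PiecewiseSmoothCurve.exists_isRHPSolution hf he hfe hdet
  obtain ⟨F, hF⟩ := PiecewiseSmoothCurve.exists_isLeftSolution hf he hfe hdet
  exact ⟨⟨χ, hχ, fun χ' hχ' => hχ.eqOn hf he hfe hχ' hF⟩,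
    ⟨F, hF, fun F' hF' a => hF.eqOn hf he hfe hdet hF' a⟩,
    PiecewiseSmoothCurve.fredholmConverges_of_bddKernel
      (PiecewiseSmoothCurve.exists_bddKernel_pull_integrableKernel hf he hfe).1.choose_spec,
    PiecewiseSmoothCurve.fredholmConverges_shiftKernel hf he hfe hshift,
    fun χ F hχ hF =>
      ⟨PiecewiseSmoothCurve.fredholmConverges_factorKernel he hshift hχ hF,
        PiecewiseSmoothCurve.fredholmDet_shiftKernel hf he hfe hshift hdet hχ hF⟩⟩
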